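/- Setting. Let $H$ be a pattern graph with $k\ge 1$ vertices, $G$ a target graph with $n\ge 2$ vertices, and $\mathcal T$ a rooted tree decomposition of $G$ of width $\tau$ in which every interior node has exactly two children. A partial match of a node (bag) $X$ of $\mathcal T$ is a triple $(\phi,C,U)$ where $C,U\subseteq V(H)$ are disjoint (the vertices "matched in a child" and the "unmatched" vertices) and $\phi$ is an injective, adjacency-preserving map from $H[V(H)\setminus(C\cup U)]$ to $G[X]$. A partial match $(\phi_Y,C_Y,U_Y)$ of a child $Y$ of $X$ is consistent with a partial match $(\phi_X,C_X,U_X)$ of $X$ if for every $v\in V(H)$: (i) if $\phi_Y(v)\in X$ or $\phi_X(v)\in Y$, then both are defined and $\phi_X(v)=\phi_Y(v)$; (ii) if $\phi_Y(v)$ is defined and not in $X$, or $v\in C_Y$, then $v\in C_X$. A partial match $M_X$ of $X$ is compatible with partial matches $M_L,M_R$ of the two children $L,R$ of $X$ if both are consistent with $M_X$ and every $v\in C_X$ is unmatched in exactly one of $M_L,M_R$. Recursively, a partial match $(\phi,C,U)$ is valid if $C=\emptyset$ or if it is compatible with valid partial matches of the two children of its node. A subpath $\mathcal P$ of $\mathcal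 T$ is a nonempty sequence of $|\mathcal P|$ nodes in which every node but the first is the parent of its predecessor. The computational model is a synchronous CREW PRAM with words of $O(k\log(n+|\mathcal P|))$ bits and unit-cost word operations; the work is the total number of operations of all processors, and the depth is the number of parallel time steps, where a processor may start any number of new processors in one step, at a work of one operation per new processor. Lemma. There is one CREW PRAM program that, given $k,n,\tau,|\mathcal P|$, the adjacency matrices of $H$ and $G$, the bags of the nodes of $\mathcal P$ and of those children of these nodes that are not on $\mathcal P$, and, for each of these children, the table of its valid partial matches, computes the tables of the valid partial matches of all nodes of $\mathcal P$. (A table has one entry for each of the $(\tau+3)^k$ codes of potential partial matches of a node.) The program takes $$O\bigl(|\mathcal P|\,(\tau+3)^{3k+1}\bigr)\ \text{work and}\ O(k\log n)\ \text{depth},$$ where $|\mathcal P|$ is assumed to be polynomially bounded in $n$. The constant of the work bound is absolute; if $|\mathcal P|\le n^{a}$, then the constant of the depth bound depends only on $a$. -/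

import Mathlib

/-! ### Parallel machine

A synchronous CREW PRAM in work-depth presentation. A program is a finite text that does not depend
on the input. At every moment a list of processors is active; each has private registers and all
share one memory, which is divided into arrays named by the program. All active processors perform
the same operation in lock step. Words are natural numbers below a bound `B`: an operation producing
a larger value has no execution. -/

namespace CREW

/-- Unit-cost word operations. -/
inductive Op
  | add | sub | mul | div | mod | eq | lt

/-- The value of a word operation (subtraction is truncated, comparisons return `0` or `1`). -/
def Op.eval : Op → ℕ → ℕ → ℕ
  | .add, x, y => x + y
  | .sub, x, y => x - y
  | .mul, x, y => x * y
  | .div, x, y => x / y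
  | .mod, x, y => x % y
  | .eq, x, y => if x = y then 1 else 0
  | .lt, x, y => if x < y then 1 else 0

/-- Programs. Registers and arrays are named by numerals. -/
inductive Prog
  /-- `r := v` for a constant `v` -/
  | const (r v : ℕ)
  /-- `r := s o t` -/
  | op (r : ℕ) (o : Op) (s t : ℕ)
  /-- `r := a[s]`, a read of the shared memory -/
  | load (r a s : ℕ)
  /-- `a[s] := t`, a write to the shared memory -/
  | store (a s t : ℕ)
  /-- sequential composition -/
  | seq (p q : Prog)
  /-- the processors with `r ≠ 0` run `p`, then those with `r = 0` run `q` -/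
  | ite (r : ℕ) (p q : Prog)
  /-- the processors with `r ≠ 0` run `p`, until none is left -/
  | while (r : ℕ) (p : Prog)
  /-- every active processor starts as many new processors as register `r` says; they inherit its
  registers, get their number in register `x`, run `p` and vanish -/
  | pardo (r x : ℕ) (p : Prog)

/-- The private registers of one processor. -/
abbrev Regs := ℕ → ℕ

/-- The shared memory: cell `i` of array `a` is `m a i`. -/
abbrev Mem := ℕ → ℕ → ℕ

/-- The memory after all active processors have performed `a[s] := t`. -/
def Mem.storeAll (m : Mem) (a s t : ℕ) (act : List Regs) : Mem :=
  act.foldl (fun m ρ => Function.update m a (Function.update (m a) (ρ s) (ρ t))) m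

/-- The processors started by `pardo r x`. -/
def spawn (r x : ℕ) (act : List Regs) : List Regs :=
  act.flatMap fun ρ => (List.range (ρ r)).map fun i => Function.update ρ x i

/-- `Exec B p m act m₂ act₂ w d`: with words below `B`, the program `p`, started in memory `m` by the
active processors `act`, halts with memory `m₂` and processors `act₂`, after `w` operations in total
over all processors (work) and `d` time steps (depth). Concurrent reads are allowed; a step in which
two processors write to the same cell has no execution. The rules are deterministic. -/
inductive Exec (B : ℕ) :
    Prog → Mem → List Regs → Mem → List Regs → ℕ → ℕ → Prop
  | const (r v : ℕ) (m : Mem) (act : List Regs) (hB : v < B) :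
      Exec B (.const r v) m act m (act.map fun ρ => Function.update ρ r v) act.length 1
  | op (r : ℕ) (o : Op) (s t : ℕ) (m : Mem) (act : List Regs)
      (hB : ∀ ρ ∈ act, o.eval (ρ s) (ρ t) < B) :
      Exec B (.op r o s t) m act m
        (act.map fun ρ => Function.update ρ r (o.eval (ρ s) (ρ t))) act.length 1
  | load (r a s : ℕ) (m : Mem) (act : List Regs) (hB : ∀ ρ ∈ act, m a (ρ s) < B) :
      Exec B (.load r a s) m act m
        (act.map fun ρ => Function.update ρ r (m a (ρ s))) act.length 1
  | store (a s t : ℕ) (m : Mem) (act : List Regs)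
      (exclusive : (act.map fun ρ => ρ s).Nodup) :
      Exec B (.store a s t) m act (m.storeAll a s t act) act act.length 1
  | seq (p q : Prog) (m m₁ m₂ : Mem) (act act₁ act₂ : List Regs) (w₁ d₁ w₂ d₂ : ℕ)
      (h₁ : Exec B p m act m₁ act₁ w₁ d₁) (h₂ : Exec B q m₁ act₁ m₂ act₂ w₂ d₂) :
      Exec B (.seq p q) m act m₂ act₂ (w₁ + w₂) (d₁ + d₂)
  | ite (r : ℕ) (p q : Prog) (m m₁ m₂ : Mem) (act act₁ act₂ : List Regs) (w₁ d₁ w₂ d₂ : ℕ)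
      (h₁ : Exec B p m (act.filter fun ρ => ρ r ≠ 0) m₁ act₁ w₁ d₁)
      (h₂ : Exec B q m₁ (act.filter fun ρ => ρ r = 0) m₂ act₂ w₂ d₂) :
      Exec B (.ite r p q) m act m₂ (act₁ ++ act₂) (act.length + w₁ + w₂) (1 + d₁ + d₂)
  | whileDone (r : ℕ) (p : Prog) (m : Mem) (act : List Regs) (h : ∀ ρ ∈ act, ρ r = 0) :
      Exec B (.while r p) m act m act act.length 1
  | whileStep (r : ℕ) (p : Prog) (m m₁ m₂ : Mem) (act act₁ act₂ : List Regs) (w₁ d₁ w₂ d₂ : ℕ)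
      (h : ∃ ρ ∈ act, ρ r ≠ 0)
      (h₁ : Exec B p m (act.filter fun ρ => ρ r ≠ 0) m₁ act₁ w₁ d₁)
      (h₂ : Exec B (.while r p) m₁ act₁ m₂ act₂ w₂ d₂) :
      Exec B (.while r p) m act m₂ ((act.filter fun ρ => ρ r = 0) ++ act₂)
        (act.length + w₁ + w₂) (1 + d₁ + d₂)
  | pardo (r x : ℕ) (p : Prog) (m m₁ : Mem) (act act₁ : List Regs) (w₁ d₁ : ℕ)
      (h₁ : Exec B p m (spawn r x act) m₁ act₁ w₁ d₁) :
      Exec B (.pardo r x p) m act m₁ act (act.length + (spawn r x act).length + w₁) (1 + d₁)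

end CREW

/-! ### Tree decompositions -/

/-- A rooted tree decomposition of `G` with decomposition tree on the node set `ι`, in which every
interior node has exactly two children. -/
structure TreeDecomposition {V : Type*} (G : SimpleGraph V) (ι : Type*) where
  tree : SimpleGraph ι
  isTree : tree.IsTree
  root : ι
  bag : ι → Finset V
  /-- every vertex lies in the bags of a nonempty contiguous subtree -/
  contiguous : ∀ v : V, (tree.induce {i | v ∈ bag i}).Connected
  /-- every edge lies in a bag -/
  edge_mem_bag : ∀ u v : V, G.Adj u v → ∃ i, u ∈ bag i ∧ v ∈ bag i
  binary : ∀ i, {j | tree.Adj i j ∧ tree.dist root j = tree.dist root i + 1}.ncard = 0 ∨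
    {j | tree.Adj i j ∧ tree.dist root j = tree.dist root i + 1}.ncard = 2

namespace TreeDecomposition

variable {V : Type*} {G : SimpleGraph V} {ι : Type*}

/-- `j` is a child of `i`. -/
def IsChild (T : TreeDecomposition G ι) (i j : ι) : Prop :=
  T.tree.Adj i j ∧ T.tree.dist T.root j = T.tree.dist T.root i + 1

/-- `i` has no children. -/
def IsLeaf (T : TreeDecomposition G ι) (i : ι) : Prop :=
  ∀ j, ¬ T.IsChild i j

/-- The width: the maximum of `|X| - 1` over all bags `X`. -/
def width [Fintype ι] (T : TreeDecomposition G ι) : ℕ :=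
  (Finset.univ.sup fun i => (T.bag i).card) - 1

end TreeDecomposition

/-! ### Partial matches -/

/-- What a partial match says about a pattern vertex. -/
inductive Status (V : Type*)
  | matched (x : V)
  | inChild
  | unmatched

/-- A triple `(φ, C, U)` is given by a map `s` on the pattern vertices: `φ v = x` when
`s v = matched x`, `C = {v | s v = inChild}` and `U = {v | s v = unmatched}`. It is a partial match
of `X` if `φ` is a subgraph isomorphism from `H[V(H) \ (C ∪ U)]` to `G[X]`. -/
structure IsPartialMatch {W V : Type*} (H : SimpleGraph W) (G : SimpleGraph V) (X : Finset V)
    (s : W → Status V) : Prop where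
  mem : ∀ v x, s v = .matched x → x ∈ X
  injective : ∀ u v x, s u = .matched x → s v = .matched x → u = v
  adj : ∀ u v x y, H.Adj u v → s u = .matched x → s v = .matched y → G.Adj x y

/-- The partial match `sY` of a child `Y` is consistent with the partial match `sX` of `X`. -/
structure Consistent {W V : Type*} (X Y : Finset V) (sX sY : W → Status V) : Prop where
  agree_left : ∀ v x, sY v = .matched x → x ∈ X → sX v = .matched x
  agree_right : ∀ v x, sX v = .matched x → x ∈ Y → sY v = .matched x
  forget : ∀ v x, sY v = .matched x → x ∉ X → sX v = .inChild
  inChild : ∀ v, sY v = .inChild → sX v = .inChild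

/-- The partial match `sX` of `X` is compatible with the partial matches `sL`, `sR` of its two
children `L`, `R`. -/
structure Compatible {W V : Type*} (X L R : Finset V) (sX sL sR : W → Status V) : Prop where
  left : Consistent X L sX sL
  right : Consistent X R sX sR
  exactly_one : ∀ v, sX v = .inChild → Xor (sL v = .unmatched) (sR v = .unmatched)

/-- The valid partial matches of the nodes of a decomposition tree. -/
inductive Valid {W V ι : Type*} (H : SimpleGraph W) {G : SimpleGraph V}
    (T : TreeDecomposition G ι) : ι → (W → Status V) → Prop
  | noChild (i : ι) (s : W → Status V) (hs : IsPartialMatch H G (T.bag i) s)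
      (h : ∀ v, s v ≠ .inChild) : Valid H T i s
  | combine (i l r : ι) (s sl sr : W → Status V) (hs : IsPartialMatch H G (T.bag i) s)
      (hl : T.IsChild i l) (hr : T.IsChild i r) (hlr : l ≠ r)
      (vl : Valid H T l sl) (vr : Valid H T r sr)
      (h : Compatible (T.bag i) (T.bag l) (T.bag r) s sl sr) : Valid H T i s

/-! ### Subpaths and their representation in memory -/

/-- A subpath of a decomposition tree, directed from the bottom node `node 0` towards the root, with
`length` nodes. The children of its nodes that do not lie on it are numbered: `off i` is the child of
`node i` off the path for `0 < i < length`; if `node 0` is not a leaf of the tree, then its two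
children are `off 0` and `off length`. Other values of `node` and `off` are irrelevant. -/
structure Subpath {V ι : Type*} {G : SimpleGraph V} (T : TreeDecomposition G ι) where
  length : ℕ
  length_pos : 0 < length
  node : ℕ → ι
  off : ℕ → ι
  child_node : ∀ i, i + 1 < length → T.IsChild (node (i + 1)) (node i)
  child_off : ∀ i, i + 1 < length →
    T.IsChild (node (i + 1)) (off (i + 1)) ∧ off (i + 1) ≠ node i
  bottom : T.IsLeaf (node 0) ∨
    (T.IsChild (node 0) (off 0) ∧ T.IsChild (node 0) (off length) ∧ off 0 ≠ off length)

/-- `s` is the number of a child off the path. -/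
def Subpath.IsOff {V ι : Type*} {G : SimpleGraph V} {T : TreeDecomposition G ι} (P : Subpath T)
    (s : ℕ) : Prop :=
  (0 < s ∧ s < P.length) ∨ (¬ T.IsLeaf (P.node 0) ∧ (s = 0 ∨ s = P.length))

/-- The digit in base `τ + 3` for one pattern vertex, when the bag is stored as the list `l`: the
position of the image in the list, or `τ + 1` for `inChild`, or `τ + 2` for `unmatched`. -/
def Status.digit {V : Type*} [DecidableEq V] (τ : ℕ) (l : List V) : Status V → ℕ
  | .matched x => l.idxOf x
  | .inChild => τ + 1
  | .unmatched => τ + 2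

/-- The number below `(τ + 3) ^ k` that represents a partial match of a bag stored as the list `l`. -/
def matchCode {V : Type*} [DecidableEq V] {k : ℕ} (τ : ℕ) (l : List V) (s : Fin k → Status V) : ℕ :=
  ∑ v : Fin k, (s v).digit τ l * (τ + 3) ^ (v : ℕ)

open Classical in
/-- The table of the valid partial matches of node `i`: entry `c` is `1` if `c` represents a valid
partial match and `0` otherwise. -/
noncomputable def validTable {k n : ℕ} {ι : Type*} (H : SimpleGraph (Fin k))
    {G : SimpleGraph (Fin n)} (T : TreeDecomposition G ι) (τ : ℕ) (l : ι → List (Fin n)) (i : ι)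
    (c : ℕ) : ℕ :=
  if ∃ s : Fin k → Status (Fin n), Valid H T i s ∧ matchCode τ (l i) s = c then 1 else 0

open Classical in
/-- The adjacency matrix of a graph, row by row. -/
noncomputable def adjArray {n : ℕ} (G : SimpleGraph (Fin n)) (x : ℕ) : ℕ :=
  if ∃ u v : Fin n, G.Adj u v ∧ x = u * n + v then 1 else 0

open Classical in
/-- The input. Array `0`: the numbers `k`, `n`, `τ`, the length of the path, and a flag telling
whether the bottom node has children. Arrays `1` and `2`: the adjacency matrices of the pattern and of
the target. Arrays `3` and `4`: the sizes and the contents (`τ + 1` cells for each) of the bags on the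
path. Arrays `5` and `6`: the same for the children off the path. Array `7`: the tables of the valid
partial matches of the children off the path (`(τ + 3) ^ k` cells for each). All other cells
are `0`. -/
noncomputable def inputMem {k n : ℕ} {ι : Type*} (H : SimpleGraph (Fin k))
    {G : SimpleGraph (Fin n)} (T : TreeDecomposition G ι) (τ : ℕ) (l : ι → List (Fin n))
    (P : Subpath T) : CREW.Mem
  | 0, x => [k, n, τ, P.length, if T.IsLeaf (P.node 0) then 0 else 1].getD x 0
  | 1, x => adjArray H x
  | 2, x => adjArray G x
  | 3, x => if x < P.length then (l (P.node x)).length else 0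
  | 4, x => if x / (τ + 1) < P.length then
      ((l (P.node (x / (τ + 1)))).map Fin.val).getD (x % (τ + 1)) 0 else 0
  | 5, x => if P.IsOff x then (l (P.off x)).length else 0
  | 6, x => if P.IsOff (x / (τ + 1)) then
      ((l (P.off (x / (τ + 1)))).map Fin.val).getD (x % (τ + 1)) 0 else 0
  | 7, x => if P.IsOff (x / (τ + 3) ^ k) then
      validTable H T τ l (P.off (x / (τ + 3) ^ k)) (x % (τ + 3) ^ k) else 0
  | _, _ => 0

/-!
# Valid partial matches along a subpath of a tree decomposition

Along the subpath, one step from a node to its parent, with a valid partial match of the child off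
the path, is a relation between partial matches (`Step`), and `Chain` is the composition of
consecutive steps. If two empty bags are put below the bottom node, then the valid partial matches
of a node are exactly those that a chain reaches from the empty match (`chain_iff_valid`). In particular
matches with empty `C`, which are valid by decree, need no rule of their own. The chains from the empty
match are found by a parallel prefix computation: a balanced binary tree composes the relations of
segments of the path, and every prefix is a shorter prefix followed by one segment of the tree.

Composing two relations means to search for the match `y` in the middle. To try all triples of
matches would cost `(τ + 3) ^ (3 * k)` operations per node, up to a constant, but needs a disjunction of
unbounded fan-in, whose depth `k * log (τ + 3)` at each of the `log |P|` levels is too large. The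
status of a pattern vertex only develops from `unmatched` through `matched` to `inChild` along the path.
So, for given statuses at the two ends of a segment, the status in the middle is one of at most two,
except for a *crossing* vertex, which is `unmatched` at the lower and `inChild` at the upper end. Every
node of the trees therefore has one gate for each vector of `k` digits of the type `Digit`, in base
`E = 11 * t + 9` with `t = τ + 1`: a digit fixes the statuses of one pattern vertex at the two ends and
restricts its status in the middle, where the restrictions for a crossing vertex are the nodes of a
binary heap over the vertices of the middle bag. A gate is the disjunction of two gates with one digit
refined (`exists_refine`), or, when all digits are decided, the conjunction of one gate of each
operand (`inner_decided`, `leaf_decided`). There are `E ^ k` gates per node, and `27 * E ≤ 20 * b ^ 3`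
for `b = τ + 3`, so that the exponential gap between `E ^ k` and `b ^ (3 * k)` even pays for a factor `k`
(`mul_W_le`).

All gates have fan-in two, and the network is evaluated by sweeps, in which gates are replaced by
their next values. The sweeps never make a gate true without reason (`Node.Sound`). A gate with a
witness `y` becomes true after a number of sweeps that is bounded by a potential (`Node.need`): a
crossing vertex pays `L + 1 = O(log τ)` sweeps for the descent in a heap in the one node where it is
matched in the middle, and afterwards it is crossing no more; every other vertex pays at most two per
level. Hence `O(k * L + k * log |P|)` sweeps suffice, instead of a product of logarithms. To keep
the work linear in `|P|`, a level of the tree is evaluated only as long as it is needed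
(`Sizes.Active`): all segments during the first `k * L` sweeps, then geometrically fewer, and the
prefixes in the reverse order. The result is `gates_iff_valid`, in terms of arrays `validTable_eq`.

The program is written with expressions and a few parallel commands, whose translations satisfy Hoare
triples with bounds for work and depth (`Spec`). It fills one array after the other with the layout,
the inputs and the thresholds of the gates (`table`, `Computes`), runs the sweeps (`spec_network`) and
reads off the tables (`spec_output`).
-/

/-! ### Expressions and their compilation -/

namespace SubpathDP

open CREW

/-- Arithmetic expressions over variables and the shared memory. -/
inductive Ex
  | lit (c : ℕ)
  | var (i : ℕ)
  | op (o : Op) (x y : Ex)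
  | ld (a : ℕ) (x : Ex)

namespace Ex

instance : Add Ex := ⟨.op .add⟩
instance : Sub Ex := ⟨.op .sub⟩
instance : Mul Ex := ⟨.op .mul⟩
instance : Div Ex := ⟨.op .div⟩
instance : Mod Ex := ⟨.op .mod⟩
instance (c : ℕ) : OfNat Ex c := ⟨.lit c⟩

/-- The value of an expression. -/
def eval (m : Mem) (σ : ℕ → ℕ) : Ex → ℕ
  | lit c => c
  | var i => σ i
  | op o x y => o.eval (x.eval m σ) (y.eval m σ)
  | ld a x => m a (x.eval m σ)

/-- `if x < y then z else w`, without branching. -/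
def ifLt (x y z w : Ex) : Ex := .op .lt x y * z + (1 - .op .lt x y) * w

/-- `if x = y then z else w`, without branching. -/
def ifEq (x y z w : Ex) : Ex := .op .eq x y * z + (1 - .op .eq x y) * w

section

variable (m : Mem) (σ : ℕ → ℕ) (x y z w : Ex)

@[simp] theorem eval_var (i : ℕ) : (var i).eval m σ = σ i := rfl
@[simp] theorem eval_ld (a : ℕ) : (ld a x).eval m σ = m a (x.eval m σ) := rfl
@[simp] theorem eval_add : (x + y).eval m σ = x.eval m σ + y.eval m σ := rfl
@[simp] theorem eval_sub : (x - y).eval m σ = x.eval m σ - y.eval m σ := rfl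
@[simp] theorem eval_mul : (x * y).eval m σ = x.eval m σ * y.eval m σ := rfl
@[simp] theorem eval_div : (x / y).eval m σ = x.eval m σ / y.eval m σ := rfl
@[simp] theorem eval_mod : (x % y).eval m σ = x.eval m σ % y.eval m σ := rfl
@[simp] theorem eval_zero : (0 : Ex).eval m σ = 0 := rfl
@[simp] theorem eval_one : (1 : Ex).eval m σ = 1 := rfl
@[simp] theorem eval_ofNat (c : ℕ) [c.AtLeastTwo] :
    (ofNat(c) : Ex).eval m σ = ofNat(c) := rfl

@[simp] theorem eval_ifLt : (ifLt x y z w).eval m σ =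
    if x.eval m σ < y.eval m σ then z.eval m σ else w.eval m σ := by
  change (if x.eval m σ < y.eval m σ then 1 else 0) * z.eval m σ +
    (1 - if x.eval m σ < y.eval m σ then 1 else 0) * w.eval m σ = _
  split_ifs <;> simp

@[simp] theorem eval_ifEq : (ifEq x y z w).eval m σ =
    if x.eval m σ = y.eval m σ then z.eval m σ else w.eval m σ := by
  change (if x.eval m σ = y.eval m σ then 1 else 0) * z.eval m σ +
    (1 - if x.eval m σ = y.eval m σ then 1 else 0) * w.eval m σ = _
  split_ifs <;> simp

end

/-- The compiled expression. Variable `i` lives in register `2 * i`; the value is left in register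
`2 * t + 1`, and of the odd registers only those from `2 * t + 1` on are changed. -/
def code : Ex → ℕ → Prog
  | lit c, t => .const (2 * t + 1) c
  | var i, t => .seq (.const (2 * t + 1) 0) (.op (2 * t + 1) .add (2 * t + 1) (2 * i))
  | op o x y, t => .seq (x.code t) (.seq (y.code (t + 1))
      (.op (2 * t + 1) o (2 * t + 1) (2 * (t + 1) + 1)))
  | ld a x, t => .seq (x.code t) (.load (2 * t + 1) a (2 * t + 1))

/-- The number of instructions of the compiled expression. -/
def size : Ex → ℕ
  | lit _ => 1
  | var _ => 2
  | op _ x y => x.size + (y.size + 1)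
  | ld _ x => x.size + 1

/-- The effect of the compiled expression on the registers of a processor. -/
def regs (m : Mem) : Ex → ℕ → Regs → Regs
  | lit c, t, ρ => Function.update ρ (2 * t + 1) c
  | var i, t, ρ => Function.update (Function.update ρ (2 * t + 1) 0) (2 * t + 1) (0 + ρ (2 * i))
  | op o x y, t, ρ =>
      let ρ' := y.regs m (t + 1) (x.regs m t ρ)
      Function.update ρ' (2 * t + 1) (o.eval (ρ' (2 * t + 1)) (ρ' (2 * (t + 1) + 1)))
  | ld a x, t, ρ =>
      Function.update (x.regs m t ρ) (2 * t + 1) (m a (x.regs m t ρ (2 * t + 1)))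

/-- All intermediate values are below the word bound. -/
def Ok (B : ℕ) (m : Mem) (σ : ℕ → ℕ) : Ex → Prop
  | lit c => c < B
  | var i => σ i < B
  | op o x y => x.Ok B m σ ∧ y.Ok B m σ ∧ o.eval (x.eval m σ) (y.eval m σ) < B
  | ld a x => x.Ok B m σ ∧ m a (x.eval m σ) < B

/-- An exponent such that the value is below `X ^ deg` when all variables and memory cells are below
`X`. -/
def deg : Ex → ℕ
  | lit c => c + 1
  | var _ => 1
  | op _ x y => x.deg + y.deg
  | ld _ x => x.deg

theorem deg_pos (e : Ex) : 0 < e.deg := by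
  induction e <;> simp only [deg] <;> omega

theorem eval_lt_ok {X B : ℕ} (hX : 2 ≤ X) {m : Mem} {σ : ℕ → ℕ} (hm : ∀ a x, m a x < X)
    (hσ : ∀ i, σ i < X) (e : Ex) (he : X ^ e.deg ≤ B) :
    e.eval m σ < X ^ e.deg ∧ e.Ok B m σ := by
  induction e with
  | lit c =>
    have : c < X ^ (c + 1) :=
      (Nat.lt_pow_self (by omega)).trans (Nat.pow_lt_pow_right (by omega) (by omega))
    exact ⟨this, this.trans_le he⟩
  | var i =>
    simp only [deg, pow_one] at he ⊢
    exact ⟨hσ i, (hσ i).trans_le he⟩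
  | ld a x ih =>
    have h := ih he
    have h1 : X ≤ X ^ x.deg := Nat.le_self_pow x.deg_pos.ne' X
    exact ⟨(hm _ _).trans_le h1, h.2, (hm _ _).trans_le (h1.trans he)⟩
  | op o x y ihx ihy =>
    have hx := ihx ((Nat.pow_le_pow_right (by omega) (by simp [deg])).trans he)
    have hy := ihy ((Nat.pow_le_pow_right (by omega) (by simp [deg])).trans he)
    have h1 : X ≤ X ^ x.deg := Nat.le_self_pow x.deg_pos.ne' X
    have h2 : X ≤ X ^ y.deg := Nat.le_self_pow y.deg_pos.ne' X
    have key : o.eval (x.eval m σ) (y.eval m σ) < X ^ (x.deg + y.deg) := by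
      rw [pow_add]
      have h3 : X ^ x.deg ≤ X ^ x.deg * X ^ y.deg := Nat.le_mul_of_pos_right _ (by omega)
      cases o
      · change x.eval m σ + y.eval m σ < _
        nlinarith [hx.1, hy.1]
      · exact (Nat.sub_le _ _).trans_lt (hx.1.trans_le h3)
      · exact Nat.mul_lt_mul'' hx.1 hy.1
      · exact (Nat.div_le_self _ _).trans_lt (hx.1.trans_le h3)
      · exact (Nat.mod_le _ _).trans_lt (hx.1.trans_le h3)
      · change (if _ then 1 else 0) < _
        split_ifs <;> omega
      · change (if _ then 1 else 0) < _
        split_ifs <;> omega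
    exact ⟨key, hx.2, hy.2, key.trans_le he⟩

/-- The variables, as stored in the even registers. -/
def env (ρ : Regs) : ℕ → ℕ := fun i => ρ (2 * i)

theorem regs_spec (m : Mem) (e : Ex) : ∀ (t : ℕ) (ρ : Regs),
    env (e.regs m t ρ) = env ρ ∧ (∀ s < t, e.regs m t ρ (2 * s + 1) = ρ (2 * s + 1)) ∧
      e.regs m t ρ (2 * t + 1) = e.eval m (env ρ) := by
  induction e with
  | lit c =>
    intro t ρ
    refine ⟨funext fun i => ?_, fun s hs => ?_, ?_⟩
    · exact Function.update_of_ne (by omega) _ _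
    · exact Function.update_of_ne (by omega) _ _
    · simp [regs, eval]
  | var i =>
    intro t ρ
    refine ⟨funext fun j => ?_, fun s hs => ?_, ?_⟩
    · simp only [env, regs]
      rw [Function.update_of_ne (by omega), Function.update_of_ne (by omega)]
    · simp only [regs]
      rw [Function.update_of_ne (by omega), Function.update_of_ne (by omega)]
    · simp [regs, env]
  | op o x y ihx ihy =>
    intro t ρ
    obtain ⟨hx1, hx2, hx3⟩ := ihx t ρ
    obtain ⟨hy1, hy2, hy3⟩ := ihy (t + 1) (x.regs m t ρ)
    refine ⟨funext fun j => ?_, fun s hs => ?_, ?_⟩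
    · simp only [regs, env]
      rw [Function.update_of_ne (by omega)]
      exact (congrFun hy1 j).trans (congrFun hx1 j)
    · simp only [regs]
      rw [Function.update_of_ne (by omega), hy2 s (by omega), hx2 s hs]
    · simp only [regs, Function.update_self]
      rw [hy3, hy2 t (by omega), hx3, hx1]
      rfl
  | ld a x ih =>
    intro t ρ
    obtain ⟨hx1, hx2, hx3⟩ := ih t ρ
    refine ⟨funext fun j => ?_, fun s hs => ?_, ?_⟩
    · simp only [regs, env]
      rw [Function.update_of_ne (by omega)]
      exact congrFun hx1 j
    · simp only [regs]
      rw [Function.update_of_ne (by omega), hx2 s hs]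
    · simp [regs, hx3]

theorem exec_code {B : ℕ} {m : Mem} (e : Ex) : ∀ (t : ℕ) (act : List Regs),
    e.deg ≤ B → (∀ ρ ∈ act, e.Ok B m (env ρ)) →
    Exec B (e.code t) m act m (act.map (e.regs m t)) (act.length * e.size) e.size := by
  have cast : ∀ {p : Prog} {act a₁ a₂ : List Regs} {w w' d d' : ℕ},
      Exec B p m act m a₁ w d → a₁ = a₂ → w = w' → d = d' → Exec B p m act m a₂ w' d' := by
    rintro p act a₁ a₂ w w' d d' h rfl rfl rfl
    exact h
  induction e with
  | lit c =>
    intro t act hB _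
    exact cast (Exec.const _ _ _ _ hB) rfl (mul_one _).symm rfl
  | var i =>
    intro t act hB h
    have h1 := Exec.const (B := B) (2 * t + 1) 0 m act hB
    have h2 := Exec.op (B := B) (2 * t + 1) .add (2 * t + 1) (2 * i) m
      (act.map fun ρ => Function.update ρ (2 * t + 1) 0) (by
        intro ρ hρ
        obtain ⟨ρ', hρ', rfl⟩ := List.mem_map.1 hρ
        have : ρ' (2 * i) < B := h ρ' hρ'
        rw [Function.update_self, Function.update_of_ne (by omega)]
        simpa [Op.eval] using this)
    refine cast (Exec.seq _ _ _ _ _ _ _ _ _ _ _ _ h1 h2) ?_ ?_ rfl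
    · rw [List.map_map]
      refine List.map_congr_left fun ρ _ => ?_
      simp only [regs, Function.comp, Function.update_self]
      rw [Function.update_of_ne (by omega)]
      rfl
    · simp [size]; ring
  | op o x y ihx ihy =>
    intro t act hB h
    simp only [deg] at hB
    have h1 := ihx t act (by omega) fun ρ hρ => (h ρ hρ).1
    have h2 := ihy (t + 1) (act.map (x.regs m t)) (by omega) (by
      intro ρ hρ
      obtain ⟨ρ', hρ', rfl⟩ := List.mem_map.1 hρ
      rw [(regs_spec m x t ρ').1]
      exact (h ρ' hρ').2.1)
    have h3 := Exec.op (B := B) (2 * t + 1) o (2 * t + 1) (2 * (t + 1) + 1) m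
      ((act.map (x.regs m t)).map (y.regs m (t + 1))) (by
        intro ρ hρ
        obtain ⟨ρ', hρ', rfl⟩ := List.mem_map.1 hρ
        obtain ⟨ρ'', hρ'', rfl⟩ := List.mem_map.1 hρ'
        rw [(regs_spec m y _ _).2.2, (regs_spec m y _ _).2.1 t (by omega),
          (regs_spec m x _ _).2.2, (regs_spec m x _ _).1]
        exact (h ρ'' hρ'').2.2)
    refine cast (Exec.seq _ _ _ _ _ _ _ _ _ _ _ _ h1 (Exec.seq _ _ _ _ _ _ _ _ _ _ _ _ h2 h3))
      ?_ ?_ rfl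
    · rw [List.map_map, List.map_map]
      rfl
    · simp [size]; ring
  | ld a x ih =>
    intro t act hB h
    have h1 := ih t act hB fun ρ hρ => (h ρ hρ).1
    have h3 := Exec.load (B := B) (2 * t + 1) a (2 * t + 1) m (act.map (x.regs m t)) (by
        intro ρ hρ
        obtain ⟨ρ', hρ', rfl⟩ := List.mem_map.1 hρ
        rw [(regs_spec m x _ _).2.2]
        exact (h ρ' hρ').2)
    refine cast (Exec.seq _ _ _ _ _ _ _ _ _ _ _ _ h1 h3) ?_ ?_ rfl
    · rw [List.map_map]
      rfl
    · simp [size]; ring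

end Ex

/-! ### Hoare triples with costs -/

/-- Started by one processor in a state that satisfies `P`, the program halts with one processor in
a state that satisfies `Q`, after at most `w` operations and `d` time steps. -/
def Spec (B : ℕ) (p : Prog) (P : Mem → (ℕ → ℕ) → Prop) (w d : ℕ)
    (Q : Mem → (ℕ → ℕ) → Prop) : Prop :=
  ∀ m ρ, P m (Ex.env ρ) → ∃ m' ρ' w' d', Exec B p m [ρ] m' [ρ'] w' d' ∧ w' ≤ w ∧ d' ≤ d ∧
    Q m' (Ex.env ρ')

section rules

variable {B : ℕ} {p q : Prog} {P P' Q Q' R : Mem → (ℕ → ℕ) → Prop} {w w' d d' : ℕ}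

theorem Spec.mono (h : Spec B p P w d Q) (hP : ∀ m σ, P' m σ → P m σ) (hw : w ≤ w') (hd : d ≤ d')
    (hQ : ∀ m σ, Q m σ → Q' m σ) : Spec B p P' w' d' Q' := by
  intro m ρ hm
  obtain ⟨m', ρ', w₁, d₁, h1, h2, h3, h4⟩ := h m ρ (hP _ _ hm)
  exact ⟨m', ρ', w₁, d₁, h1, h2.trans hw, h3.trans hd, hQ _ _ h4⟩

theorem Spec.cost (h : Spec B p P w d Q) (hw : w ≤ w') (hd : d ≤ d') : Spec B p P w' d' Q :=
  h.mono (fun _ _ h => h) hw hd fun _ _ h => h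

theorem Spec.seq (h₁ : Spec B p P w d Q) (h₂ : Spec B q Q w' d' R) :
    Spec B (.seq p q) P (w + w') (d + d') R := by
  intro m ρ hm
  obtain ⟨m₁, ρ₁, w₁, d₁, h1, h2, h3, h4⟩ := h₁ m ρ hm
  obtain ⟨m₂, ρ₂, w₂, d₂, h5, h6, h7, h8⟩ := h₂ m₁ ρ₁ h4
  exact ⟨m₂, ρ₂, _, _, .seq _ _ _ _ _ _ _ _ _ _ _ _ h1 h5, by omega, by omega, h8⟩

/-- A loop that runs exactly `n` times, with invariant `I`. -/
theorem Spec.while (r n : ℕ) (I : ℕ → Mem → (ℕ → ℕ) → Prop) (wb : ℕ → ℕ)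
    (hne : ∀ j < n, ∀ m σ, I j m σ → σ r ≠ 0) (h0 : ∀ m σ, I n m σ → σ r = 0)
    (hb : ∀ j < n, Spec B p (I j) (wb j) d (I (j + 1))) :
    Spec B (.while (2 * r) p) (I 0) (∑ j ∈ Finset.range n, (wb j + 1) + 1) (n * (d + 1) + 1)
      (I n) := by
  have key : ∀ i ≤ n, Spec B (.while (2 * r) p) (I (n - i))
      (∑ j ∈ Finset.Ico (n - i) n, (wb j + 1) + 1) (i * (d + 1) + 1) (I n) := by
    intro i
    induction i with
    | zero =>
      intro _ m ρ hm
      refine ⟨m, ρ, _, _, Exec.whileDone _ _ _ _ ?_, ?_, ?_, hm⟩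
      · simpa [Ex.env] using h0 m _ hm
      · simp
      · simp
    | succ i ih =>
      intro hi m ρ hm
      have hlt : n - (i + 1) < n := by omega
      obtain ⟨m₁, ρ₁, w₁, d₁, h1, h2, h3, h4⟩ := hb _ hlt m ρ hm
      rw [show n - (i + 1) + 1 = n - i by omega] at h4
      obtain ⟨m₂, ρ₂, w₂, d₂, h5, h6, h7, h8⟩ := ih (by omega) m₁ ρ₁ h4
      have hr : ρ (2 * r) ≠ 0 := hne _ hlt m _ hm
      have hf : [ρ].filter (fun ρ => ρ (2 * r) ≠ 0) = [ρ] := by simp [hr]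
      have hf' : [ρ].filter (fun ρ => ρ (2 * r) = 0) = [] := by simp [hr]
      have h9 := Exec.whileStep (2 * r) p m m₁ m₂ [ρ] [ρ₁] [ρ₂] w₁ d₁ w₂ d₂ ⟨ρ, by simp, hr⟩
        (by rw [hf]; exact h1) h5
      rw [hf', List.nil_append] at h9
      refine ⟨m₂, ρ₂, _, _, h9, ?_, ?_, h8⟩
      · rw [Finset.sum_eq_sum_Ico_succ_bot hlt, show n - (i + 1) + 1 = n - i by omega]
        simp only [List.length_singleton]
        omega
      · nlinarith
  have := key n le_rfl
  rwa [Nat.sub_self, ← Finset.range_eq_Ico] at this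

end rules

/-! ### Commands -/

/-- `x_r := e` -/
def asg (r : ℕ) (e : Ex) : Prog :=
  .seq (e.code 0) (.seq (.const (2 * r) 0) (.op (2 * r) .add (2 * r) 1))

/-- The variable that holds the number of a processor started by `par`. -/
abbrev tid : ℕ := 50

/-- For all `x_50 < T` in parallel: `a[e₁] := e₂`. All values are computed before the first write. -/
def par (T : Ex) (a : ℕ) (e₁ e₂ : Ex) : Prog :=
  .seq (T.code 0) (.pardo 1 (2 * tid) (.seq (e₁.code 0) (.seq (e₂.code 1) (.store a 1 3))))

/-- Run `p` as often as `e` says, counting down in `x_r`. -/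
def rep (r : ℕ) (e : Ex) (p : Prog) : Prog :=
  .seq (asg r e) (.while (2 * r) (.seq p (asg r (.var r - 1))))

/-- The shared memory is `M`, the variables listed in `Rf` have the given values, and all memory cells
and variables are below `X`. -/
def St (X : ℕ) (Rf : List (ℕ × ℕ)) (M : Mem) (m : Mem) (σ : ℕ → ℕ) : Prop :=
  (∀ a x, m a x < X) ∧ (∀ i, σ i < X) ∧ (∀ q ∈ Rf, σ q.1 = q.2) ∧ m = M

theorem St.weaken {X : ℕ} {Rf Rf' : List (ℕ × ℕ)} {M m : Mem} {σ : ℕ → ℕ} (h : St X Rf M m σ)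
    (hR : ∀ q ∈ Rf', q ∈ Rf) : St X Rf' M m σ :=
  ⟨h.1, h.2.1, fun q hq => h.2.2.1 q (hR q hq), h.2.2.2⟩

/-- A bound for the degrees of all expressions of the program. -/
abbrev degBound : ℕ := 3000

section commands

variable {B X : ℕ} (hX : 2 ≤ X) (hB : X ^ degBound ≤ B) {Rf Rf' : List (ℕ × ℕ)}
  {M : Mem}

include hX hB

theorem Ex.ok_of_le {e : Ex} (he : e.deg ≤ degBound) {m : Mem} {σ : ℕ → ℕ}
    (hm : ∀ a x, m a x < X) (hσ : ∀ i, σ i < X) : e.deg ≤ B ∧ e.Ok B m σ := by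
  refine ⟨?_, (e.eval_lt_ok hX hm hσ ((Nat.pow_le_pow_right (by omega) he).trans hB)).2⟩
  exact he.trans ((Nat.lt_pow_self (by omega)).le.trans hB)

theorem spec_asg (r : ℕ) (e : Ex) (val : ℕ) (he : e.deg ≤ degBound)
    (h : ∀ σ, (∀ q ∈ Rf, σ q.1 = q.2) → e.eval M σ = val) (hv : val < X)
    (hR : ∀ q ∈ Rf', q = (r, val) ∨ q ∈ Rf ∧ q.1 ≠ r) :
    Spec B (asg r e) (St X Rf M) (e.size + 2) (e.size + 2) (St X Rf' M) := by
  intro m ρ hm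
  obtain ⟨h1, h2⟩ := Ex.ok_of_le hX hB he hm.1 hm.2.1
  have hXB : X ≤ B := (Nat.le_self_pow (by simp) X).trans hB
  have h3 := e.exec_code 0 [ρ] h1 (by simpa using h2)
  obtain ⟨h4, -, h5⟩ := e.regs_spec m 0 ρ
  rw [hm.2.2.2, h _ hm.2.2.1, ← hm.2.2.2] at h5
  set ρ₁ := e.regs m 0 ρ
  have h6 := Exec.const (B := B) (2 * r) 0 m [ρ₁] (by omega)
  have h7 := Exec.op (B := B) (2 * r) .add (2 * r) 1 m [Function.update ρ₁ (2 * r) 0] (by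
    simp only [List.mem_singleton, forall_eq, Function.update_self]
    rw [Function.update_of_ne (by omega), show ρ₁ 1 = val from h5]
    simpa [Op.eval] using hv.trans_le hXB)
  refine ⟨m, _, _, _, .seq _ _ _ _ _ _ _ _ _ _ _ _ h3 (.seq _ _ _ _ _ _ _ _ _ _ _ _ h6 h7),
    by simp, by simp, ?_⟩
  have h8 : Ex.env (Function.update (Function.update ρ₁ (2 * r) 0) (2 * r)
      (Op.add.eval (Function.update ρ₁ (2 * r) 0 (2 * r)) (Function.update ρ₁ (2 * r) 0 1))) =
      Function.update (Ex.env ρ) r val := by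
    rw [Function.update_self, Function.update_of_ne (by omega), show ρ₁ 1 = val from h5,
      Function.update_idem]
    funext i
    by_cases hi : i = r
    · subst hi; simp [Ex.env, Op.eval]
    · rw [Function.update_of_ne hi, ← h4]
      exact Function.update_of_ne (by omega) _ _
  rw [h8]
  refine ⟨hm.1, fun i => ?_, fun q hq => ?_, hm.2.2.2⟩
  · by_cases hi : i = r
    · subst hi; simpa using hv
    · rw [Function.update_of_ne hi]; exact hm.2.1 i
  · rcases hR q hq with rfl | ⟨h9, h10⟩
    · simp
    · rw [Function.update_of_ne h10]; exact hm.2.2.1 q h9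

end commands

theorem storeAll_of_ne (m : Mem) {a a' : ℕ} (s t : ℕ) (act : List Regs) (h : a' ≠ a) :
    m.storeAll a s t act a' = m a' := by
  unfold Mem.storeAll
  induction act generalizing m with
  | nil => rfl
  | cons ρ act ih => rw [List.foldl_cons, ih, Function.update_of_ne h]

theorem storeAll_of_notMem (m : Mem) (a s t : ℕ) (act : List Regs) (y : ℕ)
    (h : ∀ ρ ∈ act, ρ s ≠ y) : m.storeAll a s t act a y = m a y := by
  unfold Mem.storeAll
  induction act generalizing m with
  | nil => rfl
  | cons ρ act ih =>
    rw [List.foldl_cons, ih _ fun ρ' h' => h ρ' (by simp [h']), Function.update_self,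
      Function.update_of_ne (h ρ (by simp)).symm]

theorem storeAll_of_mem (m : Mem) (a s t : ℕ) (act : List Regs)
    (hnd : (act.map fun ρ => ρ s).Nodup) (ρ : Regs) (hρ : ρ ∈ act) :
    m.storeAll a s t act a (ρ s) = ρ t := by
  induction act generalizing m with
  | nil => simp at hρ
  | cons ρ' act ih =>
    rw [List.map_cons, List.nodup_cons] at hnd
    change Mem.storeAll _ a s t act a (ρ s) = _
    rcases List.mem_cons.1 hρ with rfl | h
    · rw [storeAll_of_notMem]
      · simp
      · intro ρ' h' he
        exact hnd.1 (List.mem_map.2 ⟨ρ', h', he⟩)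
    · exact ih _ hnd.2 h

section commands

variable {B X : ℕ} (hX : 2 ≤ X) (hB : X ^ degBound ≤ B) {Rf Rf' : List (ℕ × ℕ)}
  {M : Mem}

include hX hB

/-- The rule for `par`; `F` is the contents of the array after the command. -/
theorem spec_par (T : Ex) (a : ℕ) (e₁ e₂ : Ex) (Tn c : ℕ) (addr val F : ℕ → ℕ)
    (hdeg : T.deg ≤ degBound ∧ e₁.deg ≤ degBound ∧ e₂.deg ≤ degBound)
    (hsize : T.size + e₁.size + e₂.size + 3 ≤ c) (htid : ∀ q ∈ Rf, q.1 ≠ tid)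
    (h : ∀ σ, (∀ q ∈ Rf, σ q.1 = q.2) → T.eval M σ = Tn ∧
      (σ tid < Tn → e₁.eval M σ = addr (σ tid) ∧ e₂.eval M σ = val (σ tid)))
    (hT : Tn < X) (hinj : ∀ i < Tn, ∀ j < Tn, addr i = addr j → i = j) (hval : ∀ i < Tn, val i < X)
    (hF : ∀ i < Tn, F (addr i) = val i) (hF' : ∀ y, (∀ i < Tn, addr i ≠ y) → F y = M a y) :
    Spec B (par T a e₁ e₂) (St X Rf M) (c * (Tn + 1)) c (St X Rf (Function.update M a F)) := by
  intro m ρ hm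
  obtain rfl := hm.2.2.2
  obtain ⟨d1, d2, d3⟩ := hdeg
  obtain ⟨hT1, hT2⟩ := Ex.ok_of_le hX hB d1 hm.1 hm.2.1
  have hT3 := (h _ hm.2.2.1).1
  have hval' : ∀ i < Tn, e₁.eval m (Function.update (Ex.env ρ) tid i) = addr i ∧
      e₂.eval m (Function.update (Ex.env ρ) tid i) = val i := by
    intro i hi
    have := (h (Function.update (Ex.env ρ) tid i) fun q hq => by
      rw [Function.update_of_ne (htid q hq)]; exact hm.2.2.1 q hq).2
    rw [Function.update_self] at this
    exact this hi
  have x1 := T.exec_code 0 [ρ] hT1 (by simpa using hT2)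
  obtain ⟨hT4, -, hT5⟩ := T.regs_spec m 0 ρ
  rw [hT3] at hT5
  set ρ₁ := T.regs m 0 ρ with hρ₁
  have hs : spawn 1 (2 * tid) [ρ₁] =
      (List.range Tn).map fun i => Function.update ρ₁ (2 * tid) i := by
    simp [spawn, show ρ₁ 1 = Tn from hT5]
  have henv : ∀ i, Ex.env (Function.update ρ₁ (2 * tid) i) = Function.update (Ex.env ρ) tid i := by
    intro i
    funext j
    by_cases hj : j = tid
    · subst hj; simp [Ex.env]
    · rw [Function.update_of_ne hj, ← hT4]
      exact Function.update_of_ne (by omega) _ _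
  have hbd : ∀ i < Tn, ∀ j, Function.update (Ex.env ρ) tid i j < X := by
    intro i hi j
    by_cases hj : j = tid
    · subst hj; simp; omega
    · rw [Function.update_of_ne hj]; exact hm.2.1 j
  set act₁ := (List.range Tn).map fun i => Function.update ρ₁ (2 * tid) i with hact₁
  have hact : ∀ ρ' ∈ act₁, ∃ i < Tn, Ex.env ρ' = Function.update (Ex.env ρ) tid i := by
    intro ρ' hρ'
    obtain ⟨i, hi, rfl⟩ := List.mem_map.1 hρ'
    exact ⟨i, List.mem_range.1 hi, henv i⟩
  have x2 := e₁.exec_code (B := B) (m := m) 0 act₁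
    (Ex.ok_of_le hX hB d2 hm.1 hm.2.1).1 (by
      intro ρ' hρ'
      obtain ⟨i, hi, he⟩ := hact ρ' hρ'
      rw [he]
      exact (Ex.ok_of_le hX hB d2 hm.1 (hbd i hi)).2)
  have x3 := e₂.exec_code (B := B) (m := m) 1 (act₁.map (e₁.regs m 0))
    (Ex.ok_of_le hX hB d3 hm.1 hm.2.1).1 (by
      intro ρ' hρ'
      obtain ⟨ρ'', hρ'', rfl⟩ := List.mem_map.1 hρ'
      obtain ⟨i, hi, he⟩ := hact ρ'' hρ''
      rw [(e₁.regs_spec m 0 ρ'').1, he]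
      exact (Ex.ok_of_le hX hB d3 hm.1 (hbd i hi)).2)
  -- the registers of processor `i` at the time of the write
  let τ : ℕ → Regs := fun i => e₂.regs m 1 (e₁.regs m 0 (Function.update ρ₁ (2 * tid) i))
  have hτ : (act₁.map (e₁.regs m 0)).map (e₂.regs m 1) = (List.range Tn).map τ := by
    rw [hact₁, List.map_map, List.map_map]
    rfl
  have hτ1 : ∀ i < Tn, τ i 1 = addr i := by
    intro i hi
    have := (e₂.regs_spec m 1 (e₁.regs m 0 (Function.update ρ₁ (2 * tid) i))).2.1 0 one_pos
    refine this.trans ((e₁.regs_spec m 0 _).2.2.trans ?_)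
    rw [henv]
    exact (hval' i hi).1
  have hτ3 : ∀ i < Tn, τ i 3 = val i := by
    intro i hi
    refine (e₂.regs_spec m 1 _).2.2.trans ?_
    rw [(e₁.regs_spec m 0 _).1, henv]
    exact (hval' i hi).2
  rw [hτ] at x3
  have hnd : (((List.range Tn).map τ).map fun ρ => ρ 1).Nodup := by
    rw [List.map_map]
    refine List.Nodup.map_on ?_ List.nodup_range
    intro i hi j hj hij
    rw [List.mem_range] at hi hj
    refine hinj i hi j hj ?_
    rw [← hτ1 i hi, ← hτ1 j hj]
    exact hij
  have x4 := Exec.store (B := B) a 1 3 m ((List.range Tn).map τ) hnd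
  have x5 := Exec.pardo (B := B) 1 (2 * tid) _ m _ [ρ₁] _ _ _ (by
    rw [hs]
    exact .seq _ _ _ _ _ _ _ _ _ _ _ _ x2 (.seq _ _ _ _ _ _ _ _ _ _ _ _ x3 x4))
  have hlen : act₁.length = Tn := by simp [hact₁]
  refine ⟨_, ρ₁, _, _, .seq _ _ _ _ _ _ _ _ _ _ _ _ x1 x5, ?_, ?_, ?_⟩
  · rw [hs]
    simp only [List.length_map, List.length_range, hlen, List.length_singleton]
    nlinarith
  · omega
  have hnew : m.storeAll a 1 3 ((List.range Tn).map τ) a = F := by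
    funext y
    by_cases hy : ∃ i < Tn, addr i = y
    · obtain ⟨i, hi, rfl⟩ := hy
      rw [hF i hi, ← hτ3 i hi, ← hτ1 i hi]
      exact storeAll_of_mem _ _ _ _ _ hnd _ (List.mem_map.2 ⟨i, List.mem_range.2 hi, rfl⟩)
    · push Not at hy
      rw [hF' y hy, storeAll_of_notMem]
      intro ρ' hρ'
      obtain ⟨i, hi, rfl⟩ := List.mem_map.1 hρ'
      rw [hτ1 i (List.mem_range.1 hi)]
      exact hy i (List.mem_range.1 hi)
  rw [hT4]
  refine ⟨fun a' y => ?_, hm.2.1, hm.2.2.1, funext fun a' => ?_⟩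
  · by_cases ha : a' = a
    · subst ha
      rw [hnew]
      by_cases hy : ∃ i < Tn, addr i = y
      · obtain ⟨i, hi, rfl⟩ := hy
        rw [hF i hi]; exact hval i hi
      · push Not at hy
        rw [hF' y hy]; exact hm.1 _ _
    · rw [storeAll_of_ne _ _ _ _ ha]; exact hm.1 _ _
  · by_cases ha : a' = a
    · subst ha
      rw [hnew, Function.update_self]
    · rw [storeAll_of_ne _ _ _ _ ha, Function.update_of_ne ha]

/-- The rule for `par` when processor `i` writes to cell `i`. -/
theorem spec_par_id (T : Ex) (a : ℕ) (e : Ex) (Tn c : ℕ) (F : ℕ → ℕ)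
    (hdeg : T.deg ≤ degBound ∧ e.deg ≤ degBound) (hsize : T.size + e.size + 5 ≤ c)
    (htid : ∀ q ∈ Rf, q.1 ≠ tid)
    (h : ∀ σ, (∀ q ∈ Rf, σ q.1 = q.2) → T.eval M σ = Tn ∧
      (σ tid < Tn → e.eval M σ = F (σ tid)))
    (hT : Tn < X) (hval : ∀ i < Tn, F i < X) (hF : ∀ i, Tn ≤ i → F i = M a i) :
    Spec B (par T a (.var tid) e) (St X Rf M) (c * (Tn + 1)) c
      (St X Rf (Function.update M a F)) := by
  refine spec_par hX hB T a (.var tid) e Tn c id F F ⟨hdeg.1, by simp [Ex.deg], hdeg.2⟩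
    (by simp only [Ex.size]; omega) htid (fun σ hσ => ?_) hT (fun _ _ _ _ h => h) hval
    (fun i hi => rfl) (fun y hy => hF y ?_)
  · exact ⟨(h σ hσ).1, fun hi => ⟨rfl, (h σ hσ).2 hi⟩⟩
  · exact Nat.le_of_not_lt fun h => hy y h rfl

/-- The rule for `rep`; the body may not change the counter. -/
theorem spec_rep (r : ℕ) (e : Ex) (p : Prog) (n d : ℕ) (wb : ℕ → ℕ) (Rfj : ℕ → List (ℕ × ℕ))
    (Mj : ℕ → Mem) (he : e.deg ≤ degBound)
    (hn : ∀ σ, (∀ q ∈ Rf, σ q.1 = q.2) → e.eval (Mj 0) σ = n) (hnX : n < X)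
    (h0 : ∀ q ∈ Rfj 0, q ∈ Rf ∧ q.1 ≠ r)
    (hr : ∀ j, ∀ q ∈ Rfj j, q.1 ≠ r)
    (hb : ∀ j < n, Spec B p (St X ((r, n - j) :: Rfj j) (Mj j)) (wb j) d
      (St X ((r, n - j) :: Rfj (j + 1)) (Mj (j + 1)))) :
    Spec B (rep r e p) (St X Rf (Mj 0)) (e.size + ∑ j ∈ Finset.range n, (wb j + 7) + 3)
      (e.size + n * (d + 7) + 3) (St X (Rfj n) (Mj n)) := by
  have h1 := spec_asg hX hB (Rf := Rf) (Rf' := (r, n) :: Rfj 0) (M := Mj 0) r e n he hn hnX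
    (by
      intro q hq
      rcases List.mem_cons.1 hq with rfl | hq
      · exact .inl rfl
      · exact .inr (h0 q hq))
  have h2 := Spec.while (B := B) (p := .seq p (asg r (.var r - 1))) (d := d + 6) r n
    (fun j => St X ((r, n - j) :: Rfj j) (Mj j)) (fun j => wb j + 6)
    (fun j hj m σ hm => by
      have := hm.2.2.1 _ (List.mem_cons_self ..)
      simp only at this
      omega)
    (fun m σ hm => by
      have := hm.2.2.1 _ (List.mem_cons_self ..)
      simpa using this)
    (fun j hj => by
      refine (hb j hj).seq ((spec_asg hX hB r (.var r - 1) (n - (j + 1)) ?_ ?_ ?_ ?_).cost ?_ ?_)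
      · change 1 + (1 + 1) ≤ 3000; norm_num
      · intro σ hσ
        have := hσ _ (List.mem_cons_self ..)
        simp only at this
        simp only [Ex.eval_sub, Ex.eval_var, Ex.eval_one, this]
        omega
      · omega
      · intro q hq
        rcases List.mem_cons.1 hq with rfl | hq
        · exact .inl rfl
        · exact .inr ⟨List.mem_cons_of_mem _ hq, hr _ q hq⟩
      · exact le_of_eq rfl
      · exact le_of_eq rfl)
  refine ((h1.seq h2).mono (fun _ _ h => h) ?_ ?_ fun m σ hm => ?_)
  · simp only [add_assoc, Nat.reduceAdd]
    omega
  · ring_nf; omega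
  · exact hm.weaken fun q hq => List.mem_cons_of_mem _ hq

end commands

end SubpathDP

/-! ### Vectors of digits -/

namespace SubpathDP

/-- The number with the digits `f v` in base `E`. -/
def enc {k : ℕ} (E : ℕ) (f : Fin k → ℕ) : ℕ := ∑ v : Fin k, f v * E ^ (v : ℕ)

/-- The sum of `g d * q ^ v` over the lowest digits `d` in base `E`, by recursion on the number of
digits. -/
def digitSum (g : ℕ → ℕ) (q E : ℕ) : ℕ → ℕ → ℕ
  | 0, _ => 0
  | v + 1, e => digitSum g q E v (e % E ^ v) + g (e / E ^ v) * q ^ v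

/-- The number in which `U` has been applied to the last digit that satisfies `un`. -/
def replaceLast (un : ℕ → Prop) [DecidablePred un] (U : ℕ → ℕ) (E : ℕ) : ℕ → ℕ → ℕ
  | 0, _ => 0
  | v + 1, e => if un (e / E ^ v) then e % E ^ v + U (e / E ^ v) * E ^ v
      else replaceLast un U E v (e % E ^ v) + e / E ^ v * E ^ v

theorem enc_castSucc {k : ℕ} (E : ℕ) (f : Fin (k + 1) → ℕ) :
    enc E f = enc E (fun v : Fin k => f v.castSucc) + f (Fin.last k) * E ^ k := by
  simp [enc, Fin.sum_univ_castSucc]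

theorem enc_lt {k : ℕ} {E : ℕ} (f : Fin k → ℕ) (hf : ∀ v, f v < E) : enc E f < E ^ k := by
  induction k with
  | zero => simp [enc]
  | succ k ih =>
    rw [enc_castSucc, pow_succ]
    have h1 := ih (fun v => f v.castSucc) fun v => hf _
    have h2 : f (Fin.last k) * E ^ k + E ^ k ≤ E ^ k * E := by
      have := hf (Fin.last k)
      nlinarith [Nat.mul_le_mul_right (E ^ k) this]
    omega

theorem enc_mod_div {k : ℕ} {E : ℕ} (f : Fin (k + 1) → ℕ) (hf : ∀ v, f v < E) :
    enc E f % E ^ k = enc E (fun v : Fin k => f v.castSucc) ∧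
      enc E f / E ^ k = f (Fin.last k) := by
  have h1 := enc_lt (fun v : Fin k => f v.castSucc) fun v => hf _
  rw [enc_castSucc]
  have h2 : 0 < E ^ k := by omega
  constructor
  · rw [Nat.add_mul_mod_self_right, Nat.mod_eq_of_lt h1]
  · rw [Nat.add_mul_div_right _ _ h2, Nat.div_eq_of_lt h1, zero_add]

theorem enc_injective {k : ℕ} {E : ℕ} {f g : Fin k → ℕ} (hf : ∀ v, f v < E) (hg : ∀ v, g v < E)
    (h : enc E f = enc E g) : f = g := by
  induction k with
  | zero => exact funext fun v => v.elim0
  | succ k ih =>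
    obtain ⟨f1, f2⟩ := enc_mod_div f hf
    obtain ⟨g1, g2⟩ := enc_mod_div g hg
    rw [h] at f1 f2
    have h1 := ih (fun v => hf _) (fun v => hg _) (f1.symm.trans g1)
    funext v
    refine Fin.lastCases ?_ (fun v => ?_) v
    · exact f2.symm.trans g2
    · exact congrFun h1 v

theorem exists_enc {k E : ℕ} {c : ℕ} (hc : c < E ^ k) :
    ∃ f : Fin k → ℕ, (∀ v, f v < E) ∧ enc E f = c := by
  induction k generalizing c with
  | zero => exact ⟨fun _ => 0, fun v => v.elim0, by simp at hc; simp [enc, hc]⟩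
  | succ k ih =>
    have h0 : 0 < E ^ k := Nat.pos_of_ne_zero fun h => by simp [pow_succ, h] at hc
    obtain ⟨f, hf, h⟩ := ih (Nat.mod_lt c h0)
    have h1 : c / E ^ k < E := by
      rw [Nat.div_lt_iff_lt_mul h0]
      rwa [pow_succ, mul_comm] at hc
    refine ⟨Fin.lastCases (c / E ^ k) f, fun v => ?_, ?_⟩
    · refine Fin.lastCases ?_ (fun v => ?_) v
      · simpa using h1
      · simpa using hf v
    · rw [enc_castSucc]
      simp only [Fin.lastCases_castSucc, Fin.lastCases_last, h]
      rw [mul_comm]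
      exact Nat.mod_add_div c _

theorem enc_digit {k E : ℕ} {f : Fin k → ℕ} (hf : ∀ v, f v < E) (v : Fin k) :
    enc E f / E ^ (v : ℕ) % E = f v := by
  induction k with
  | zero => exact v.elim0
  | succ k ih =>
    obtain ⟨h1, h2⟩ := enc_mod_div f hf
    refine Fin.lastCases ?_ (fun v => ?_) v
    · rw [Fin.val_last, h2, Nat.mod_eq_of_lt (hf _)]
    · rw [← ih (f := fun v => f v.castSucc) (fun v => hf _) v, ← h1, Fin.val_castSucc]
      have h3 : E ^ k = E ^ (v : ℕ) * E ^ (k - v) := by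
        rw [← pow_add]; congr 1; omega
      have h4 : E ∣ E ^ (k - v) := dvd_pow_self _ (by omega)
      rw [h3, Nat.mod_mul_right_div_self, Nat.mod_mod_of_dvd _ h4]

theorem digitSum_enc (g : ℕ → ℕ) (q : ℕ) {E k : ℕ} (f : Fin k → ℕ) (hf : ∀ v, f v < E) :
    digitSum g q E k (enc E f) = ∑ v : Fin k, g (f v) * q ^ (v : ℕ) := by
  induction k with
  | zero => simp [digitSum]
  | succ k ih =>
    obtain ⟨h1, h2⟩ := enc_mod_div f hf
    rw [digitSum, h1, h2, ih _ fun v => hf _, Fin.sum_univ_castSucc]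
    simp

theorem replaceLast_enc (un : ℕ → Prop) [DecidablePred un] {E k : ℕ} (f : Fin k → ℕ)
    (hf : ∀ v, f v < E) (h : ∃ v, un (f v)) :
    ∃ v, un (f v) ∧ ∀ U : ℕ → ℕ,
      replaceLast un U E k (enc E f) = enc E (Function.update f v (U (f v))) := by
  induction k with
  | zero => exact h.choose.elim0
  | succ k ih =>
    obtain ⟨h1, h2⟩ := enc_mod_div f hf
    by_cases hl : un (f (Fin.last k))
    · refine ⟨Fin.last k, hl, fun U => ?_⟩
      rw [replaceLast, h1, h2, if_pos hl, enc_castSucc]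
      congr 2
      · funext v
        rw [Function.update_of_ne (Fin.castSucc_lt_last v).ne]
      · simp
    · obtain ⟨v, hv, hU⟩ := ih (fun v => f v.castSucc) (fun v => hf _) (by
        obtain ⟨v, hv⟩ := h
        revert hv
        refine Fin.lastCases (fun h => absurd h hl) (fun v hv => ⟨v, hv⟩) v)
      refine ⟨v.castSucc, hv, fun U => ?_⟩
      rw [replaceLast, h1, h2, if_neg hl, hU, enc_castSucc,
        Function.update_of_ne (Fin.castSucc_lt_last v).ne']
      congr 2
      funext u
      by_cases hu : u = v
      · subst hu; simp
      · rw [Function.update_of_ne hu, Function.update_of_ne fun h => hu (Fin.castSucc_injective _ h)]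

end SubpathDP

/-! ### Validity along a subpath -/

namespace SubpathDP

open Status

theorem Valid.isPartialMatch {W V ι : Type*} {H : SimpleGraph W} {G : SimpleGraph V}
    {T : TreeDecomposition G ι} {i : ι} {s : W → Status V} (h : Valid H T i s) :
    IsPartialMatch H G (T.bag i) s := by
  cases h with
  | noChild _ _ hs _ => exact hs
  | combine _ _ _ _ _ _ hs => exact hs

/-- Compatibility of the statuses `c` (upper bag `X`), `a` (lower bag `Y`) and `w` (bag `Z` off the
path) of one pattern vertex. -/
structure LocalCompat {V : Type*} (Y Z X : List V) (a w c : Status V) : Prop where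
  mem : ∀ x, w = matched x → x ∈ Z
  agree_left₁ : ∀ x, a = matched x → x ∈ X → c = matched x
  agree_right₁ : ∀ x, c = matched x → x ∈ Y → a = matched x
  forget₁ : ∀ x, a = matched x → x ∉ X → c = inChild
  inChild₁ : a = inChild → c = inChild
  agree_left₂ : ∀ x, w = matched x → x ∈ X → c = matched x
  agree_right₂ : ∀ x, c = matched x → x ∈ Z → w = matched x
  forget₂ : ∀ x, w = matched x → x ∉ X → c = inChild
  inChild₂ : w = inChild → c = inChild
  exactly_one : c = inChild → Xor (a = unmatched) (w = unmatched)

theorem compatible_iff {W V : Type*} [DecidableEq V] {X Y Z : List V} {c a w : W → Status V}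
    (hw : ∀ v x, w v = matched x → x ∈ Z) :
    Compatible X.toFinset Y.toFinset Z.toFinset c a w ↔
      ∀ v, LocalCompat Y Z X (a v) (w v) (c v) := by
  constructor
  · rintro ⟨⟨a1, a2, a3, a4⟩, ⟨b1, b2, b3, b4⟩, h⟩ v
    simp only [List.mem_toFinset] at a1 a2 a3 b1 b2 b3
    exact ⟨hw v, a1 v, a2 v, a3 v, a4 v, b1 v, b2 v, b3 v, b4 v, h v⟩
  · intro h
    refine ⟨⟨?_, ?_, ?_, ?_⟩, ⟨?_, ?_, ?_, ?_⟩, fun v => (h v).exactly_one⟩ <;>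
      try simp only [List.mem_toFinset]
    · exact fun v => (h v).agree_left₁
    · exact fun v => (h v).agree_right₁
    · exact fun v => (h v).forget₁
    · exact fun v => (h v).inChild₁
    · exact fun v => (h v).agree_left₂
    · exact fun v => (h v).agree_right₂
    · exact fun v => (h v).forget₂
    · exact fun v => (h v).inChild₂

theorem Compatible.swap {W V : Type*} {X L R : Finset V} {s sl sr : W → Status V}
    (h : Compatible X L R s sl sr) : Compatible X R L s sr sl :=
  ⟨h.right, h.left, fun v hv => (xor_comm _ _).mp (h.exactly_one v hv)⟩

/-- The part of a partial match inside another bag. -/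
def restrict {W V : Type*} [DecidableEq V] (Y : List V) (c : W → Status V) (v : W) : Status V :=
  match c v with
  | matched x => if x ∈ Y then matched x else unmatched
  | _ => unmatched

section restrict

variable {W V : Type*} [DecidableEq V] {X Y Z : List V} {c : W → Status V}

theorem restrict_eq_matched {v : W} {x : V} :
    restrict Y c v = matched x ↔ c v = matched x ∧ x ∈ Y := by
  rcases hv : c v with y | _ | _
  · by_cases hy : y ∈ Y
    · simp only [restrict, hv, hy, if_true, matched.injEq]
      exact ⟨fun h => ⟨h, h ▸ hy⟩, fun h => h.1⟩
    · simp only [restrict, hv, hy, if_false, reduceCtorEq, matched.injEq, false_iff, not_and]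
      exact fun h => h ▸ hy
  · simp [restrict, hv]
  · simp [restrict, hv]

theorem restrict_ne_inChild (v : W) : restrict Y c v ≠ inChild := by
  unfold restrict
  split
  · split_ifs <;> simp
  · simp

theorem isPartialMatch_restrict {H : SimpleGraph W} {G : SimpleGraph V}
    (h : IsPartialMatch H G X.toFinset c) : IsPartialMatch H G Y.toFinset (restrict Y c) where
  mem _ _ hv := List.mem_toFinset.2 (restrict_eq_matched.1 hv).2
  injective u v x hu hv := h.injective u v x (restrict_eq_matched.1 hu).1 (restrict_eq_matched.1 hv).1
  adj u v x y huv hu hv := h.adj u v x y huv (restrict_eq_matched.1 hu).1 (restrict_eq_matched.1 hv).1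

theorem localCompat_restrict (hc : ∀ v, c v ≠ inChild) (hX : ∀ v x, c v = matched x → x ∈ X)
    (v : W) : LocalCompat Y Z X (restrict Y c v) (restrict Z c v) (c v) where
  mem _ h := (restrict_eq_matched.1 h).2
  agree_left₁ _ h _ := (restrict_eq_matched.1 h).1
  agree_right₁ _ h h' := restrict_eq_matched.2 ⟨h, h'⟩
  forget₁ x h h' := absurd (hX v x (restrict_eq_matched.1 h).1) h'
  inChild₁ h := absurd h (restrict_ne_inChild v)
  agree_left₂ _ h _ := (restrict_eq_matched.1 h).1
  agree_right₂ _ h h' := restrict_eq_matched.2 ⟨h, h'⟩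
  forget₂ x h h' := absurd (hX v x (restrict_eq_matched.1 h).1) h'
  inChild₂ h := absurd h (restrict_ne_inChild v)
  exactly_one h := absurd h (hc v)

end restrict

theorem eq_or_eq_of_isChild {V ι : Type*} [Finite ι] {G : SimpleGraph V} {T : TreeDecomposition G ι}
    {i a b c : ι} (ha : T.IsChild i a) (hb : T.IsChild i b) (hab : a ≠ b) (hc : T.IsChild i c) :
    c = a ∨ c = b := by
  have h2 : {j | T.IsChild i j}.ncard = 2 := by
    refine (T.binary i).resolve_left fun h => ?_
    have h0 : {j | T.IsChild i j} = ∅ := (Set.ncard_eq_zero (Set.toFinite _)).1 h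
    exact Set.notMem_empty a (h0 ▸ ha)
  obtain ⟨x, y, -, hxy⟩ := Set.ncard_eq_two.1 h2
  have ha' : a ∈ ({x, y} : Set ι) := hxy ▸ ha
  have hb' : b ∈ ({x, y} : Set ι) := hxy ▸ hb
  have hc' : c ∈ ({x, y} : Set ι) := hxy ▸ hc
  simp only [Set.mem_insert_iff, Set.mem_singleton_iff] at ha' hb' hc'
  grind

theorem valid_iff_of_children {W V ι : Type*} [DecidableEq V] {H : SimpleGraph W}
    {G : SimpleGraph V} [Finite ι] {T : TreeDecomposition G ι} {l : ι → List V}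
    (hl : ∀ i, (l i).toFinset = T.bag i) {i a b : ι}
    (ha : T.IsChild i a) (hb : T.IsChild i b) (hab : a ≠ b) (c : W → Status V) :
    Valid H T i c ↔ ∃ s, Valid H T a s ∧ ∃ w, Valid H T b w ∧
      (∀ v, LocalCompat (l a) (l b) (l i) (s v) (w v) (c v)) ∧
        IsPartialMatch H G (l i).toFinset c := by
  have hmem : ∀ w, Valid H T b w → ∀ v x, w v = matched x → x ∈ l b := by
    intro w hw v x h
    rw [← List.mem_toFinset, hl]
    exact (Valid.isPartialMatch hw).mem v x h
  constructor
  · intro h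
    cases h with
    | noChild _ _ hs hc =>
      rw [← hl i] at hs
      refine ⟨restrict (l a) c, .noChild _ _ ?_ restrict_ne_inChild, restrict (l b) c,
        .noChild _ _ ?_ restrict_ne_inChild, localCompat_restrict hc fun v x h => ?_, hs⟩
      · rw [← hl]; exact isPartialMatch_restrict hs
      · rw [← hl]; exact isPartialMatch_restrict hs
      · exact List.mem_toFinset.1 (hs.mem v x h)
    | combine _ l' r' _ sl sr hs hl' hr' hlr vl vr h =>
      rw [hl]
      rcases eq_or_eq_of_isChild ha hb hab hl' with rfl | rfl <;>
        rcases eq_or_eq_of_isChild ha hb hab hr' with rfl | rfl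
      · exact absurd rfl hlr
      · rw [← hl, ← hl, ← hl, compatible_iff (hmem _ vr)] at h
        exact ⟨sl, vl, sr, vr, h, hs⟩
      · have h' := Compatible.swap h
        rw [← hl, ← hl, ← hl, compatible_iff (hmem _ vl)] at h'
        exact ⟨sr, vr, sl, vl, h', hs⟩
      · exact absurd rfl hlr
  · rintro ⟨s, hs, w, hw, h, hc⟩
    rw [← compatible_iff (hmem _ hw), hl, hl, hl] at h
    rw [hl] at hc
    exact .combine _ _ _ _ _ _ hc ha hb hab hs hw h

section path

variable {k n : ℕ} {ι : Type*} (H : SimpleGraph (Fin k)) {G : SimpleGraph (Fin n)}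
  {T : TreeDecomposition G ι} (P : Subpath T) (l : ι → List (Fin n))

open Classical in
/-- The bag of the child number `s` off the path; empty if there is no such child. -/
noncomputable def offList (s : ℕ) : List (Fin n) := if P.IsOff s then l (P.off s) else []

open Classical in
/-- The bags along the path. Layer `j + 2` is node `j`; below the bottom node there are the child
number `P.length` and an additional empty bag. -/
noncomputable def layer : ℕ → List (Fin n)
  | 0 => []
  | 1 => offList P l P.length
  | j + 2 => if j < P.length then l (P.node j) else []

/-- The number of the child off the path that takes part in the step from layer `i` to layer
`i + 1`. In step `0` this is the child that is itself layer `1`: a match of it is compatible with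
the same match and the empty match of the empty bag. -/
def offNumber (p i : ℕ) : ℕ := if i = 0 then p else i - 1

/-- The valid partial matches of the children off the path; if the bottom node is a leaf, then its
missing children are replaced by empty bags with the empty match. -/
def OffValid (s : ℕ) (w : Fin k → Status (Fin n)) : Prop :=
  P.IsOff s ∧ Valid H T (P.off s) w ∨
    T.IsLeaf (P.node 0) ∧ (s = 0 ∨ s = P.length) ∧ w = fun _ => unmatched

/-- One step along the path: `c` on layer `i + 1` is compatible with `s` on layer `i` and some valid
partial match of the child off the path. -/
def Step (i : ℕ) (s c : Fin k → Status (Fin n)) : Prop :=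
  ∃ w, OffValid H P (offNumber P.length i) w ∧
    (∀ v, LocalCompat (layer P l i) (offList P l (offNumber P.length i)) (layer P l (i + 1))
      (s v) (w v) (c v)) ∧ IsPartialMatch H G (layer P l (i + 1)).toFinset c

/-- A chain of `j` steps from layer `i` to layer `i + j`. -/
def Chain (i : ℕ) : ℕ → (Fin k → Status (Fin n)) → (Fin k → Status (Fin n)) → Prop
  | 0, s, c => s = c
  | j + 1, s, c => ∃ y, Chain i j s y ∧ Step H P l (i + j) y c

theorem chain_add (i a b : ℕ) (s c : Fin k → Status (Fin n)) :
    Chain H P l i (a + b) s c ↔ ∃ y, Chain H P l i a s y ∧ Chain H P l (i + a) b y c := by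
  induction b generalizing c with
  | zero => exact ⟨fun h => ⟨c, h, rfl⟩, fun ⟨y, h, h'⟩ => by rwa [← show y = c from h']⟩
  | succ b ih =>
    constructor
    · rintro ⟨z, hz, h3⟩
      obtain ⟨y, h1, h2⟩ := (ih z).1 hz
      exact ⟨y, h1, z, h2, (add_assoc i a b).symm ▸ h3⟩
    · rintro ⟨y, h1, z, h2, h3⟩
      rw [add_assoc] at h3
      exact ⟨z, (ih z).2 ⟨y, h1, h2⟩, h3⟩

variable {l} (hl : ∀ i, (l i).toFinset = T.bag i)

include hl

theorem OffValid.isPartialMatch {s : ℕ} {w : Fin k → Status (Fin n)} (h : OffValid H P s w) :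
    IsPartialMatch H G (offList P l s).toFinset w := by
  rcases h with ⟨h1, h2⟩ | ⟨-, -, rfl⟩
  · rw [offList, if_pos h1, hl]
    exact Valid.isPartialMatch h2
  · exact ⟨by simp, by simp, by simp⟩

theorem chain_one_iff (c : Fin k → Status (Fin n)) :
    Chain H P l 0 1 (fun _ => unmatched) c ↔ OffValid H P P.length c := by
  constructor
  · rintro ⟨_, rfl, w, hw, h, hc⟩
    rw [offNumber, if_pos rfl] at hw h
    have hPM := OffValid.isPartialMatch H P hl hw
    suffices hwc : w = c by rwa [← hwc]
    funext v
    obtain ⟨-, -, -, -, -, h1, h2, h3, h4, h5⟩ := h v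
    rcases hv : w v with x | _ | _
    · refine (h1 x hv ?_).symm
      exact List.mem_toFinset.1 (hPM.mem v x hv)
    · exact (h4 hv).symm
    · rcases hc' : c v with x | _ | _
      · rw [h2 x hc' (List.mem_toFinset.1 (hc.mem v x hc'))] at hv
        cases hv
      · have := h5 hc'
        simp [hv, Xor] at this
      · rfl
  · intro h
    have hPM := OffValid.isPartialMatch H P hl h
    refine ⟨_, rfl, c, ?_, fun v => ?_, ?_⟩
    · rwa [offNumber, if_pos rfl]
    · rw [offNumber, if_pos rfl]
      have hmem : ∀ x, c v = matched x → x ∈ offList P l P.length := fun x hx =>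
        List.mem_toFinset.1 (hPM.mem v x hx)
      exact ⟨hmem, by simp, by simp [layer], by simp, by simp, fun _ h _ => h, fun _ h _ => h,
        fun x h h' => absurd (hmem x h) h', fun h => h, fun h => by simp [h, Xor]⟩
    · exact hPM

/-- Layer `j + 2` reaches exactly the valid partial matches of node `j`. Matches with empty `C` need
no separate rule: their restrictions to the two children are valid and compatible with them. -/
theorem chain_iff_valid [Finite ι] (j : ℕ) (hj : j < P.length) (c : Fin k → Status (Fin n)) :
    Chain H P l 0 (j + 2) (fun _ => unmatched) c ↔ Valid H T (P.node j) c := by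
  induction j generalizing c with
  | zero =>
    have hlay : layer P l 2 = l (P.node 0) := by simp [layer, hj]
    by_cases hleaf : T.IsLeaf (P.node 0)
    · have hoff : ∀ s, s = 0 ∨ s = P.length → offList P l s = [] := by
        intro s hs
        rw [offList, if_neg]
        rintro (⟨h1, h2⟩ | ⟨h1, -⟩)
        · omega
        · exact h1 hleaf
      have hOff : ∀ s, s = 0 ∨ s = P.length → ∀ w : Fin k → Status (Fin n),
          OffValid H P s w ↔ w = fun _ => unmatched := by
        intro s hs w
        refine ⟨?_, fun h => .inr ⟨hleaf, hs, h⟩⟩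
        rintro (⟨h1 | h1, -⟩ | h)
        · omega
        · exact absurd hleaf h1.1
        · exact h.2.2
      have hval : Valid H T (P.node 0) c ↔
          IsPartialMatch H G (l (P.node 0)).toFinset c ∧ ∀ v, c v ≠ inChild := by
        rw [hl]
        constructor
        · intro h
          cases h with
          | noChild _ _ hs hc => exact ⟨hs, hc⟩
          | combine _ l' _ _ _ _ _ hl' => exact absurd hl' (hleaf l')
        · exact fun h => .noChild _ _ h.1 h.2
      rw [hval]
      constructor
      · rintro ⟨y, hy, w, hw, h, hc⟩
        have hy' := (chain_one_iff H P hl y).1 hy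
        rw [hOff _ (.inr rfl)] at hy'
        rw [show offNumber P.length (0 + 1) = 0 from rfl, hOff _ (.inl rfl)] at hw
        refine ⟨hlay ▸ hc, fun v hv => ?_⟩
        have := (h v).exactly_one hv
        simp [hy', hw, Xor] at this
      · rintro ⟨h1, h2⟩
        refine ⟨fun _ => unmatched, (chain_one_iff H P hl _).2 ((hOff _ (.inr rfl) _).2 rfl),
          fun _ => unmatched, (hOff _ (.inl rfl) _).2 rfl, fun v => ?_, ?_⟩
        · have h3 : layer P l (0 + 1) = [] := hoff _ (.inr rfl)
          have h4 : offList P l (offNumber P.length (0 + 1)) = [] := hoff _ (.inl rfl)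
          rw [h3, h4]
          exact ⟨by simp, by simp, by simp, by simp, by simp, by simp, by simp, by simp, by simp,
            fun h => absurd h (h2 v)⟩
        · rw [show 0 + 1 + 1 = 2 from rfl, hlay]; exact h1
    · obtain ⟨h1, h2, h3⟩ := P.bottom.resolve_left hleaf
      have hoff : ∀ s, s = 0 ∨ s = P.length → P.IsOff s := fun s hs => .inr ⟨hleaf, hs⟩
      have hOff : ∀ s, s = 0 ∨ s = P.length → ∀ w : Fin k → Status (Fin n),
          OffValid H P s w ↔ Valid H T (P.off s) w := by
        intro s hs w
        exact ⟨fun h => (h.resolve_right fun h => hleaf h.1).2, fun h => .inl ⟨hoff s hs, h⟩⟩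
      rw [valid_iff_of_children hl h2 h1 h3.symm]
      have h4 : layer P l (0 + 1) = l (P.off P.length) := if_pos (hoff _ (.inr rfl))
      have h5 : offList P l (offNumber P.length (0 + 1)) = l (P.off 0) := if_pos (hoff _ (.inl rfl))
      change (∃ y, Chain H P l 0 1 _ y ∧ Step H P l (0 + 1) y c) ↔ _
      simp only [chain_one_iff H P hl, Step, h4, h5, show 0 + 1 + 1 = 2 from rfl, hlay]
      simp only [show offNumber P.length (0 + 1) = 0 from rfl, hOff _ (.inr rfl), hOff _ (.inl rfl)]
  | succ j ih =>
    have h1 := P.child_node j hj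
    obtain ⟨h2, h3⟩ := P.child_off j hj
    have hoff : P.IsOff (j + 1) := .inl ⟨by omega, hj⟩
    have hOff : ∀ w : Fin k → Status (Fin n),
        OffValid H P (j + 1) w ↔ Valid H T (P.off (j + 1)) w := by
      intro w
      refine ⟨?_, fun h => .inl ⟨hoff, h⟩⟩
      rintro (h | ⟨-, h, -⟩)
      · exact h.2
      · omega
    rw [valid_iff_of_children hl h1 h2 h3.symm]
    have h4 : layer P l (0 + (j + 2)) = l (P.node j) := by
      rw [zero_add]; exact if_pos (by omega)
    have h5 : layer P l (0 + (j + 2) + 1) = l (P.node (j + 1)) := by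
      rw [zero_add]; exact if_pos hj
    have h6 : offNumber P.length (0 + (j + 2)) = j + 1 := by simp [offNumber]
    have h7 : offList P l (j + 1) = l (P.off (j + 1)) := if_pos hoff
    change (∃ y, Chain H P l 0 (j + 2) _ y ∧ Step H P l (0 + (j + 2)) y c) ↔ _
    simp only [ih (by omega), Step, h4, h5, h6, h7, hOff]

end path

end SubpathDP

/-! ### Digits of gates -/

namespace SubpathDP

open Status

/-- The order in which the status of a pattern vertex develops along a path. -/
def Le {V : Type*} (a c : Status V) : Prop := a = unmatched ∨ c = inChild ∨ a = c

theorem Le.trans {V : Type*} {a b c : Status V} (h : Le a b) (h' : Le b c) : Le a c := by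
  unfold Le at *
  grind

theorem LocalCompat.le {V : Type*} {Y Z X : List V} {a w c : Status V}
    (h : LocalCompat Y Z X a w c) : Le a c := by
  rcases a with x | _ | _
  · by_cases hx : x ∈ X
    · exact .inr (.inr (h.agree_left₁ x rfl hx).symm)
    · exact .inr (.inl (h.forget₁ x rfl hx))
  · exact .inr (.inl (h.inChild₁ rfl))
  · exact .inl rfl

/-- The positions of the elements of `l₁` in `l₂`, counted from one; zero means absence. -/
def transl {V : Type*} [DecidableEq V] (l₁ l₂ : List V) (x : ℕ) : ℕ :=
  match l₁[x]? with
  | some w => if w ∈ l₂ then l₂.idxOf w + 1 else 0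
  | none => 0

theorem transl_idxOf {V : Type*} [DecidableEq V] {l₁ l₂ : List V} {w : V} (h : w ∈ l₁) :
    transl l₁ l₂ (l₁.idxOf w) = if w ∈ l₂ then l₂.idxOf w + 1 else 0 := by
  have h1 : l₁[l₁.idxOf w]? = some w := by
    rw [List.getElem?_eq_getElem (List.idxOf_lt_length_iff.2 h), List.getElem_idxOf]
  simp [transl, h1]

theorem transl_le {V : Type*} [DecidableEq V] {l₁ l₂ : List V} (x : ℕ) :
    transl l₁ l₂ x ≤ l₂.length := by
  unfold transl
  split
  · split_ifs with h
    · exact List.idxOf_lt_length_iff.2 h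
    · omega
  · omega

/-- The digit for a pair of statuses `a`, `c` on layers with the bags `lα`, `lβ`; `t` bounds the
sizes of the bags. Only pairs with `Le a c` matter. -/
def pairDigit {V : Type*} [DecidableEq V] (t : ℕ) (lα lβ : List V) : Status V → Status V → ℕ
  | unmatched, unmatched => 0
  | unmatched, inChild => 1
  | inChild, inChild => 2
  | unmatched, matched x => 3 + lβ.idxOf x
  | matched x, inChild => 3 + t + lα.idxOf x
  | matched x, matched _ => 3 + 2 * t + lα.idxOf x
  | _, _ => 0

/-- The pair of statuses is ordered and occurs on layers with these bags. -/
structure WfPair {V : Type*} (lα lβ : List V) (a c : Status V) : Prop where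
  le : Le a c
  left : ∀ x, a = matched x → x ∈ lα
  right : ∀ x, c = matched x → x ∈ lβ

/-- The meaning of one digit of a gate: the statuses `a`, `c` of a pattern vertex at the two ends of
a segment and a set of statuses in the middle. `pend` allows all of them, `keep` and `next` decide
for the status at the lower or at the upper end, and `heap` decides for a match, if `a` is
`unmatched` and `c` is `inChild`: the bag in the middle forms the leaves of a heap with the root
`1`, and `heap i` stands for the leaves below `i`. The digit `heap 0` stands for the remaining
possibilities for such `a`, `c`. -/
inductive Digit (V : Type*)
  | pend (a c : Status V)
  | keep (a c : Status V)
  | next (a c : Status V)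
  | heap (i : ℕ)

namespace Digit

variable {V : Type*} [DecidableEq V] (t : ℕ) (leaf : Bool) (lα lμ lβ : List V)

/-- The number of digits that stand for a pair. -/
abbrev numPairs (t : ℕ) : ℕ := 3 * t + 3

/-- The base of the number system for gates. -/
abbrev base (t : ℕ) : ℕ := 11 * t + 9

/-- The number of a digit. -/
def code : Digit V → ℕ
  | pend a c => pairDigit t lα lβ a c
  | keep a c => pairDigit t lα lβ a c + numPairs t
  | next a c => pairDigit t lα lβ a c + 2 * numPairs t
  | heap i => 3 * numPairs t + i

/-- The status at the lower end. -/
def lo : Digit V → Status V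
  | pend a _ | keep a _ | next a _ => a
  | heap _ => unmatched

/-- The status at the upper end. -/
def hi : Digit V → Status V
  | pend _ c | keep _ c | next _ c => c
  | heap _ => inChild

/-- The digit occurs at a node with these bags. -/
def Wf : Digit V → Prop
  | pend a c | keep a c | next a c => WfPair lα lβ a c
  | heap i => i < 2 * t

/-- The local condition on the status `y` in the middle. At a leaf of the tree of segments the
middle is the child off the path. -/
def Mid (a y c : Status V) : Prop :=
  if leaf then LocalCompat lα lμ lβ a y c else Le a y ∧ Le y c ∧ ∀ x, y = matched x → x ∈ lμ

/-- The statuses in the middle that a digit allows. -/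
def Allows : Digit V → Status V → Prop
  | pend a c, y => Mid leaf lα lμ lβ a y c
  | keep a c, y => Mid leaf lα lμ lβ a y c ∧
      if leaf then ¬ (a = unmatched ∧ c = inChild ∧ ∃ x, y = matched x) else y = a
  | next a c, y => Mid leaf lα lμ lβ a y c ∧ leaf = false ∧ y = c ∧ a ≠ c
  | heap i, y => Mid leaf lα lμ lβ unmatched y inChild ∧
      if i = 0 then ∀ x, y ≠ matched x else ∃ x j, y = matched x ∧ (lμ.idxOf x + t) / 2 ^ j = i

/-- The number of steps until a digit is decided in favour of `y`, if the heap has height `L`. -/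
def delay (L : ℕ) : Digit V → Status V → ℕ
  | pend unmatched inChild, matched _ => L + 1
  | pend _ _, _ => 2
  | keep _ _, _ | next _ _, _ => 0
  | heap 0, _ => 1
  | heap i, _ => L - Nat.log 2 i

/-- The numbers of the digits that are not decided yet. -/
def Undecided (d : ℕ) : Prop := d < numPairs t ∨ 3 * numPairs t ≤ d ∧ d - 3 * numPairs t < t

instance : DecidablePred (Undecided t) := fun _ => inferInstanceAs (Decidable (_ ∨ _))

/-- The first of the two digits that refine an undecided digit. -/
def first (d : ℕ) : ℕ :=
  if d < numPairs t then if d = 1 then 3 * numPairs t else d + numPairs t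
  else if d = 3 * numPairs t then 1 + numPairs t
  else 3 * numPairs t + 2 * (d - 3 * numPairs t)

/-- The second of the two digits that refine an undecided digit. -/
def second (d : ℕ) : ℕ :=
  if d < numPairs t then if d = 1 then 3 * numPairs t + 1 else d + 2 * numPairs t
  else if d = 3 * numPairs t then 1 + 2 * numPairs t
  else 3 * numPairs t + 2 * (d - 3 * numPairs t) + 1

variable {t leaf lα lμ lβ}

theorem pairDigit_lt (hα : lα.length ≤ t) (hβ : lβ.length ≤ t) {a c : Status V}
    (h : WfPair lα lβ a c) : pairDigit t lα lβ a c < numPairs t := by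
  rcases a with x | _ | _ <;> rcases c with y | _ | _ <;> simp only [pairDigit] <;>
    try (simp only [numPairs]; omega)
  · have := List.idxOf_lt_length_iff.2 (h.left x rfl)
    simp only [numPairs]; omega
  · have := List.idxOf_lt_length_iff.2 (h.left x rfl)
    simp only [numPairs]; omega
  · have := List.idxOf_lt_length_iff.2 (h.right y rfl)
    simp only [numPairs]; omega

theorem code_lt (hα : lα.length ≤ t) (hβ : lβ.length ≤ t) {F : Digit V}
    (h : F.Wf t lα lβ) : F.code t lα lβ < base t := by
  rcases F with ⟨a, c⟩ | ⟨a, c⟩ | ⟨a, c⟩ | i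
  · have := pairDigit_lt hα hβ h
    simp only [code, numPairs, base] at *; omega
  · have := pairDigit_lt hα hβ h
    simp only [code, numPairs, base] at *; omega
  · have := pairDigit_lt hα hβ h
    simp only [code, numPairs, base] at *; omega
  · simp only [code, numPairs, base, Wf] at *; omega

theorem pairDigit_eq_one {a c : Status V} (hβ : lβ.length ≤ t) (h : WfPair lα lβ a c) :
    pairDigit t lα lβ a c = 1 ↔ a = unmatched ∧ c = inChild := by
  have := h.le
  rcases a with x | _ | _ <;> rcases c with y | _ | _ <;> simp [pairDigit] <;> omega

/-- An undecided digit is the union of its two refinements, and each of them is decided earlier. -/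
theorem exists_refine {L : ℕ} (ht : 0 < t) (hL : 2 * t ≤ 2 ^ L) (hα : lα.length ≤ t)
    (hβ : lβ.length ≤ t) {F : Digit V} (hF : F.Wf t lα lβ) (hun : Undecided t (F.code t lα lβ)) :
    ∃ F₁ F₂ : Digit V, F₁.Wf t lα lβ ∧ F₂.Wf t lα lβ ∧
      F₁.code t lα lβ = first t (F.code t lα lβ) ∧ F₂.code t lα lβ = second t (F.code t lα lβ) ∧
      F₁.lo = F.lo ∧ F₁.hi = F.hi ∧ F₂.lo = F.lo ∧ F₂.hi = F.hi ∧
      ∀ y, (F₁.Allows t leaf lα lμ lβ y → F.Allows t leaf lα lμ lβ y) ∧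
        (F₂.Allows t leaf lα lμ lβ y → F.Allows t leaf lα lμ lβ y) ∧
        (F.Allows t leaf lα lμ lβ y →
          F₁.Allows t leaf lα lμ lβ y ∧ F₁.delay L y + 1 ≤ F.delay L y ∨
          F₂.Allows t leaf lα lμ lβ y ∧ F₂.delay L y + 1 ≤ F.delay L y) := by
  rcases F with ⟨a, c⟩ | ⟨a, c⟩ | ⟨a, c⟩ | i
  · have hlt := pairDigit_lt hα hβ hF
    by_cases hone : a = unmatched ∧ c = inChild
    · obtain ⟨rfl, rfl⟩ := hone
      refine ⟨heap 0, heap 1, ?_, ?_, ?_, ?_, rfl, rfl, rfl, rfl, fun y => ⟨?_, ?_, ?_⟩⟩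
      · change 0 < 2 * t; omega
      · change 1 < 2 * t; omega
      · simp [code, first, pairDigit]
      · simp [code, second, pairDigit]
      · exact fun h => h.1
      · exact fun h => h.1
      · intro h
        rcases y with x | _ | _
        · refine .inr ⟨⟨h, x, Nat.log 2 (lμ.idxOf x + t), rfl, ?_⟩, ?_⟩
          · refine Nat.div_eq_of_lt_le ?_ ?_
            · rw [one_mul]; exact Nat.pow_log_le_self 2 (by omega)
            · have := Nat.lt_pow_succ_log_self (b := 2) (by norm_num) (lμ.idxOf x + t)
              rw [pow_succ] at this
              omega
          · simp [delay]
        · exact .inl ⟨⟨h, by simp⟩, by simp [delay]⟩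
        · exact .inl ⟨⟨h, by simp⟩, by simp [delay]⟩
    · have h1 : pairDigit t lα lβ a c ≠ 1 := fun h => hone ((pairDigit_eq_one hβ hF).1 h)
      refine ⟨keep a c, next a c, hF, hF, ?_, ?_, rfl, rfl, rfl, rfl, fun y => ⟨?_, ?_, ?_⟩⟩
      · change pairDigit t lα lβ a c + _ = first t (pairDigit t lα lβ a c)
        rw [first, if_pos hlt, if_neg h1]
      · change pairDigit t lα lβ a c + _ = second t (pairDigit t lα lβ a c)
        rw [second, if_pos hlt, if_neg h1]
      · exact fun h => h.1
      · exact fun h => h.1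
      · intro h
        have hd : 1 ≤ delay L (pend a c) y := by
          unfold delay
          split <;> simp_all
        rcases leaf with _ | _
        · have h' : Mid false lα lμ lβ a y c := h
          simp only [Mid, Bool.false_eq_true, if_false] at h'
          by_cases hy : y = a
          · exact .inl ⟨⟨h, by simpa using hy⟩, by simpa [delay] using hd⟩
          · refine .inr ⟨⟨h, rfl, ?_⟩, by simpa [delay] using hd⟩
            obtain ⟨h2, h3, -⟩ := h'
            unfold Le at h2 h3
            grind
        · refine .inl ⟨⟨h, ?_⟩, by simpa [delay] using hd⟩
          simp only [if_true]
          exact fun h => hone ⟨h.1, h.2.1⟩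
  · have := pairDigit_lt hα hβ hF
    simp only [Undecided, code, numPairs] at *; omega
  · have := pairDigit_lt hα hβ hF
    simp only [Undecided, code, numPairs] at *; omega
  · have hi : i < t := by
      simp only [Undecided, code, numPairs] at hun; omega
    have hne : ¬ 3 * numPairs t + i < numPairs t := by simp only [numPairs]; omega
    rcases Nat.eq_zero_or_pos i with rfl | hpos
    · have hwf : WfPair lα lβ (unmatched : Status V) inChild := ⟨.inl rfl, by simp, by simp⟩
      refine ⟨keep unmatched inChild, next unmatched inChild, hwf, hwf, ?_, ?_, rfl, rfl, rfl, rfl,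
        fun y => ⟨?_, ?_, ?_⟩⟩
      · simp [code, first, pairDigit]
      · simp [code, second, pairDigit]
      · rintro ⟨h1, h2⟩
        refine ⟨h1, fun x hx => ?_⟩
        subst hx
        rcases leaf with _ | _ <;> simp at h2
      · rintro ⟨h1, h2, rfl, -⟩
        exact ⟨h1, fun x hx => by cases hx⟩
      · rintro ⟨h1, h2⟩
        simp only [if_true] at h2
        rcases leaf with _ | _
        · rcases y with x | _ | _
          · exact absurd rfl (h2 x)
          · exact .inr ⟨⟨h1, by simp⟩, by simp [delay]⟩
          · exact .inl ⟨⟨h1, by simp⟩, by simp [delay]⟩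
        · refine .inl ⟨⟨h1, ?_⟩, by simp [delay]⟩
          simp only [if_true]
          rintro ⟨-, -, x, hx⟩
          exact h2 x hx
    · have hcode : (heap i : Digit V).code t lα lβ = 3 * numPairs t + i := rfl
      have hlog : Nat.log 2 (2 * i) = Nat.log 2 i + 1 := by
        rw [mul_comm]; exact Nat.log_mul_base (by norm_num) hpos.ne'
      have hlog' : Nat.log 2 (2 * i + 1) = Nat.log 2 i + 1 := by
        rw [← hlog, Nat.log_eq_iff (.inl (by omega))]
        have h1 := Nat.pow_log_le_self 2 (x := 2 * i) (by omega)
        have h2 := Nat.lt_pow_succ_log_self (b := 2) (by norm_num) (2 * i)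
        refine ⟨by omega, ?_⟩
        rw [pow_succ] at h2 ⊢
        omega
      have hle : Nat.log 2 i + 1 ≤ L := by
        rw [← hlog]
        exact (Nat.log_mono_right (by omega : 2 * i ≤ 2 ^ L)).trans (by rw [Nat.log_pow (by norm_num)])
      have hd : ∀ y : Status V, delay L (heap i) y = L - Nat.log 2 i := by
        intro y
        obtain ⟨j, rfl⟩ : ∃ j, i = j + 1 := ⟨i - 1, by omega⟩
        rfl
      have hd1 : ∀ y : Status V, delay L (heap (2 * i)) y = L - (Nat.log 2 i + 1) := by
        intro y
        rw [← hlog]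
        obtain ⟨j, hj⟩ : ∃ j, 2 * i = j + 1 := ⟨2 * i - 1, by omega⟩
        rw [hj]
        rfl
      have hd2 : ∀ y : Status V, delay L (heap (2 * i + 1)) y = L - (Nat.log 2 i + 1) := by
        intro y
        rw [← hlog']
        rfl
      have hup : ∀ z j : ℕ, z / 2 ^ j = 2 * i ∨ z / 2 ^ j = 2 * i + 1 → z / 2 ^ (j + 1) = i := by
        intro z j h
        rw [pow_succ, ← Nat.div_div_eq_div_mul]
        omega
      refine ⟨heap (2 * i), heap (2 * i + 1), ?_, ?_, ?_, ?_, rfl, rfl, rfl, rfl,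
        fun y => ⟨?_, ?_, ?_⟩⟩
      · change 2 * i < 2 * t; omega
      · change 2 * i + 1 < 2 * t; omega
      · simp only [hcode, first, if_neg hne]
        rw [if_neg (by omega), code]
        omega
      · simp only [hcode, second, if_neg hne]
        rw [if_neg (by omega), code]
        omega
      · rintro ⟨h1, h2⟩
        rw [if_neg (by omega)] at h2
        obtain ⟨x, j, hx, hj⟩ := h2
        refine ⟨h1, ?_⟩
        rw [if_neg (by omega)]
        exact ⟨x, j + 1, hx, hup _ _ (.inl hj)⟩
      · rintro ⟨h1, h2⟩
        rw [if_neg (by omega)] at h2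
        obtain ⟨x, j, hx, hj⟩ := h2
        refine ⟨h1, ?_⟩
        rw [if_neg (by omega)]
        exact ⟨x, j + 1, hx, hup _ _ (.inr hj)⟩
      · rintro ⟨h1, h2⟩
        rw [if_neg (by omega)] at h2
        obtain ⟨x, j, hx, hj⟩ := h2
        rw [hd, hd1, hd2]
        rcases j with _ | j
        · simp at hj; omega
        rw [pow_succ, ← Nat.div_div_eq_div_mul] at hj
        rcases Nat.even_or_odd' ((lμ.idxOf x + t) / 2 ^ j) with ⟨q, hq | hq⟩
        · refine .inl ⟨⟨h1, ?_⟩, by omega⟩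
          rw [if_neg (by omega)]
          exact ⟨x, j, hx, by omega⟩
        · refine .inr ⟨⟨h1, ?_⟩, by omega⟩
          rw [if_neg (by omega)]
          exact ⟨x, j, hx, by omega⟩

/-! ### Decided digits -/

/-- The operand digit for the lower half of a segment; `A` and `D` translate positions in the lower
and the upper bag to positions in the middle bag. -/
def innerA (t : ℕ) (D : ℕ → ℕ) (d : ℕ) : ℕ :=
  if d < 2 * numPairs t then
    if d - numPairs t = 2 then 2
    else if d - numPairs t < 3 + t then 0
    else if d - numPairs t < 3 + 2 * t then d - numPairs t + t
    else d - numPairs t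
  else if d < 3 * numPairs t then
    if d - 2 * numPairs t = 1 then 1
    else if d - 2 * numPairs t < 3 + t then 2 + D (d - 2 * numPairs t - 3)
    else d - 2 * numPairs t
  else 3 + (d - 3 * numPairs t - t)

/-- The operand digit for the upper half of a segment, plus one; zero if the digit allows no status
in the middle. The size of the middle bag is `s`. -/
def innerB (t s : ℕ) (A D : ℕ → ℕ) (d : ℕ) : ℕ :=
  if d < 2 * numPairs t then
    if d - numPairs t < 3 + t then d - numPairs t + 1
    else if d - numPairs t < 3 + 2 * t then
      if A (d - numPairs t - 3 - t) = 0 then 0 else 3 + t + A (d - numPairs t - 3 - t)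
    else if A (d - numPairs t - 3 - 2 * t) = 0 then 0 else 3 + 2 * t + A (d - numPairs t - 3 - 2 * t)
  else if d < 3 * numPairs t then
    if d - 2 * numPairs t = 1 then 3
    else if d - 2 * numPairs t < 3 then 0
    else if d - 2 * numPairs t < 3 + t then
      if D (d - 2 * numPairs t - 3) = 0 then 0 else 3 + 2 * t + D (d - 2 * numPairs t - 3)
    else if d - 2 * numPairs t < 3 + 2 * t then 3 else 0
  else if d - 3 * numPairs t - t < s then 4 + t + (d - 3 * numPairs t - t) else 0

/-- The digit, in the code of a partial match, of the status at the child off the path. -/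
def leafA (t : ℕ) (A D : ℕ → ℕ) (d : ℕ) : ℕ :=
  if d < 2 * numPairs t then
    if d - numPairs t = 0 then t + 1
    else if d - numPairs t = 1 then t
    else if d - numPairs t = 2 then t + 1
    else if d - numPairs t < 3 + t then
      if D (d - numPairs t - 3) = 0 then t + 1 else D (d - numPairs t - 3) - 1
    else if d - numPairs t < 3 + 2 * t then t + 1
    else if A (d - numPairs t - 3 - 2 * t) = 0 then t + 1 else A (d - numPairs t - 3 - 2 * t) - 1
  else d - 3 * numPairs t - t

/-- The digit, in the code of a partial match, of the status at the upper end, plus one; zero if the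
digit allows no status in the middle. The functions `U`, `L` and `M` translate positions from the
lower to the upper, from the upper to the lower, and from the middle to the upper bag; `s` and `s'`
are the sizes of the lower and of the middle bag. -/
def leafB (t s s' : ℕ) (U L M : ℕ → ℕ) (d : ℕ) : ℕ :=
  if d < 2 * numPairs t then
    if d - numPairs t = 0 then t + 2
    else if d - numPairs t < 3 then t + 1
    else if d - numPairs t < 3 + t then
      if L (d - numPairs t - 3) = 0 then d - numPairs t - 3 + 1 else 0
    else if d - numPairs t < 3 + 2 * t then
      if d - numPairs t - 3 - t < s then
        if U (d - numPairs t - 3 - t) = 0 then t + 1 else 0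
      else 0
    else U (d - numPairs t - 3 - 2 * t)
  else if d < 3 * numPairs t then 0
  else if d - 3 * numPairs t - t < s' then
    if M (d - 3 * numPairs t - t) = 0 then t + 1 else 0
  else 0

section eval

variable (t s s' : ℕ) (A D U L M : ℕ → ℕ)

theorem innerA_keep : innerA t D (0 + numPairs t) = 0 ∧ innerA t D (1 + numPairs t) = 0 ∧
    innerA t D (2 + numPairs t) = 2 ∧ ∀ x < t, innerA t D (3 + x + numPairs t) = 0 ∧
      innerA t D (3 + t + x + numPairs t) = 3 + 2 * t + x ∧
      innerA t D (3 + 2 * t + x + numPairs t) = 3 + 2 * t + x := by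
  have hp : numPairs t = 3 * t + 3 := rfl
  refine ⟨?_, ?_, ?_, fun x hx => ⟨?_, ?_, ?_⟩⟩ <;> unfold innerA <;> split_ifs <;> omega

theorem innerA_next : innerA t D (1 + 2 * numPairs t) = 1 ∧
    ∀ x < t, innerA t D (3 + x + 2 * numPairs t) = 2 + D x ∧
      innerA t D (3 + t + x + 2 * numPairs t) = 3 + t + x := by
  have hp : numPairs t = 3 * t + 3 := rfl
  refine ⟨?_, fun x hx => ⟨?_, ?_⟩⟩
  · unfold innerA; split_ifs <;> omega
  · unfold innerA
    rw [show 3 + x + 2 * numPairs t - 2 * numPairs t - 3 = x by omega]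
    split_ifs <;> omega
  · unfold innerA; split_ifs <;> omega

theorem innerA_heap (x : ℕ) : innerA t D (3 * numPairs t + (x + t)) = 3 + x := by
  have hp : numPairs t = 3 * t + 3 := rfl
  unfold innerA; split_ifs <;> omega

theorem innerB_keep : innerB t s A D (0 + numPairs t) = 1 ∧ innerB t s A D (1 + numPairs t) = 2 ∧
    innerB t s A D (2 + numPairs t) = 3 ∧ ∀ x < t, innerB t s A D (3 + x + numPairs t) = 4 + x ∧
      innerB t s A D (3 + t + x + numPairs t) = (if A x = 0 then 0 else 3 + t + A x) ∧
      innerB t s A D (3 + 2 * t + x + numPairs t) =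
        if A x = 0 then 0 else 3 + 2 * t + A x := by
  have hp : numPairs t = 3 * t + 3 := rfl
  refine ⟨?_, ?_, ?_, fun x hx => ⟨?_, ?_, ?_⟩⟩
  · unfold innerB; split_ifs <;> omega
  · unfold innerB; split_ifs <;> omega
  · unfold innerB; split_ifs <;> omega
  · unfold innerB; split_ifs <;> omega
  · unfold innerB
    rw [show 3 + t + x + numPairs t - numPairs t - 3 - t = x by omega, if_pos (by omega),
      if_neg (by omega), if_pos (by omega)]
  · unfold innerB
    rw [show 3 + 2 * t + x + numPairs t - numPairs t - 3 - 2 * t = x by omega, if_pos (by omega),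
      if_neg (by omega), if_neg (by omega)]

theorem innerB_next : innerB t s A D (0 + 2 * numPairs t) = 0 ∧
    innerB t s A D (1 + 2 * numPairs t) = 3 ∧ innerB t s A D (2 + 2 * numPairs t) = 0 ∧
    ∀ x < t, innerB t s A D (3 + x + 2 * numPairs t) =
        (if D x = 0 then 0 else 3 + 2 * t + D x) ∧
      innerB t s A D (3 + t + x + 2 * numPairs t) = 3 ∧
      innerB t s A D (3 + 2 * t + x + 2 * numPairs t) = 0 := by
  have hp : numPairs t = 3 * t + 3 := rfl
  refine ⟨?_, ?_, ?_, fun x hx => ⟨?_, ?_, ?_⟩⟩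
  · unfold innerB; split_ifs <;> omega
  · unfold innerB; split_ifs <;> omega
  · unfold innerB; split_ifs <;> omega
  · unfold innerB
    rw [show 3 + x + 2 * numPairs t - 2 * numPairs t - 3 = x by omega, if_neg (by omega),
      if_pos (by omega), if_neg (by omega), if_neg (by omega), if_pos (by omega)]
  · unfold innerB; split_ifs <;> omega
  · unfold innerB; split_ifs <;> omega

theorem innerB_heap (x : ℕ) : innerB t s A D (3 * numPairs t + (x + t)) =
    if x < s then 4 + t + x else 0 := by
  have hp : numPairs t = 3 * t + 3 := rfl
  unfold innerB
  rw [if_neg (by omega), if_neg (by omega),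
    show 3 * numPairs t + (x + t) - 3 * numPairs t - t = x by omega]

theorem leafA_keep : leafA t A D (0 + numPairs t) = t + 1 ∧ leafA t A D (1 + numPairs t) = t ∧
    leafA t A D (2 + numPairs t) = t + 1 ∧ ∀ x < t,
      leafA t A D (3 + x + numPairs t) = (if D x = 0 then t + 1 else D x - 1) ∧
      leafA t A D (3 + t + x + numPairs t) = t + 1 ∧
      leafA t A D (3 + 2 * t + x + numPairs t) = if A x = 0 then t + 1 else A x - 1 := by
  have hp : numPairs t = 3 * t + 3 := rfl
  refine ⟨?_, ?_, ?_, fun x hx => ⟨?_, ?_, ?_⟩⟩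
  · unfold leafA; split_ifs <;> omega
  · unfold leafA; split_ifs <;> omega
  · unfold leafA; split_ifs <;> omega
  · unfold leafA
    rw [show 3 + x + numPairs t - numPairs t - 3 = x by omega, if_pos (by omega),
      if_neg (by omega), if_neg (by omega), if_neg (by omega), if_pos (by omega)]
  · unfold leafA; split_ifs <;> omega
  · unfold leafA
    rw [show 3 + 2 * t + x + numPairs t - numPairs t - 3 - 2 * t = x by omega, if_pos (by omega),
      if_neg (by omega), if_neg (by omega), if_neg (by omega), if_neg (by omega),
      if_neg (by omega)]

theorem leafA_heap (x : ℕ) : leafA t A D (3 * numPairs t + (x + t)) = x := by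
  have hp : numPairs t = 3 * t + 3 := rfl
  unfold leafA; split_ifs <;> omega

theorem leafB_keep : leafB t s s' U L M (0 + numPairs t) = t + 2 ∧
    leafB t s s' U L M (1 + numPairs t) = t + 1 ∧ leafB t s s' U L M (2 + numPairs t) = t + 1 ∧
    ∀ x < t, leafB t s s' U L M (3 + x + numPairs t) = (if L x = 0 then x + 1 else 0) ∧
      leafB t s s' U L M (3 + t + x + numPairs t) =
        (if x < s then if U x = 0 then t + 1 else 0 else 0) ∧
      leafB t s s' U L M (3 + 2 * t + x + numPairs t) = U x := by
  have hp : numPairs t = 3 * t + 3 := rfl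
  refine ⟨?_, ?_, ?_, fun x hx => ⟨?_, ?_, ?_⟩⟩
  · unfold leafB; split_ifs <;> omega
  · unfold leafB; split_ifs <;> omega
  · unfold leafB; split_ifs <;> omega
  · unfold leafB
    rw [show 3 + x + numPairs t - numPairs t - 3 = x by omega, if_pos (by omega),
      if_neg (by omega), if_neg (by omega), if_pos (by omega)]
  · unfold leafB
    rw [show 3 + t + x + numPairs t - numPairs t - 3 - t = x by omega, if_pos (by omega),
      if_neg (by omega), if_neg (by omega), if_neg (by omega), if_pos (by omega)]
  · unfold leafB
    rw [show 3 + 2 * t + x + numPairs t - numPairs t - 3 - 2 * t = x by omega, if_pos (by omega),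
      if_neg (by omega), if_neg (by omega), if_neg (by omega), if_neg (by omega)]

theorem leafB_next {r : ℕ} (hr : r < numPairs t) : leafB t s s' U L M (r + 2 * numPairs t) = 0 := by
  unfold leafB
  rw [if_neg (by omega), if_pos (by omega)]

theorem leafB_heap (x : ℕ) : leafB t s s' U L M (3 * numPairs t + (x + t)) =
    if x < s' then if M x = 0 then t + 1 else 0 else 0 := by
  have hp : numPairs t = 3 * t + 3 := rfl
  unfold leafB
  rw [if_neg (by omega), if_neg (by omega),
    show 3 * numPairs t + (x + t) - 3 * numPairs t - t = x by omega]

end eval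

omit [DecidableEq V] in
theorem mid_false {a y c : Status V} :
    Mid false lα lμ lβ a y c ↔ Le a y ∧ Le y c ∧ ∀ x, y = matched x → x ∈ lμ := by
  simp [Mid]

omit [DecidableEq V] in
theorem mid_true {a y c : Status V} : Mid true lα lμ lβ a y c ↔ LocalCompat lα lμ lβ a y c := by
  simp [Mid]

theorem WfPair.cases {V : Type*} {lα lβ : List V} {a c : Status V} (h : WfPair lα lβ a c) :
    (a = unmatched ∧ c = unmatched) ∨ (a = unmatched ∧ c = inChild) ∨
    (a = inChild ∧ c = inChild) ∨ (∃ x ∈ lβ, a = unmatched ∧ c = matched x) ∨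
    (∃ x ∈ lα, a = matched x ∧ c = inChild) ∨
    ∃ x ∈ lα, x ∈ lβ ∧ a = matched x ∧ c = matched x := by
  obtain ⟨h1, h2, h3⟩ := h
  rcases a with x | _ | _ <;> rcases c with z | _ | _ <;> simp_all [Le]

theorem eq_of_heap_leaf {x z j : ℕ} (hz : z < t) (h : (z + t) / 2 ^ j = x + t) : z = x := by
  rcases j with _ | j
  · simp at h; omega
  · -- a proper ancestor of a leaf is less than `t`
    rw [pow_succ, mul_comm, ← Nat.div_div_eq_div_mul] at h
    have := Nat.div_le_self ((z + t) / 2) (2 ^ j)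
    omega

/-- The conclusion of `inner_decided`. -/
def InnerDecided (t : ℕ) (lα lμ lβ : List V) (F : Digit V) : Prop :=
  innerB t lμ.length (transl lα lμ) (transl lβ lμ) (F.code t lα lβ) = 0 ∧
      (∀ y, ¬ F.Allows t false lα lμ lβ y) ∨
    ∃ y₀, (∀ y, F.Allows t false lα lμ lβ y ↔ y = y₀) ∧
      innerA t (transl lβ lμ) (F.code t lα lβ) = pairDigit t lα lμ F.lo y₀ ∧
      innerB t lμ.length (transl lα lμ) (transl lβ lμ) (F.code t lα lβ) =
        pairDigit t lμ lβ y₀ F.hi + 1 ∧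
      WfPair lα lμ F.lo y₀ ∧ WfPair lμ lβ y₀ F.hi

/-- A decided digit of an inner node of the tree of segments allows at most one status in the
middle, and then its two operand digits stand for the two pairs with this status. -/
theorem inner_decided (hnd : lμ.Nodup) (hα : lα.length ≤ t)
    (hμ : lμ.length ≤ t) (hβ : lβ.length ≤ t) {F : Digit V} (hF : F.Wf t lα lβ)
    (hun : ¬ Undecided t (F.code t lα lβ)) : InnerDecided t lα lμ lβ F := by
  unfold InnerDecided
  rcases F with ⟨a, c⟩ | ⟨a, c⟩ | ⟨a, c⟩ | i
  · exact absurd (.inl (pairDigit_lt hα hβ hF)) hun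
  · have hal : ∀ y, (keep a c).Allows t false lα lμ lβ y ↔ y = a ∧ ∀ x, a = matched x → x ∈ lμ := by
      intro y
      simp only [Allows, mid_false, Bool.false_eq_true, if_false]
      constructor
      · rintro ⟨⟨-, -, h⟩, rfl⟩
        exact ⟨rfl, h⟩
      · rintro ⟨rfl, h⟩
        exact ⟨⟨.inr (.inr rfl), hF.le, h⟩, rfl⟩
    simp only [hal]
    obtain ⟨A0, A1, A2, A3⟩ := innerA_keep t (transl lβ lμ)
    obtain ⟨B0, B1, B2, B3⟩ := innerB_keep t lμ.length (transl lα lμ) (transl lβ lμ)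
    rcases WfPair.cases hF with ⟨rfl, rfl⟩ | ⟨rfl, rfl⟩ | ⟨rfl, rfl⟩ | ⟨x, hx, rfl, rfl⟩ |
      ⟨x, hx, rfl, rfl⟩ | ⟨x, hx, hx', rfl, rfl⟩
    · refine .inr ⟨unmatched, by simp, A0, B0, ?_, ?_⟩ <;> constructor <;> simp [Le, lo, hi]
    · refine .inr ⟨unmatched, by simp, A1, B1, ?_, ?_⟩ <;> constructor <;> simp [Le, lo, hi]
    · refine .inr ⟨inChild, by simp, A2, B2, ?_, ?_⟩ <;> constructor <;> simp [Le, lo, hi]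
    · have hlt := (List.idxOf_lt_length_iff.2 hx).trans_le hβ
      refine .inr ⟨unmatched, by simp, (A3 _ hlt).1, (B3 _ hlt).1.trans ?_, ?_, ?_⟩
      · simp only [pairDigit, hi]; omega
      all_goals constructor <;> simp [Le, lo, hi, hx]
    · have hlt := (List.idxOf_lt_length_iff.2 hx).trans_le hα
      have e1 := (B3 _ hlt).2.1
      rw [transl_idxOf hx] at e1
      by_cases h : x ∈ lμ
      · rw [if_pos h, if_neg (by omega)] at e1
        refine .inr ⟨matched x, by simp [h], (A3 _ hlt).2.1, e1, ?_, ?_⟩ <;> constructor <;>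
          simp [Le, lo, hi, hx, h]
      · rw [if_neg h, if_pos rfl] at e1
        exact .inl ⟨e1, by simp [h]⟩
    · have hlt := (List.idxOf_lt_length_iff.2 hx).trans_le hα
      have e1 := (B3 _ hlt).2.2
      rw [transl_idxOf hx] at e1
      by_cases h : x ∈ lμ
      · rw [if_pos h, if_neg (by omega)] at e1
        refine .inr ⟨matched x, by simp [h], (A3 _ hlt).2.2, e1, ?_, ?_⟩ <;> constructor <;>
          simp [Le, lo, hi, hx, hx', h]
      · rw [if_neg h, if_pos rfl] at e1
        exact .inl ⟨e1, by simp [h]⟩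
  · have hal : ∀ y, (next a c).Allows t false lα lμ lβ y ↔
        y = c ∧ a ≠ c ∧ ∀ x, c = matched x → x ∈ lμ := by
      intro y
      simp only [Allows, mid_false]
      constructor
      · rintro ⟨⟨-, -, h⟩, -, rfl, h'⟩
        exact ⟨rfl, h', h⟩
      · rintro ⟨rfl, h, h'⟩
        exact ⟨⟨hF.le, .inr (.inr rfl), h'⟩, by simp, rfl, h⟩
    simp only [hal]
    obtain ⟨A1, A3⟩ := innerA_next t (transl lβ lμ)
    obtain ⟨B0, B1, B2, B3⟩ := innerB_next t lμ.length (transl lα lμ) (transl lβ lμ)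
    rcases WfPair.cases hF with ⟨rfl, rfl⟩ | ⟨rfl, rfl⟩ | ⟨rfl, rfl⟩ | ⟨x, hx, rfl, rfl⟩ |
      ⟨x, hx, rfl, rfl⟩ | ⟨x, hx, hx', rfl, rfl⟩
    · exact .inl ⟨B0, by simp⟩
    · refine .inr ⟨inChild, by simp, A1, B1, ?_, ?_⟩ <;> constructor <;> simp [Le, lo, hi]
    · exact .inl ⟨B2, by simp⟩
    · have hlt := (List.idxOf_lt_length_iff.2 hx).trans_le hβ
      have e1 := (B3 _ hlt).1
      have e2 := (A3 _ hlt).1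
      rw [transl_idxOf hx] at e1 e2
      by_cases h : x ∈ lμ
      · rw [if_pos h, if_neg (by omega)] at e1
        rw [if_pos h] at e2
        refine .inr ⟨matched x, by simp [h], e2.trans ?_, e1, ?_, ?_⟩
        · simp only [pairDigit, lo]; omega
        all_goals constructor <;> simp [Le, lo, hi, hx, h]
      · rw [if_neg h, if_pos rfl] at e1
        exact .inl ⟨e1, by simp [h]⟩
    · have hlt := (List.idxOf_lt_length_iff.2 hx).trans_le hα
      refine .inr ⟨inChild, by simp, (A3 _ hlt).2, (B3 _ hlt).2.1, ?_, ?_⟩ <;> constructor <;>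
        simp [Le, lo, hi, hx]
    · have hlt := (List.idxOf_lt_length_iff.2 hx).trans_le hα
      exact .inl ⟨(B3 _ hlt).2.2, by simp⟩
  · have hi1 : ¬ i < t := fun h => hun (.inr ⟨by simp [code], by simpa [code] using h⟩)
    obtain ⟨x, rfl⟩ : ∃ x, i = x + t := ⟨i - t, by omega⟩
    have e1 := innerA_heap t (transl lβ lμ) x
    have e2 := innerB_heap t lμ.length (transl lα lμ) (transl lβ lμ) x
    have hxt : x < t := by
      have : x + t < 2 * t := hF
      omega
    have hal : ∀ y, (heap (x + t)).Allows t false lα lμ lβ y ↔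
        ∃ z, y = matched z ∧ z ∈ lμ ∧ lμ.idxOf z = x := by
      intro y
      simp only [Allows, mid_false]
      rw [if_neg (by omega)]
      constructor
      · rintro ⟨⟨-, -, h⟩, z, j, rfl, h'⟩
        refine ⟨z, rfl, h z rfl, ?_⟩
        have h2 := List.idxOf_lt_length_iff.2 (h z rfl)
        exact eq_of_heap_leaf (by omega) h'
      · rintro ⟨z, rfl, h, rfl⟩
        exact ⟨⟨.inl rfl, .inr (.inl rfl), by simpa using h⟩, z, 0, by simp⟩
    simp only [hal]
    by_cases h : x < lμ.length
    · rw [if_pos h] at e2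
      have h1 : lμ.idxOf lμ[x] = x := hnd.idxOf_getElem x h
      refine .inr ⟨matched lμ[x], fun y => ⟨?_, ?_⟩, e1.trans ?_, e2.trans ?_, ?_, ?_⟩
      · rintro ⟨z, rfl, hz, rfl⟩
        simp
      · rintro rfl
        exact ⟨_, rfl, List.getElem_mem h, h1⟩
      · simp [pairDigit, lo, h1]
      · simp only [pairDigit, hi, h1]; omega
      all_goals constructor <;> simp [Le, lo, hi]
    · rw [if_neg h] at e2
      refine .inl ⟨e2, ?_⟩
      rintro y ⟨z, rfl, hz, rfl⟩
      exact h (List.idxOf_lt_length_iff.2 hz)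

/-- The conclusion of `leaf_decided`. -/
def LeafDecided (τ : ℕ) (lα lμ lβ : List V) (F : Digit V) : Prop :=
  leafB (τ + 1) lα.length lμ.length (transl lα lβ) (transl lβ lα) (transl lμ lβ)
      (F.code (τ + 1) lα lβ) = 0 ∧ (∀ y, ¬ F.Allows (τ + 1) true lα lμ lβ y) ∨
    ∃ y₀, (∀ y, F.Allows (τ + 1) true lα lμ lβ y ↔ y = y₀) ∧
      leafA (τ + 1) (transl lα lμ) (transl lβ lμ) (F.code (τ + 1) lα lβ) = y₀.digit τ lμ ∧
      leafB (τ + 1) lα.length lμ.length (transl lα lβ) (transl lβ lα) (transl lμ lβ)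
        (F.code (τ + 1) lα lβ) = F.hi.digit τ lβ + 1 ∧ ∀ x, y₀ = matched x → x ∈ lμ

/-- A decided digit of a leaf of the tree of segments allows at most one status at the child off the
path. -/
theorem leaf_decided {τ : ℕ} (hnd : lμ.Nodup) (hα : lα.length ≤ τ + 1)
    (hμ : lμ.length ≤ τ + 1) (hβ : lβ.length ≤ τ + 1) {F : Digit V} (hF : F.Wf (τ + 1) lα lβ)
    (hun : ¬ Undecided (τ + 1) (F.code (τ + 1) lα lβ)) : LeafDecided τ lα lμ lβ F := by
  unfold LeafDecided
  rcases F with ⟨a, c⟩ | ⟨a, c⟩ | ⟨a, c⟩ | i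
  · exact absurd (.inl (pairDigit_lt hα hβ hF)) hun
  · have hal : ∀ y, (keep a c).Allows (τ + 1) true lα lμ lβ y ↔ LocalCompat lα lμ lβ a y c ∧
        ¬ (a = unmatched ∧ c = inChild ∧ ∃ x, y = matched x) := by
      intro y
      simp only [Allows, mid_true, if_true]
    simp only [hal]
    obtain ⟨A0, A1, A2, A3⟩ := leafA_keep (τ + 1) (transl lα lμ) (transl lβ lμ)
    obtain ⟨B0, B1, B2, B3⟩ := leafB_keep (τ + 1) lα.length lμ.length (transl lα lβ) (transl lβ lα)
      (transl lμ lβ)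
    rcases WfPair.cases hF with ⟨rfl, rfl⟩ | ⟨rfl, rfl⟩ | ⟨rfl, rfl⟩ | ⟨x, hx, rfl, rfl⟩ |
      ⟨x, hx, rfl, rfl⟩ | ⟨x, hx, hx', rfl, rfl⟩
    · refine .inr ⟨unmatched, fun y => ⟨?_, ?_⟩, A0, B0, by simp⟩
      · rintro ⟨h, -⟩
        rcases y with z | _ | _
        · by_cases hz : z ∈ lβ
          · cases h.agree_left₂ z rfl hz
          · cases h.forget₂ z rfl hz
        · cases h.inChild₂ rfl
        · rfl
      · rintro rfl
        exact ⟨by constructor <;> simp, by simp⟩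
    · refine .inr ⟨inChild, fun y => ⟨?_, ?_⟩, A1, B1, by simp⟩
      · rintro ⟨h, h'⟩
        rcases y with z | _ | _
        · exact absurd ⟨rfl, rfl, z, rfl⟩ h'
        · rfl
        · have := h.exactly_one rfl
          simp [Xor] at this
      · rintro rfl
        exact ⟨by constructor <;> simp [Xor], by simp⟩
    · refine .inr ⟨unmatched, fun y => ⟨?_, ?_⟩, A2, B2, by simp⟩
      · rintro ⟨h, -⟩
        simpa [Xor] using h.exactly_one rfl
      · rintro rfl
        exact ⟨by constructor <;> simp [Xor], by simp⟩
    · have hlt := (List.idxOf_lt_length_iff.2 hx).trans_le hβ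
      have e1 := (A3 _ hlt).1
      have e2 := (B3 _ hlt).1
      rw [transl_idxOf hx] at e1 e2
      by_cases hα' : x ∈ lα
      · rw [if_pos hα', if_neg (by omega)] at e2
        refine .inl ⟨e2, fun y h => ?_⟩
        cases h.1.agree_right₁ x rfl hα'
      · rw [if_neg hα', if_pos rfl] at e2
        by_cases hμ' : x ∈ lμ
        · rw [if_pos hμ', if_neg (by omega)] at e1
          refine .inr ⟨matched x, fun y => ⟨fun h => h.1.agree_right₂ x rfl hμ', ?_⟩,
            e1.trans (by simp [digit]), e2, by simp [hμ']⟩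
          rintro rfl
          exact ⟨by constructor <;> simp [hμ', hα', hx], by simp⟩
        · rw [if_neg hμ', if_pos rfl] at e1
          refine .inr ⟨unmatched, fun y => ⟨?_, ?_⟩, e1, e2, by simp⟩
          · rintro ⟨h, -⟩
            rcases y with z | _ | _
            · have hz := h.mem z rfl
              by_cases hz' : z ∈ lβ
              · cases h.agree_left₂ z rfl hz'
                exact absurd hz hμ'
              · cases h.forget₂ z rfl hz'
            · cases h.inChild₂ rfl
            · rfl
          · rintro rfl
            exact ⟨by constructor <;> simp [hμ', hα'], by simp⟩
    · have hlt := (List.idxOf_lt_length_iff.2 hx).trans_le hα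
      have e1 := (A3 _ hlt).2.1
      have e2 := (B3 _ hlt).2.1
      rw [if_pos (List.idxOf_lt_length_iff.2 hx), transl_idxOf hx] at e2
      by_cases hβ' : x ∈ lβ
      · rw [if_pos hβ', if_neg (by omega)] at e2
        refine .inl ⟨e2, fun y h => ?_⟩
        cases h.1.agree_left₁ x rfl hβ'
      · rw [if_neg hβ', if_pos rfl] at e2
        refine .inr ⟨unmatched, fun y => ⟨?_, ?_⟩, e1, e2, by simp⟩
        · rintro ⟨h, -⟩
          simpa [Xor] using h.exactly_one rfl
        · rintro rfl
          exact ⟨by constructor <;> simp [hβ', Xor], by simp⟩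
    · have hlt := (List.idxOf_lt_length_iff.2 hx).trans_le hα
      have e1 := (A3 _ hlt).2.2
      have e2 := (B3 _ hlt).2.2
      rw [transl_idxOf hx] at e1 e2
      rw [if_pos hx'] at e2
      by_cases hμ' : x ∈ lμ
      · rw [if_pos hμ', if_neg (by omega)] at e1
        refine .inr ⟨matched x, fun y => ⟨fun h => h.1.agree_right₂ x rfl hμ', ?_⟩,
          e1.trans (by simp [digit]), e2, by simp [hμ']⟩
        rintro rfl
        exact ⟨by constructor <;> simp [hμ', hx, hx'], by simp⟩
      · rw [if_neg hμ', if_pos rfl] at e1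
        refine .inr ⟨unmatched, fun y => ⟨?_, ?_⟩, e1, e2, by simp⟩
        · rintro ⟨h, -⟩
          rcases y with z | _ | _
          · have hz := h.mem z rfl
            by_cases hz' : z ∈ lβ
            · cases h.agree_left₂ z rfl hz'
              exact absurd hz hμ'
            · cases h.forget₂ z rfl hz'
          · cases h.inChild₂ rfl
          · rfl
        · rintro rfl
          exact ⟨by constructor <;> simp [hμ', hx'], by simp⟩
  · refine .inl ⟨leafB_next (τ + 1) _ _ _ _ _ (pairDigit_lt hα hβ hF), ?_⟩
    rintro y ⟨-, h, -⟩
    cases h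
  · have hi1 : ¬ i < τ + 1 := fun h => hun (.inr ⟨by simp [code], by simpa [code] using h⟩)
    obtain ⟨x, rfl⟩ : ∃ x, i = x + (τ + 1) := ⟨i - (τ + 1), by omega⟩
    have e1 := leafA_heap (τ + 1) (transl lα lμ) (transl lβ lμ) x
    have e2 := leafB_heap (τ + 1) lα.length lμ.length (transl lα lβ) (transl lβ lα)
      (transl lμ lβ) x
    have hxt : x < τ + 1 := by
      have : x + (τ + 1) < 2 * (τ + 1) := hF
      omega
    have hal : ∀ y, (heap (x + (τ + 1))).Allows (τ + 1) true lα lμ lβ y ↔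
        ∃ z, y = matched z ∧ z ∈ lμ ∧ z ∉ lβ ∧ lμ.idxOf z = x := by
      intro y
      simp only [Allows, mid_true]
      rw [if_neg (by omega)]
      constructor
      · rintro ⟨h, z, j, rfl, h'⟩
        refine ⟨z, rfl, h.mem z rfl, fun hz => absurd (h.agree_left₂ z rfl hz) (by simp), ?_⟩
        have h2 := List.idxOf_lt_length_iff.2 (h.mem z rfl)
        exact eq_of_heap_leaf (by omega) h'
      · rintro ⟨z, rfl, h, h', rfl⟩
        exact ⟨by constructor <;> simp [h, h', Xor], z, 0, by simp⟩
    simp only [hal]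
    by_cases h : x < lμ.length
    · have h1 : lμ.idxOf lμ[x] = x := hnd.idxOf_getElem x h
      have h3 := transl_idxOf (l₂ := lβ) (List.getElem_mem h)
      rw [h1] at h3
      rw [if_pos h, h3] at e2
      by_cases h4 : lμ[x] ∈ lβ
      · rw [if_pos h4, if_neg (by omega)] at e2
        refine .inl ⟨e2, ?_⟩
        rintro y ⟨z, rfl, hz, hz', rfl⟩
        simp at h4
        exact hz' h4
      · rw [if_neg h4, if_pos rfl] at e2
        refine .inr ⟨matched lμ[x], fun y => ⟨?_, ?_⟩, e1.trans ?_, e2, ?_⟩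
        · rintro ⟨z, rfl, hz, -, rfl⟩
          simp
        · rintro rfl
          exact ⟨_, rfl, List.getElem_mem h, h4, h1⟩
        · simp [digit, h1]
        · rintro z hz
          cases hz
          exact List.getElem_mem h
    · rw [if_neg h] at e2
      refine .inl ⟨e2, ?_⟩
      rintro y ⟨z, rfl, hz, -, rfl⟩
      exact h (List.idxOf_lt_length_iff.2 hz)

end Digit

end SubpathDP

/-! ### Gates of a node -/

namespace SubpathDP

open Status

open Classical in
/-- The number of pattern vertices that are unmatched in `s` and matched in a child in `c`. -/
noncomputable def crossings {k : ℕ} {V : Type*} (s c : Fin k → Status V) : ℕ :=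
  ∑ v, if s v = unmatched ∧ c v = inChild then 1 else 0

open Classical in
/-- The number of those vertices counted by `crossings s c` that are not matched in `y`. -/
noncomputable def residual {k : ℕ} {V : Type*} (s y c : Fin k → Status V) : ℕ :=
  ∑ v, if s v = unmatched ∧ c v = inChild ∧ ∀ x, y v ≠ matched x then 1 else 0

namespace Digit

variable {V : Type*} [DecidableEq V] {t : ℕ} {leaf : Bool} {lα lμ lβ : List V}

theorem Allows.mid {F : Digit V} {y : Status V} (h : F.Allows t leaf lα lμ lβ y) :
    Mid leaf lα lμ lβ F.lo y F.hi := by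
  rcases F with ⟨a, c⟩ | ⟨a, c⟩ | ⟨a, c⟩ | i
  · exact h
  · exact h.1
  · exact h.1
  · exact h.1

omit [DecidableEq V] in
theorem Wf.wfPair {F : Digit V} (h : F.Wf t lα lβ) : WfPair lα lβ F.lo F.hi := by
  rcases F with ⟨a, c⟩ | ⟨a, c⟩ | ⟨a, c⟩ | i
  · exact h
  · exact h
  · exact h
  · exact ⟨.inl rfl, by simp [lo], by simp [hi]⟩

end Digit

open Digit

/-- A node of the tree of segments or of the tree of prefixes: the bags `bot`, `mid`, `top`, the
relations `relA` and `relB` of its two operands, the addresses `opA` and `opB` of their gates, and the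
number `rank` of steps after which the operands are known. -/
structure Node (k n : ℕ) where
  leaf : Bool
  bot : List (Fin n)
  mid : List (Fin n)
  top : List (Fin n)
  relA : (Fin k → Status (Fin n)) → (Fin k → Status (Fin n)) → Prop
  relB : (Fin k → Status (Fin n)) → (Fin k → Status (Fin n)) → Prop
  opA : ℕ
  opB : ℕ
  rank : ℕ

namespace Node

variable {k n : ℕ} (τ : ℕ) (N : Node k n)

/-- The relation of a node: some match in the middle connects the two ends. -/
def Rel (s c : Fin k → Status (Fin n)) : Prop :=
  ∃ y, (∀ v, Mid N.leaf N.bot N.mid N.top (s v) (y v) (c v)) ∧ N.relA s y ∧ N.relB y c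

/-- The match `y` in the middle witnesses the gate `F`. -/
def Wit (F : Fin k → Digit (Fin n)) (y : Fin k → Status (Fin n)) : Prop :=
  (∀ v, (F v).Allows (τ + 1) N.leaf N.bot N.mid N.top (y v)) ∧
    N.relA (fun v => (F v).lo) y ∧ N.relB y fun v => (F v).hi

/-- The digits of a gate fit the bags. -/
def WfGate (F : Fin k → Digit (Fin n)) : Prop := ∀ v, (F v).Wf (τ + 1) N.bot N.top

/-- The number of a gate. -/
def gate (F : Fin k → Digit (Fin n)) : ℕ :=
  enc (base (τ + 1)) fun v => (F v).code (τ + 1) N.bot N.top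

/-- The base of the number system for the operands. -/
def opBase : ℕ := if N.leaf then τ + 3 else base (τ + 1)

/-- The digit for the statuses `a`, `y` in an address of the operand `relA`: for a leaf this is the
table of a child off the path. -/
def digitA (a y : Status (Fin n)) : ℕ :=
  if N.leaf then y.digit τ N.mid else pairDigit (τ + 1) N.bot N.mid a y

/-- The digit for the statuses `y`, `c` in an address of the operand `relB`: for a leaf this is the
table of the partial matches of the upper layer. -/
def digitB (y c : Status (Fin n)) : ℕ :=
  if N.leaf then c.digit τ N.top else pairDigit (τ + 1) N.mid N.top y c

/-- The status occurs in the operand `relA`. -/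
def WfA (a y : Status (Fin n)) : Prop :=
  if N.leaf then ∀ x, y = matched x → x ∈ N.mid else WfPair N.bot N.mid a y

/-- The status occurs in the operand `relB`. -/
def WfB (y c : Status (Fin n)) : Prop :=
  if N.leaf then ∀ x, c = matched x → x ∈ N.top else WfPair N.mid N.top y c

/-- The address for the pair `s`, `y` in the operand `relA`. -/
def addrA (s y : Fin k → Status (Fin n)) : ℕ :=
  N.opA + enc (N.opBase τ) fun v => N.digitA τ (s v) (y v)

/-- The address for the pair `y`, `c` in the operand `relB`. -/
def addrB (y c : Fin k → Status (Fin n)) : ℕ :=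
  N.opB + enc (N.opBase τ) fun v => N.digitB τ (y v) (c v)

/-- The digit of the operand `relA` for a decided digit. -/
def decA (d : ℕ) : ℕ :=
  if N.leaf then leafA (τ + 1) (transl N.bot N.mid) (transl N.top N.mid) d
  else innerA (τ + 1) (transl N.top N.mid) d

/-- The digit of the operand `relB` for a decided digit, plus one; or zero. -/
def decB (d : ℕ) : ℕ :=
  if N.leaf then leafB (τ + 1) N.bot.length N.mid.length (transl N.bot N.top) (transl N.top N.bot)
    (transl N.mid N.top) d
  else innerB (τ + 1) N.mid.length (transl N.bot N.mid) (transl N.top N.mid) d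

/-- The bags are lists of at most `τ + 1` vertices without repetition. -/
structure WfBags : Prop where
  nodup : N.mid.Nodup
  bot_le : N.bot.length ≤ τ + 1
  mid_le : N.mid.length ≤ τ + 1
  top_le : N.top.length ≤ τ + 1

variable {τ N}

theorem decided (hN : N.WfBags τ) {F : Digit (Fin n)} (hF : F.Wf (τ + 1) N.bot N.top)
    (hun : ¬ Undecided (τ + 1) (F.code (τ + 1) N.bot N.top)) :
    N.decB τ (F.code (τ + 1) N.bot N.top) = 0 ∧
        (∀ y, ¬ F.Allows (τ + 1) N.leaf N.bot N.mid N.top y) ∨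
      ∃ y₀, (∀ y, F.Allows (τ + 1) N.leaf N.bot N.mid N.top y ↔ y = y₀) ∧
        N.decA τ (F.code (τ + 1) N.bot N.top) = N.digitA τ F.lo y₀ ∧
        N.decB τ (F.code (τ + 1) N.bot N.top) = N.digitB τ y₀ F.hi + 1 ∧
        N.WfA F.lo y₀ ∧ N.WfB y₀ F.hi := by
  unfold decA decB digitA digitB WfA WfB
  rcases hleaf : N.leaf with _ | _
  · simpa [InnerDecided] using inner_decided hN.nodup hN.bot_le hN.mid_le hN.top_le hF hun
  · rcases leaf_decided hN.nodup hN.bot_le hN.mid_le hN.top_le hF hun with h | ⟨y, h1, h2, h3, h4⟩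
    · exact .inl (by simpa using h)
    · refine .inr ⟨y, h1, by simpa using h2, by simpa using h3, by simpa using h4, ?_⟩
      simpa using hF.wfPair.right

section wiring

variable (τ N) (o e : ℕ)

/-- The number of undecided digits of a gate. -/
def undecided (k τ e : ℕ) : ℕ :=
  digitSum (fun d => if Undecided (τ + 1) d then 1 else 0) 1 (base (τ + 1)) k e

/-- The number of digits of a gate that allow no status in the middle. -/
def impossible : ℕ := digitSum (fun d => if N.decB τ d = 0 then 1 else 0) 1 (base (τ + 1)) k e

/-- The first input of gate `e` of a node whose gates start at address `o`. The gate is the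
disjunction of two refinements, if some digit is undecided, and otherwise the conjunction of two
gates of the operands. A gate that cannot be satisfied depends on itself only. -/
def src₁ : ℕ :=
  if undecided k τ e = 0 then
    if N.impossible τ e = 0 then N.opA + digitSum (N.decA τ) (N.opBase τ) (base (τ + 1)) k e
    else o + e
  else o + replaceLast (Undecided (τ + 1)) (first (τ + 1)) (base (τ + 1)) k e

/-- The second input of a gate. -/
def src₂ : ℕ :=
  if undecided k τ e = 0 then
    if N.impossible τ e = 0 then
      N.opB + digitSum (fun d => N.decB τ d - 1) (N.opBase τ) (base (τ + 1)) k e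
    else o + e
  else o + replaceLast (Undecided (τ + 1)) (second (τ + 1)) (base (τ + 1)) k e

/-- The threshold that the sum of the inputs of a gate has to exceed. -/
def thr (k τ e : ℕ) : ℕ := if undecided k τ e = 0 then 1 else 0

/-- The next value of a gate. -/
def next (G : ℕ → ℕ) : ℕ :=
  if thr k τ e < G (N.src₁ τ o e) + G (N.src₂ τ o e) then 1 else 0

end wiring

/-- The two cases for a gate: it has two refinements, or it is decided. -/
theorem gate_cases {L : ℕ} (hL : 2 * (τ + 1) ≤ 2 ^ L) (hN : N.WfBags τ)
    {F : Fin k → Digit (Fin n)} (hF : N.WfGate τ F) (o : ℕ) :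
    (∃ F₁ F₂ : Fin k → Digit (Fin n), N.WfGate τ F₁ ∧ N.WfGate τ F₂ ∧
      (∀ G, N.next τ o (N.gate τ F) G =
        if 0 < G (o + N.gate τ F₁) + G (o + N.gate τ F₂) then 1 else 0) ∧
      (∀ y, N.Wit τ F₁ y → N.Wit τ F y) ∧ (∀ y, N.Wit τ F₂ y → N.Wit τ F y) ∧
      (∀ v, (F₁ v).lo = (F v).lo ∧ (F₁ v).hi = (F v).hi) ∧
      (∀ v, (F₂ v).lo = (F v).lo ∧ (F₂ v).hi = (F v).hi) ∧
      ∀ y, N.Wit τ F y →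
        N.Wit τ F₁ y ∧ ∑ v, (F₁ v).delay L (y v) + 1 ≤ ∑ v, (F v).delay L (y v) ∨
        N.Wit τ F₂ y ∧ ∑ v, (F₂ v).delay L (y v) + 1 ≤ ∑ v, (F v).delay L (y v)) ∨
    ((∀ y, ¬ N.Wit τ F y) ∧ ∀ G, N.next τ o (N.gate τ F) G =
      if 1 < G (o + N.gate τ F) + G (o + N.gate τ F) then 1 else 0) ∨
    ∃ y, (∀ v, (F v).Allows (τ + 1) N.leaf N.bot N.mid N.top (y v)) ∧
      (∀ y', N.Wit τ F y' → y' = y) ∧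
      (∀ v, N.WfA (F v).lo (y v)) ∧ (∀ v, N.WfB (y v) (F v).hi) ∧
      ∀ G, N.next τ o (N.gate τ F) G =
        if 1 < G (N.addrA τ (fun v => (F v).lo) y) + G (N.addrB τ y fun v => (F v).hi) then 1
        else 0 := by
  have hlt : ∀ v, (F v).code (τ + 1) N.bot N.top < base (τ + 1) := fun v =>
    code_lt hN.bot_le hN.top_le (hF v)
  have hund : undecided k τ (N.gate τ F) =
      ∑ v, if Undecided (τ + 1) ((F v).code (τ + 1) N.bot N.top) then 1 else 0 := by
    rw [undecided, gate, digitSum_enc _ _ _ hlt]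
    simp
  have hbad : N.impossible τ (N.gate τ F) =
      ∑ v, if N.decB τ ((F v).code (τ + 1) N.bot N.top) = 0 then 1 else 0 := by
    rw [impossible, gate, digitSum_enc _ _ _ hlt]
    simp
  by_cases hun : ∃ v, Undecided (τ + 1) ((F v).code (τ + 1) N.bot N.top)
  · left
    obtain ⟨v, hv, hU⟩ := replaceLast_enc _ _ hlt hun
    obtain ⟨D₁, D₂, w₁, w₂, c₁, c₂, lo₁, hi₁, lo₂, hi₂, hy⟩ :=
      exists_refine (leaf := N.leaf) (lμ := N.mid) (Nat.succ_pos τ) hL hN.bot_le hN.top_le (hF v) hv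
    have hne : undecided k τ (N.gate τ F) ≠ 0 := by
      rw [hund]
      intro h
      have := Finset.sum_eq_zero_iff.1 h v (Finset.mem_univ v)
      simp [hv] at this
    have hwf : ∀ D : Digit (Fin n), D.Wf (τ + 1) N.bot N.top →
        N.WfGate τ (Function.update F v D) := by
      intro D hD u
      by_cases hu : u = v
      · subst hu; simpa using hD
      · rw [Function.update_of_ne hu]; exact hF u
    have hg : ∀ (D : Digit (Fin n)) (U : ℕ → ℕ),
        D.code (τ + 1) N.bot N.top = U ((F v).code (τ + 1) N.bot N.top) →
        replaceLast (Undecided (τ + 1)) U (base (τ + 1)) k (N.gate τ F) =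
          N.gate τ (Function.update F v D) := by
      intro D U hD
      rw [gate, hU, gate]
      congr 1
      funext u
      by_cases hu : u = v
      · subst hu; simp [hD]
      · rw [Function.update_of_ne hu, Function.update_of_ne hu]
    have hlo : ∀ D : Digit (Fin n), D.lo = (F v).lo → D.hi = (F v).hi →
        ∀ u, (Function.update F v D u).lo = (F u).lo ∧
          (Function.update F v D u).hi = (F u).hi := by
      intro D h1 h2 u
      by_cases hu : u = v
      · subst hu; simp [h1, h2]
      · rw [Function.update_of_ne hu]; exact ⟨rfl, rfl⟩
    have hwit : ∀ (D : Digit (Fin n)) (y : Fin k → Status (Fin n)), D.lo = (F v).lo →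
        D.hi = (F v).hi → (N.Wit τ (Function.update F v D) y ↔
          D.Allows (τ + 1) N.leaf N.bot N.mid N.top (y v) ∧
          (∀ u, u ≠ v → (F u).Allows (τ + 1) N.leaf N.bot N.mid N.top (y u)) ∧
          N.relA (fun v => (F v).lo) y ∧ N.relB y fun v => (F v).hi) := by
      intro D y h1 h2
      have e1 : (fun u => (Function.update F v D u).lo) = fun u => (F u).lo :=
        funext fun u => (hlo D h1 h2 u).1
      have e2 : (fun u => (Function.update F v D u).hi) = fun u => (F u).hi :=
        funext fun u => (hlo D h1 h2 u).2
      rw [Wit, e1, e2]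
      constructor
      · rintro ⟨h, h'⟩
        exact ⟨by simpa using h v, fun u hu => by simpa [hu] using h u, h'⟩
      · rintro ⟨h, h2, h'⟩
        refine ⟨fun u => ?_, h'⟩
        by_cases hu : u = v
        · subst hu; simpa using h
        · rw [Function.update_of_ne hu]; exact h2 u hu
    have hself : ∀ y, N.Wit τ F y ↔ (F v).Allows (τ + 1) N.leaf N.bot N.mid N.top (y v) ∧
          (∀ u, u ≠ v → (F u).Allows (τ + 1) N.leaf N.bot N.mid N.top (y u)) ∧
          N.relA (fun v => (F v).lo) y ∧ N.relB y fun v => (F v).hi := by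
      intro y
      have := hwit (F v) y rfl rfl
      rwa [Function.update_eq_self] at this
    have hsum : ∀ (D : Digit (Fin n)) (y : Fin k → Status (Fin n)),
        D.delay L (y v) + 1 ≤ (F v).delay L (y v) →
        ∑ u, (Function.update F v D u).delay L (y u) + 1 ≤ ∑ u, (F u).delay L (y u) := by
      intro D y h
      rw [← Finset.add_sum_erase _ _ (Finset.mem_univ v),
        ← Finset.add_sum_erase _ (fun u => (F u).delay L (y u)) (Finset.mem_univ v)]
      have : ∑ u ∈ Finset.univ.erase v, (Function.update F v D u).delay L (y u) =
          ∑ u ∈ Finset.univ.erase v, (F u).delay L (y u) := by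
        refine Finset.sum_congr rfl fun u hu => ?_
        rw [Function.update_of_ne (Finset.ne_of_mem_erase hu)]
      rw [this, Function.update_self]
      omega
    refine ⟨Function.update F v D₁, Function.update F v D₂, hwf _ w₁, hwf _ w₂, fun G => ?_,
      fun y h => ?_, fun y h => ?_, hlo _ lo₁ hi₁, hlo _ lo₂ hi₂, fun y h => ?_⟩
    · rw [next, thr, src₁, src₂, if_neg hne, if_neg hne, if_neg hne, hg _ _ c₁, hg _ _ c₂]
    · rw [hwit _ _ lo₁ hi₁] at h
      exact (hself y).2 ⟨(hy _).1 h.1, h.2⟩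
    · rw [hwit _ _ lo₂ hi₂] at h
      exact (hself y).2 ⟨(hy _).2.1 h.1, h.2⟩
    · rw [hself] at h
      rw [hwit _ _ lo₁ hi₁, hwit _ _ lo₂ hi₂]
      rcases (hy _).2.2 h.1 with ⟨h1, h2⟩ | ⟨h1, h2⟩
      · exact .inl ⟨⟨h1, h.2⟩, hsum _ _ h2⟩
      · exact .inr ⟨⟨h1, h.2⟩, hsum _ _ h2⟩
  · right
    push Not at hun
    have hz : undecided k τ (N.gate τ F) = 0 := by
      rw [hund]
      exact Finset.sum_eq_zero fun v _ => if_neg (hun v)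
    have hdec := fun v => decided hN (hF v) (hun v)
    by_cases hb : ∃ v, N.decB τ ((F v).code (τ + 1) N.bot N.top) = 0
    · left
      obtain ⟨v, hv⟩ := hb
      have hne : N.impossible τ (N.gate τ F) ≠ 0 := by
        rw [hbad]
        intro h
        have := Finset.sum_eq_zero_iff.1 h v (Finset.mem_univ v)
        simp [hv] at this
      refine ⟨fun y h => ?_, fun G => ?_⟩
      · rcases hdec v with h' | ⟨y₀, -, -, h', -⟩
        · exact h'.2 _ (h.1 v)
        · omega
      · rw [next, thr, src₁, src₂, if_pos hz, if_pos hz, if_pos hz, if_neg hne, if_neg hne]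
    · right
      push Not at hb
      have hb' : N.impossible τ (N.gate τ F) = 0 := by
        rw [hbad]
        exact Finset.sum_eq_zero fun v _ => if_neg (hb v)
      have := fun v => (hdec v).resolve_left fun h => hb v h.1
      choose y hy hA hB hWA hWB using this
      refine ⟨y, fun v => (hy v _).2 rfl, fun y' h => funext fun v => (hy v _).1 (h.1 v), hWA, hWB,
        fun G => ?_⟩
      rw [next, thr, src₁, src₂, if_pos hz, if_pos hz, if_pos hz, if_pos hb', if_pos hb', gate,
        digitSum_enc _ _ _ hlt, digitSum_enc _ _ _ hlt]
      simp only [hA, hB, Nat.add_sub_cancel]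
      rfl

/-! ### Soundness and progress of one step -/

variable (τ N) in
/-- The gates of a node are correct. -/
def Sound (o : ℕ) (G : ℕ → ℕ) : Prop :=
  ∀ F, N.WfGate τ F → G (o + N.gate τ F) = 1 → ∃ y, N.Wit τ F y

variable (τ N) in
/-- The operands of a node are correct. -/
structure SoundOps (G : ℕ → ℕ) : Prop where
  a : ∀ s y, (∀ v, N.WfA (s v) (y v)) → G (N.addrA τ s y) = 1 → N.relA s y
  b : ∀ y c, (∀ v, N.WfB (y v) (c v)) → G (N.addrB τ y c) = 1 → N.relB y c

theorem Sound.next {L : ℕ} (hL : 2 * (τ + 1) ≤ 2 ^ L) (hN : N.WfBags τ) {o : ℕ} {G : ℕ → ℕ}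
    (hG : ∀ a, G a ≤ 1) (h : N.Sound τ o G) (hop : N.SoundOps τ G) {F : Fin k → Digit (Fin n)}
    (hF : N.WfGate τ F) (h1 : N.next τ o (N.gate τ F) G = 1) : ∃ y, N.Wit τ F y := by
  rcases gate_cases hL hN hF o with ⟨F₁, F₂, w₁, w₂, e, i₁, i₂, -⟩ | ⟨-, e⟩ | ⟨y, h2, -, wA, wB, e⟩
  · rw [e] at h1
    split_ifs at h1 with h2
    have h3 := hG (o + N.gate τ F₁)
    have h4 := hG (o + N.gate τ F₂)
    rcases (by omega : G (o + N.gate τ F₁) = 1 ∨ G (o + N.gate τ F₂) = 1) with h5 | h5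
    · obtain ⟨y, hy⟩ := h F₁ w₁ h5
      exact ⟨y, i₁ y hy⟩
    · obtain ⟨y, hy⟩ := h F₂ w₂ h5
      exact ⟨y, i₂ y hy⟩
  · rw [e] at h1
    split_ifs at h1 with h2
    have h3 := hG (o + N.gate τ F)
    exact h F hF (by omega)
  · rw [e] at h1
    split_ifs at h1 with h5
    have h3 := hG (N.addrA τ (fun v => (F v).lo) y)
    have h4 := hG (N.addrB τ y fun v => (F v).hi)
    exact ⟨y, h2, hop.a _ _ wA (by omega), hop.b _ _ wB (by omega)⟩

variable (N) in
/-- The number of steps after which a gate with the witness `y` is known. -/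
noncomputable def need (L : ℕ) (F : Fin k → Digit (Fin n)) (y : Fin k → Status (Fin n)) : ℕ :=
  N.rank + L * residual (fun v => (F v).lo) y (fun v => (F v).hi) + 1 + ∑ v, (F v).delay L (y v)

variable (τ N) in
/-- The gates that should be known after `T` steps are known. -/
def Good (L T o : ℕ) (G : ℕ → ℕ) : Prop :=
  ∀ F y, N.WfGate τ F → N.Wit τ F y → N.need L F y ≤ T → G (o + N.gate τ F) = 1

variable (τ N) in
/-- The operands that should be known after `T` steps are known. -/
structure GoodOps (L T : ℕ) (G : ℕ → ℕ) : Prop where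
  a : ∀ s y, (∀ v, N.WfA (s v) (y v)) → N.relA s y →
    (N.leaf ∨ N.rank + L * crossings s y ≤ T) → G (N.addrA τ s y) = 1
  b : ∀ y c, (∀ v, N.WfB (y v) (c v)) → N.relB y c →
    (N.leaf ∨ N.rank + L * crossings y c ≤ T) → G (N.addrB τ y c) = 1

theorem Good.next {L T : ℕ} (hL : 2 * (τ + 1) ≤ 2 ^ L) (hN : N.WfBags τ) {o : ℕ} {G : ℕ → ℕ}
    (h : N.Good τ L T o G) (hop : N.GoodOps τ L T G) {F : Fin k → Digit (Fin n)}
    {y : Fin k → Status (Fin n)} (hF : N.WfGate τ F) (hy : N.Wit τ F y)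
    (hT : N.need L F y ≤ T + 1) : N.next τ o (N.gate τ F) G = 1 := by
  rcases gate_cases hL hN hF o with ⟨F₁, F₂, w₁, w₂, e, -, -, s₁, s₂, i⟩ | ⟨e, -⟩ |
    ⟨y', h2, huniq, wA, wB, e⟩
  · rw [e, if_pos]
    have hneed : ∀ F' : Fin k → Digit (Fin n),
        (∀ v, (F' v).lo = (F v).lo ∧ (F' v).hi = (F v).hi) →
        ∑ v, (F' v).delay L (y v) + 1 ≤ ∑ v, (F v).delay L (y v) → N.need L F' y ≤ T := by
      intro F' h1 h2
      unfold need at hT ⊢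
      simp only [h1]
      omega
    rcases i y hy with ⟨h1, h2⟩ | ⟨h1, h2⟩
    · have := h F₁ y w₁ h1 (hneed F₁ s₁ h2)
      omega
    · have := h F₂ y w₂ h1 (hneed F₂ s₂ h2)
      omega
  · exact absurd hy (e y)
  · obtain rfl := huniq y hy
    have hcount : N.leaf = true ∨ crossings (fun v => (F v).lo) y ≤
        residual (fun v => (F v).lo) y (fun v => (F v).hi) ∧
        crossings y (fun v => (F v).hi) ≤
        residual (fun v => (F v).lo) y (fun v => (F v).hi) := by
      rcases hleaf : N.leaf with _ | _
      · right
        have hm := fun v => (h2 v).mid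
        simp only [hleaf, mid_false] at hm
        constructor
        · refine Finset.sum_le_sum fun v _ => ?_
          obtain ⟨m1, m2, -⟩ := hm v
          split_ifs with g1 g2 g2
          · exact le_rfl
          · refine absurd ⟨g1.1, ?_, by simp [g1.2]⟩ g2
            rw [g1.2] at m2
            rcases m2 with m2 | m2 | m2
            · cases m2
            · exact m2
            · exact m2.symm
          · omega
          · omega
        · refine Finset.sum_le_sum fun v _ => ?_
          obtain ⟨m1, m2, -⟩ := hm v
          split_ifs with g1 g2 g2
          · exact le_rfl
          · refine absurd ⟨?_, g1.2, by simp [g1.1]⟩ g2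
            rw [g1.1] at m1
            rcases m1 with m1 | m1 | m1
            · exact m1
            · cases m1
            · exact m1
          · omega
          · omega
      · exact .inl rfl
    have hr : N.rank + L * residual (fun v => (F v).lo) y (fun v => (F v).hi) ≤ T := by
      unfold need at hT
      omega
    have gA := hop.a _ _ wA hy.2.1 (hcount.imp id fun h =>
      (Nat.add_le_add_left (Nat.mul_le_mul_left L h.1) _).trans hr)
    have gB := hop.b _ _ wB hy.2.2 (hcount.imp id fun h =>
      (Nat.add_le_add_left (Nat.mul_le_mul_left L h.2) _).trans hr)
    rw [e, gA, gB]
    rfl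

theorem rank_lt_need (L : ℕ) (F : Fin k → Digit (Fin n)) (y : Fin k → Status (Fin n)) :
    N.rank < N.need L F y := by
  unfold need
  omega

theorem need_le {L : ℕ} {F : Fin k → Digit (Fin n)} {y : Fin k → Status (Fin n)}
    (h : N.Wit τ F y) : N.need L F y ≤ N.rank + (2 * k + 1) + L * k := by
  have key : L * residual (fun v => (F v).lo) y (fun v => (F v).hi) + ∑ v, (F v).delay L (y v) ≤
      ∑ _v : Fin k, (2 + L) := by
    rw [residual, Finset.mul_sum, ← Finset.sum_add_distrib]
    refine Finset.sum_le_sum fun v _ => ?_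
    have hv := h.1 v
    rcases hF : F v with ⟨a, c⟩ | ⟨a, c⟩ | ⟨a, c⟩ | i
    · rcases a with x | _ | _ <;> rcases c with z | _ | _ <;> rcases y v with w | _ | _ <;>
        simp [lo, hi, delay] <;> omega
    · simp only [delay, add_zero]
      split_ifs <;> omega
    · simp only [delay, add_zero]
      split_ifs <;> omega
    · rw [hF] at hv
      rcases i with _ | i
      · simp only [delay]
        split_ifs <;> omega
      · obtain ⟨x, -, hx, -⟩ := hv.2
        rw [if_neg fun h => h.2.2 x hx]
        simp only [delay]
        omega
  simp only [Finset.sum_const, Finset.card_univ, Fintype.card_fin, smul_eq_mul] at key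
  unfold need
  nlinarith

theorem need_pend_le (L : ℕ) (s y c : Fin k → Status (Fin n)) :
    N.need L (fun v => pend (s v) (c v)) y ≤ N.rank + (2 * k + 1) + L * crossings s c := by
  have key : L * residual s y c + ∑ v, (pend (s v) (c v)).delay L (y v) ≤
      ∑ v : Fin k, 2 + L * crossings s c := by
    rw [residual, crossings, Finset.mul_sum, Finset.mul_sum, ← Finset.sum_add_distrib,
      ← Finset.sum_add_distrib]
    refine Finset.sum_le_sum fun v _ => ?_
    rcases s v with x | _ | _ <;> rcases c v with z | _ | _ <;> rcases y v with w | _ | _ <;>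
        simp [delay] <;> omega
  simp only [Finset.sum_const, Finset.card_univ, Fintype.card_fin, smul_eq_mul] at key
  have : N.need L (fun v => pend (s v) (c v)) y =
    N.rank + L * residual s y c + 1 + ∑ v, (pend (s v) (c v)).delay L (y v) := rfl
  omega

end Node

end SubpathDP

/-! ### The network -/

namespace SubpathDP

open Status Digit

/-- The numbers that determine the layout of the network: `p` is the length of the subpath, the tree
of segments has `2 ^ d` leaves, and `2 ^ L` is an upper bound for the heaps in a digit. -/
structure Sizes (k : ℕ) where
  τ : ℕ
  p : ℕ
  d : ℕ
  L : ℕ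

namespace Sizes

variable {k : ℕ} (z : Sizes k)

/-- The number of codes of partial matches. -/
abbrev N : ℕ := (z.τ + 3) ^ k

/-- The base for the digits of gates. -/
abbrev E : ℕ := base (z.τ + 1)

/-- The number of gates of a node. -/
abbrev W : ℕ := z.E ^ k

/-- The number of leaves of the tree of segments. -/
abbrev S : ℕ := 2 ^ z.d

/-- The number of nodes. The segments have the numbers of a heap with the root `1` and the leaves
`S`, …, `2 * S - 1`; the prefix `[0, x)` has the number `2 * S + x`. -/
abbrev NI : ℕ := 3 * z.S + 1

/-- The rank of a node exceeds the rank of its operands by at least this number. -/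
abbrev K (_z : Sizes k) : ℕ := 2 * k + 1

/-- The length of a segment. -/
def segStep (id : ℕ) : ℕ := if id = 0 then 0 else z.S / 2 ^ Nat.log 2 id

/-- The length of the last segment of the prefix `[0, x)`. -/
def preStep (x : ℕ) : ℕ := if x = 0 then 0 else Nat.gcd x z.S

/-- The bags are numbered: first the layers, then the children off the path. -/
def offBag (s : ℕ) : ℕ := z.S + 1 + s

/-- The number of the bag at the lower end. -/
def botBag (id : ℕ) : ℕ := if id < 2 * z.S then id * z.segStep id - z.S else 0

/-- The number of the bag at the upper end. -/
def topBag (id : ℕ) : ℕ := if id < 2 * z.S then z.botBag id + z.segStep id else id - 2 * z.S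

/-- The number of the bag in the middle. -/
def midBag (id : ℕ) : ℕ :=
  if id < z.S then z.botBag id + z.segStep id / 2
  else if id < 2 * z.S then z.offBag (offNumber z.p (id - z.S))
  else id - 2 * z.S - z.preStep (id - 2 * z.S)

/-- The address of the tables of the children off the path. -/
def tabBase : ℕ := z.NI * z.W

/-- The address of the tables of the partial matches of the layers. -/
def pmBase : ℕ := z.tabBase + (z.p + 1) * z.N

/-- The address of the lower operand. -/
def opA (id : ℕ) : ℕ :=
  if id < z.S then 2 * id * z.W
  else if id < 2 * z.S then z.tabBase + offNumber z.p (id - z.S) * z.N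
  else (2 * z.S + (id - 2 * z.S - z.preStep (id - 2 * z.S))) * z.W

/-- The address of the upper operand. -/
def opB (id : ℕ) : ℕ :=
  if id < z.S then (2 * id + 1) * z.W
  else if id < 2 * z.S then z.pmBase + (id - z.S + 1) * z.N
  else (z.S / z.preStep (id - 2 * z.S) + (id - 2 * z.S) / z.preStep (id - 2 * z.S) - 1) * z.W

/-- A node is a leaf of the tree of segments. -/
def isLeaf (id : ℕ) : Bool := decide (z.S ≤ id ∧ id < 2 * z.S)

/-- See `Node.rank`. The prefixes follow the segments, the short last segments come last. -/
def rank (id : ℕ) : ℕ :=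
  if id < 2 * z.S then z.K * (z.d - Nat.log 2 id)
  else z.L * k + z.K * (z.d + 1) + z.K * (z.d - Nat.log 2 (z.preStep (id - 2 * z.S)))

/-- The segment or prefix is nonempty and ends at layer `p + 1` or below. -/
def Ok (id : ℕ) : Prop := id ≠ 0 ∧ id ≠ 2 * z.S ∧ z.topBag id ≤ z.p + 1

variable {z}

theorem segStep_inner {id : ℕ} (h0 : id ≠ 0) (h : id < z.S) :
    ∃ a c, id = 2 ^ a + c ∧ c < 2 ^ a ∧ a < z.d ∧ Nat.log 2 id = a ∧
      z.segStep id = 2 * 2 ^ (z.d - a - 1) ∧ z.segStep (2 * id) = 2 ^ (z.d - a - 1) ∧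
      z.segStep (2 * id + 1) = 2 ^ (z.d - a - 1) ∧ Nat.log 2 (2 * id) = a + 1 ∧
      Nat.log 2 (2 * id + 1) = a + 1 ∧ z.S = 2 * (2 ^ a * 2 ^ (z.d - a - 1)) := by
  have h1 := Nat.pow_log_le_self 2 h0
  have h2 := Nat.lt_pow_succ_log_self (b := 2) (by norm_num) id
  rw [pow_succ] at h2
  have h3 : Nat.log 2 id < z.d := Nat.log_lt_of_lt_pow h0 h
  have h4 : Nat.log 2 (2 * id) = Nat.log 2 id + 1 := by
    rw [mul_comm, Nat.log_mul_base (by norm_num) h0]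
  have h5 : Nat.log 2 (2 * id + 1) = Nat.log 2 id + 1 := by
    rw [Nat.log_eq_iff (.inl (by omega)), pow_succ, pow_succ]
    omega
  have hS : z.S = 2 * (2 ^ Nat.log 2 id * 2 ^ (z.d - Nat.log 2 id - 1)) := by
    change 2 ^ z.d = _
    rw [← pow_add, ← pow_succ']
    congr 1
    omega
  refine ⟨Nat.log 2 id, id - 2 ^ Nat.log 2 id, by omega, by omega, h3, rfl, ?_, ?_, ?_, h4, h5, hS⟩
  · rw [segStep, if_neg h0, hS]
    refine Nat.div_eq_of_eq_mul_left (by positivity) ?_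
    ring
  · rw [segStep, if_neg (by omega), hS, h4, pow_succ]
    refine Nat.div_eq_of_eq_mul_left (by positivity) ?_
    ring
  · rw [segStep, if_neg (by omega), hS, h5, pow_succ]
    refine Nat.div_eq_of_eq_mul_left (by positivity) ?_
    ring

theorem segStep_leaf {id : ℕ} (h : z.S ≤ id) (h' : id < 2 * z.S) :
    Nat.log 2 id = z.d ∧ z.segStep id = 1 := by
  have h0 : 0 < z.S := by positivity
  have h1 : Nat.log 2 id = z.d := by
    rw [Nat.log_eq_iff (.inr ⟨by norm_num, by omega⟩), pow_succ]
    exact ⟨h, by rwa [mul_comm]⟩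
  exact ⟨h1, by rw [segStep, if_neg (by omega), h1, Nat.div_self h0]⟩

theorem preStep_pos {x : ℕ} (h0 : x ≠ 0) (hx : x ≤ z.S) :
    ∃ a c, a ≤ z.d ∧ z.preStep x = 2 ^ a ∧ x = (c + 1) * 2 ^ a ∧ c + 1 ≤ 2 ^ (z.d - a) ∧
      z.S = 2 ^ (z.d - a) * 2 ^ a ∧ (c ≠ 0 → 2 ^ (a + 1) ∣ c * 2 ^ a) := by
  obtain ⟨a, ha, hg⟩ := (Nat.dvd_prime_pow Nat.prime_two).1 (Nat.gcd_dvd_right x z.S)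
  obtain ⟨c, hc⟩ := Nat.gcd_dvd_left x z.S
  rw [hg] at hc
  have hc0 : c ≠ 0 := by rintro rfl; simp at hc; exact h0 hc
  obtain ⟨c, rfl⟩ := Nat.exists_eq_succ_of_ne_zero hc0
  have hS : z.S = 2 ^ (z.d - a) * 2 ^ a := by
    change 2 ^ z.d = _
    rw [← pow_add]; congr 1; omega
  have hp : 0 < 2 ^ a := by positivity
  refine ⟨a, c, ha, by rw [preStep, if_neg h0, hg], by rw [mul_comm]; exact hc, ?_, hS, fun hne => ?_⟩
  · rw [hc, hS, mul_comm] at hx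
    exact Nat.le_of_mul_le_mul_right hx hp
  · -- otherwise `c + 1` is even and at least `2`, and the step is longer
    rw [pow_succ, mul_comm c]
    refine Nat.mul_dvd_mul_left _ ?_
    by_contra hodd
    have h2 : 2 ∣ c + 1 := by omega
    have had : a < z.d := by
      by_contra h
      have : z.d - a = 0 := by omega
      rw [hc, hS, this, pow_zero, one_mul] at hx
      have : c.succ ≤ 1 := Nat.le_of_mul_le_mul_left (by simpa using hx) hp
      omega
    have h3 : 2 ^ (a + 1) ∣ Nat.gcd x z.S := by
      refine Nat.dvd_gcd ?_ (pow_dvd_pow 2 had)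
      rw [hc, pow_succ]
      exact Nat.mul_dvd_mul_left _ h2
    rw [hg] at h3
    have := Nat.le_of_dvd hp h3
    rw [pow_succ] at this
    omega

end Sizes

section network

variable {k n : ℕ} {ι : Type*} (H : SimpleGraph (Fin k)) {G : SimpleGraph (Fin n)}
  {T : TreeDecomposition G ι} (P : Subpath T) (l : ι → List (Fin n)) (z : Sizes k)

/-- The bag with a given number. -/
noncomputable def bagList (j : ℕ) : List (Fin n) :=
  if j ≤ z.S then layer P l j else offList P l (j - z.S - 1)

open Classical in
/-- The node with a given number. -/
noncomputable def node (id : ℕ) : Node k n where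
  leaf := z.isLeaf id
  bot := bagList P l z (z.botBag id)
  mid := bagList P l z (z.midBag id)
  top := bagList P l z (z.topBag id)
  relA s y :=
    if id < z.S then Chain H P l (z.botBag id) (z.segStep id / 2) s y
    else if id < 2 * z.S then OffValid H P (offNumber z.p (id - z.S)) y
    else (s = fun _ => unmatched) ∧ Chain H P l 0 (z.midBag id) (fun _ => unmatched) y
  relB y c :=
    if id < z.S then Chain H P l (z.midBag id) (z.segStep id / 2) y c
    else if id < 2 * z.S then IsPartialMatch H G (layer P l (z.topBag id)).toFinset c
    else Chain H P l (z.midBag id) (z.preStep (id - 2 * z.S)) y c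
  opA := z.opA id
  opB := z.opB id
  rank := z.rank id

/-- The relation that the gates of a node decide: the matches at the two ends are connected by a
chain; prefixes start from the empty match. -/
def NodeRel (id : ℕ) (s c : Fin k → Status (Fin n)) : Prop :=
  if id < 2 * z.S then Chain H P l (z.botBag id) (z.segStep id) s c
  else (s = fun _ => unmatched) ∧ Chain H P l 0 (id - 2 * z.S) (fun _ => unmatched) c

variable {l}

theorem Chain.le {i j : ℕ} {s c : Fin k → Status (Fin n)} (h : Chain H P l i j s c) (v : Fin k) :
    Le (s v) (c v) := by
  induction j generalizing c with
  | zero => exact .inr (.inr (congrFun (show s = c from h) v))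
  | succ j ih =>
    obtain ⟨y, h1, w, -, h2, -⟩ := h
    exact (ih h1).trans (LocalCompat.le (h2 v))

theorem Chain.mem {i j : ℕ} (hj : 0 < j) {s c : Fin k → Status (Fin n)}
    (h : Chain H P l i j s c) (v : Fin k) (x : Fin n) (hx : c v = matched x) :
    x ∈ layer P l (i + j) := by
  obtain ⟨j, rfl⟩ : ∃ j', j = j' + 1 := ⟨j - 1, by omega⟩
  obtain ⟨y, h1, w, -, -, h2⟩ := h
  exact List.mem_toFinset.1 (h2.mem v x hx)

variable (hp : P.length = z.p) (hd : z.p + 1 ≤ z.S)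

include hp hd

theorem node_rel_iff {id : ℕ} (hid : z.Ok id) (s c : Fin k → Status (Fin n)) :
    (node H P l z id).Rel s c ↔ NodeRel H P l z id s c := by
  obtain ⟨h0, h1, h2⟩ := hid
  by_cases hS : id < z.S
  · obtain ⟨a, c', -, -, -, -, e, -⟩ := Sizes.segStep_inner h0 hS
    have hS2 : id < 2 * z.S := by omega
    have hleaf : z.isLeaf id = false := by simp [Sizes.isLeaf]; omega
    have hmid : z.midBag id = z.botBag id + z.segStep id / 2 := by rw [Sizes.midBag, if_pos hS]
    rw [Sizes.topBag, if_pos hS2] at h2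
    have hlist : bagList P l z (z.midBag id) = layer P l (z.midBag id) := by
      rw [bagList, if_pos]; omega
    simp only [Node.Rel, node, hleaf, mid_false, NodeRel, if_pos hS2, if_pos hS, hlist]
    have hs : z.segStep id = z.segStep id / 2 + z.segStep id / 2 := by omega
    conv_rhs => rw [hs]
    have hpos : 0 < z.segStep id / 2 := by
      rw [e, Nat.mul_div_cancel_left _ (by norm_num)]; positivity
    rw [chain_add, ← hmid]
    constructor
    · rintro ⟨y, -, h3, h4⟩
      exact ⟨y, h3, h4⟩
    · rintro ⟨y, h3, h4⟩
      refine ⟨y, fun v => ⟨Chain.le H P h3 v, Chain.le H P h4 v, fun x hx => ?_⟩, h3, h4⟩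
      have := Chain.mem H P hpos h3 v x hx
      rwa [← hmid] at this
  by_cases hS2 : id < 2 * z.S
  · have hleaf : z.isLeaf id = true := by simp [Sizes.isLeaf]; omega
    obtain ⟨-, hstep⟩ := Sizes.segStep_leaf (Nat.le_of_not_lt hS) hS2
    have hbot : z.botBag id = id - z.S := by rw [Sizes.botBag, if_pos hS2, hstep, mul_one]
    have htop : z.topBag id = id - z.S + 1 := by rw [Sizes.topBag, if_pos hS2, hbot, hstep]
    rw [htop] at h2
    have l1 : bagList P l z (id - z.S) = layer P l (id - z.S) := by
      rw [bagList, if_pos (by omega)]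
    have l2 : bagList P l z (id - z.S + 1) = layer P l (id - z.S + 1) := by
      rw [bagList, if_pos (by omega)]
    have l3 : bagList P l z (z.midBag id) = offList P l (offNumber z.p (id - z.S)) := by
      rw [bagList, Sizes.midBag, if_neg hS, if_pos hS2, Sizes.offBag, if_neg (by omega)]
      congr 1
      omega
    simp only [Node.Rel, node, hleaf, mid_true, NodeRel, if_pos hS2, if_neg hS, hbot, hstep, htop, l1, l2,
      l3]
    constructor
    · rintro ⟨y, h3, h4, h5⟩
      exact ⟨s, rfl, y, hp ▸ h4, hp ▸ h3, h5⟩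
    · rintro ⟨_, rfl, y, h3, h4, h5⟩
      exact ⟨y, hp ▸ h4, hp ▸ h3, h5⟩
  · have hleaf : z.isLeaf id = false := by simp [Sizes.isLeaf]; omega
    rw [Sizes.topBag, if_neg hS2] at h2
    obtain ⟨a, c', -, e1, e2, -⟩ := Sizes.preStep_pos (z := z) (x := id - 2 * z.S) (by omega)
      (by omega)
    have hmid : z.midBag id = id - 2 * z.S - z.preStep (id - 2 * z.S) := by
      rw [Sizes.midBag, if_neg hS, if_neg hS2]
    have hle : z.preStep (id - 2 * z.S) ≤ id - 2 * z.S := by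
      rw [e1, e2]; exact Nat.le_mul_of_pos_left _ (by omega)
    have hsum : id - 2 * z.S = z.midBag id + z.preStep (id - 2 * z.S) := by omega
    have hlist : bagList P l z (z.midBag id) = layer P l (z.midBag id) := by
      rw [bagList, if_pos]; omega
    simp only [Node.Rel, node, hleaf, mid_false, NodeRel, if_neg hS2, if_neg hS, hlist]
    conv_rhs => rw [hsum]
    rw [chain_add, zero_add]
    constructor
    · rintro ⟨y, -, ⟨h3, h4⟩, h5⟩
      exact ⟨h3, y, h4, h5⟩
    · rintro ⟨rfl, y, h3, h4⟩
      refine ⟨y, fun v => ⟨.inl rfl, Chain.le H P h4 v, fun x hx => ?_⟩, ⟨rfl, h3⟩, h4⟩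
      rcases Nat.eq_zero_or_pos (z.midBag id) with h6 | h6
      · rw [h6] at h3
        have := congrFun (show (fun _ => unmatched) = y from h3) v
        rw [hx] at this
        cases this
      · have := Chain.mem H P h6 h3 v x hx
        rwa [zero_add] at this

omit hp hd in
theorem node_wfBags {τ : ℕ} (hτ : ∀ j, (bagList P l z j).Nodup ∧ (bagList P l z j).length ≤ τ + 1)
    (id : ℕ) : (node H P l z id).WfBags τ :=
  ⟨(hτ _).1, (hτ _).2, (hτ _).2, (hτ _).2⟩

/-! ### Constant gates -/

omit hp hd in
variable (l) in
/-- The values of the gates at the beginning: the tables of the children off the path, the tables of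
the partial matches of the layers, and the gate for the empty prefix. -/
structure Init (G₀ : ℕ → ℕ) : Prop where
  le_one : ∀ a, G₀ a ≤ 1
  tab : ∀ s ≤ z.p, ∀ w : Fin k → Status (Fin n), (∀ v x, w v = matched x → x ∈ offList P l s) →
    (G₀ (z.tabBase + s * z.N + matchCode z.τ (offList P l s) w) = 1 ↔ OffValid H P s w)
  pm : ∀ i ≤ z.p + 1, ∀ c : Fin k → Status (Fin n), (∀ v x, c v = matched x → x ∈ layer P l i) →
    (G₀ (z.pmBase + i * z.N + matchCode z.τ (layer P l i) c) = 1 ↔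
      IsPartialMatch H G (layer P l i).toFinset c)
  unit : ∀ e < z.W, G₀ (2 * z.S * z.W + e) = 1 ↔ e = 0
  zero : ∀ id < z.NI, id ≠ 2 * z.S → ∀ e < z.W, G₀ (id * z.W + e) = 0

end network

end SubpathDP

/-! ### The order of evaluation -/

namespace SubpathDP

open Status Digit

namespace Sizes

variable {k : ℕ} {z : Sizes k}

/-- The operands of an inner segment are its two halves. -/
theorem segment_operands {id : ℕ} (hid : z.Ok id) (hS : id < z.S) :
    z.Ok (2 * id) ∧ z.Ok (2 * id + 1) ∧ 2 * id < 2 * z.S ∧ 2 * id + 1 < 2 * z.S ∧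
      z.botBag (2 * id) = z.botBag id ∧ z.topBag (2 * id) = z.midBag id ∧
      z.botBag (2 * id + 1) = z.midBag id ∧ z.topBag (2 * id + 1) = z.topBag id ∧
      z.segStep (2 * id) = z.segStep id / 2 ∧ z.segStep (2 * id + 1) = z.segStep id / 2 ∧
      z.rank (2 * id) + z.K ≤ z.rank id ∧ z.rank (2 * id + 1) + z.K ≤ z.rank id := by
  obtain ⟨h0, -, h2⟩ := hid
  obtain ⟨a, c, hac, hc, had, hlog, e, e1, e2, l1, l2, hS'⟩ := segStep_inner h0 hS
  set q := 2 ^ (z.d - a - 1) with hq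
  have hs2 : z.segStep id / 2 = q := by omega
  have hb : z.botBag id = c * (2 * q) := by
    rw [botBag, if_pos (by omega), e, hac, hS']
    refine Nat.sub_eq_of_eq_add ?_
    ring
  have hm : z.midBag id = c * (2 * q) + q := by rw [midBag, if_pos hS, hb, hs2]
  have ht : z.topBag id = c * (2 * q) + 2 * q := by rw [topBag, if_pos (by omega), hb, e]
  have hb1 : z.botBag (2 * id) = c * (2 * q) := by
    rw [botBag, if_pos (by omega), e1, hac, hS']
    refine Nat.sub_eq_of_eq_add ?_
    ring
  have hb2 : z.botBag (2 * id + 1) = c * (2 * q) + q := by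
    rw [botBag, if_pos (by omega), e2, hac, hS']
    refine Nat.sub_eq_of_eq_add ?_
    ring
  have ht1 : z.topBag (2 * id) = c * (2 * q) + q := by rw [topBag, if_pos (by omega), hb1, e1]
  have ht2 : z.topBag (2 * id + 1) = c * (2 * q) + 2 * q := by
    rw [topBag, if_pos (by omega), hb2, e2]; ring
  have hr : z.K * (z.d - (a + 1)) + z.K = z.K * (z.d - a) := by
    rw [← Nat.mul_succ]
    congr 1
    omega
  refine ⟨⟨by omega, by omega, by omega⟩, ⟨by omega, by omega, by omega⟩, by omega, by omega,
    by omega, by omega, by omega, by omega, by omega, by omega, ?_, ?_⟩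
  · rw [rank, rank, if_pos (by omega), if_pos (by omega), hlog, l1, hr]
  · rw [rank, rank, if_pos (by omega), if_pos (by omega), hlog, l2, hr]

/-- The operands of a prefix are a shorter prefix and a segment. -/
theorem prefix_operands (hd : z.p + 1 ≤ z.S) {id : ℕ} (hid : z.Ok id) (hS : 2 * z.S ≤ id) :
    ∃ i₁ i₂, z.opA id = i₁ * z.W ∧ z.opB id = i₂ * z.W ∧ 2 * z.S ≤ i₁ ∧ i₂ < 2 * z.S ∧
      (i₁ = 2 * z.S ∨ z.Ok i₁ ∧ z.rank i₁ + z.K ≤ z.rank id) ∧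
      z.Ok i₂ ∧ z.rank i₂ + z.K ≤ z.rank id ∧
      z.botBag i₁ = z.botBag id ∧ z.topBag i₁ = z.midBag id ∧
      z.botBag i₂ = z.midBag id ∧ z.topBag i₂ = z.topBag id ∧ i₁ - 2 * z.S = z.midBag id ∧
      z.segStep i₂ = z.preStep (id - 2 * z.S) := by
  obtain ⟨h0, h1, h2⟩ := hid
  rw [topBag, if_neg (by omega)] at h2
  obtain ⟨x, rfl⟩ := Nat.exists_eq_add_of_le hS
  rw [Nat.add_sub_cancel_left] at h2
  obtain ⟨a, c, ha, hg, hx, hc, hS', hdvd⟩ := preStep_pos (z := z) (x := x) (by omega) (by omega)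
  have hp : 0 < 2 ^ a := by positivity
  have hxs : x - z.preStep x = c * 2 ^ a := by
    rw [hg, hx]
    refine Nat.sub_eq_of_eq_add ?_
    ring
  have hid2 : z.S / z.preStep x + x / z.preStep x - 1 = 2 ^ (z.d - a) + c := by
    rw [hg, hS', hx, Nat.mul_div_cancel _ hp, Nat.mul_div_cancel _ hp]
    omega
  have hpd : 0 < 2 ^ (z.d - a) := by positivity
  have hle : 2 ^ (z.d - a) ≤ z.S := by rw [hS']; exact Nat.le_mul_of_pos_right _ hp
  have hlog : Nat.log 2 (2 ^ (z.d - a) + c) = z.d - a := by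
    rw [Nat.log_eq_iff (.inr ⟨by norm_num, by omega⟩), pow_succ]
    omega
  have hseg : z.segStep (2 ^ (z.d - a) + c) = 2 ^ a := by
    rw [segStep, if_neg (by omega), hlog]
    exact Nat.div_eq_of_eq_mul_right hpd hS'
  have hbot : z.botBag (2 ^ (z.d - a) + c) = c * 2 ^ a := by
    rw [botBag, if_pos (by omega), hseg, hS']
    refine Nat.sub_eq_of_eq_add ?_
    ring
  have htop : z.topBag (2 ^ (z.d - a) + c) = x := by
    rw [topBag, if_pos (by omega), hbot, hseg, hx]; ring
  have hmid : z.midBag (2 * z.S + x) = c * 2 ^ a := by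
    rw [midBag, if_neg (by omega), if_neg (by omega), Nat.add_sub_cancel_left, hxs]
  have hrank : z.rank (2 * z.S + x) = z.L * k + z.K * (z.d + 1) + z.K * (z.d - a) := by
    rw [rank, if_neg (by omega), Nat.add_sub_cancel_left, hg, Nat.log_pow (by norm_num)]
  refine ⟨2 * z.S + c * 2 ^ a, 2 ^ (z.d - a) + c, ?_, ?_, by omega, by omega, ?_,
    ⟨by omega, by omega, by omega⟩, ?_, ?_, ?_, ?_, ?_, ?_, ?_⟩
  · rw [opA, if_neg (by omega), if_neg (by omega), Nat.add_sub_cancel_left, hxs]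
  · rw [opB, if_neg (by omega), if_neg (by omega), Nat.add_sub_cancel_left, hid2]
  · rcases Nat.eq_zero_or_pos c with rfl | hc0
    · left; simp
    · right
      have hpos : 0 < c * 2 ^ a := Nat.mul_pos hc0 hp
      have hlt : c * 2 ^ a ≤ x := by rw [← hxs]; exact Nat.sub_le _ _
      obtain ⟨a', c', ha', hg', -⟩ := preStep_pos (z := z) (x := c * 2 ^ a) (by omega) (by omega)
      have haa : a < a' := by
        have h3 : 2 ^ (a + 1) ∣ z.preStep (c * 2 ^ a) := by
          rw [preStep, if_neg (by omega)]
          refine Nat.dvd_gcd (hdvd (by omega)) (pow_dvd_pow 2 ?_)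
          -- the step of a prefix that is not a single segment is less than `S`
          by_contra h4
          have : z.d - a = 0 := by omega
          rw [this, pow_zero] at hc
          omega
        rw [hg'] at h3
        have := (Nat.pow_dvd_pow_iff_le_right (by norm_num : 1 < 2)).1 h3
        omega
      refine ⟨⟨by omega, by omega, ?_⟩, ?_⟩
      · rw [topBag, if_neg (by omega), Nat.add_sub_cancel_left]
        omega
      · rw [hrank, rank, if_neg (by omega), Nat.add_sub_cancel_left, hg', Nat.log_pow (by norm_num),
          add_assoc]
        refine Nat.add_le_add_left ?_ _
        rw [← Nat.mul_succ]
        exact Nat.mul_le_mul_left _ (by omega)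
  · rw [hrank, rank, if_pos (by omega), hlog]
    have : z.K * (z.d - (z.d - a)) + z.K ≤ z.K * (z.d + 1) := by
      rw [← Nat.mul_succ]
      exact Nat.mul_le_mul_left _ (by omega)
    omega
  · rw [botBag, botBag, if_neg (by omega), if_neg (by omega)]
  · rw [hmid, topBag, if_neg (by omega), Nat.add_sub_cancel_left]
  · rw [hmid, hbot]
  · rw [htop, topBag, if_neg (by omega), Nat.add_sub_cancel_left]
  · rw [hmid, Nat.add_sub_cancel_left]
  · rw [hseg, Nat.add_sub_cancel_left, hg]

variable (z) in
/-- The number of steps of the first and of the last phase. -/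
abbrev EX : ℕ := z.L * k

open Classical in
variable (z) in
/-- The nodes whose gates are evaluated in step `T`. First all segments, then fewer and fewer levels
of them, then the prefixes level by level, and in the end all prefixes. -/
def Active (T id : ℕ) : Prop :=
  if T < z.EX then id < 2 * z.S
  else if T < z.EX + z.K * (z.d + 1) then id < 2 * z.S / 2 ^ ((T - z.EX) / z.K)
  else if T < z.EX + 2 * (z.K * (z.d + 1)) then
    ∃ c, 1 ≤ c ∧ c ≤ 2 ^ ((T - z.EX - z.K * (z.d + 1)) / z.K) ∧
      id = 2 * z.S + c * (z.S / 2 ^ ((T - z.EX - z.K * (z.d + 1)) / z.K))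
  else 2 * z.S < id ∧ id < z.NI

variable (z) in
/-- The number of all steps. -/
abbrev steps : ℕ := 2 * z.EX + 2 * (z.K * (z.d + 1))

theorem active_of_rank (hd : z.p + 1 ≤ z.S) {id T : ℕ} (hid : z.Ok id) (h1 : z.rank id ≤ T)
    (h2 : T < z.rank id + z.K + z.EX) : z.Active T id := by
  obtain ⟨h0, hP, htop⟩ := hid
  have hKk : z.K = 2 * k + 1 := rfl
  have hEX : z.EX = z.L * k := rfl
  have hNI : z.NI = 3 * z.S + 1 := rfl
  have hSd : z.S = 2 ^ z.d := rfl
  have hK : 0 < z.K := by omega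
  have hSp : 0 < z.S := by positivity
  by_cases hS : id < 2 * z.S
  · rw [rank, if_pos hS] at h1 h2
    have hlog : Nat.log 2 id ≤ z.d := by
      have := Nat.log_lt_of_lt_pow (b := 2) h0 (show id < 2 ^ (z.d + 1) by rw [pow_succ']; omega)
      omega
    have hTlt : T < z.EX + z.K * (z.d + 1) := by
      have : z.K * (z.d - Nat.log 2 id) + z.K ≤ z.K * (z.d + 1) := by
        rw [← Nat.mul_succ]
        exact Nat.mul_le_mul_left _ (by omega)
      omega
    rw [Active]
    split_ifs with h3
    · exact hS
    · have h4 : (T - z.EX) / z.K < z.d - Nat.log 2 id + 1 := by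
        rw [Nat.div_lt_iff_lt_mul hK, Nat.add_mul, one_mul, mul_comm]
        omega
      rw [Nat.lt_iff_add_one_le, Nat.le_div_iff_mul_le (by positivity)]
      have h5 := Nat.lt_pow_succ_log_self (b := 2) (by norm_num) id
      calc (id + 1) * 2 ^ ((T - z.EX) / z.K)
          ≤ 2 ^ (Nat.log 2 id + 1) * 2 ^ (z.d - Nat.log 2 id) :=
            Nat.mul_le_mul h5 (Nat.pow_le_pow_right (by norm_num) (by omega))
        _ = 2 * z.S := by
            change _ = 2 * 2 ^ z.d
            rw [← pow_add, ← pow_succ']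
            congr 1
            omega
  · rw [topBag, if_neg hS] at htop
    rw [rank, if_neg hS] at h1 h2
    obtain ⟨x, rfl⟩ := Nat.exists_eq_add_of_le (Nat.le_of_not_lt hS)
    rw [Nat.add_sub_cancel_left] at htop h1 h2
    obtain ⟨a, c, ha, hg, hx, hc, hS', -⟩ := preStep_pos (z := z) (x := x) (by omega) (by omega)
    rw [hg, Nat.log_pow (by norm_num)] at h1 h2
    rw [Active, if_neg (by omega), if_neg (by omega)]
    split_ifs with h3
    · set j := (T - z.EX - z.K * (z.d + 1)) / z.K with hj
      have h4 : z.d - a ≤ j := by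
        rw [hj, Nat.le_div_iff_mul_le hK, mul_comm]
        omega
      have h5 : j < z.d + 1 := by
        rw [hj, Nat.div_lt_iff_lt_mul hK, mul_comm (z.d + 1)]
        omega
      have h6 : z.S / 2 ^ j = 2 ^ (z.d - j) := Nat.pow_div (by omega) (by norm_num)
      have h7 : z.d - (z.d - a) = a := by omega
      have h8 : 2 ^ a = 2 ^ (j - (z.d - a)) * 2 ^ (z.d - j) := by
        rw [← pow_add]; congr 1; omega
      have h9 : 2 ^ j = 2 ^ (z.d - a) * 2 ^ (j - (z.d - a)) := by
        rw [← pow_add]; congr 1; omega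
      refine ⟨(c + 1) * 2 ^ (j - (z.d - a)), Nat.succ_le_of_lt (by positivity), ?_, ?_⟩
      · rw [h9]
        exact Nat.mul_le_mul_right _ hc
      · rw [h6, mul_assoc, ← h8, ← hx]
    · constructor
      · omega
      · omega

end Sizes

section network

variable {k n : ℕ} {ι : Type*} (H : SimpleGraph (Fin k)) {G : SimpleGraph (Fin n)}
  {T : TreeDecomposition G ι} (P : Subpath T) {l : ι → List (Fin n)} {z : Sizes k}

open Classical in
variable (l z) in
/-- One step of the gates of the nodes `act`. -/
noncomputable def sweep (act : ℕ → Prop) (g : ℕ → ℕ) (a : ℕ) : ℕ :=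
  if a < z.NI * z.W ∧ act (a / z.W) then
    (node H P l z (a / z.W)).next z.τ (a / z.W * z.W) (a % z.W) g
  else g a

variable (l z) in
/-- The values of the gates after a number of steps. -/
noncomputable def gates (g₀ : ℕ → ℕ) : ℕ → ℕ → ℕ
  | 0 => g₀
  | t + 1 => sweep H P l z (z.Active t) (gates g₀ t)

variable (l z) in
/-- The state of the network after `t` steps. -/
structure Inv (g₀ : ℕ → ℕ) (t : ℕ) (g : ℕ → ℕ) : Prop where
  le_one : ∀ a, g a ≤ 1
  fixed : ∀ a, z.NI * z.W ≤ a → g a = g₀ a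
  unit : ∀ e < z.W, g (2 * z.S * z.W + e) = g₀ (2 * z.S * z.W + e)
  sound : ∀ id, z.Ok id → (node H P l z id).Sound z.τ (id * z.W) g
  good : ∀ id, z.Ok id → (node H P l z id).Good z.τ z.L t (id * z.W) g

variable (hp : P.length = z.p) (hd : z.p + 1 ≤ z.S) {g₀ : ℕ → ℕ}
  (hbag : ∀ j, (bagList P l z j).Nodup ∧ (bagList P l z j).length ≤ z.τ + 1)

theorem unit_iff (h : Init H P l z g₀) {s c : Fin k → Status (Fin n)}
    (hw : ∀ v, WfPair (bagList P l z 0) (bagList P l z 0) (s v) (c v)) :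
    g₀ (2 * z.S * z.W + enc z.E fun v => pairDigit (z.τ + 1) (bagList P l z 0) (bagList P l z 0)
      (s v) (c v)) = 1 ↔ s = (fun _ => unmatched) ∧ c = fun _ => unmatched := by
  have h0 : bagList P l z 0 = [] := by rw [bagList, if_pos (Nat.zero_le _), layer]
  rw [h0] at hw ⊢
  have hlt : ∀ v, pairDigit (z.τ + 1) [] [] (s v) (c v) < z.E := fun v =>
    (pairDigit_lt (by simp) (by simp) (hw v)).trans_le
      (by change 3 * (z.τ + 1) + 3 ≤ 11 * (z.τ + 1) + 9; omega)
  rw [h.unit _ (enc_lt _ hlt)]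
  have hz : (0 : ℕ) = enc (k := k) z.E fun _ => 0 := by simp [enc]
  constructor
  · intro h1
    rw [hz] at h1
    have h2 := enc_injective hlt (fun _ => by change 0 < 11 * (z.τ + 1) + 9; omega) h1
    have h3 : ∀ v, s v = unmatched ∧ c v = unmatched := by
      intro v
      have h4 := congrFun h2 v
      rcases WfPair.cases (hw v) with h5 | ⟨h5, h6⟩ | ⟨h5, h6⟩ | ⟨x, hx, -⟩ | ⟨x, hx, -⟩ | ⟨x, hx, -⟩
      · exact h5
      · simp [h5, h6, pairDigit] at h4
      · simp [h5, h6, pairDigit] at h4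
      all_goals simp at hx
    exact ⟨funext fun v => (h3 v).1, funext fun v => (h3 v).2⟩
  · rintro ⟨rfl, rfl⟩
    simp [enc, pairDigit]

variable {H P}

section operands

variable {t : ℕ} {g : ℕ → ℕ} (hg : Inv H P l z g₀ t g)

include hp hd hg

theorem Inv.nodeRel {id : ℕ} (hid : z.Ok id) {s c : Fin k → Status (Fin n)}
    (hw : ∀ v, WfPair (bagList P l z (z.botBag id)) (bagList P l z (z.topBag id)) (s v) (c v))
    (h : g (id * z.W + enc z.E fun v => pairDigit (z.τ + 1) (bagList P l z (z.botBag id))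
      (bagList P l z (z.topBag id)) (s v) (c v)) = 1) : NodeRel H P l z id s c := by
  obtain ⟨y, hy⟩ := hg.sound id hid (fun v => pend (s v) (c v)) hw h
  exact (node_rel_iff H P z hp hd hid s c).1 ⟨y, hy⟩

theorem Inv.gate_eq_one {id : ℕ} (hid : z.Ok id) {s c : Fin k → Status (Fin n)}
    (hw : ∀ v, WfPair (bagList P l z (z.botBag id)) (bagList P l z (z.topBag id)) (s v) (c v))
    (h : NodeRel H P l z id s c) (ht : z.rank id + z.K + z.L * crossings s c ≤ t) :
    g (id * z.W + enc z.E fun v => pairDigit (z.τ + 1) (bagList P l z (z.botBag id))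
      (bagList P l z (z.topBag id)) (s v) (c v)) = 1 := by
  obtain ⟨y, hy⟩ := (node_rel_iff H P z hp hd hid s c).2 h
  exact hg.good id hid (fun v => pend (s v) (c v)) y hw hy
    ((Node.need_pend_le z.L s y c).trans ht)

variable (h₀ : Init H P l z g₀)

include h₀

theorem Inv.ops {id : ℕ} (hid : z.Ok id) :
    (node H P l z id).SoundOps z.τ g ∧ (node H P l z id).GoodOps z.τ z.L t g := by
  by_cases hS : id < z.S
  · obtain ⟨k1, k2, s1, s2, b1, b2, b3, b4, e1, e2, r1, r2⟩ := Sizes.segment_operands hid hS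
    have hleaf : z.isLeaf id = false := by simp [Sizes.isLeaf]; omega
    have n1 := fun s y => hg.nodeRel hp hd k1 (s := s) (c := y)
    have n2 := fun s y => hg.nodeRel hp hd k2 (s := s) (c := y)
    have g1 := fun s y => hg.gate_eq_one hp hd k1 (s := s) (c := y)
    have g2 := fun s y => hg.gate_eq_one hp hd k2 (s := s) (c := y)
    rw [b1, b2] at n1 g1
    rw [b3, b4] at n2 g2
    simp only [NodeRel, if_pos s1, if_pos s2, b1, b3, e1, e2] at n1 n2 g1 g2
    constructor
    · constructor <;> intro s y <;> simp only [node, hleaf, Node.WfA, Node.WfB, Node.addrA,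
        Node.addrB, Node.opBase, Node.digitA, Node.digitB, Bool.false_eq_true, if_false, if_pos hS,
        Sizes.opA, Sizes.opB]
      · exact n1 s y
      · exact n2 s y
    · constructor <;> intro s y <;> simp only [node, hleaf, Node.WfA, Node.WfB, Node.addrA,
        Node.addrB, Node.opBase, Node.digitA, Node.digitB, Bool.false_eq_true, if_false, if_pos hS,
        Sizes.opA, Sizes.opB, false_or]
      · exact fun hw h ht => g1 s y hw h (by omega)
      · exact fun hw h ht => g2 s y hw h (by omega)
  by_cases hS2 : id < 2 * z.S
  · have hleaf : z.isLeaf id = true := by simp [Sizes.isLeaf]; omega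
    obtain ⟨-, -, htop⟩ := hid
    obtain ⟨-, hstep⟩ := Sizes.segStep_leaf (Nat.le_of_not_lt hS) hS2
    have et : z.topBag id = id - z.S + 1 := by
      rw [Sizes.topBag, if_pos hS2, Sizes.botBag, if_pos hS2, hstep, mul_one]
    rw [et] at htop
    have ho : offNumber z.p (id - z.S) ≤ z.p := by
      unfold offNumber
      split_ifs <;> omega
    have l2 : bagList P l z (id - z.S + 1) = layer P l (id - z.S + 1) := by
      rw [bagList, if_pos (by omega)]
    have l3 : bagList P l z (z.midBag id) = offList P l (offNumber z.p (id - z.S)) := by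
      rw [bagList, Sizes.midBag, if_neg hS, if_pos hS2, Sizes.offBag, if_neg (by omega)]
      congr 1
      omega
    have hge : ∀ x, z.NI * z.W ≤ z.tabBase + x := fun x => Nat.le_add_right _ _
    have hge' : ∀ x, z.NI * z.W ≤ z.pmBase + x := fun x => by
      rw [Sizes.pmBase, add_assoc]; exact hge _
    have f1 : ∀ y : Fin k → Status (Fin n),
        (∀ v x, y v = matched x → x ∈ offList P l (offNumber z.p (id - z.S))) →
        (g (z.tabBase + offNumber z.p (id - z.S) * z.N +
          enc (z.τ + 3) fun v => (y v).digit z.τ (offList P l (offNumber z.p (id - z.S)))) = 1 ↔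
        OffValid H P (offNumber z.p (id - z.S)) y) := by
      intro y hy
      rw [add_assoc, hg.fixed _ (hge _), ← add_assoc]
      exact h₀.tab _ ho y hy
    have f2 : ∀ c : Fin k → Status (Fin n),
        (∀ v x, c v = matched x → x ∈ layer P l (id - z.S + 1)) →
        (g (z.pmBase + (id - z.S + 1) * z.N +
          enc (z.τ + 3) fun v => (c v).digit z.τ (layer P l (id - z.S + 1))) = 1 ↔
        IsPartialMatch H G (layer P l (id - z.S + 1)).toFinset c) := by
      intro c hc
      rw [add_assoc, hg.fixed _ (hge' _), ← add_assoc]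
      exact h₀.pm _ htop c hc
    constructor
    · constructor <;> intro s y <;> simp only [node, hleaf, Node.WfA, Node.WfB, Node.addrA,
        Node.addrB, Node.opBase, Node.digitA, Node.digitB, if_true, if_pos hS2, if_neg hS,
        Sizes.opA, Sizes.opB, et, l2, l3]
      · exact fun hw h => (f1 y hw).1 h
      · exact fun hw h => (f2 y hw).1 h
    · constructor <;> intro s y <;> simp only [node, hleaf, Node.WfA, Node.WfB, Node.addrA,
        Node.addrB, Node.opBase, Node.digitA, Node.digitB, if_true, if_pos hS2, if_neg hS,
        Sizes.opA, Sizes.opB, et, l2, l3]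
      · exact fun hw h _ => (f1 y hw).2 h
      · exact fun hw h _ => (f2 y hw).2 h
  · obtain ⟨i₁, i₂, eA, eB, s1, s2, k1, k2, r2, b1, b2, b3, b4, e1, e2⟩ :=
      Sizes.prefix_operands hd hid (Nat.le_of_not_lt hS2)
    have hleaf : z.isLeaf id = false := by simp [Sizes.isLeaf]; omega
    have n2 := fun s y => hg.nodeRel hp hd k2 (s := s) (c := y)
    have g2 := fun s y => hg.gate_eq_one hp hd k2 (s := s) (c := y)
    rw [b3, b4] at n2 g2
    simp only [NodeRel, if_pos s2, b3, e2] at n2 g2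
    have hA : ∀ s y : Fin k → Status (Fin n),
        (∀ v, WfPair (bagList P l z (z.botBag id)) (bagList P l z (z.midBag id)) (s v) (y v)) →
        (g (i₁ * z.W + enc z.E fun v => pairDigit (z.τ + 1) (bagList P l z (z.botBag id))
          (bagList P l z (z.midBag id)) (s v) (y v)) = 1 →
          s = (fun _ => unmatched) ∧ Chain H P l 0 (z.midBag id) (fun _ => unmatched) y) ∧
        (s = (fun _ => unmatched) ∧ Chain H P l 0 (z.midBag id) (fun _ => unmatched) y →
          z.rank id + z.L * crossings s y ≤ t →
          g (i₁ * z.W + enc z.E fun v => pairDigit (z.τ + 1) (bagList P l z (z.botBag id))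
          (bagList P l z (z.midBag id)) (s v) (y v)) = 1) := by
      intro s y hw
      rcases k1 with rfl | ⟨k1, r1⟩
      · have hm : z.midBag id = 0 := by omega
        have hb : z.botBag id = 0 := by rw [Sizes.botBag, if_neg hS2]
        rw [hm, hb] at hw ⊢
        have hu := unit_iff H P h₀ hw
        rw [hg.unit _ (enc_lt _ fun v => (pairDigit_lt ?_ ?_ (hw v)).trans_le ?_), hu]
        · refine ⟨fun h => ⟨h.1, h.2.symm⟩, fun h _ => ⟨h.1, h.2.symm⟩⟩
        · simp [bagList, layer]
        · simp [bagList, layer]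
        · change 3 * (z.τ + 1) + 3 ≤ 11 * (z.τ + 1) + 9; omega
      · have n1 := hg.nodeRel hp hd k1 (s := s) (c := y)
        have g1 := hg.gate_eq_one hp hd k1 (s := s) (c := y)
        rw [b1, b2] at n1 g1
        simp only [NodeRel, if_neg (Nat.not_lt.2 s1), e1] at n1 g1
        exact ⟨n1 hw, fun h ht => g1 hw h (by omega)⟩
    constructor
    · constructor <;> intro s y <;> simp only [node, hleaf, Node.WfA, Node.WfB, Node.addrA,
        Node.addrB, Node.opBase, Node.digitA, Node.digitB, Bool.false_eq_true, if_false, if_neg hS,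
        if_neg hS2, eA, eB]
      · exact fun hw => (hA s y hw).1
      · exact n2 s y
    · constructor <;> intro s y <;> simp only [node, hleaf, Node.WfA, Node.WfB, Node.addrA,
        Node.addrB, Node.opBase, Node.digitA, Node.digitB, Bool.false_eq_true, if_false, if_neg hS,
        if_neg hS2, eA, eB, false_or]
      · exact fun hw h ht => (hA s y hw).2 h ht
      · exact fun hw h ht => g2 s y hw h (by omega)

end operands

include hp hd hbag

theorem Inv.sweep (hL : 2 * (z.τ + 1) ≤ 2 ^ z.L) (h₀ : Init H P l z g₀) {t : ℕ} {g : ℕ → ℕ}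
    (hg : Inv H P l z g₀ t g) {act : ℕ → Prop} (hu : ¬ act (2 * z.S))
    (hact : ∀ id, z.Ok id → z.rank id ≤ t → t < z.rank id + z.K + z.EX → act id) :
    Inv H P l z g₀ (t + 1) (sweep H P l z act g) := by
  have hW : 0 < z.W := by positivity
  have hdiv : ∀ id e, e < z.W → (id * z.W + e) / z.W = id := by
    intro id e he
    rw [mul_comm, Nat.mul_add_div hW, Nat.div_eq_of_lt he, add_zero]
  have hmod : ∀ id e, e < z.W → (id * z.W + e) % z.W = e := by
    intro id e he
    rw [mul_comm, Nat.mul_add_mod, Nat.mod_eq_of_lt he]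
  have hgate : ∀ id (F : Fin k → Digit (Fin n)), (node H P l z id).WfGate z.τ F →
      (node H P l z id).gate z.τ F < z.W := fun id F hF =>
    enc_lt _ fun v => code_lt (hbag _).2 (hbag _).2 (hF v)
  have hid : ∀ id, z.Ok id → id < z.NI := by
    rintro id ⟨h1, h2, h3⟩
    rw [Sizes.topBag] at h3
    have hNI : z.NI = 3 * z.S + 1 := rfl
    split_ifs at h3 <;> omega
  have hval : ∀ id, z.Ok id → ∀ e < z.W, SubpathDP.sweep H P l z act g (id * z.W + e) =
      open Classical in if act id then (node H P l z id).next z.τ (id * z.W) e g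
        else g (id * z.W + e) := by
    intro id h e he
    have h2 : id * z.W + e < z.NI * z.W := by
      have := Nat.mul_le_mul_right z.W (hid id h)
      rw [Nat.succ_mul] at this
      omega
    rw [SubpathDP.sweep, hdiv _ _ he, hmod _ _ he]
    by_cases ha : act id
    · rw [if_pos ⟨h2, ha⟩, if_pos ha]
    · rw [if_neg fun h => ha h.2, if_neg ha]
  constructor
  · intro a
    rw [SubpathDP.sweep]
    split_ifs
    · rw [Node.next]
      split_ifs <;> omega
    · exact hg.le_one a
  · intro a ha
    rw [SubpathDP.sweep, if_neg (by omega), hg.fixed a ha]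
  · intro e he
    rw [SubpathDP.sweep, hdiv _ _ he, if_neg (by simp [hu]), hg.unit e he]
  · intro id h F hF h1
    rw [hval id h _ (hgate id F hF)] at h1
    split_ifs at h1 with ha
    · exact (hg.sound id h).next hL (node_wfBags H P z hbag id) hg.le_one
        (hg.ops hp hd h₀ h).1 hF h1
    · exact hg.sound id h F hF h1
  · intro id h F y hF hy hn
    rw [hval id h _ (hgate id F hF)]
    split_ifs with ha
    · exact (hg.good id h).next hL (node_wfBags H P z hbag id) (hg.ops hp hd h₀ h).2 hF hy hn
    · -- the node is not evaluated because its gates are known, or because none is needed yet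
      have h1 := (node H P l z id).rank_lt_need z.L F y
      have h2 := Node.need_le (L := z.L) hy
      have h3 : (node H P l z id).rank = z.rank id := rfl
      have hKk : z.K = 2 * k + 1 := rfl
      have hEX : z.EX = z.L * k := rfl
      refine hg.good id h F y hF hy ?_
      by_contra h4
      exact ha (hact id h (by omega) (by omega))

theorem inv_gates (hL : 2 * (z.τ + 1) ≤ 2 ^ z.L) (h₀ : Init H P l z g₀) (t : ℕ) :
    Inv H P l z g₀ t (gates H P l z g₀ t) := by
  induction t with
  | zero =>
    refine ⟨h₀.le_one, fun _ _ => rfl, fun _ _ => rfl, fun id h F hF h1 => ?_,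
      fun id h F y hF hy hn => ?_⟩
    · have hid : id < z.NI := by
        obtain ⟨h1, h2, h3⟩ := h
        rw [Sizes.topBag] at h3
        have hNI : z.NI = 3 * z.S + 1 := rfl
        split_ifs at h3 <;> omega
      have := h₀.zero id hid h.2.1 _ (enc_lt _ fun v => code_lt (hbag _).2 (hbag _).2 (hF v))
      exact absurd (h1.symm.trans this) one_ne_zero
    · have := (node H P l z id).rank_lt_need z.L F y
      omega
  | succ t ih =>
    refine ih.sweep hp hd hbag hL h₀ ?_ fun id h h1 h2 => Sizes.active_of_rank hd h h1 h2
    have hSp : 0 < z.S := by positivity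
    rw [Sizes.Active]
    split_ifs with h1 h2 h3
    · omega
    · exact fun h => (Nat.div_le_self _ _).not_gt h
    · rintro ⟨c, hc, -, h⟩
      have hj : (t - z.EX - z.K * (z.d + 1)) / z.K ≤ z.d := by
        have : (t - z.EX - z.K * (z.d + 1)) / z.K < z.d + 1 := by
          rw [Nat.div_lt_iff_lt_mul (show 0 < z.K from Nat.succ_pos _), mul_comm (z.d + 1)]
          omega
        omega
      have : 0 < z.S / 2 ^ ((t - z.EX - z.K * (z.d + 1)) / z.K) :=
        Nat.div_pos (Nat.pow_le_pow_right (by norm_num) hj) (by positivity)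
      have := Nat.mul_pos hc this
      omega
    · omega

/-- In the end, the gates of the prefix `[0, j + 2)` give the valid partial matches of node `j`. -/
theorem gates_iff_valid [Finite ι] (hl : ∀ i, (l i).toFinset = T.bag i)
    (hL : 2 * (z.τ + 1) ≤ 2 ^ z.L) (h₀ : Init H P l z g₀) {j : ℕ} (hj : j < z.p)
    {c : Fin k → Status (Fin n)} (hc : ∀ v x, c v = matched x → x ∈ l (P.node j)) :
    gates H P l z g₀ z.steps ((2 * z.S + j + 2) * z.W +
      enc z.E fun v => pairDigit (z.τ + 1) [] (l (P.node j)) unmatched (c v)) = 1 ↔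
    Valid H T (P.node j) c := by
  have hSp : 0 < z.S := by positivity
  have hKk : z.K = 2 * k + 1 := rfl
  have hEX : z.EX = z.L * k := rfl
  have hinv := inv_gates hp hd hbag hL h₀ z.steps
  have hS : ¬ 2 * z.S + j + 2 < 2 * z.S := by omega
  have htop : z.topBag (2 * z.S + j + 2) = j + 2 := by rw [Sizes.topBag, if_neg hS]; omega
  have hbot : z.botBag (2 * z.S + j + 2) = 0 := by rw [Sizes.botBag, if_neg hS]
  have hid : z.Ok (2 * z.S + j + 2) := ⟨by omega, by omega, by omega⟩
  have l1 : bagList P l z 0 = [] := by rw [bagList, if_pos (Nat.zero_le _), layer]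
  have l2 : bagList P l z (j + 2) = l (P.node j) := by
    rw [bagList, if_pos (by omega), layer, if_pos (by omega)]
  have e1 := hinv.nodeRel hp hd hid (s := fun _ => unmatched) (c := c)
  have e2 := hinv.gate_eq_one hp hd hid (s := fun _ => unmatched) (c := c)
  rw [hbot, htop, l1, l2] at e1 e2
  have hw : ∀ v, WfPair [] (l (P.node j)) unmatched (c v) := fun v =>
    ⟨.inl rfl, by simp, hc v⟩
  have hrel : NodeRel H P l z (2 * z.S + j + 2) (fun _ => unmatched) c ↔ Valid H T (P.node j) c := by
    rw [NodeRel, if_neg hS, show 2 * z.S + j + 2 - 2 * z.S = j + 2 by omega,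
      chain_iff_valid H P hl j (by omega)]
    simp
  rw [← hrel]
  refine ⟨e1 hw, fun h => e2 hw h ?_⟩
  have hcr : crossings (fun _ => unmatched) c ≤ k := by
    unfold crossings
    calc _ ≤ ∑ _v : Fin k, 1 := Finset.sum_le_sum fun v _ => by split_ifs <;> omega
      _ = k := by simp
  have h1 : z.L * crossings (fun _ => unmatched) c ≤ z.L * k := Nat.mul_le_mul_left _ hcr
  have h2 : z.rank (2 * z.S + j + 2) + z.K ≤ z.EX + 2 * (z.K * (z.d + 1)) := by
    rw [Sizes.rank, if_neg hS]
    have h3 : z.K * (z.d - Nat.log 2 (z.preStep (2 * z.S + j + 2 - 2 * z.S))) + z.K ≤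
        z.K * (z.d + 1) := by
      rw [← Nat.mul_succ]
      exact Nat.mul_le_mul_left _ (by omega)
    omega
  have h3 : z.steps = z.EX + (z.EX + 2 * (z.K * (z.d + 1))) := by
    unfold Sizes.steps
    omega
  omega

end network

end SubpathDP

/-! ### Codes of partial matches -/

namespace SubpathDP

open Status Digit

section codes

variable {V : Type*} [DecidableEq V] {k τ : ℕ} {X : List V}

theorem digit_lt (hX : X.length ≤ τ + 1) {a : Status V} (ha : ∀ x, a = matched x → x ∈ X) :
    a.digit τ X < τ + 3 := by
  rcases a with x | _ | _
  · have := List.idxOf_lt_length_iff.2 (ha x rfl)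
    simp only [digit]
    omega
  · simp [digit]
  · simp [digit]

theorem digit_injective (hX : X.length ≤ τ + 1) {a a' : Status V}
    (ha : ∀ x, a = matched x → x ∈ X) (ha' : ∀ x, a' = matched x → x ∈ X)
    (h : a.digit τ X = a'.digit τ X) : a = a' := by
  rcases a with x | _ | _ <;> rcases a' with y | _ | _ <;> simp only [digit] at h
  · rw [(List.idxOf_inj (ha x rfl)).1 h]
  · have := List.idxOf_lt_length_iff.2 (ha x rfl); omega
  · have := List.idxOf_lt_length_iff.2 (ha x rfl); omega
  · have := List.idxOf_lt_length_iff.2 (ha' y rfl); omega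
  · rfl
  · omega
  · have := List.idxOf_lt_length_iff.2 (ha' y rfl); omega
  · omega
  · rfl

theorem matchCode_eq_enc (s : Fin k → Status V) :
    matchCode τ X s = enc (τ + 3) fun v => (s v).digit τ X := rfl

theorem matchCode_injective (hX : X.length ≤ τ + 1) {s s' : Fin k → Status V}
    (hs : ∀ v x, s v = matched x → x ∈ X) (hs' : ∀ v x, s' v = matched x → x ∈ X)
    (h : matchCode τ X s = matchCode τ X s') : s = s' := by
  have := enc_injective (fun v => digit_lt hX (hs v)) (fun v => digit_lt hX (hs' v)) h
  exact funext fun v => digit_injective hX (hs v) (hs' v) (congrFun this v)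

/-- The status with a given digit. -/
def ofDigit (τ : ℕ) (X : List V) (d : ℕ) : Status V :=
  if d = τ + 1 then inChild else match X[d]? with
    | some x => matched x
    | none => unmatched

theorem digit_ofDigit (hnd : X.Nodup) {d : ℕ} (hd : d < τ + 3)
    (h : d < τ + 1 → d < X.length) : (ofDigit τ X d).digit τ X = d := by
  unfold ofDigit
  split_ifs with h1
  · exact h1.symm
  · by_cases h2 : d < X.length
    · rw [List.getElem?_eq_getElem h2]
      exact hnd.idxOf_getElem d h2
    · rw [List.getElem?_eq_none (by omega)]
      simp only [digit]
      omega

omit [DecidableEq V] in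
theorem ofDigit_eq_matched {d : ℕ} {x : V} (h : ofDigit τ X d = matched x) : X[d]? = some x := by
  unfold ofDigit at h
  split_ifs at h
  split at h
  · next h' => rw [h']; simpa using h
  · cases h

end codes

theorem adjArray_apply {n : ℕ} (G : SimpleGraph (Fin n)) (u v : Fin n) [Decidable (G.Adj u v)] :
    adjArray G (u * n + v) = if G.Adj u v then 1 else 0 := by
  by_cases hadj : G.Adj u v
  · rw [if_pos hadj, adjArray, if_pos ⟨u, v, hadj, rfl⟩]
  rw [if_neg hadj, adjArray, if_neg]
  rintro ⟨u', v', h, he⟩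
  have h1 : ∀ a b : Fin n, (a * n + b : ℕ) / n = a ∧ (a * n + b : ℕ) % n = b := fun a b => by
    have hn : 0 < n := a.pos
    rw [mul_comm, Nat.mul_add_div hn, Nat.div_eq_of_lt b.2, add_zero, Nat.mul_add_mod,
      Nat.mod_eq_of_lt b.2]
    exact ⟨rfl, rfl⟩
  have hu : u = u' := Fin.ext (by rw [← (h1 u v).1, ← (h1 u' v').1, he])
  have hv : v = v' := Fin.ext (by rw [← (h1 u v).2, ← (h1 u' v').2, he])
  rw [hu, hv] at hadj
  exact hadj h

/-- Entry `u`, `v` of a matrix that vanishes if and only if `c` is the code of a partial match of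
the bag `X`. -/
noncomputable def badPair {k n : ℕ} (H : SimpleGraph (Fin k)) (G : SimpleGraph (Fin n)) (τ : ℕ)
    (X : List (Fin n)) (c u v : ℕ) : ℕ :=
  if c / (τ + 3) ^ u % (τ + 3) < τ + 1 then
    if u = v then if c / (τ + 3) ^ u % (τ + 3) < X.length then 0 else 1
    else if c / (τ + 3) ^ v % (τ + 3) < τ + 1 then
      if c / (τ + 3) ^ u % (τ + 3) = c / (τ + 3) ^ v % (τ + 3) then 1
      else if adjArray H (u * k + v) = 0 then 0
      else 1 - adjArray G ((X.map Fin.val).getD (c / (τ + 3) ^ u % (τ + 3)) 0 * n +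
        (X.map Fin.val).getD (c / (τ + 3) ^ v % (τ + 3)) 0)
    else 0
  else 0

/-- The number of violated conditions of a partial match. -/
noncomputable def badSum {k n : ℕ} (H : SimpleGraph (Fin k)) (G : SimpleGraph (Fin n)) (τ : ℕ)
    (X : List (Fin n)) (c : ℕ) : ℕ :=
  ∑ u ∈ Finset.range k, ∑ v ∈ Finset.range k, badPair H G τ X c u v

theorem badSum_eq_zero_iff {k n τ : ℕ} {H : SimpleGraph (Fin k)} {G : SimpleGraph (Fin n)}
    {X : List (Fin n)} (hnd : X.Nodup) (hX : X.length ≤ τ + 1) {c : ℕ} (hc : c < (τ + 3) ^ k) :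
    badSum H G τ X c = 0 ↔
      ∃ s : Fin k → Status (Fin n), matchCode τ X s = c ∧ IsPartialMatch H G X.toFinset s := by
  classical
  obtain ⟨f, hf, rfl⟩ := exists_enc hc
  have hbad : badSum H G τ X (enc (τ + 3) f) = 0 ↔
      ∀ u v : Fin k, badPair H G τ X (enc (τ + 3) f) u v = 0 := by
    simp only [badSum, Finset.sum_eq_zero_iff, Finset.mem_range]
    exact ⟨fun h u v => h u u.2 v v.2, fun h u hu v hv => h ⟨u, hu⟩ ⟨v, hv⟩⟩
  rw [hbad]
  simp only [badPair, enc_digit hf, Fin.val_inj, adjArray_apply]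
  have hget : ∀ {d : ℕ} {x : Fin n}, X[d]? = some x → (X.map Fin.val).getD d 0 = x := by
    intro d x h
    simp [List.getD_eq_getElem?_getD, h]
  constructor
  · intro h
    have h1 : ∀ v, f v < τ + 1 → f v < X.length := by
      intro v hv
      have := h v v
      rw [if_pos hv, if_pos rfl] at this
      by_contra h2
      simp [h2] at this
    have hdig : ∀ v, (ofDigit τ X (f v)).digit τ X = f v := fun v =>
      digit_ofDigit hnd (hf v) (h1 v)
    have hlt : ∀ {v x}, ofDigit τ X (f v) = matched x → f v < τ + 1 := by
      intro v x hx
      have := (List.getElem?_eq_some_iff.1 (ofDigit_eq_matched hx)).1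
      omega
    refine ⟨fun v => ofDigit τ X (f v), ?_, ?_, ?_, ?_⟩
    · rw [matchCode_eq_enc]
      simp only [hdig]
    · intro v x hx
      exact List.mem_toFinset.2 (List.mem_of_getElem? (ofDigit_eq_matched hx))
    · intro u v x hu hv
      by_contra huv
      have := h u v
      rw [if_pos (hlt hu), if_neg huv, if_pos (hlt hv), if_pos] at this
      · cases this
      · rw [← hdig u, ← hdig v, hu, hv]
    · intro u v x y huv hu hv
      by_contra hxy
      have := h u v
      have hne : u ≠ v := huv.ne
      rw [if_pos (hlt hu), if_neg hne, if_pos (hlt hv)] at this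
      rw [hget (ofDigit_eq_matched hu), hget (ofDigit_eq_matched hv), adjArray_apply] at this
      simp [huv, hxy] at this
  · rintro ⟨s, hs, hpm⟩ u v
    have hmem : ∀ v x, s v = matched x → x ∈ X := fun v x hx =>
      List.mem_toFinset.1 (hpm.mem v x hx)
    have hfs := enc_injective (fun v => digit_lt hX (hmem v)) hf hs
    have hfv : ∀ v, f v = (s v).digit τ X := fun v => (congrFun hfs v).symm
    have hm : ∀ v, f v < τ + 1 → ∃ x, s v = matched x ∧ X[f v]? = some x := by
      intro v hv
      have h2 := hfv v
      rcases hsv : s v with x | _ | _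
      · refine ⟨x, rfl, ?_⟩
        rw [h2, hsv, digit, List.getElem?_eq_getElem (List.idxOf_lt_length_iff.2 (hmem v x hsv)),
          List.getElem_idxOf]
      · rw [hsv, digit] at h2; omega
      · rw [hsv, digit] at h2; omega
    by_cases h1 : f u < τ + 1
    · obtain ⟨x, hx, hx'⟩ := hm u h1
      rw [if_pos h1]
      by_cases h2 : u = v
      · rw [if_pos h2, if_pos (List.getElem?_eq_some_iff.1 hx').1]
      rw [if_neg h2]
      by_cases h4 : f v < τ + 1
      · obtain ⟨y, hy, hy'⟩ := hm v h4
        rw [if_pos h4, if_neg]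
        · by_cases hadj : H.Adj u v
          · rw [if_pos hadj, if_neg one_ne_zero, hget hx', hget hy', adjArray_apply,
              if_pos (hpm.adj u v x y hadj hx hy)]
          · rw [if_neg hadj, if_pos rfl]
        · intro h5
          rw [h5, hy'] at hx'
          cases hx'
          exact h2 (hpm.injective u v _ hx hy)
      · rw [if_neg h4]
    · rw [if_neg h1]

/-- A digit of a partial match as a digit of a gate of a prefix. -/
def convDigit (τ d : ℕ) : ℕ := if d < τ + 1 then 3 + d else if d = τ + 1 then 1 else 0

theorem convDigit_digit {V : Type*} [DecidableEq V] {τ : ℕ} {X : List V} (hX : X.length ≤ τ + 1)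
    {a : Status V} (ha : ∀ x, a = matched x → x ∈ X) :
    convDigit τ (a.digit τ X) = pairDigit (τ + 1) [] X unmatched a := by
  rcases a with x | _ | _
  · have := List.idxOf_lt_length_iff.2 (ha x rfl)
    exact if_pos (show X.idxOf x < τ + 1 by omega)
  · simp [digit, convDigit, pairDigit]
  · simp [digit, convDigit, pairDigit]

/-! ### Initial and final values -/

section tables

variable {k n : ℕ} {ι : Type*} (H : SimpleGraph (Fin k)) {G : SimpleGraph (Fin n)}
  {T : TreeDecomposition G ι} (P : Subpath T) (l : ι → List (Fin n)) (z : Sizes k)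

open Classical in
/-- The values of the gates at the beginning. -/
noncomputable def startGates (a : ℕ) : ℕ :=
  if a < z.tabBase then if a = 2 * z.S * z.W then 1 else 0
  else if a < z.pmBase then
    if T.IsLeaf (P.node 0) ∧ ((a - z.tabBase) / z.N = 0 ∨ (a - z.tabBase) / z.N = z.p) then
      if (a - z.tabBase) % z.N = z.N - 1 then 1 else 0
    else inputMem H T z.τ l P 7 (a - z.tabBase)
  else if a < z.pmBase + (z.p + 2) * z.N then
    if badSum H G z.τ (bagList P l z ((a - z.pmBase) / z.N)) ((a - z.pmBase) % z.N) = 0 then 1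
    else 0
  else 0

variable {l} (hp : P.length = z.p) (hd : z.p + 1 ≤ z.S)
  (hbag : ∀ j, (bagList P l z j).Nodup ∧ (bagList P l z j).length ≤ z.τ + 1)

theorem validTable_le_one {τ : ℕ} (i : ι) (c : ℕ) : validTable H T τ l i c ≤ 1 := by
  unfold validTable
  split_ifs <;> omega

theorem validTable_matchCode (hl : ∀ i, (l i).toFinset = T.bag i) {τ : ℕ} {i : ι}
    (hX : (l i).length ≤ τ + 1) {w : Fin k → Status (Fin n)}
    (hw : ∀ v x, w v = matched x → x ∈ l i) :
    validTable H T τ l i (matchCode τ (l i) w) = 1 ↔ Valid H T i w := by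
  unfold validTable
  constructor
  · intro h
    split_ifs at h with h1
    obtain ⟨s, hs, he⟩ := h1
    have hs' : ∀ v x, s v = matched x → x ∈ l i := by
      intro v x hx
      rw [← List.mem_toFinset, hl]
      exact (Valid.isPartialMatch hs).mem v x hx
    rwa [← matchCode_injective hX hs' hw he]
  · exact fun h => if_pos ⟨w, h, rfl⟩

include hp hd hbag

theorem init_startGates (hl : ∀ i, (l i).toFinset = T.bag i) :
    Init H P l z (startGates H P l z) := by
  classical
  have hN : 0 < z.N := by positivity
  have hW : 0 < z.W := by positivity
  have hoffb : ∀ s, offList P l s = bagList P l z (z.S + 1 + s) := by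
    intro s
    rw [bagList, if_neg (by omega)]
    congr 1
    omega
  have hcode : ∀ (j : ℕ) (w : Fin k → Status (Fin n)),
      (∀ v x, w v = matched x → x ∈ bagList P l z j) →
      matchCode z.τ (bagList P l z j) w < z.N := fun j w hw =>
    enc_lt _ fun v => digit_lt (hbag j).2 (hw v)
  have hdm : ∀ a c : ℕ, c < z.N → (a * z.N + c) / z.N = a ∧ (a * z.N + c) % z.N = c := by
    intro a c hc
    rw [mul_comm, Nat.mul_add_div hN, Nat.div_eq_of_lt hc, add_zero, Nat.mul_add_mod,
      Nat.mod_eq_of_lt hc]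
    exact ⟨rfl, rfl⟩
  constructor
  · intro a
    unfold startGates
    split_ifs
    any_goals omega
    change (if P.IsOff _ then _ else 0) ≤ 1
    split_ifs
    · exact validTable_le_one H _ _
    · omega
  · intro s hs w hw
    rw [hoffb] at hw ⊢
    have hlt := hcode _ w hw
    set c := matchCode z.τ (bagList P l z (z.S + 1 + s)) w with hc
    have hcN := hdm s c hlt
    have hsz : s * z.N + c < (z.p + 1) * z.N := by
      have := Nat.mul_le_mul_right z.N (Nat.succ_le_succ hs)
      rw [Nat.succ_mul] at this
      exact (Nat.add_lt_add_left hlt _).trans_le this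
    have hsub : z.tabBase + s * z.N + c - z.tabBase = s * z.N + c := by omega
    rw [startGates, if_neg (by omega), if_pos (by rw [Sizes.pmBase]; omega), hsub, hcN.1, hcN.2]
    by_cases hleaf : T.IsLeaf (P.node 0) ∧ (s = 0 ∨ s = z.p)
    · rw [if_pos hleaf]
      have hoff : ¬ P.IsOff s := by
        rintro (⟨h1, h2⟩ | ⟨h1, -⟩)
        · omega
        · exact h1 hleaf.1
      have hX : bagList P l z (z.S + 1 + s) = [] := by rw [← hoffb, offList, if_neg hoff]
      rw [hX] at hw hc
      have hu : matchCode (k := k) z.τ ([] : List (Fin n)) (fun _ => unmatched) = z.N - 1 := by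
        have h1 : ∀ j : ℕ, ∑ v : Fin j, (z.τ + 2) * (z.τ + 3) ^ (v : ℕ) + 1 = (z.τ + 3) ^ j := by
          intro j
          induction j with
          | zero => simp
          | succ j ih =>
            rw [Fin.sum_univ_castSucc, pow_succ, ← ih]
            simp only [Fin.val_castSucc, Fin.val_last, ← ih]
            ring
        rw [Sizes.N, ← h1 k]
        rfl
      have hiff : c = z.N - 1 ↔ w = fun _ => unmatched := by
        rw [← hu, hc]
        exact ⟨fun h => matchCode_injective (by simp) hw (by simp) h, fun h => by rw [h]⟩
      rw [if_congr hiff rfl rfl]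
      constructor
      · intro h
        split_ifs at h with h1
        exact .inr ⟨hleaf.1, by rw [hp]; exact hleaf.2, h1⟩
      · rintro (h | h)
        · exact absurd h.1 hoff
        · exact if_pos h.2.2
    · rw [if_neg hleaf]
      change (if P.IsOff ((s * z.N + c) / z.N) then
        validTable H T z.τ l (P.off ((s * z.N + c) / z.N)) ((s * z.N + c) % z.N) else 0) = 1 ↔ _
      rw [hcN.1, hcN.2]
      have hno : ¬ (T.IsLeaf (P.node 0) ∧ (s = 0 ∨ s = P.length) ∧ w = fun _ => unmatched) :=
        fun h => hleaf ⟨h.1, by rw [← hp]; exact h.2.1⟩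
      by_cases hoff : P.IsOff s
      · have hX : bagList P l z (z.S + 1 + s) = l (P.off s) := by
          rw [← hoffb, offList, if_pos hoff]
        rw [if_pos hoff, hc, hX]
        have hlen := (hbag (z.S + 1 + s)).2
        rw [hX] at hw hlen
        rw [validTable_matchCode H hl hlen hw]
        exact ⟨fun h => .inl ⟨hoff, h⟩, fun h => (h.resolve_right hno).2⟩
      · rw [if_neg hoff]
        exact ⟨fun h => absurd h zero_ne_one, fun h =>
          absurd (h.resolve_right hno).1 hoff⟩
  · intro i hi c hc
    have hlay : layer P l i = bagList P l z i := by rw [bagList, if_pos (by omega)]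
    rw [hlay] at hc ⊢
    have hlt := hcode _ c hc
    set cc := matchCode z.τ (bagList P l z i) c with hcc
    have hcN := hdm i cc hlt
    have hsz : i * z.N + cc < (z.p + 2) * z.N := by
      have := Nat.mul_le_mul_right z.N (Nat.succ_le_succ hi)
      rw [Nat.succ_mul] at this
      exact (Nat.add_lt_add_left hlt _).trans_le this
    have hsub : z.pmBase + i * z.N + cc - z.pmBase = i * z.N + cc := by omega
    rw [startGates, if_neg (by rw [Sizes.pmBase]; omega), if_neg (by omega), if_pos (by omega), hsub,
      hcN.1, hcN.2]
    have hiff := badSum_eq_zero_iff (H := H) (G := G) (hbag i).1 (hbag i).2 hlt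
    rw [if_congr hiff rfl rfl]
    constructor
    · intro h
      split_ifs at h with h1
      obtain ⟨s, hs, hpm⟩ := h1
      rwa [← matchCode_injective (hbag i).2 (fun v x hx => List.mem_toFinset.1 (hpm.mem v x hx)) hc hs]
    · exact fun h => if_pos ⟨c, rfl, h⟩
  · intro e he
    have hlt : 2 * z.S * z.W + e < z.tabBase := by
      have h1 : z.tabBase = (3 * z.S + 1) * z.W := rfl
      have h2 : 0 < z.S := by positivity
      nlinarith
    rw [startGates, if_pos hlt]
    constructor
    · intro h
      split_ifs at h with h1
      omega
    · rintro rfl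
      exact if_pos (by omega)
  · intro id hid hne e he
    have hlt : id * z.W + e < z.tabBase := by
      have := Nat.mul_le_mul_right z.W (Nat.succ_le_of_lt hid)
      rw [Nat.succ_mul] at this
      exact (Nat.add_lt_add_left he _).trans_le this
    rw [startGates, if_pos hlt, if_neg]
    intro h
    apply hne
    have h1 : (id * z.W + e) / z.W = id := by
      rw [mul_comm, Nat.mul_add_div hW, Nat.div_eq_of_lt he, add_zero]
    rw [← h1, h, Nat.mul_div_cancel _ hW]

/-- The tables of the nodes of the subpath are read off the gates of the prefixes. -/
theorem validTable_eq [Finite ι] (hl : ∀ i, (l i).toFinset = T.bag i)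
    (hL : 2 * (z.τ + 1) ≤ 2 ^ z.L) {j : ℕ} (hj : j < z.p) {c : ℕ} (hc : c < z.N) :
    validTable H T z.τ l (P.node j) c =
      if badSum H G z.τ (bagList P l z (j + 2)) c = 0 then
        gates H P l z (startGates H P l z) z.steps ((2 * z.S + j + 2) * z.W +
          digitSum (convDigit z.τ) z.E (z.τ + 3) k c)
      else 0 := by
  have l2 : bagList P l z (j + 2) = l (P.node j) := by
    rw [bagList, if_pos (by omega), layer, if_pos (by omega)]
  have hX := hbag (j + 2)
  rw [l2] at hX
  have h₀ := init_startGates H P z hp hd hbag hl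
  have hle := (inv_gates hp hd hbag hL h₀ z.steps).le_one
  have hiff := badSum_eq_zero_iff (H := H) (G := G) hX.1 hX.2 hc
  rw [l2]
  by_cases h : badSum H G z.τ (l (P.node j)) c = 0
  · rw [if_pos h]
    rw [hiff] at h
    obtain ⟨s, rfl, hpm⟩ := h
    have hs : ∀ v x, s v = matched x → x ∈ l (P.node j) := fun v x hx =>
      List.mem_toFinset.1 (hpm.mem v x hx)
    have h1 := validTable_matchCode H hl hX.2 hs
    have h2 := gates_iff_valid hp hd hbag hl hL h₀ hj hs
    rw [matchCode_eq_enc, digitSum_enc _ _ _ fun v => digit_lt hX.2 (hs v), ← matchCode_eq_enc]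
    simp only [convDigit_digit hX.2 (hs _)]
    have h3 := validTable_le_one H (T := T) (l := l) (τ := z.τ) (P.node j)
      (matchCode z.τ (l (P.node j)) s)
    have h4 := hle ((2 * z.S + j + 2) * z.W +
      enc z.E fun v => pairDigit (z.τ + 1) [] (l (P.node j)) unmatched (s v))
    rw [← h2] at h1
    change _ = gates H P l z (startGates H P l z) z.steps ((2 * z.S + j + 2) * z.W +
      enc z.E fun v => pairDigit (z.τ + 1) [] (l (P.node j)) unmatched (s v))
    omega
  · rw [if_neg h]
    rw [hiff] at h
    unfold validTable
    rw [if_neg]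
    rintro ⟨s, hs, he⟩
    refine h ⟨s, he, ?_⟩
    rw [hl]
    exact Valid.isPartialMatch hs

end tables

end SubpathDP

/-! ### Loops -/

namespace SubpathDP

open CREW Digit

/-- The variables with the sizes; `fl` tells whether the bottom node of the subpath has children. -/
def baseRegs {k : ℕ} (z : Sizes k) (n fl : ℕ) : List (ℕ × ℕ) :=
  [(0, k), (1, n), (2, z.τ), (3, z.p), (4, fl), (5, z.τ + 1), (6, z.τ + 3),
    (7, numPairs (z.τ + 1)), (8, z.E), (9, z.N), (10, z.W), (11, z.S), (12, z.d), (13, z.L),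
    (14, z.NI), (15, z.tabBase), (16, z.pmBase), (17, z.K), (18, z.EX)]

theorem mem_baseRegs_lt {k : ℕ} {z : Sizes k} {n fl : ℕ} : ∀ q ∈ baseRegs z n fl, q.1 < 20 := by
  simp [baseRegs]

/-- The values of `baseRegs`, one by one. -/
structure Base {k : ℕ} (z : Sizes k) (n fl : ℕ) (σ : ℕ → ℕ) : Prop where
  k : σ 0 = k
  n : σ 1 = n
  τ : σ 2 = z.τ
  p : σ 3 = z.p
  fl : σ 4 = fl
  t : σ 5 = z.τ + 1
  b : σ 6 = z.τ + 3
  M : σ 7 = numPairs (z.τ + 1)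
  E : σ 8 = z.E
  N : σ 9 = z.N
  W : σ 10 = z.W
  S : σ 11 = z.S
  d : σ 12 = z.d
  L : σ 13 = z.L
  NI : σ 14 = z.NI
  tabBase : σ 15 = z.tabBase
  pmBase : σ 16 = z.pmBase
  K : σ 17 = z.K
  EX : σ 18 = z.EX

theorem Base.of_mem {k : ℕ} {z : Sizes k} {n fl : ℕ} {σ : ℕ → ℕ}
    (h : ∀ q ∈ baseRegs z n fl, σ q.1 = q.2) : Base z n fl σ := by
  simp only [baseRegs, List.forall_mem_cons] at h
  obtain ⟨h0, h1, h2, h3, h4, h5, h6, h7, h8, h9, h10, h11, h12, h13, h14, h15, h16, h17, h18, -⟩ := h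
  constructor <;> assumption

/-! Names for the variables of `baseRegs`, and for the number `vi` of a processor. -/

abbrev vk : Ex := .var 0
abbrev vn : Ex := .var 1
abbrev vτ : Ex := .var 2
abbrev vp : Ex := .var 3
abbrev vfl : Ex := .var 4
abbrev vt : Ex := .var 5
abbrev vb : Ex := .var 6
abbrev vM : Ex := .var 7
abbrev vE : Ex := .var 8
abbrev vN : Ex := .var 9
abbrev vW : Ex := .var 10
abbrev vS : Ex := .var 11
abbrev vd : Ex := .var 12
abbrev vL : Ex := .var 13
abbrev vNI : Ex := .var 14
abbrev vTab : Ex := .var 15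
abbrev vPm : Ex := .var 16
abbrev vK : Ex := .var 17
abbrev vEX : Ex := .var 18
abbrev vi : Ex := .var 50

/-- A bound for the sizes of all expressions of the program. -/
abbrev kcost : ℕ := 4000

/-- A loop over the levels `j ≤ d` of the trees. The variables 21 and 22 hold `2 ^ j` and
`S / 2 ^ j`. -/
def levels (p : Prog) : Prog :=
  .seq (asg 21 1) (.seq (asg 22 vS) (rep 20 (vd + 1)
    (.seq p (.seq (asg 21 (.var 21 * 2)) (asg 22 (.var 22 / 2))))))

/-- A loop over the `k` digits of codes. The variables 21, 22 and 23 hold `E ^ j`, `b ^ j` and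
`j`. -/
def digits (p : Prog) : Prog :=
  .seq (asg 21 1) (.seq (asg 22 1) (.seq (asg 23 0) (rep 20 vk
    (.seq p (.seq (asg 21 (.var 21 * vE)) (.seq (asg 22 (.var 22 * vb)) (asg 23 (.var 23 + 1))))))))

section loops

variable {B X : ℕ} (hX : 2 ≤ X) (hB : X ^ degBound ≤ B) {k : ℕ} {z : Sizes k} {n fl : ℕ}

include hX hB

theorem spec_levels {p : Prog} (Mj : ℕ → Mem) (wb : ℕ → ℕ) (D : ℕ) (hS : 2 * z.S < X)
    (hd : z.d + 1 < X)
    (hb : ∀ j < z.d + 1, Spec B p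
      (St X ((20, z.d + 1 - j) :: (22, z.S / 2 ^ j) :: (21, 2 ^ j) :: baseRegs z n fl) (Mj j))
      (wb j) D
      (St X ((20, z.d + 1 - j) :: (22, z.S / 2 ^ j) :: (21, 2 ^ j) :: baseRegs z n fl)
        (Mj (j + 1)))) :
    Spec B (levels p) (St X (baseRegs z n fl) (Mj 0))
      (∑ j ∈ Finset.range (z.d + 1), (wb j + 30) + 30) ((z.d + 1) * (D + 30) + 30)
      (St X (baseRegs z n fl) (Mj (z.d + 1))) := by
  have hlt := mem_baseRegs_lt (z := z) (n := n) (fl := fl)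
  have h1 := spec_asg hX hB (Rf := baseRegs z n fl) (Rf' := (21, 1) :: baseRegs z n fl) (M := Mj 0)
    21 1 1 (by decide) (fun σ _ => rfl) (by omega) (by
      intro q hq
      have := hlt q
      simp only [List.mem_cons] at hq ⊢
      grind)
  have h2 := spec_asg hX hB (Rf := (21, 1) :: baseRegs z n fl)
    (Rf' := (22, z.S) :: (21, 1) :: baseRegs z n fl) (M := Mj 0)
    22 vS z.S (by decide) (fun σ h => by
      simp only [List.forall_mem_cons] at h
      simp [(Base.of_mem h.2).S]) (by omega) (by
      intro q hq
      have := hlt q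
      simp only [List.mem_cons] at hq ⊢
      grind)
  have h3 := spec_rep hX hB (Rf := (22, z.S) :: (21, 1) :: baseRegs z n fl) 20 (vd + 1)
    (.seq p (.seq (asg 21 (.var 21 * 2)) (asg 22 (.var 22 / 2)))) (z.d + 1) (D + 12)
    (fun j => wb j + 12) (fun j => (22, z.S / 2 ^ j) :: (21, 2 ^ j) :: baseRegs z n fl) Mj
    (by decide) (fun σ h => by
      simp only [List.forall_mem_cons] at h
      simp [(Base.of_mem h.2.2).d]) hd
    (by
      intro q hq
      have := hlt q
      simp only [List.mem_cons, pow_zero, Nat.div_one] at hq ⊢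
      grind)
    (by
      intro j q hq
      have := hlt q
      simp only [List.mem_cons] at hq ⊢
      grind)
    (fun j hj => by
      have hj' : 2 ^ (j + 1) ≤ 2 * z.S := by
        rw [pow_succ, mul_comm]
        exact Nat.mul_le_mul_left 2 (Nat.pow_le_pow_right (by norm_num) (by omega))
      have h4 := spec_asg hX hB
        (Rf := (20, z.d + 1 - j) :: (22, z.S / 2 ^ j) :: (21, 2 ^ j) :: baseRegs z n fl)
        (Rf' := (20, z.d + 1 - j) :: (22, z.S / 2 ^ j) :: (21, 2 ^ (j + 1)) :: baseRegs z n fl)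
        (M := Mj (j + 1)) 21 (.var 21 * 2) (2 ^ (j + 1)) (by decide) (fun σ h => by
          simp only [List.forall_mem_cons] at h
          simp [h.2.2.1, pow_succ]) (by omega) (by
          intro q hq
          have := hlt q
          simp only [List.mem_cons] at hq ⊢
          grind)
      have h5 := spec_asg hX hB
        (Rf := (20, z.d + 1 - j) :: (22, z.S / 2 ^ j) :: (21, 2 ^ (j + 1)) :: baseRegs z n fl)
        (Rf' := (20, z.d + 1 - j) :: (22, z.S / 2 ^ (j + 1)) :: (21, 2 ^ (j + 1)) ::
          baseRegs z n fl)
        (M := Mj (j + 1)) 22 (.var 22 / 2) (z.S / 2 ^ (j + 1)) (by decide) (fun σ h => by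
          simp only [List.forall_mem_cons] at h
          simp [h.2.1, pow_succ, Nat.div_div_eq_div_mul])
        ((Nat.div_le_self _ _).trans_lt (by omega)) (by
          intro q hq
          have := hlt q
          simp only [List.mem_cons] at hq ⊢
          grind)
      exact ((hb j hj).seq (h4.seq h5)).cost (le_of_eq rfl) (le_of_eq rfl))
  refine (h1.seq (h2.seq h3)).mono (fun _ _ h => h) ?_ ?_ fun m σ h => h.weaken ?_
  · have : ∀ j, wb j + 12 + 7 ≤ wb j + 30 := fun j => by omega
    have := Finset.sum_le_sum fun j (_ : j ∈ Finset.range (z.d + 1)) => this j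
    have e1 : (vd + 1 : Ex).size = 4 := rfl
    have e2 : (1 : Ex).size = 1 := rfl
    have e3 : vS.size = 2 := rfl
    omega
  · have e1 : (vd + 1 : Ex).size = 4 := rfl
    have e2 : (1 : Ex).size = 1 := rfl
    have e3 : vS.size = 2 := rfl
    have : (z.d + 1) * (D + 12 + 7) ≤ (z.d + 1) * (D + 30) := Nat.mul_le_mul_left _ (by omega)
    omega
  · intro q hq
    simp only [List.mem_cons]
    exact .inr (.inr hq)

theorem spec_digits {p : Prog} (Mj : ℕ → Mem) (w D : ℕ) (hE : z.W < X) (hN : z.N < X) (hk : k < X)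
    (hb : ∀ j < k, Spec B p
      (St X ((20, k - j) :: (23, j) :: (22, (z.τ + 3) ^ j) :: (21, z.E ^ j) :: baseRegs z n fl)
        (Mj j)) w D
      (St X ((20, k - j) :: (23, j) :: (22, (z.τ + 3) ^ j) :: (21, z.E ^ j) :: baseRegs z n fl)
        (Mj (j + 1)))) :
    Spec B (digits p) (St X (baseRegs z n fl) (Mj 0)) (k * (w + 40) + 40) (k * (D + 40) + 40)
      (St X (baseRegs z n fl) (Mj k)) := by
  have hlt := mem_baseRegs_lt (z := z) (n := n) (fl := fl)
  have h1 := spec_asg hX hB (Rf := baseRegs z n fl) (Rf' := (21, 1) :: baseRegs z n fl) (M := Mj 0)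
    21 1 1 (by decide) (fun σ _ => rfl) (by omega) (by
      intro q hq
      have := hlt q
      simp only [List.mem_cons] at hq ⊢
      grind)
  have h2 := spec_asg hX hB (Rf := (21, 1) :: baseRegs z n fl)
    (Rf' := (22, 1) :: (21, 1) :: baseRegs z n fl) (M := Mj 0)
    22 1 1 (by decide) (fun σ _ => rfl) (by omega) (by
      intro q hq
      have := hlt q
      simp only [List.mem_cons] at hq ⊢
      grind)
  have h2' := spec_asg hX hB (Rf := (22, 1) :: (21, 1) :: baseRegs z n fl)
    (Rf' := (23, 0) :: (22, 1) :: (21, 1) :: baseRegs z n fl) (M := Mj 0)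
    23 0 0 (by decide) (fun σ _ => rfl) (by omega) (by
      intro q hq
      have := hlt q
      simp only [List.mem_cons] at hq ⊢
      grind)
  have h3 := spec_rep hX hB (Rf := (23, 0) :: (22, 1) :: (21, 1) :: baseRegs z n fl) 20 vk
    (.seq p (.seq (asg 21 (.var 21 * vE)) (.seq (asg 22 (.var 22 * vb)) (asg 23 (.var 23 + 1)))))
    k (D + 20) (fun _ => w + 20)
    (fun j => (23, j) :: (22, (z.τ + 3) ^ j) :: (21, z.E ^ j) :: baseRegs z n fl) Mj
    (by decide) (fun σ h => by
      simp only [List.forall_mem_cons] at h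
      simp [(Base.of_mem h.2.2.2).k]) hk
    (by
      intro q hq
      have := hlt q
      simp only [List.mem_cons, pow_zero] at hq ⊢
      grind)
    (by
      intro j q hq
      have := hlt q
      simp only [List.mem_cons] at hq ⊢
      grind)
    (fun j hj => by
      have hj1 : z.E ^ (j + 1) ≤ z.W := Nat.pow_le_pow_right (by change 0 < 11 * _ + 9; omega) hj
      have hj2 : (z.τ + 3) ^ (j + 1) ≤ z.N := Nat.pow_le_pow_right (by omega) hj
      have h4 := spec_asg hX hB
        (Rf := (20, k - j) :: (23, j) :: (22, (z.τ + 3) ^ j) :: (21, z.E ^ j) :: baseRegs z n fl)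
        (Rf' := (20, k - j) :: (23, j) :: (22, (z.τ + 3) ^ j) :: (21, z.E ^ (j + 1)) ::
          baseRegs z n fl)
        (M := Mj (j + 1)) 21 (.var 21 * vE) (z.E ^ (j + 1)) (by decide) (fun σ h => by
          simp only [List.forall_mem_cons] at h
          simp [h.2.2.2.1, (Base.of_mem h.2.2.2.2).E, pow_succ]) (by omega) (by
          intro q hq
          have := hlt q
          simp only [List.mem_cons] at hq ⊢
          grind)
      have h5 := spec_asg hX hB
        (Rf := (20, k - j) :: (23, j) :: (22, (z.τ + 3) ^ j) :: (21, z.E ^ (j + 1)) ::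
          baseRegs z n fl)
        (Rf' := (20, k - j) :: (23, j) :: (22, (z.τ + 3) ^ (j + 1)) :: (21, z.E ^ (j + 1)) ::
          baseRegs z n fl)
        (M := Mj (j + 1)) 22 (.var 22 * vb) ((z.τ + 3) ^ (j + 1)) (by decide) (fun σ h => by
          simp only [List.forall_mem_cons] at h
          simp [h.2.2.1, (Base.of_mem h.2.2.2.2).b, pow_succ]) (by omega) (by
          intro q hq
          have := hlt q
          simp only [List.mem_cons] at hq ⊢
          grind)
      have h6 := spec_asg hX hB
        (Rf := (20, k - j) :: (23, j) :: (22, (z.τ + 3) ^ (j + 1)) :: (21, z.E ^ (j + 1)) ::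
          baseRegs z n fl)
        (Rf' := (20, k - j) :: (23, j + 1) :: (22, (z.τ + 3) ^ (j + 1)) :: (21, z.E ^ (j + 1)) ::
          baseRegs z n fl)
        (M := Mj (j + 1)) 23 (.var 23 + 1) (j + 1) (by decide) (fun σ h => by
          simp only [List.forall_mem_cons] at h
          simp [h.2.1]) (by omega) (by
          intro q hq
          have := hlt q
          simp only [List.mem_cons] at hq ⊢
          grind)
      exact ((hb j hj).seq (h4.seq (h5.seq h6))).cost (le_of_eq rfl) (le_of_eq rfl))
  refine (h1.seq (h2.seq (h2'.seq h3))).mono (fun _ _ h => h) ?_ ?_ fun m σ h => h.weaken ?_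
  · have e1 : vk.size = 2 := rfl
    have e2 : (1 : Ex).size = 1 := rfl
    have e3 : (0 : Ex).size = 1 := rfl
    have : k * (w + 20 + 7) ≤ k * (w + 40) := Nat.mul_le_mul_left _ (by omega)
    simp only [Finset.sum_const, Finset.card_range, smul_eq_mul]
    omega
  · have e1 : vk.size = 2 := rfl
    have e2 : (1 : Ex).size = 1 := rfl
    have e3 : (0 : Ex).size = 1 := rfl
    have : k * (D + 20 + 7) ≤ k * (D + 40) := Nat.mul_le_mul_left _ (by omega)
    omega
  · intro q hq
    simp only [List.mem_cons]
    exact .inr (.inr (.inr hq))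

end loops

end SubpathDP

/-! ### The contents of the memory -/

namespace SubpathDP

open CREW Status Digit

/-- The function `f`, cut off at `b`. -/
def cut (b : ℕ) (f : ℕ → ℕ) (i : ℕ) : ℕ := if i < b then f i else 0

theorem cut_of_lt {b i : ℕ} {f : ℕ → ℕ} (h : i < b) : cut b f i = f i := if_pos h

namespace Sizes

variable {k : ℕ} (z : Sizes k)

/-- The numbers of the bags between which positions are translated: the first one. -/
def kindFrom (id kind : ℕ) : ℕ :=
  if kind = 0 then z.botBag id else if kind = 1 then z.topBag id else if kind = 2 then z.botBag id
  else if kind = 3 then z.topBag id else z.midBag id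

/-- The numbers of the bags between which positions are translated: the second one. -/
def kindTo (id kind : ℕ) : ℕ :=
  if kind = 0 then z.midBag id else if kind = 1 then z.midBag id else if kind = 2 then z.topBag id
  else if kind = 3 then z.botBag id else z.topBag id

end Sizes

section memory

variable {k n : ℕ} {ι : Type*} (H : SimpleGraph (Fin k)) {G : SimpleGraph (Fin n)}
  {T : TreeDecomposition G ι} (P : Subpath T) (l : ι → List (Fin n)) (z : Sizes k)

/-- The arrays that the program computes, in this order: powers of `τ + 3`, the bags, the layout of
the network, the digits for the operands of decided gates, the wiring of the network, the violated
conditions of partial matches, and the initial values of the gates. -/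
noncomputable def table : Mem
  | 9 => cut k fun v => (z.τ + 3) ^ v
  | 10 => cut (2 * z.S + 2) fun j => (bagList P l z j).length
  | 11 => cut ((2 * z.S + 2) * (z.τ + 1)) fun i =>
      ((bagList P l z (i / (z.τ + 1))).map Fin.val).getD (i % (z.τ + 1)) 0
  | 12 => cut (2 * z.S) z.segStep
  | 13 => cut (z.S + 1) z.preStep
  | 14 => cut z.NI z.botBag
  | 15 => cut z.NI z.topBag
  | 16 => cut z.NI z.midBag
  | 17 => cut z.NI z.opA
  | 18 => cut z.NI z.opB
  | 19 => cut (z.NI * 5 * (z.τ + 1)) fun i =>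
      transl (bagList P l z (z.kindFrom (i / (z.τ + 1) / 5) (i / (z.τ + 1) % 5)))
        (bagList P l z (z.kindTo (i / (z.τ + 1) / 5) (i / (z.τ + 1) % 5))) (i % (z.τ + 1))
  | 20 => cut (z.NI * z.E) fun i => (node H P l z (i / z.E)).decA z.τ (i % z.E)
  | 21 => cut (z.NI * z.E) fun i => (node H P l z (i / z.E)).decB z.τ (i % z.E)
  | 22 => cut (z.NI * z.W) fun i => digitSum ((node H P l z (i / z.W)).decA z.τ)
      ((node H P l z (i / z.W)).opBase z.τ) z.E k (i % z.W)
  | 23 => cut (z.NI * z.W) fun i => digitSum (fun d => (node H P l z (i / z.W)).decB z.τ d - 1)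
      ((node H P l z (i / z.W)).opBase z.τ) z.E k (i % z.W)
  | 24 => cut (z.NI * z.W) fun i => (node H P l z (i / z.W)).impossible z.τ (i % z.W)
  | 25 => cut (z.NI * z.W) fun i => Node.undecided k z.τ (i % z.W)
  | 26 => cut (z.NI * z.W) fun i =>
      replaceLast (Undecided (z.τ + 1)) (first (z.τ + 1)) z.E k (i % z.W)
  | 27 => cut (z.NI * z.W) fun i =>
      replaceLast (Undecided (z.τ + 1)) (second (z.τ + 1)) z.E k (i % z.W)
  | 28 => cut ((z.p + 2) * z.N * k) fun i => ∑ v ∈ Finset.range k,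
      badPair H G z.τ (bagList P l z (i / k / z.N)) (i / k % z.N) (i % k) v
  | 29 => cut ((z.p + 2) * z.N) fun i => badSum H G z.τ (bagList P l z (i / z.N)) (i % z.N)
  | 30 => cut (z.NI * z.W) fun i =>
      (node H P l z (i / z.W)).src₁ z.τ (i / z.W * z.W) (i % z.W)
  | 31 => cut (z.NI * z.W) fun i =>
      (node H P l z (i / z.W)).src₂ z.τ (i / z.W * z.W) (i % z.W)
  | 32 => cut (z.NI * z.W) fun i => Node.thr k z.τ (i % z.W)
  | 33 => cut z.N fun c => digitSum (convDigit z.τ) z.E (z.τ + 3) k c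
  | 34 => startGates H P l z
  | a => inputMem H T z.τ l P a

/-- The memory when the arrays below `s` have been computed. -/
noncomputable def memAt (s : ℕ) : Mem := fun a =>
  if a < s then table H P l z a else inputMem H T z.τ l P a

variable {H P l z}

theorem memAt_of_lt {s a : ℕ} (h : a < s) : memAt H P l z s a = table H P l z a := if_pos h

theorem memAt_input {s a : ℕ} (h : a < 9) : memAt H P l z s a = inputMem H T z.τ l P a := by
  unfold memAt
  split_ifs
  · interval_cases a <;> rfl
  · rfl

theorem inputMem_of_le {τ a : ℕ} (h : 9 ≤ a) (i : ℕ) : inputMem H T τ l P a i = 0 := by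
  obtain ⟨a, rfl⟩ := Nat.exists_eq_add_of_le' h
  rfl

theorem memAt_of_le {s a : ℕ} (hs : 9 ≤ s) (h : s ≤ a) (i : ℕ) : memAt H P l z s a i = 0 := by
  unfold memAt
  rw [if_neg (by omega), inputMem_of_le (by omega)]

theorem update_memAt {s : ℕ} : Function.update (memAt H P l z s) s (table H P l z s) =
    memAt H P l z (s + 1) := by
  funext a
  by_cases h : a = s
  · subst h
    rw [Function.update_self, memAt_of_lt (by omega)]
  · rw [Function.update_of_ne h]
    unfold memAt
    exact if_congr (by omega) rfl rfl

theorem memAt_nine : memAt H P l z 9 = inputMem H T z.τ l P := funext fun a => by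
  by_cases h : a < 9
  · exact memAt_input h
  · exact if_neg h

end memory

section kernels

variable {B X : ℕ} (hX : 2 ≤ X) (hB : X ^ degBound ≤ B)
  {k n : ℕ} {ι : Type*} {H : SimpleGraph (Fin k)} {G : SimpleGraph (Fin n)}
  {T : TreeDecomposition G ι} {P : Subpath T} {l : ι → List (Fin n)} {z : Sizes k} {fl : ℕ}

include hX hB

/-- An array that is computed in one step. -/
theorem spec_kernel (s : ℕ) (Tx e : Ex) (Tn : ℕ) (f : ℕ → ℕ) (hs : 9 ≤ s)
    (hdeg : Tx.deg ≤ degBound ∧ e.deg ≤ degBound) (hsize : Tx.size + e.size + 5 ≤ kcost)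
    (hf : table H P l z s = cut Tn f)
    (h : ∀ σ, Base z n fl σ → Tx.eval (memAt H P l z s) σ = Tn ∧
      (σ tid < Tn → e.eval (memAt H P l z s) σ = f (σ tid)))
    (hT : Tn < X) (hval : ∀ i < Tn, f i < X) :
    Spec B (par Tx s vi e) (St X (baseRegs z n fl) (memAt H P l z s)) (kcost * (Tn + 1)) kcost
      (St X (baseRegs z n fl) (memAt H P l z (s + 1))) := by
  rw [← update_memAt, hf]
  refine spec_par_id hX hB Tx s e Tn kcost (cut Tn f) hdeg hsize
    (fun q hq => by have := mem_baseRegs_lt q hq; change q.1 ≠ 50; omega) (fun σ hσ => ?_) hT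
    (fun i hi => ?_) fun i hi => ?_
  · have := h σ (Base.of_mem hσ)
    exact ⟨this.1, fun hi => by rw [cut_of_lt hi]; exact this.2 hi⟩
  · rw [cut_of_lt hi]; exact hval i hi
  · rw [memAt_of_le hs le_rfl]
    exact if_neg (by omega)

/-- An array that is computed digit by digit. -/
theorem spec_digits_kernel (s : ℕ) (Tx e : Ex) (Tn : ℕ) (f : ℕ → ℕ → ℕ) (hs : 9 ≤ s)
    (hdeg : Tx.deg ≤ degBound ∧ e.deg ≤ degBound) (hsize : Tx.size + e.size + 5 ≤ kcost)
    (hW : z.W < X) (hN : z.N < X) (hk : k < X)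
    (hf : table H P l z s = cut Tn (f k)) (h0 : ∀ i < Tn, f 0 i = 0)
    (h : ∀ j < k, ∀ M : Mem, (∀ a < s, M a = memAt H P l z s a) → (∀ i < Tn, M s i = f j i) →
      ∀ σ, Base z n fl σ → σ 21 = z.E ^ j → σ 22 = (z.τ + 3) ^ j → σ 23 = j →
      Tx.eval M σ = Tn ∧ (σ tid < Tn → e.eval M σ = f (j + 1) (σ tid)))
    (hT : Tn < X) (hval : ∀ j < k, ∀ i < Tn, f (j + 1) i < X) :
    Spec B (digits (par Tx s vi e)) (St X (baseRegs z n fl) (memAt H P l z s))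
      (k * (kcost * (Tn + 1) + 40) + 40) (k * (kcost + 40) + 40)
      (St X (baseRegs z n fl) (memAt H P l z (s + 1))) := by
  have key := spec_digits hX hB (p := par Tx s vi e) (z := z) (n := n) (fl := fl)
    (fun j => Function.update (memAt H P l z s) s (cut Tn (f j))) (kcost * (Tn + 1)) kcost
    hW hN hk (fun j hj => by
      have := spec_par_id hX hB
        (M := Function.update (memAt H P l z s) s (cut Tn (f j)))
        (Rf := (20, k - j) :: (23, j) :: (22, (z.τ + 3) ^ j) :: (21, z.E ^ j) :: baseRegs z n fl)
        Tx s e Tn kcost (cut Tn (f (j + 1))) hdeg hsize (fun q hq => by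
          simp only [List.mem_cons] at hq
          have := mem_baseRegs_lt (z := z) (n := n) (fl := fl) q
          change q.1 ≠ 50
          rcases hq with rfl | rfl | rfl | rfl | hq <;> [simp; simp; simp; simp; skip]
          have := this hq
          omega)
        (fun σ hσ => by
          simp only [List.forall_mem_cons] at hσ
          obtain ⟨-, h23, h22, h21, hb⟩ := hσ
          obtain ⟨e1, e2⟩ := h j hj (Function.update (memAt H P l z s) s (cut Tn (f j)))
            (fun a ha => Function.update_of_ne (by omega) _ _)
            (fun i hi => by rw [Function.update_self, cut_of_lt hi]) σ (Base.of_mem hb) h21 h22 h23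
          exact ⟨e1, fun hi => by rw [cut_of_lt hi]; exact e2 hi⟩)
        hT (fun i hi => by rw [cut_of_lt hi]; exact hval j hj i hi)
        (fun i hi => by
          rw [Function.update_self]
          unfold cut
          rw [if_neg (by omega), if_neg (by omega)])
      rwa [Function.update_idem] at this)
  rw [← hf, update_memAt] at key
  have e0 : cut Tn (f 0) = memAt H P l z s s := funext fun i => by
    rw [memAt_of_le hs le_rfl]
    unfold cut
    split_ifs with hi
    · exact h0 i hi
    · rfl
  rwa [e0, Function.update_eq_self] at key

end kernels

end SubpathDP

/-! ### Costs of the commands that fill an array -/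

namespace SubpathDP

open CREW Status Digit

namespace Sizes

variable {k : ℕ} (z : Sizes k)

/-- The unit of the work: every part of the program takes a constant multiple of it. -/
def work : ℕ := k * z.L * z.S * z.W + z.S * (z.τ + 3) ^ 2

/-- The unit of the depth. -/
def depth : ℕ := k * (z.L + z.d + 1)

end Sizes

/-- The assumptions under which the program runs: the sizes fit the input, the bags are lists of
different vertices, and memory cells below `X` have enough room. -/
structure Setting {k n : ℕ} {ι : Type*} {G : SimpleGraph (Fin n)} {T : TreeDecomposition G ι}
    (P : Subpath T) (l : ι → List (Fin n)) (z : Sizes k) (X : ℕ) : Prop where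
  k_pos : 0 < k
  L_pos : 0 < z.L
  L_le : z.L ≤ z.W
  len : P.length = z.p
  le : z.p + 1 ≤ z.S
  bag : ∀ j, (bagList P l z j).Nodup ∧ (bagList P l z j).length ≤ z.τ + 1
  room : 8 * (z.NI * z.W * z.W * z.W) ≤ X
  n_lt : n < X

namespace Setting

variable {k n : ℕ} {ι : Type*} {G : SimpleGraph (Fin n)} {T : TreeDecomposition G ι}
    {P : Subpath T} {l : ι → List (Fin n)} {z : Sizes k} {X : ℕ} (h : Setting P l z X)

include h

theorem E_le_W : z.E ≤ z.W := Nat.le_self_pow h.k_pos.ne' _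

omit h in
theorem W_pos : 0 < z.W := Nat.pow_pos (by change 0 < 11 * _ + 9; omega)

omit h in
theorem S_pos : 0 < z.S := Nat.pow_pos (by omega)

omit h in
theorem mul_pow_le : 3 ^ k * z.N ≤ z.W := by
  rw [Sizes.N, ← mul_pow]
  exact Nat.pow_le_pow_left (by change _ ≤ 11 * (z.τ + 1) + 9; omega) k

omit h in
theorem N_mul_le : z.N * k ≤ z.W := by
  have h1 : k < 3 ^ k := Nat.lt_pow_self (by norm_num)
  calc z.N * k ≤ z.N * 3 ^ k := Nat.mul_le_mul_left _ h1.le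
    _ = 3 ^ k * z.N := mul_comm _ _
    _ ≤ z.W := mul_pow_le

theorem N_le_W : z.N ≤ z.W := (Nat.le_mul_of_pos_right _ h.k_pos).trans N_mul_le

omit h in
theorem three_pow_le : 3 ^ k ≤ z.W :=
  (Nat.le_mul_of_pos_right _ (Nat.pow_pos (by omega))).trans mul_pow_le

omit h in
theorem k_le_W : k ≤ z.W := (Nat.lt_pow_self (by norm_num)).le.trans three_pow_le

theorem t_le_W : z.τ + 1 ≤ z.W := by
  have := h.E_le_W
  have hE : z.E = 11 * (z.τ + 1) + 9 := rfl
  omega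

/-- Everything bounded by `8 * NI * W ^ 3` fits into a memory cell. -/
theorem lt_X {a b c d e : ℕ} (ha : a ≤ z.NI) (hb : b ≤ z.W) (hc : c ≤ z.W) (hd : d ≤ z.W)
    (he : e < 8 * (a * b * c * d)) : e < X :=
  (he.trans_le (Nat.mul_le_mul_left 8
    (Nat.mul_le_mul (Nat.mul_le_mul (Nat.mul_le_mul ha hb) hc) hd))).trans_le h.room

theorem lt_X' {e : ℕ} (he : e ≤ 7 * (z.S * z.W)) : e < X := by
  have h1 := W_pos (z := z)
  have h2 := S_pos (z := z)
  refine h.lt_X (a := z.S) (b := z.W) (c := 1) (d := 1) ?_ le_rfl h1 h1 ?_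
  · have : z.NI = 3 * z.S + 1 := rfl
    omega
  · have := Nat.mul_pos h2 h1
    omega

omit h in
theorem le_S_mul_W {a b c x : ℕ} (hb : b ≤ z.W) (ha : a ≤ c * z.S) (hx : x ≤ a * b) :
    x ≤ c * (z.S * z.W) := by
  rw [← mul_assoc]
  exact hx.trans (Nat.mul_le_mul ha hb)

omit h in
theorem le_W {x : ℕ} (hx : x ≤ z.W) : x ≤ 7 * (z.S * z.W) :=
  le_S_mul_W (a := 1) (b := x) (c := 7) hx (by have := S_pos (z := z); omega) (by omega)

omit h in
theorem le_S {x c : ℕ} (hx : x ≤ c * z.S) : x ≤ c * (z.S * z.W) :=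
  le_S_mul_W (a := x) (b := 1) W_pos hx (by omega)

theorem mul_le_work {x c : ℕ} (hx : x ≤ c * (k * (z.S * z.W))) : x ≤ c * z.work := by
  refine hx.trans (Nat.mul_le_mul_left _ ?_)
  unfold Sizes.work
  calc k * (z.S * z.W) ≤ k * (z.S * z.W) * z.L := Nat.le_mul_of_pos_right _ h.L_pos
    _ = k * z.L * z.S * z.W := by ring
    _ ≤ _ := Nat.le_add_right _ _

theorem S_mul_W_le {x c : ℕ} (hx : x ≤ c * (z.S * z.W)) : x ≤ c * z.work :=
  h.mul_le_work (hx.trans (Nat.mul_le_mul_left _ (Nat.le_mul_of_pos_left _ h.k_pos)))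

omit h in
theorem k_le_depth : k ≤ z.depth := Nat.le_mul_of_pos_right _ (by omega)

end Setting

section kernels

variable {B X : ℕ} (hX : 2 ≤ X) (hB : X ^ degBound ≤ B)
  {k n : ℕ} {ι : Type*} {H : SimpleGraph (Fin k)} {G : SimpleGraph (Fin n)}
  {T : TreeDecomposition G ι} {P : Subpath T} {l : ι → List (Fin n)} {z : Sizes k} {fl : ℕ}
  (hs : Setting P l z X)

variable (B X n H P l z fl) in
/-- The program computes array `s`, when the arrays with smaller numbers have been computed. -/
abbrev Computes (s : ℕ) (p : Prog) : Prop :=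
  Spec B p (St X (baseRegs z n fl) (memAt H P l z s)) (84000 * z.work) (4080 * z.depth)
    (St X (baseRegs z n fl) (memAt H P l z (s + 1)))

include hX hB hs

theorem kernel (s : ℕ) (Tx e : Ex) (Tn : ℕ) (f : ℕ → ℕ) (h9 : 9 ≤ s)
    (hdeg : Tx.deg ≤ degBound ∧ e.deg ≤ degBound) (hsize : Tx.size + e.size + 5 ≤ kcost)
    (hf : table H P l z s = cut Tn f) (hT : Tn ≤ 7 * (z.S * z.W)) (hval : ∀ i < Tn, f i < X)
    (h : ∀ σ, Base z n fl σ → Tx.eval (memAt H P l z s) σ = Tn ∧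
      (σ 50 < Tn → e.eval (memAt H P l z s) σ = f (σ 50))) :
    Computes B X n H P l z fl s (par Tx s vi e) := by
  refine (spec_kernel hX hB s Tx e Tn f h9 hdeg hsize hf h (hs.lt_X' hT) hval).cost ?_ ?_
  · have := hs.S_mul_W_le (x := Tn + 1) (c := 8) (by
      have := Nat.mul_pos (Setting.S_pos (z := z)) (Setting.W_pos (z := z))
      omega)
    rw [show kcost = 4000 from rfl]
    omega
  · have := Setting.k_le_depth (z := z)
    have := hs.k_pos
    rw [show kcost = 4000 from rfl]
    omega

theorem digits_kernel (s : ℕ) (Tx e : Ex) (Tn : ℕ) (f : ℕ → ℕ → ℕ) (h9 : 9 ≤ s)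
    (hdeg : Tx.deg ≤ degBound ∧ e.deg ≤ degBound) (hsize : Tx.size + e.size + 5 ≤ kcost)
    (hf : table H P l z s = cut Tn (f k)) (hT : Tn ≤ 7 * (z.S * z.W))
    (h0 : ∀ i < Tn, f 0 i = 0) (hval : ∀ j < k, ∀ i < Tn, f (j + 1) i < X)
    (h : ∀ j < k, ∀ M : Mem, (∀ a < s, M a = memAt H P l z s a) → (∀ i < Tn, M s i = f j i) →
      ∀ σ, Base z n fl σ → σ 21 = z.E ^ j → σ 22 = (z.τ + 3) ^ j → σ 23 = j →
      Tx.eval M σ = Tn ∧ (σ 50 < Tn → e.eval M σ = f (j + 1) (σ 50))) :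
    Computes B X n H P l z fl s (digits (par Tx s vi e)) := by
  refine (spec_digits_kernel hX hB s Tx e Tn f h9 hdeg hsize (hs.lt_X' (Setting.le_W le_rfl))
    (hs.lt_X' (Setting.le_W hs.N_le_W)) (hs.lt_X' (Setting.le_W Setting.k_le_W)) hf h0 h (hs.lt_X' hT)
    hval).cost ?_ ?_
  · have h1 := Nat.mul_pos (Setting.S_pos (z := z)) (Setting.W_pos (z := z))
    have h2 := Nat.mul_le_mul_left k (show kcost * (Tn + 1) + 40 ≤ 32040 * (z.S * z.W) by
      rw [show kcost = 4000 from rfl]; omega)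
    have h3 : 0 < k * (z.S * z.W) := Nat.mul_pos hs.k_pos h1
    have h4 : k * (32040 * (z.S * z.W)) = 32040 * (k * (z.S * z.W)) := by ring
    refine hs.mul_le_work ((Nat.add_le_add_right h2 40).trans ?_)
    rw [h4]
    omega
  · have := Setting.k_le_depth (z := z)
    have := hs.k_pos
    rw [show kcost = 4000 from rfl]
    omega

end kernels

/-! ### The bags and the layout of the network -/

section layout

variable {B X : ℕ} (hX : 2 ≤ X) (hB : X ^ degBound ≤ B)
  {k n : ℕ} {ι : Type*} {H : SimpleGraph (Fin k)} {G : SimpleGraph (Fin n)}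
  {T : TreeDecomposition G ι} {P : Subpath T} {l : ι → List (Fin n)} {z : Sizes k} {fl : ℕ}
  (hs : Setting P l z X)

include hX hB hs

theorem computes_powers : Computes B X n H P l z fl 9
    (digits (par vk 9 vi (.ifEq vi (.var 23) (.var 22) (.ld 9 vi)))) := by
  refine digits_kernel hX hB hs 9 _ _ k (fun j i => if i < j then (z.τ + 3) ^ i else 0) le_rfl
    ⟨by decide, by decide⟩ (by decide) ?_ (Setting.le_W Setting.k_le_W) (fun i _ => if_neg (by omega)) ?_ ?_
  · funext i
    change cut k _ i = _
    unfold cut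
    split_ifs with h
    · exact (if_pos h).symm
    · rfl
  · intro j hj i hi
    refine hs.lt_X' (Setting.le_W ?_)
    split_ifs
    · exact (Nat.pow_le_pow_right (by omega) hi.le).trans hs.N_le_W
    · omega
  · intro j hj M hM hM' σ hσ h21 h22 h23
    refine ⟨by simp [hσ.k], fun hi => ?_⟩
    simp only [Ex.eval_ifEq, Ex.eval_var, Ex.eval_ld, h22, h23, hM' _ hi]
    split_ifs <;> first | omega | simp_all

omit hX hB in
open Classical in
theorem bagList_length (j : ℕ) : (bagList P l z j).length =
    if j = 0 then 0 else if j = 1 then inputMem H T z.τ l P 5 z.p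
    else if j < z.S + 1 then inputMem H T z.τ l P 3 (j - 2)
    else inputMem H T z.τ l P 5 (j - z.S - 1) := by
  have hle := hs.le
  have hoff : ∀ s, (offList P l s).length = inputMem H T z.τ l P 5 s := by
    intro s
    change (if P.IsOff s then l (P.off s) else []).length =
      if P.IsOff s then (l (P.off s)).length else 0
    split_ifs <;> rfl
  rw [bagList]
  rcases j with _ | _ | j
  · simp [layer]
  · rw [if_pos (by omega), layer, hs.len, hoff]
    simp
  · rw [if_neg (by omega : ¬ j + 1 + 1 = 0), if_neg (by omega : ¬ j + 1 + 1 = 1)]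
    by_cases h1 : j + 1 + 1 ≤ z.S
    · rw [if_pos h1, if_pos (by omega)]
      change (if j < P.length then l (P.node j) else []).length =
        if j < P.length then (l (P.node j)).length else 0
      split_ifs <;> rfl
    · rw [if_neg h1, if_neg (by omega)]
      exact hoff _

omit hX hB in
open Classical in
theorem bagList_getD (j x : ℕ) (hx : x < z.τ + 1) : ((bagList P l z j).map Fin.val).getD x 0 =
    if j = 0 then 0 else if j = 1 then inputMem H T z.τ l P 6 (z.p * (z.τ + 1) + x)
    else if j < z.S + 1 then inputMem H T z.τ l P 4 ((j - 2) * (z.τ + 1) + x)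
    else inputMem H T z.τ l P 6 ((j - z.S - 1) * (z.τ + 1) + x) := by
  have hle := hs.le
  have hdm : ∀ s, (s * (z.τ + 1) + x) / (z.τ + 1) = s ∧ (s * (z.τ + 1) + x) % (z.τ + 1) = x := by
    intro s
    rw [mul_comm, Nat.mul_add_div (by omega), Nat.div_eq_of_lt hx, Nat.mul_add_mod,
      Nat.mod_eq_of_lt hx]
    simp
  have hoff : ∀ s, ((offList P l s).map Fin.val).getD x 0 =
      inputMem H T z.τ l P 6 (s * (z.τ + 1) + x) := by
    intro s
    change ((if P.IsOff s then l (P.off s) else []).map Fin.val).getD x 0 =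
      if P.IsOff ((s * (z.τ + 1) + x) / (z.τ + 1)) then
      ((l (P.off ((s * (z.τ + 1) + x) / (z.τ + 1)))).map Fin.val).getD
        ((s * (z.τ + 1) + x) % (z.τ + 1)) 0 else 0
    rw [(hdm s).1, (hdm s).2]
    split_ifs <;> simp
  rw [bagList]
  rcases j with _ | _ | j
  · simp [layer]
  · rw [if_pos (by omega), layer, hs.len, hoff]
    simp
  · rw [if_neg (by omega : ¬ j + 1 + 1 = 0), if_neg (by omega : ¬ j + 1 + 1 = 1)]
    by_cases h1 : j + 1 + 1 ≤ z.S
    · rw [if_pos h1, if_pos (by omega)]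
      change ((if j < P.length then l (P.node j) else []).map Fin.val).getD x 0 =
        if (j * (z.τ + 1) + x) / (z.τ + 1) < P.length then
        ((l (P.node ((j * (z.τ + 1) + x) / (z.τ + 1)))).map Fin.val).getD
          ((j * (z.τ + 1) + x) % (z.τ + 1)) 0 else 0
      rw [(hdm j).1, (hdm j).2]
      split_ifs <;> simp
    · rw [if_neg h1, if_neg (by omega)]
      exact hoff _

theorem computes_bagSizes : Computes B X n H P l z fl 10
    (par (2 * vS + 2) 10 vi (.ifEq vi 0 0 (.ifEq vi 1 (.ld 5 vp)
      (.ifLt vi (vS + 1) (.ld 3 (vi - 2)) (.ld 5 (vi - vS - 1)))))) := by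
  refine kernel hX hB hs 10 _ _ (2 * z.S + 2) _ (by norm_num)
    ⟨by decide, by decide⟩ (by decide) rfl (Setting.le_S (by have := Setting.S_pos (z := z); omega))
    ?_ ?_
  · intro i _
    exact hs.lt_X' (Setting.le_W ((hs.bag i).2.trans hs.t_le_W))
  · intro σ hσ
    refine ⟨by simp [hσ.S], fun hi => ?_⟩
    rw [bagList_length hs (H := H)]
    simp only [Ex.eval_ifEq, Ex.eval_ifLt, Ex.eval_var, Ex.eval_ld, Ex.eval_zero, Ex.eval_one,
      Ex.eval_add, Ex.eval_sub, Ex.eval_ofNat, hσ.S, hσ.p, memAt_input (show 5 < 9 by norm_num),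
      memAt_input (show 3 < 9 by norm_num)]

theorem computes_bags : Computes B X n H P l z fl 11
    (par ((2 * vS + 2) * vt) 11 vi (.ifEq (vi / vt) 0 0 (.ifEq (vi / vt) 1 (.ld 6 (vp * vt + vi % vt))
      (.ifLt (vi / vt) (vS + 1) (.ld 4 ((vi / vt - 2) * vt + vi % vt))
        (.ld 6 ((vi / vt - vS - 1) * vt + vi % vt)))))) := by
  refine kernel hX hB hs 11 _ _ ((2 * z.S + 2) * (z.τ + 1)) _ (by norm_num)
    ⟨by decide, by decide⟩ (by decide) rfl
    (Setting.le_S_mul_W (b := z.τ + 1) hs.t_le_W (by have := Setting.S_pos (z := z); omega) le_rfl)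
    ?_ ?_
  · intro i _
    have : ∀ (L : List (Fin n)) x, (L.map Fin.val).getD x 0 < X := by
      intro L x
      have := hs.n_lt
      rw [List.getD_eq_getElem?_getD, List.getElem?_map]
      rcases L[x]? with _ | y
      · simp; omega
      · simp; omega
    exact this _ _
  · intro σ hσ
    refine ⟨by simp [hσ.S, hσ.t], fun hi => ?_⟩
    rw [bagList_getD hs (H := H) _ _ (Nat.mod_lt _ (by omega))]
    simp only [Ex.eval_ifEq, Ex.eval_ifLt, Ex.eval_var, Ex.eval_ld, Ex.eval_zero, Ex.eval_one,
      Ex.eval_add, Ex.eval_sub, Ex.eval_mul, Ex.eval_div, Ex.eval_mod, Ex.eval_ofNat, hσ.S, hσ.p,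
      hσ.t, memAt_input (show 6 < 9 by norm_num), memAt_input (show 4 < 9 by norm_num)]

omit hX hB hs in
theorem sum_two_pow (d : ℕ) : ∑ j ∈ Finset.range (d + 1), 2 ^ j ≤ 2 * 2 ^ d := by
  induction d with
  | zero => simp
  | succ d ih => rw [Finset.sum_range_succ, pow_succ]; omega

omit hX hB hs in
theorem sum_div_two_pow (d : ℕ) : ∑ j ∈ Finset.range (d + 1), 2 ^ d / 2 ^ j ≤ 2 * 2 ^ d := by
  rw [← Finset.sum_range_reflect]
  refine le_of_eq_of_le (Finset.sum_congr rfl fun j hj => ?_) (sum_two_pow d)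
  have hj' := Finset.mem_range.1 hj
  rw [Nat.add_sub_cancel, Nat.pow_div (by omega) (by norm_num)]
  congr 1
  omega

omit hX hB hs in
theorem d_lt_S : z.d + 1 ≤ z.S := Nat.lt_pow_self (by norm_num)

/-- An array that is computed level by level. -/
theorem levels_kernel (s : ℕ) (Tx e₁ e₂ : Ex) (Tn : ℕ → ℕ) (addr val F : ℕ → ℕ → ℕ) (h9 : 9 ≤ s)
    (hdeg : Tx.deg ≤ degBound ∧ e₁.deg ≤ degBound ∧ e₂.deg ≤ degBound)
    (hsize : Tx.size + e₁.size + e₂.size + 3 ≤ kcost)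
    (hf : table H P l z s = F (z.d + 1)) (h0 : ∀ i, F 0 i = 0)
    (hT : ∀ j ≤ z.d, Tn j ≤ z.S) (hsum : ∑ j ∈ Finset.range (z.d + 1), Tn j ≤ 2 * z.S)
    (h : ∀ j ≤ z.d, ∀ M : Mem, ∀ σ, Base z n fl σ → σ 21 = 2 ^ j → σ 22 = z.S / 2 ^ j →
      Tx.eval M σ = Tn j ∧
      (σ 50 < Tn j → e₁.eval M σ = addr j (σ 50) ∧ e₂.eval M σ = val j (σ 50)))
    (hinj : ∀ j ≤ z.d, ∀ i < Tn j, ∀ i' < Tn j, addr j i = addr j i' → i = i')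
    (hval : ∀ j ≤ z.d, ∀ i < Tn j, val j i < X)
    (hF : ∀ j ≤ z.d, ∀ i < Tn j, F (j + 1) (addr j i) = val j i)
    (hF' : ∀ j ≤ z.d, ∀ y, (∀ i < Tn j, addr j i ≠ y) → F (j + 1) y = F j y) :
    Computes B X n H P l z fl s (levels (par Tx s e₁ e₂)) := by
  have hdS := d_lt_S (z := z)
  have key := spec_levels hX hB (p := par Tx s e₁ e₂) (z := z) (n := n) (fl := fl)
    (fun j => Function.update (memAt H P l z s) s (F j)) (fun j => kcost * (Tn j + 1)) kcost
    (hs.lt_X' (Setting.le_S (by omega)))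
    (hs.lt_X' (Setting.le_S (by omega))) (fun j hj => by
      have := spec_par hX hB
        (M := Function.update (memAt H P l z s) s (F j))
        (Rf := (20, z.d + 1 - j) :: (22, z.S / 2 ^ j) :: (21, 2 ^ j) :: baseRegs z n fl)
        Tx s e₁ e₂ (Tn j) kcost (addr j) (val j) (F (j + 1)) hdeg hsize (fun q hq => by
          simp only [List.mem_cons] at hq
          have := mem_baseRegs_lt (z := z) (n := n) (fl := fl) q
          change q.1 ≠ 50
          rcases hq with rfl | rfl | rfl | hq <;> [simp; simp; simp; skip]
          have := this hq
          omega)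
        (fun σ hσ => by
          simp only [List.forall_mem_cons] at hσ
          obtain ⟨-, h22, h21, hb⟩ := hσ
          exact h j (by omega) _ σ (Base.of_mem hb) h21 h22)
        (hs.lt_X' (Setting.le_S (by have := hT j (by omega); omega)))
        (hinj j (by omega)) (hval j (by omega)) (hF j (by omega)) (fun y hy => by
          rw [Function.update_self]
          exact hF' j (by omega) y hy)
      rwa [Function.update_idem] at this)
  rw [← hf, update_memAt] at key
  have e0 : F 0 = memAt H P l z s s := funext fun i => by
    rw [memAt_of_le h9 le_rfl, h0]
  rw [e0, Function.update_eq_self] at key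
  refine key.cost ?_ ?_
  · have h1 : ∑ j ∈ Finset.range (z.d + 1), (kcost * (Tn j + 1) + 30) =
        4000 * ∑ j ∈ Finset.range (z.d + 1), Tn j + 4030 * (z.d + 1) := by
      rw [Finset.mul_sum, Finset.sum_congr rfl fun j _ =>
        show kcost * (Tn j + 1) + 30 = 4000 * Tn j + 4030 from by change 4000 * _ + 30 = _; ring,
        Finset.sum_add_distrib]
      simp [mul_comm]
    rw [h1]
    refine (hs.S_mul_W_le (Setting.le_S (c := 84000) ?_))
    omega
  · have h2 : z.d + 1 ≤ z.depth :=
      (show z.d + 1 ≤ z.L + z.d + 1 by omega).trans (Nat.le_mul_of_pos_left _ hs.k_pos)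
    rw [show kcost = 4000 from rfl]
    omega

theorem computes_segStep : Computes B X n H P l z fl 12
    (levels (par (.var 21) 12 (.var 21 + vi) (.var 22))) := by
  have hS := Setting.S_pos (z := z)
  refine levels_kernel hX hB hs 12 _ _ _ (fun j => 2 ^ j) (fun j i => 2 ^ j + i)
    (fun j _ => z.S / 2 ^ j) (fun j => cut (2 ^ j) z.segStep) (by norm_num)
    ⟨by decide, by decide, by decide⟩ (by decide) ?_ ?_
    (fun j hj => Nat.pow_le_pow_right (by norm_num) hj) (sum_two_pow z.d) ?_
    (fun j _ i _ i' _ h => by omega) ?_ ?_ ?_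
  · change cut (2 * z.S) _ = _
    rw [pow_succ, mul_comm]
  · intro i
    unfold cut
    split_ifs with h
    · have : i = 0 := by simpa using h
      simp [this, Sizes.segStep]
    · rfl
  · intro j hj M σ hσ h21 h22
    simp [h21, h22]
  · intro j hj i hi
    exact (Nat.div_le_self _ _).trans_lt (hs.lt_X' (Setting.le_S (by omega)))
  · intro j hj i hi
    rw [cut_of_lt (by rw [pow_succ]; omega), Sizes.segStep, if_neg (by omega)]
    rw [(Nat.log_eq_iff (.inr ⟨by norm_num, by omega⟩)).2 ⟨Nat.le_add_right _ _, by
      rw [pow_succ]; omega⟩]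
  · intro j hj y hy
    unfold cut
    have : ¬ (2 ^ j ≤ y ∧ y < 2 ^ (j + 1)) := by
      rintro ⟨h1, h2⟩
      rw [pow_succ] at h2
      exact hy (y - 2 ^ j) (by omega) (by omega)
    rw [pow_succ] at this ⊢
    exact if_congr (by omega) rfl rfl

theorem computes_preStep : Computes B X n H P l z fl 13
    (levels (par (.var 22) 13 ((vi + 1) * .var 21) (.var 21))) := by
  have hS := Setting.S_pos (z := z)
  have hSj : ∀ j ≤ z.d, z.S = z.S / 2 ^ j * 2 ^ j := fun j hj =>
    (Nat.div_mul_cancel (pow_dvd_pow 2 hj)).symm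
  refine levels_kernel hX hB hs 13 _ _ _ (fun j => z.S / 2 ^ j) (fun j i => (i + 1) * 2 ^ j)
    (fun j _ => 2 ^ j)
    (fun j y => if j = 0 ∨ y = 0 ∨ z.S < y then 0 else Nat.gcd y (2 ^ (j - 1))) (by norm_num)
    ⟨by decide, by decide, by decide⟩ (by decide) ?_ ?_
    (fun j hj => Nat.div_le_self _ _) (sum_div_two_pow z.d) ?_
    (fun j _ i _ i' _ h => by
      have := Nat.eq_of_mul_eq_mul_right (show 0 < 2 ^ j by positivity) h
      omega) ?_ ?_ ?_
  · funext y
    change cut (z.S + 1) z.preStep y = _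
    unfold cut Sizes.preStep
    simp only [Nat.add_sub_cancel]
    by_cases h : y = 0 ∨ z.S < y
    · rw [if_pos (Or.inr h)]
      split_ifs <;> omega
    · rw [if_neg (show ¬ (z.d + 1 = 0 ∨ y = 0 ∨ z.S < y) by omega),
        if_pos (show y < z.S + 1 by omega), if_neg (show ¬ y = 0 by omega)]
  · intro i
    simp
  · intro j hj M σ hσ h21 h22
    simp [h21, h22]
  · intro j hj i hi
    exact (Nat.pow_le_pow_right (by norm_num) hj).trans_lt
      (hs.lt_X' (Setting.le_S (c := 7) (show z.S ≤ 7 * z.S by omega)))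
  · intro j hj i hi
    have h1 : (i + 1) * 2 ^ j ≤ z.S := by
      rw [hSj j hj]
      exact Nat.mul_le_mul_right _ hi
    have h2 : 0 < (i + 1) * 2 ^ j := by positivity
    rw [if_neg (by omega), Nat.add_sub_cancel]
    exact Nat.gcd_eq_right (Dvd.intro_left _ rfl)
  · intro j hj y hy
    by_cases h : y = 0 ∨ z.S < y
    · rw [if_pos (.inr h), if_pos (.inr h)]
    have hnd : ¬ 2 ^ j ∣ y := by
      rintro ⟨c, rfl⟩
      have h0 : c ≠ 0 := by rintro rfl; simp at h
      obtain ⟨c, rfl⟩ := Nat.exists_eq_succ_of_ne_zero h0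
      refine hy c ?_ (mul_comm _ _)
      rw [Nat.lt_iff_add_one_le, Nat.le_div_iff_mul_le (by positivity), mul_comm]
      exact Nat.le_of_not_lt fun hlt => h (.inr hlt)
    have hj0 : j ≠ 0 := by rintro rfl; simp at hnd
    obtain ⟨j, rfl⟩ := Nat.exists_eq_succ_of_ne_zero hj0
    rw [if_neg (by omega), if_neg (by omega)]
    simp only [Nat.add_sub_cancel, Nat.succ_eq_add_one]
    -- the common divisors of `y` and a power of two that does not divide `y`
    obtain ⟨a, ha, hg⟩ := (Nat.dvd_prime_pow Nat.prime_two).1 (Nat.gcd_dvd_right y (2 ^ (j + 1)))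
    have haj : a ≤ j := by
      by_contra hlt
      have : a = j + 1 := by omega
      rw [this] at hg
      exact hnd (hg ▸ Nat.gcd_dvd_left _ _)
    refine Nat.dvd_antisymm (Nat.dvd_gcd (Nat.gcd_dvd_left _ _) ?_)
      (Nat.gcd_dvd_gcd_of_dvd_right _ (pow_dvd_pow 2 (by omega)))
    rw [hg]
    exact pow_dvd_pow 2 haj

end layout

end SubpathDP

/-! ### The nodes of the network -/

namespace SubpathDP

open CREW Status Digit

namespace Sizes

variable {k : ℕ} {z : Sizes k}

theorem segStep_le (id : ℕ) : z.segStep id ≤ z.S := by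
  unfold segStep
  split_ifs
  · exact Nat.zero_le _
  · exact Nat.div_le_self _ _

theorem botBag_le (id : ℕ) : z.botBag id ≤ z.S := by
  unfold botBag segStep
  split_ifs with h h0
  · omega
  · have h1 := Nat.lt_pow_succ_log_self (b := 2) (by norm_num) id
    have h2 : id * (z.S / 2 ^ Nat.log 2 id) ≤ 2 * z.S := by
      calc id * (z.S / 2 ^ Nat.log 2 id)
          ≤ 2 ^ (Nat.log 2 id + 1) * (z.S / 2 ^ Nat.log 2 id) := Nat.mul_le_mul_right _ h1.le
        _ = 2 * (2 ^ Nat.log 2 id * (z.S / 2 ^ Nat.log 2 id)) := by rw [pow_succ]; ring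
        _ ≤ 2 * z.S := Nat.mul_le_mul_left 2 (Nat.mul_div_le _ _)
    omega
  · omega

theorem topBag_le {id : ℕ} (h : id < z.NI) : z.topBag id ≤ 2 * z.S := by
  have h1 := z.botBag_le id
  have h2 := z.segStep_le id
  have hNI : z.NI = 3 * z.S + 1 := rfl
  unfold topBag
  split_ifs <;> omega

theorem midBag_lt (hd : z.p + 1 ≤ z.S) {id : ℕ} (h : id < z.NI) : z.midBag id < 2 * z.S + 2 := by
  have h1 := z.botBag_le id
  have h2 := z.segStep_le id
  have hNI : z.NI = 3 * z.S + 1 := rfl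
  unfold midBag offBag offNumber
  split_ifs <;> omega

theorem opA_le (hd : z.p + 1 ≤ z.S) {id : ℕ} (h : id < z.NI) :
    z.opA id ≤ 3 * z.S * z.W + z.W + z.S * z.N := by
  have hNI : z.NI = 3 * z.S + 1 := rfl
  unfold opA tabBase offNumber
  split_ifs with h1 h2 h3
  · exact (Nat.mul_le_mul_right z.W (show 2 * id ≤ 3 * z.S by omega)).trans (by omega)
  · have := Nat.mul_le_mul_right z.N (show z.p ≤ z.S by omega)
    rw [hNI, Nat.add_mul, one_mul]
    omega
  · have := Nat.mul_le_mul_right z.N (show id - z.S - 1 ≤ z.S by omega)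
    rw [hNI, Nat.add_mul, one_mul]
    omega
  · exact (Nat.mul_le_mul_right z.W (show _ ≤ 3 * z.S by omega)).trans (by omega)

theorem opB_le (hd : z.p + 1 ≤ z.S) {id : ℕ} (h : id < z.NI) :
    z.opB id ≤ 3 * z.S * z.W + z.W + 2 * (z.S * z.N) := by
  have hNI : z.NI = 3 * z.S + 1 := rfl
  have h0 : 0 < z.S := by positivity
  unfold opB pmBase tabBase
  split_ifs with h1 h2
  · exact (Nat.mul_le_mul_right z.W (show 2 * id + 1 ≤ 3 * z.S by omega)).trans (by omega)
  · have h3 := Nat.mul_le_mul_right z.N hd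
    have h4 := Nat.mul_le_mul_right z.N (show id - z.S + 1 ≤ z.S by omega)
    rw [hNI, Nat.add_mul (3 * z.S), one_mul]
    omega
  · have h3 := Nat.div_le_self z.S (z.preStep (id - 2 * z.S))
    have h4 := Nat.div_le_self (id - 2 * z.S) (z.preStep (id - 2 * z.S))
    exact (Nat.mul_le_mul_right z.W (show _ ≤ 3 * z.S by omega)).trans (by omega)

end Sizes

section reads

variable {k n : ℕ} {ι : Type*} {H : SimpleGraph (Fin k)} {G : SimpleGraph (Fin n)}
  {T : TreeDecomposition G ι} {P : Subpath T} {l : ι → List (Fin n)} {z : Sizes k} {s : ℕ}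

theorem memAt_powers (h : 9 < s) {u : ℕ} (hu : u < k) :
    memAt H P l z s 9 u = (z.τ + 3) ^ u := by
  rw [memAt_of_lt h]
  exact cut_of_lt hu

theorem memAt_bagSizes (h : 10 < s) {j : ℕ} (hj : j < 2 * z.S + 2) :
    memAt H P l z s 10 j = (bagList P l z j).length := by
  rw [memAt_of_lt h]
  exact cut_of_lt (f := fun j => (bagList P l z j).length) hj

theorem memAt_bags (h : 11 < s) {j x : ℕ} (hj : j < 2 * z.S + 2) (hx : x < z.τ + 1) :
    memAt H P l z s 11 (j * (z.τ + 1) + x) = ((bagList P l z j).map Fin.val).getD x 0 := by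
  rw [memAt_of_lt h]
  refine (cut_of_lt (b := (2 * z.S + 2) * (z.τ + 1)) (f := fun i =>
    ((bagList P l z (i / (z.τ + 1))).map Fin.val).getD (i % (z.τ + 1)) 0) ?_).trans ?_
  · have := Nat.mul_le_mul_right (z.τ + 1) hj
    rw [Nat.succ_mul] at this
    omega
  · rw [mul_comm, Nat.mul_add_div (by omega), Nat.div_eq_of_lt hx, Nat.mul_add_mod,
      Nat.mod_eq_of_lt hx, add_zero]

theorem memAt_segStep (h : 12 < s) {id : ℕ} (hi : id < 2 * z.S) :
    memAt H P l z s 12 id = z.segStep id := by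
  rw [memAt_of_lt h]
  exact cut_of_lt hi

theorem memAt_preStep (h : 13 < s) {x : ℕ} (hx : x < z.S + 1) :
    memAt H P l z s 13 x = z.preStep x := by
  rw [memAt_of_lt h]
  exact cut_of_lt hx

theorem memAt_botBag (h : 14 < s) {id : ℕ} (hi : id < z.NI) :
    memAt H P l z s 14 id = z.botBag id := by
  rw [memAt_of_lt h]
  exact cut_of_lt hi

theorem memAt_topBag (h : 15 < s) {id : ℕ} (hi : id < z.NI) :
    memAt H P l z s 15 id = z.topBag id := by
  rw [memAt_of_lt h]
  exact cut_of_lt hi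

theorem memAt_midBag (h : 16 < s) {id : ℕ} (hi : id < z.NI) :
    memAt H P l z s 16 id = z.midBag id := by
  rw [memAt_of_lt h]
  exact cut_of_lt hi

theorem memAt_opA (h : 17 < s) {id : ℕ} (hi : id < z.NI) :
    memAt H P l z s 17 id = z.opA id := by
  rw [memAt_of_lt h]
  exact cut_of_lt hi

theorem memAt_opB (h : 18 < s) {id : ℕ} (hi : id < z.NI) :
    memAt H P l z s 18 id = z.opB id := by
  rw [memAt_of_lt h]
  exact cut_of_lt hi

theorem memAt_transl (h : 19 < s) {id kind x : ℕ} (hi : id < z.NI) (hk : kind < 5)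
    (hx : x < z.τ + 1) : memAt H P l z s 19 ((id * 5 + kind) * (z.τ + 1) + x) =
      transl (bagList P l z (z.kindFrom id kind)) (bagList P l z (z.kindTo id kind)) x := by
  rw [memAt_of_lt h]
  refine (cut_of_lt (b := z.NI * 5 * (z.τ + 1)) (f := fun i =>
    transl (bagList P l z (z.kindFrom (i / (z.τ + 1) / 5) (i / (z.τ + 1) % 5)))
      (bagList P l z (z.kindTo (i / (z.τ + 1) / 5) (i / (z.τ + 1) % 5)))
      (i % (z.τ + 1))) ?_).trans ?_
  · have h1 : id * 5 + kind + 1 ≤ z.NI * 5 := by omega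
    have := Nat.mul_le_mul_right (z.τ + 1) h1
    rw [Nat.succ_mul] at this
    omega
  · rw [mul_comm (id * 5 + kind), Nat.mul_add_div (by omega), Nat.div_eq_of_lt hx, Nat.mul_add_mod,
      Nat.mod_eq_of_lt hx, add_zero, mul_comm, Nat.mul_add_div (by omega), Nat.div_eq_of_lt hk,
      Nat.mul_add_mod, Nat.mod_eq_of_lt hk, add_zero]

end reads

section nodes

variable {B X : ℕ} (hX : 2 ≤ X) (hB : X ^ degBound ≤ B)
  {k n : ℕ} {ι : Type*} {H : SimpleGraph (Fin k)} {G : SimpleGraph (Fin n)}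
  {T : TreeDecomposition G ι} {P : Subpath T} {l : ι → List (Fin n)} {z : Sizes k} {fl : ℕ}
  (hs : Setting P l z X)

theorem NI_le : z.NI ≤ 7 * (z.S * z.W) := by
  have := Setting.S_pos (z := z)
  have hNI : z.NI = 3 * z.S + 1 := rfl
  exact Setting.le_S (by omega)

include hs in
theorem Setting.lt_X_of_le_S {x : ℕ} (h : x ≤ 7 * z.S) : x < X := hs.lt_X' (Setting.le_S h)

include hX hB hs

theorem computes_botBag : Computes B X n H P l z fl 14
    (par vNI 14 vi (.ifLt vi (2 * vS) (vi * .ld 12 vi - vS) 0)) := by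
  have hS := Setting.S_pos (z := z)
  refine kernel hX hB hs 14 _ _ z.NI z.botBag (by norm_num)
    ⟨by decide, by decide⟩ (by decide) rfl NI_le ?_ ?_
  · intro i _
    have := z.botBag_le i
    exact hs.lt_X_of_le_S (by omega)
  · intro σ hσ
    refine ⟨by simp [hσ.NI], fun hi => ?_⟩
    simp only [Ex.eval_ifLt, Ex.eval_var, Ex.eval_ld, Ex.eval_zero, Ex.eval_sub, Ex.eval_mul,
      Ex.eval_ofNat, hσ.S]
    unfold Sizes.botBag
    split_ifs with h
    · rw [memAt_segStep (by norm_num) h]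
    · rfl

theorem computes_topBag : Computes B X n H P l z fl 15
    (par vNI 15 vi (.ifLt vi (2 * vS) (.ld 14 vi + .ld 12 vi) (vi - 2 * vS))) := by
  have hS := Setting.S_pos (z := z)
  refine kernel hX hB hs 15 _ _ z.NI z.topBag (by norm_num)
    ⟨by decide, by decide⟩ (by decide) rfl NI_le ?_ ?_
  · intro i hi
    have := z.topBag_le hi
    exact hs.lt_X_of_le_S (by omega)
  · intro σ hσ
    refine ⟨by simp [hσ.NI], fun hi => ?_⟩
    simp only [Ex.eval_ifLt, Ex.eval_var, Ex.eval_ld, Ex.eval_add, Ex.eval_sub, Ex.eval_mul,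
      Ex.eval_ofNat, hσ.S]
    unfold Sizes.topBag
    split_ifs with h
    · rw [memAt_segStep (by norm_num) h, memAt_botBag (by norm_num) hi]
    · rfl

theorem computes_midBag : Computes B X n H P l z fl 16
    (par vNI 16 vi (.ifLt vi vS (.ld 14 vi + .ld 12 vi / 2) (.ifLt vi (2 * vS)
      (vS + 1 + .ifEq (vi - vS) 0 vp (vi - vS - 1)) (vi - 2 * vS - .ld 13 (vi - 2 * vS))))) := by
  have hS := Setting.S_pos (z := z)
  have hNI : z.NI = 3 * z.S + 1 := rfl
  refine kernel hX hB hs 16 _ _ z.NI z.midBag (by norm_num)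
    ⟨by decide, by decide⟩ (by decide) rfl NI_le ?_ ?_
  · intro i hi
    have := z.midBag_lt hs.le hi
    exact hs.lt_X_of_le_S (by omega)
  · intro σ hσ
    refine ⟨by simp [hσ.NI], fun hi => ?_⟩
    simp only [Ex.eval_ifLt, Ex.eval_ifEq, Ex.eval_var, Ex.eval_ld, Ex.eval_add, Ex.eval_sub,
      Ex.eval_mul, Ex.eval_div, Ex.eval_zero, Ex.eval_one, Ex.eval_ofNat, hσ.S, hσ.p]
    unfold Sizes.midBag
    split_ifs with h h' h''
    · rw [memAt_segStep (by norm_num) (by omega), memAt_botBag (by norm_num) hi]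
    · rw [offNumber, if_pos h'', Sizes.offBag]
    · rw [offNumber, if_neg h'', Sizes.offBag]
    · rw [memAt_preStep (by norm_num) (by omega)]

theorem computes_opA : Computes B X n H P l z fl 17
    (par vNI 17 vi (.ifLt vi vS (2 * vi * vW) (.ifLt vi (2 * vS)
      (vTab + .ifEq (vi - vS) 0 vp (vi - vS - 1) * vN)
      ((2 * vS + (vi - 2 * vS - .ld 13 (vi - 2 * vS))) * vW)))) := by
  have hS := Setting.S_pos (z := z)
  have hNI : z.NI = 3 * z.S + 1 := rfl
  refine kernel hX hB hs 17 _ _ z.NI z.opA (by norm_num)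
    ⟨by decide, by decide⟩ (by decide) rfl NI_le ?_ ?_
  · intro i hi
    have h1 := z.opA_le hs.le hi
    have h2 := Nat.mul_le_mul_left z.S (Setting.N_le_W hs)
    have h3 := Nat.mul_le_mul_right z.W hS
    exact hs.lt_X' (by rw [mul_assoc] at h1; omega)
  · intro σ hσ
    refine ⟨by simp [hσ.NI], fun hi => ?_⟩
    simp only [Ex.eval_ifLt, Ex.eval_ifEq, Ex.eval_var, Ex.eval_ld, Ex.eval_add, Ex.eval_sub,
      Ex.eval_mul, Ex.eval_zero, Ex.eval_one, Ex.eval_ofNat, hσ.S, hσ.p, hσ.W, hσ.tabBase, hσ.N]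
    unfold Sizes.opA
    split_ifs with h h' h''
    · rfl
    · rw [offNumber, if_pos h'']
    · rw [offNumber, if_neg h'']
    · rw [memAt_preStep (by norm_num) (by omega)]

theorem computes_opB : Computes B X n H P l z fl 18
    (par vNI 18 vi (.ifLt vi vS ((2 * vi + 1) * vW) (.ifLt vi (2 * vS)
      (vPm + (vi - vS + 1) * vN)
      ((vS / .ld 13 (vi - 2 * vS) + (vi - 2 * vS) / .ld 13 (vi - 2 * vS) - 1) * vW)))) := by
  have hS := Setting.S_pos (z := z)
  have hNI : z.NI = 3 * z.S + 1 := rfl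
  refine kernel hX hB hs 18 _ _ z.NI z.opB (by norm_num)
    ⟨by decide, by decide⟩ (by decide) rfl NI_le ?_ ?_
  · intro i hi
    have h1 := z.opB_le hs.le hi
    have h2 := Nat.mul_le_mul_left z.S (Setting.N_le_W hs)
    have h3 := Nat.mul_le_mul_right z.W hS
    exact hs.lt_X' (by rw [mul_assoc] at h1; omega)
  · intro σ hσ
    refine ⟨by simp [hσ.NI], fun hi => ?_⟩
    simp only [Ex.eval_ifLt, Ex.eval_var, Ex.eval_ld, Ex.eval_add, Ex.eval_sub, Ex.eval_div,
      Ex.eval_mul, Ex.eval_one, Ex.eval_ofNat, hσ.S, hσ.W, hσ.pmBase, hσ.N]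
    unfold Sizes.opB
    split_ifs with h h'
    · rfl
    · rfl
    · rw [memAt_preStep (by norm_num) (by omega)]

end nodes

end SubpathDP

/-! ### Operands of decided gates -/

namespace SubpathDP

open CREW Status Digit

theorem transl_eq_succ_iff {V : Type*} [DecidableEq V] {l₁ l₂ : List V} (hnd : l₂.Nodup) {x y : ℕ} :
    transl l₁ l₂ x = y + 1 ↔ ∃ w, l₁[x]? = some w ∧ l₂[y]? = some w := by
  unfold transl
  rcases h : l₁[x]? with _ | w
  · simp
  · simp only [Option.some.injEq, exists_eq_left']
    constructor
    · intro h1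
      split_ifs at h1 with h2
      have h3 : l₂.idxOf w = y := by omega
      rw [← h3, List.getElem?_eq_getElem (List.idxOf_lt_length_iff.2 h2), List.getElem_idxOf]
    · intro h1
      obtain ⟨h2, h3⟩ := List.getElem?_eq_some_iff.1 h1
      rw [if_pos (h3 ▸ List.getElem_mem h2), ← h3, hnd.idxOf_getElem y h2]

theorem getD_eq_iff {n : ℕ} {l₁ l₂ : List (Fin n)} {x y : ℕ} (hx : x < l₁.length)
    (hy : y < l₂.length) : (l₁.map Fin.val).getD x 0 = (l₂.map Fin.val).getD y 0 ↔
      ∃ w, l₁[x]? = some w ∧ l₂[y]? = some w := by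
  rw [List.getElem?_eq_getElem hx, List.getElem?_eq_getElem hy]
  simp only [List.getD_eq_getElem?_getD, List.getElem?_map, List.getElem?_eq_getElem hx,
    List.getElem?_eq_getElem hy, Option.map_some, Option.getD_some, Option.some.injEq,
    exists_eq_left', Fin.val_inj]
  exact eq_comm

section expressions

variable (t M id d : Ex) (A D : Ex → Ex)

/-- The number of the first bag of a translation. -/
def exFrom (id kind : Ex) : Ex := .ifEq kind 0 (.ld 14 id) (.ifEq kind 1 (.ld 15 id)
  (.ifEq kind 2 (.ld 14 id) (.ifEq kind 3 (.ld 15 id) (.ld 16 id))))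

/-- The number of the second bag of a translation. -/
def exTo (id kind : Ex) : Ex := .ifEq kind 0 (.ld 16 id) (.ifEq kind 1 (.ld 16 id)
  (.ifEq kind 2 (.ld 15 id) (.ifEq kind 3 (.ld 14 id) (.ld 15 id))))

/-- Position `x` of bag `a` and position `y` of bag `b` exist and hold the same vertex. -/
def exSame (a x b y : Ex) : Ex := .ifLt x (.ld 10 a) (.ifLt y (.ld 10 b)
  (.ifEq (.ld 11 (a * vt + x)) (.ld 11 (b * vt + y)) 1 0) 0) 0

/-- A translated position. -/
def exTransl (id kind x : Ex) : Ex := .ld 19 ((id * 5 + kind) * vt + x)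

/-- One for the leaves of the tree of segments, zero for the other nodes. -/
def exLeaf : Ex := .ifLt id vS 0 (.ifLt id (2 * vS) 1 0)

/-- See `innerA`. -/
def exInnerA : Ex :=
  .ifLt d (2 * M)
    (.ifEq (d - M) 2 2 (.ifLt (d - M) (3 + t) 0 (.ifLt (d - M) (3 + 2 * t) (d - M + t) (d - M))))
    (.ifLt d (3 * M)
      (.ifEq (d - 2 * M) 1 1 (.ifLt (d - 2 * M) (3 + t) (2 + D (d - 2 * M - 3)) (d - 2 * M)))
      (3 + (d - 3 * M - t)))

/-- See `innerB`. -/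
def exInnerB (s : Ex) : Ex :=
  .ifLt d (2 * M)
    (.ifLt (d - M) (3 + t) (d - M + 1)
      (.ifLt (d - M) (3 + 2 * t)
        (.ifEq (A (d - M - 3 - t)) 0 0 (3 + t + A (d - M - 3 - t)))
        (.ifEq (A (d - M - 3 - 2 * t)) 0 0 (3 + 2 * t + A (d - M - 3 - 2 * t)))))
    (.ifLt d (3 * M)
      (.ifEq (d - 2 * M) 1 3 (.ifLt (d - 2 * M) 3 0 (.ifLt (d - 2 * M) (3 + t)
        (.ifEq (D (d - 2 * M - 3)) 0 0 (3 + 2 * t + D (d - 2 * M - 3)))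
        (.ifLt (d - 2 * M) (3 + 2 * t) 3 0))))
      (.ifLt (d - 3 * M - t) s (4 + t + (d - 3 * M - t)) 0))

/-- See `leafA`. -/
def exLeafA : Ex :=
  .ifLt d (2 * M)
    (.ifEq (d - M) 0 (t + 1) (.ifEq (d - M) 1 t (.ifEq (d - M) 2 (t + 1) (.ifLt (d - M) (3 + t)
      (.ifEq (D (d - M - 3)) 0 (t + 1) (D (d - M - 3) - 1))
      (.ifLt (d - M) (3 + 2 * t) (t + 1)
        (.ifEq (A (d - M - 3 - 2 * t)) 0 (t + 1) (A (d - M - 3 - 2 * t) - 1)))))))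
    (d - 3 * M - t)

/-- See `leafB`. -/
def exLeafB (s s' : Ex) (U L M' : Ex → Ex) : Ex :=
  .ifLt d (2 * M)
    (.ifEq (d - M) 0 (t + 2) (.ifLt (d - M) 3 (t + 1) (.ifLt (d - M) (3 + t)
      (.ifEq (L (d - M - 3)) 0 (d - M - 3 + 1) 0)
      (.ifLt (d - M) (3 + 2 * t)
        (.ifLt (d - M - 3 - t) s (.ifEq (U (d - M - 3 - t)) 0 (t + 1) 0) 0)
        (U (d - M - 3 - 2 * t))))))
    (.ifLt d (3 * M) 0
      (.ifLt (d - 3 * M - t) s' (.ifEq (M' (d - 3 * M - t)) 0 (t + 1) 0) 0))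

variable {t M id d A D} {m : Mem} {σ : ℕ → ℕ} {A' D' : ℕ → ℕ}

theorem eval_exInnerA (hM : M.eval m σ = numPairs (t.eval m σ))
    (hD : ∀ x, (D x).eval m σ = D' (x.eval m σ)) :
    (exInnerA t M d D).eval m σ = innerA (t.eval m σ) D' (d.eval m σ) := by
  simp only [exInnerA, innerA, Ex.eval_ifEq, Ex.eval_ifLt, Ex.eval_zero, Ex.eval_one, Ex.eval_add,
    Ex.eval_sub, Ex.eval_mul, Ex.eval_ofNat, hM, hD]

theorem eval_exInnerB {s : Ex} (hM : M.eval m σ = numPairs (t.eval m σ))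
    (hA : ∀ x, (A x).eval m σ = A' (x.eval m σ)) (hD : ∀ x, (D x).eval m σ = D' (x.eval m σ)) :
    (exInnerB t M d A D s).eval m σ =
      innerB (t.eval m σ) (s.eval m σ) A' D' (d.eval m σ) := by
  simp only [exInnerB, innerB, Ex.eval_ifEq, Ex.eval_ifLt, Ex.eval_zero, Ex.eval_one, Ex.eval_add,
    Ex.eval_sub, Ex.eval_mul, Ex.eval_ofNat, hM, hA, hD]

theorem eval_exLeafA (hM : M.eval m σ = numPairs (t.eval m σ))
    (hA : ∀ x, (A x).eval m σ = A' (x.eval m σ)) (hD : ∀ x, (D x).eval m σ = D' (x.eval m σ)) :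
    (exLeafA t M d A D).eval m σ = leafA (t.eval m σ) A' D' (d.eval m σ) := by
  simp only [exLeafA, leafA, Ex.eval_ifEq, Ex.eval_ifLt, Ex.eval_zero, Ex.eval_one, Ex.eval_add,
    Ex.eval_sub, Ex.eval_mul, Ex.eval_ofNat, hM, hA, hD]

theorem eval_exLeafB {s s' : Ex} {U L M' : Ex → Ex} {u b w : ℕ → ℕ}
    (hM : M.eval m σ = numPairs (t.eval m σ)) (hU : ∀ x, (U x).eval m σ = u (x.eval m σ))
    (hL : ∀ x, (L x).eval m σ = b (x.eval m σ)) (hM' : ∀ x, (M' x).eval m σ = w (x.eval m σ)) :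
    (exLeafB t M d s s' U L M').eval m σ =
      leafB (t.eval m σ) (s.eval m σ) (s'.eval m σ) u b w (d.eval m σ) := by
  simp only [exLeafB, leafB, Ex.eval_ifEq, Ex.eval_ifLt, Ex.eval_zero, Ex.eval_one, Ex.eval_add,
    Ex.eval_sub, Ex.eval_mul, Ex.eval_ofNat, hM, hU, hL, hM']

end expressions

section congr

variable {t s s' d : ℕ} {A A' D D' U U' L L' M M' : ℕ → ℕ}

theorem innerA_congr (ht : 0 < t) (h : ∀ x < t, D x = D' x) :
    innerA t D d = innerA t D' d := by
  unfold innerA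
  split_ifs <;> first | rfl | (rw [h]; omega)

theorem innerB_congr (hA : ∀ x < t, A x = A' x) (hD : ∀ x < t, D x = D' x) :
    innerB t s A D d = innerB t s A' D' d := by
  unfold innerB
  simp only [numPairs] at *
  split_ifs <;> first | rfl | grind

theorem leafA_congr (hA : ∀ x < t, A x = A' x) (hD : ∀ x < t, D x = D' x) :
    leafA t A D d = leafA t A' D' d := by
  unfold leafA
  simp only [numPairs] at *
  split_ifs <;> first | rfl | grind

theorem leafB_congr (hs' : s' ≤ t) (hU : ∀ x < t, U x = U' x)
    (hL : ∀ x < t, L x = L' x) (hM : ∀ x < t, M x = M' x) :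
    leafB t s s' U L M d = leafB t s s' U' L' M' d := by
  unfold leafB
  simp only [numPairs] at *
  split_ifs <;> first | rfl | grind

theorem innerA_lt (hd : d < base t) (h : ∀ x, D x ≤ t) : innerA t D d < 3 * base t := by
  have := h (d - 2 * numPairs t - 3)
  unfold innerA
  simp only [numPairs, base] at *
  split_ifs <;> omega

theorem innerB_lt (hd : d < base t) (hA : ∀ x, A x ≤ t) (hD : ∀ x, D x ≤ t) :
    innerB t s A D d < 3 * base t := by
  have h1 := hD (d - 2 * numPairs t - 3)
  have h2 := hA (d - numPairs t - 3 - t)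
  have h3 := hA (d - numPairs t - 3 - 2 * t)
  unfold innerB
  simp only [numPairs, base] at *
  split_ifs <;> omega

theorem leafA_lt (hd : d < base t) (hA : ∀ x, A x ≤ t) (hD : ∀ x, D x ≤ t) :
    leafA t A D d < 3 * base t := by
  have h1 := hD (d - numPairs t - 3)
  have h3 := hA (d - numPairs t - 3 - 2 * t)
  unfold leafA
  simp only [numPairs, base] at *
  split_ifs <;> omega

theorem leafB_lt (hd : d < base t) (hU : ∀ x, U x ≤ t) : leafB t s s' U L M d < 3 * base t := by
  have h3 := hU (d - numPairs t - 3 - 2 * t)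
  unfold leafB
  simp only [numPairs, base] at *
  split_ifs <;> omega

end congr

end SubpathDP

/-! ### The digits of operands -/

namespace SubpathDP

open CREW Status Digit

section digits

variable {B X : ℕ} (hX : 2 ≤ X) (hB : X ^ degBound ≤ B)
  {k n : ℕ} {ι : Type*} {H : SimpleGraph (Fin k)} {G : SimpleGraph (Fin n)}
  {T : TreeDecomposition G ι} {P : Subpath T} {l : ι → List (Fin n)} {z : Sizes k} {fl : ℕ}
  (hs : Setting P l z X)

theorem eval_exFrom {s : ℕ} (h : 16 < s) {id kind : Ex} {σ : ℕ → ℕ}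
    (hi : id.eval (memAt H P l z s) σ < z.NI) : (exFrom id kind).eval (memAt H P l z s) σ =
      z.kindFrom (id.eval (memAt H P l z s) σ) (kind.eval (memAt H P l z s) σ) := by
  simp only [exFrom, Sizes.kindFrom, Ex.eval_ifEq, Ex.eval_ld, Ex.eval_zero, Ex.eval_one,
    Ex.eval_ofNat, memAt_botBag (show 14 < s by omega) hi, memAt_topBag (show 15 < s by omega) hi,
    memAt_midBag (show 16 < s by omega) hi]

theorem eval_exTo {s : ℕ} (h : 16 < s) {id kind : Ex} {σ : ℕ → ℕ}
    (hi : id.eval (memAt H P l z s) σ < z.NI) : (exTo id kind).eval (memAt H P l z s) σ =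
      z.kindTo (id.eval (memAt H P l z s) σ) (kind.eval (memAt H P l z s) σ) := by
  simp only [exTo, Sizes.kindTo, Ex.eval_ifEq, Ex.eval_ld, Ex.eval_zero, Ex.eval_one,
    Ex.eval_ofNat, memAt_botBag (show 14 < s by omega) hi, memAt_topBag (show 15 < s by omega) hi,
    memAt_midBag (show 16 < s by omega) hi]

include hs in
theorem kindFrom_lt {id kind : ℕ} (hi : id < z.NI) : z.kindFrom id kind < 2 * z.S + 2 := by
  have h1 := z.botBag_le id
  have h2 := z.topBag_le hi
  have h3 := z.midBag_lt hs.le hi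
  unfold Sizes.kindFrom
  split_ifs <;> omega

include hs in
theorem kindTo_lt {id kind : ℕ} (hi : id < z.NI) : z.kindTo id kind < 2 * z.S + 2 := by
  have h1 := z.botBag_le id
  have h2 := z.topBag_le hi
  have h3 := z.midBag_lt hs.le hi
  unfold Sizes.kindTo
  split_ifs <;> omega

include hs in
theorem eval_exSame {s : ℕ} (h : 11 < s) {a x b y : Ex} {σ : ℕ → ℕ} (hσ : Base z n fl σ)
    (ha : a.eval (memAt H P l z s) σ < 2 * z.S + 2) (hb : b.eval (memAt H P l z s) σ < 2 * z.S + 2) :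
    (exSame a x b y).eval (memAt H P l z s) σ =
      if transl (bagList P l z (a.eval (memAt H P l z s) σ))
        (bagList P l z (b.eval (memAt H P l z s) σ)) (x.eval (memAt H P l z s) σ) =
        y.eval (memAt H P l z s) σ + 1 then 1 else 0 := by
  have h1 := (hs.bag (a.eval (memAt H P l z s) σ)).2
  have h2 := (hs.bag (b.eval (memAt H P l z s) σ)).2
  simp only [transl_eq_succ_iff (hs.bag (b.eval (memAt H P l z s) σ)).1]
  simp only [exSame, Ex.eval_ifEq, Ex.eval_ifLt, Ex.eval_ld, Ex.eval_zero, Ex.eval_one, Ex.eval_add,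
    Ex.eval_mul, Ex.eval_var, hσ.t, memAt_bagSizes (show 10 < s by omega) ha,
    memAt_bagSizes (show 10 < s by omega) hb]
  split_ifs with h3 h4 h5 h6 h6 h6 h6
  · rfl
  · rw [memAt_bags h ha (by omega), memAt_bags h hb (by omega), getD_eq_iff h3 h4] at h5
    exact absurd h5 h6
  · rw [memAt_bags h ha (by omega), memAt_bags h hb (by omega), getD_eq_iff h3 h4] at h5
    exact absurd h6 h5
  · rfl
  · obtain ⟨w, -, h7⟩ := h6
    exact absurd (List.getElem?_eq_some_iff.1 h7).1 h4
  · rfl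
  · obtain ⟨w, h7, -⟩ := h6
    exact absurd (List.getElem?_eq_some_iff.1 h7).1 h3
  · rfl

/-- The number of a cell of the array of translations, as an expression. -/
abbrev exCell : Ex := vi / vt

/-- One, if the positions that the processor compares hold the same vertex. -/
def exHit : Ex := exSame (exFrom (exCell / vt / 5) (exCell / vt % 5)) (exCell % vt)
  (exTo (exCell / vt / 5) (exCell / vt % 5)) (vi % vt)

include hX hB hs

theorem computes_transl : Computes B X n H P l z fl 19
    (par (vNI * 5 * vt * vt) 19 (vNI * 5 * vt + vi - exHit * (vNI * 5 * vt + vi - exCell))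
      (exHit * (vi % vt + 1))) := by
  have hS := Setting.S_pos (z := z)
  have hNI : z.NI = 3 * z.S + 1 := rfl
  set t := z.τ + 1 with ht
  have ht0 : 0 < t := by omega
  have htW := Setting.t_le_W hs
  set big := z.NI * 5 * t with hbig
  let tr : ℕ → ℕ := fun c => transl (bagList P l z (z.kindFrom (c / t / 5) (c / t % 5)))
    (bagList P l z (z.kindTo (c / t / 5) (c / t % 5))) (c % t)
  have hlt : big * t < X := by
    refine hs.lt_X (a := z.NI) (b := t) (c := t) (d := 1) le_rfl htW htW Setting.W_pos ?_
    have e : big * t = 5 * (z.NI * t * t) := by rw [hbig]; ring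
    have : 0 < z.NI * t * t := by positivity
    rw [e, mul_one]
    omega
  have hdiv : ∀ i < big * t, i / t < big := fun i hi => by
    rwa [Nat.div_lt_iff_lt_mul ht0]
  have htr : ∀ c, tr c ≤ t := fun c => (transl_le _).trans (hs.bag _).2
  have key := spec_par hX hB (M := memAt H P l z 19) (Rf := baseRegs z n fl)
    (vNI * 5 * vt * vt) 19 (vNI * 5 * vt + vi - exHit * (vNI * 5 * vt + vi - exCell))
    (exHit * (vi % vt + 1)) (big * t) 4000
    (fun i => if tr (i / t) = i % t + 1 then i / t else big + i)
    (fun i => if tr (i / t) = i % t + 1 then i % t + 1 else 0)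
    (table H P l z 19) ⟨by decide +kernel, by decide +kernel, by decide +kernel⟩ (by decide +kernel)
    (fun q hq => by have := mem_baseRegs_lt q hq; change q.1 ≠ 50; omega) (fun σ hσ => ?_) hlt ?_ ?_
    ?_ ?_
  · rw [update_memAt] at key
    refine key.cost ?_ ?_
    · have h1 : z.S * (z.τ + 3) ^ 2 ≤ z.work := Nat.le_add_left _ _
      have h2 : t * t ≤ (z.τ + 3) ^ 2 := by
        rw [pow_two]
        exact Nat.mul_le_mul (by omega) (by omega)
      have h3 : big * t ≤ 20 * (z.S * (z.τ + 3) ^ 2) := by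
        calc big * t = 5 * (z.NI * (t * t)) := by rw [hbig]; ring
          _ ≤ 5 * (4 * z.S * (z.τ + 3) ^ 2) :=
            Nat.mul_le_mul_left 5 (Nat.mul_le_mul (by omega) h2)
          _ = _ := by ring
      have h4 : 0 < z.S * (z.τ + 3) ^ 2 := by positivity
      omega
    · have := Setting.k_le_depth (z := z)
      have := hs.k_pos
      omega
  · have hb := Base.of_mem hσ
    refine ⟨by simp [hb.NI, hb.t, hbig, ht], fun hi => ?_⟩
    change σ 50 < _ at hi
    have hid : σ 50 / t / t / 5 < z.NI := by
      have := hdiv _ hi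
      rw [Nat.div_lt_iff_lt_mul (by norm_num), Nat.div_lt_iff_lt_mul ht0]
      exact this
    have hid' : (exCell / vt / 5).eval (memAt H P l z 19) σ < z.NI := by
      simpa only [Ex.eval_div, Ex.eval_var, Ex.eval_ofNat, hb.t] using hid
    have hhit : exHit.eval (memAt H P l z 19) σ =
        if tr (σ 50 / t) = σ 50 % t + 1 then 1 else 0 := by
      rw [exHit, eval_exSame hs (by norm_num) hb
        (by rw [eval_exFrom (by norm_num) hid']; exact kindFrom_lt hs hid')
        (by rw [eval_exTo (by norm_num) hid']; exact kindTo_lt hs hid'),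
        eval_exFrom (by norm_num) hid', eval_exTo (by norm_num) hid']
      simp only [Ex.eval_div, Ex.eval_mod, Ex.eval_var, Ex.eval_ofNat, hb.t]
      rfl
    have hle := hdiv _ hi
    simp only [Ex.eval_add, Ex.eval_sub, Ex.eval_mul, Ex.eval_div, Ex.eval_mod, Ex.eval_var,
      Ex.eval_ofNat, Ex.eval_one, hhit, hb.t, hb.NI]
    change (big + σ 50 - _ * (big + σ 50 - σ 50 / t) =
        if tr (σ 50 / t) = σ 50 % t + 1 then σ 50 / t else big + σ 50) ∧
      (_ * (σ 50 % t + 1) = if tr (σ 50 / t) = σ 50 % t + 1 then σ 50 % t + 1 else 0)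
    split_ifs
    · rw [one_mul, one_mul]
      exact ⟨Nat.sub_sub_self (hle.le.trans (Nat.le_add_right _ _)), rfl⟩
    · simp
  · -- the processor of a hit is determined by the cell and by the value
    intro i hi j hj hij
    have h1 := hdiv i hi
    have h2 := hdiv j hj
    split_ifs at hij with h3 h4 h4
    · rw [hij] at h3
      rw [← Nat.div_add_mod i t, ← Nat.div_add_mod j t, hij]
      omega
    · omega
    · omega
    · omega
  · intro i _
    refine hs.lt_X' (Setting.le_W ?_)
    have := Nat.mod_lt i ht0
    split_ifs <;> omega
  · intro i hi
    change cut big tr _ = _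
    have h1 := hdiv i hi
    split_ifs with h2
    · rw [cut_of_lt h1, h2]
    · exact if_neg (by omega)
  · intro y hy
    rw [memAt_of_le (by norm_num) le_rfl]
    change cut big tr y = 0
    unfold cut
    split_ifs with h
    · by_contra h0
      obtain ⟨x, hx⟩ := Nat.exists_eq_succ_of_ne_zero h0
      have hxt : x < t := by have := htr y; omega
      have h1 : (y * t + x) / t = y := by
        rw [mul_comm, Nat.mul_add_div ht0, Nat.div_eq_of_lt hxt, add_zero]
      have h2 : (y * t + x) % t = x := by rw [mul_comm, Nat.mul_add_mod, Nat.mod_eq_of_lt hxt]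
      refine hy (y * t + x) ?_ ?_
      · have := Nat.mul_le_mul_right t h
        rw [Nat.succ_mul] at this
        omega
      · rw [h1, h2, if_pos hx]
    · rfl

variable (H P l z) in
/-- The part of the array of translations for one node and one pair of bags. -/
noncomputable def cellTransl (s id c x : ℕ) : ℕ :=
  memAt H P l z s 19 ((id * 5 + c) * (z.τ + 1) + x)

omit hX hB hs in
theorem eval_exTransl {s : ℕ} {σ : ℕ → ℕ} (hσ : Base z n fl σ) {kind : Ex} (c : ℕ)
    (hc : kind.eval (memAt H P l z s) σ = c) (x : Ex) :
    (exTransl (vi / vE) kind x).eval (memAt H P l z s) σ =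
      cellTransl H P l z s (σ 50 / z.E) c (x.eval (memAt H P l z s) σ) := by
  simp only [exTransl, cellTransl, Ex.eval_ld, Ex.eval_add, Ex.eval_mul, Ex.eval_div, Ex.eval_var,
    Ex.eval_ofNat, hσ.t, hσ.E, hc]

omit hX hB hs in
theorem eval_exLeaf {M : Mem} {σ : ℕ → ℕ} (hσ : Base z n fl σ) {id : Ex} :
    (exLeaf id).eval M σ = if z.isLeaf (id.eval M σ) then 1 else 0 := by
  simp only [exLeaf, Ex.eval_ifLt, Ex.eval_zero, Ex.eval_one, Ex.eval_mul, Ex.eval_var,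
    Ex.eval_ofNat, hσ.S, Sizes.isLeaf, decide_eq_true_eq]
  split_ifs <;> omega

omit hX hB in
theorem decA_lt {id d : ℕ} (hd : d < z.E) : (node H P l z id).decA z.τ d < 3 * z.E := by
  have htr : ∀ a b x, transl (bagList P l z a) (bagList P l z b) x ≤ z.τ + 1 := fun a b x =>
    (transl_le _).trans (hs.bag _).2
  unfold Node.decA
  split_ifs
  · exact leafA_lt hd (htr _ _) (htr _ _)
  · exact innerA_lt hd (htr _ _)

omit hX hB in
theorem decB_lt {id d : ℕ} (hd : d < z.E) : (node H P l z id).decB z.τ d < 3 * z.E := by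
  have htr : ∀ a b x, transl (bagList P l z a) (bagList P l z b) x ≤ z.τ + 1 := fun a b x =>
    (transl_le _).trans (hs.bag _).2
  unfold Node.decB
  split_ifs
  · exact leafB_lt hd (htr _ _)
  · exact innerB_lt hd (htr _ _) (htr _ _)

omit hX hB in
theorem NI_mul_E_le : z.NI * z.E ≤ 7 * (z.S * z.W) := by
  have := Setting.S_pos (z := z)
  have hNI : z.NI = 3 * z.S + 1 := rfl
  exact Setting.le_S_mul_W hs.E_le_W (by omega) le_rfl

omit hX hB in
theorem three_E_le : 3 * z.E ≤ 7 * (z.S * z.W) := by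
  have := Setting.S_pos (z := z)
  exact Setting.le_S_mul_W (a := 3) hs.E_le_W (by omega) le_rfl

theorem computes_decA : Computes B X n H P l z fl 20
    (par (vNI * vE) 20 vi (.ifEq (exLeaf (vi / vE)) 1
      (exLeafA vt vM (vi % vE) (exTransl (vi / vE) 0) (exTransl (vi / vE) 1))
      (exInnerA vt vM (vi % vE) (exTransl (vi / vE) 1)))) := by
  have hE : 0 < z.E := by change 0 < 11 * _ + 9; omega
  refine kernel hX hB hs 20 _ _ (z.NI * z.E) _ (by norm_num)
    ⟨by decide +kernel, by decide +kernel⟩ (by decide +kernel) rfl (NI_mul_E_le hs) ?_ ?_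
  · intro i _
    exact (decA_lt hs (Nat.mod_lt _ hE)).trans (hs.lt_X' (three_E_le hs))
  · intro σ hσ
    refine ⟨by simp [hσ.NI, hσ.E], fun hi => ?_⟩
    have hid : σ 50 / z.E < z.NI := by rwa [Nat.div_lt_iff_lt_mul hE]
    have hM : vM.eval (memAt H P l z 20) σ = numPairs (vt.eval (memAt H P l z 20) σ) := by
      rw [Ex.eval_var, Ex.eval_var, hσ.M, hσ.t]
    rw [Ex.eval_ifEq, eval_exLeaf hσ, eval_exLeafA hM (eval_exTransl hσ 0 rfl) (eval_exTransl hσ 1 rfl),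
      eval_exInnerA hM (eval_exTransl hσ 1 rfl)]
    simp only [Ex.eval_div, Ex.eval_mod, Ex.eval_var, Ex.eval_one, hσ.E, hσ.t]
    rw [Node.decA, show (node H P l z (σ 50 / z.E)).leaf = z.isLeaf (σ 50 / z.E) from rfl]
    split_ifs
    · exact leafA_congr (fun x hx => memAt_transl (by norm_num) hid (by norm_num) hx)
        fun x hx => memAt_transl (by norm_num) hid (by norm_num) hx
    · simp at *
    · simp at *
    · exact innerA_congr (by omega) fun x hx => memAt_transl (by norm_num) hid (by norm_num) hx

theorem computes_decB : Computes B X n H P l z fl 21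
    (par (vNI * vE) 21 vi (.ifEq (exLeaf (vi / vE)) 1
      (exLeafB vt vM (vi % vE) (.ld 10 (.ld 14 (vi / vE))) (.ld 10 (.ld 16 (vi / vE)))
        (exTransl (vi / vE) 2) (exTransl (vi / vE) 3) (exTransl (vi / vE) 4))
      (exInnerB vt vM (vi % vE) (exTransl (vi / vE) 0) (exTransl (vi / vE) 1)
        (.ld 10 (.ld 16 (vi / vE)))))) := by
  have hE : 0 < z.E := by change 0 < 11 * _ + 9; omega
  refine kernel hX hB hs 21 _ _ (z.NI * z.E) _ (by norm_num)
    ⟨by decide +kernel, by decide +kernel⟩ (by decide +kernel) rfl (NI_mul_E_le hs) ?_ ?_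
  · intro i _
    exact (decB_lt hs (Nat.mod_lt _ hE)).trans (hs.lt_X' (three_E_le hs))
  · intro σ hσ
    refine ⟨by simp [hσ.NI, hσ.E], fun hi => ?_⟩
    have hid : σ 50 / z.E < z.NI := by rwa [Nat.div_lt_iff_lt_mul hE]
    have hM : vM.eval (memAt H P l z 21) σ = numPairs (vt.eval (memAt H P l z 21) σ) := by
      rw [Ex.eval_var, Ex.eval_var, hσ.M, hσ.t]
    rw [Ex.eval_ifEq, eval_exLeaf hσ, eval_exLeafB hM (eval_exTransl hσ 2 rfl) (eval_exTransl hσ 3 rfl)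
      (eval_exTransl hσ 4 rfl),
      eval_exInnerB hM (eval_exTransl hσ 0 rfl) (eval_exTransl hσ 1 rfl)]
    have hbot := z.botBag_le (σ 50 / z.E)
    simp only [Ex.eval_div, Ex.eval_mod, Ex.eval_ld, Ex.eval_var, Ex.eval_one,
      hσ.E, hσ.t, memAt_botBag (show 14 < 21 by norm_num) hid,
      memAt_midBag (show 16 < 21 by norm_num) hid,
      memAt_bagSizes (show 10 < 21 by norm_num) (z.midBag_lt hs.le hid),
      memAt_bagSizes (show 10 < 21 by norm_num) (show z.botBag (σ 50 / z.E) < 2 * z.S + 2 by omega)]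
    rw [Node.decB, show (node H P l z (σ 50 / z.E)).leaf = z.isLeaf (σ 50 / z.E) from rfl]
    split_ifs
    · exact leafB_congr (hs.bag _).2
        (fun x hx => memAt_transl (by norm_num) hid (by norm_num) hx)
        (fun x hx => memAt_transl (by norm_num) hid (by norm_num) hx)
        fun x hx => memAt_transl (by norm_num) hid (by norm_num) hx
    · simp at *
    · simp at *
    · exact innerB_congr (fun x hx => memAt_transl (by norm_num) hid (by norm_num) hx)
        fun x hx => memAt_transl (by norm_num) hid (by norm_num) hx

end digits

end SubpathDP

/-! ### The wiring of the network -/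

namespace SubpathDP

open CREW Status Digit

theorem digitSum_succ_mod (g : ℕ → ℕ) (q E j x : ℕ) :
    digitSum g q E (j + 1) (x % E ^ (j + 1)) =
      digitSum g q E j (x % E ^ j) + g (x / E ^ j % E) * q ^ j := by
  rw [digitSum, Nat.mod_mod_of_dvd x (pow_dvd_pow E (Nat.le_succ j)), pow_succ,
    Nat.mod_mul_right_div_self]

theorem replaceLast_succ_mod (un : ℕ → Prop) [DecidablePred un] (U : ℕ → ℕ) (E j x : ℕ) :
    replaceLast un U E (j + 1) (x % E ^ (j + 1)) =
      if un (x / E ^ j % E) then x % E ^ j + U (x / E ^ j % E) * E ^ j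
      else replaceLast un U E j (x % E ^ j) + x / E ^ j % E * E ^ j := by
  rw [replaceLast, Nat.mod_mod_of_dvd x (pow_dvd_pow E (Nat.le_succ j)), pow_succ,
    Nat.mod_mul_right_div_self]

theorem digitSum_lt_of_digits {g : ℕ → ℕ} {q Q E : ℕ} (hg : ∀ d < E, g d < Q) (hq : q ≤ Q) (v : ℕ)
    {e : ℕ} (he : e < E ^ v) : digitSum g q E v e < Q ^ v := by
  induction v generalizing e with
  | zero => simp [digitSum]
  | succ v ih =>
    have h0 : 0 < E ^ v := Nat.pos_of_ne_zero fun h => by simp [pow_succ, h] at he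
    have h1 := ih (Nat.mod_lt e h0)
    have h2 := hg (e / E ^ v) (by rwa [Nat.div_lt_iff_lt_mul h0, mul_comm, ← pow_succ])
    have h3 := Nat.pow_le_pow_left hq v
    rw [digitSum, pow_succ]
    have h4 := Nat.mul_le_mul_right (Q ^ v) h2
    have h5 := Nat.mul_le_mul_left (g (e / E ^ v)) h3
    rw [Nat.succ_mul] at h4
    rw [mul_comm (Q ^ v)]
    omega

theorem replaceLast_lt_pow (un : ℕ → Prop) [DecidablePred un] {U : ℕ → ℕ} {E : ℕ}
    (hU : ∀ d < E, un d → U d < E) (k : ℕ) {e : ℕ} (he : e < E ^ k) :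
    replaceLast un U E k e < E ^ k := by
  induction k generalizing e with
  | zero => simp [replaceLast]
  | succ k ih =>
    have h0 : 0 < E ^ k := Nat.pos_of_ne_zero fun h => by simp [pow_succ, h] at he
    have h1 : e / E ^ k < E := by
      rw [Nat.div_lt_iff_lt_mul h0]
      rwa [pow_succ, mul_comm] at he
    have h2 := Nat.mod_lt e h0
    rw [replaceLast, pow_succ]
    split_ifs with h
    · nlinarith [Nat.mul_le_mul_right (E ^ k) (hU _ h1 h)]
    · nlinarith [Nat.mul_le_mul_right (E ^ k) h1, ih h2]

theorem first_lt {t d : ℕ} (ht : 0 < t) (hd : d < base t) (h : Undecided t d) : first t d < base t := by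
  change d < 11 * t + 9 at hd
  change _ < 11 * t + 9
  unfold Undecided at h
  unfold first
  have hM : numPairs t = 3 * t + 3 := rfl
  rw [hM] at h ⊢
  split_ifs <;> omega

theorem second_lt {t d : ℕ} (ht : 0 < t) (hd : d < base t) (h : Undecided t d) : second t d < base t := by
  change d < 11 * t + 9 at hd
  change _ < 11 * t + 9
  unfold Undecided at h
  unfold second
  have hM : numPairs t = 3 * t + 3 := rfl
  rw [hM] at h ⊢
  split_ifs <;> omega

/-- The current digit of the gate of a processor in a loop over digits. -/
abbrev exDig : Ex := vi % vW / .var 21 % vE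

/-- One for undecided digits, zero for the other ones. -/
def exUndecided (d : Ex) : Ex := .ifLt d vM 1 (.ifLt d (3 * vM) 0 (.ifLt (d - 3 * vM) vt 1 0))

/-- See `first`. -/
def exFirst (d : Ex) : Ex := .ifLt d vM (.ifEq d 1 (3 * vM) (d + vM))
  (.ifEq d (3 * vM) (1 + vM) (3 * vM + 2 * (d - 3 * vM)))

/-- See `second`. -/
def exSecond (d : Ex) : Ex := .ifLt d vM (.ifEq d 1 (3 * vM + 1) (d + 2 * vM))
  (.ifEq d (3 * vM) (1 + 2 * vM) (3 * vM + 2 * (d - 3 * vM) + 1))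

section wiring

variable {B X : ℕ} (hX : 2 ≤ X) (hB : X ^ degBound ≤ B)
  {k n : ℕ} {ι : Type*} {H : SimpleGraph (Fin k)} {G : SimpleGraph (Fin n)}
  {T : TreeDecomposition G ι} {P : Subpath T} {l : ι → List (Fin n)} {z : Sizes k} {fl : ℕ}
  (hs : Setting P l z X)

theorem eval_exUndecided {M : Mem} {σ : ℕ → ℕ} (hσ : Base z n fl σ) (d : Ex) :
    (exUndecided d).eval M σ = if Undecided (z.τ + 1) (d.eval M σ) then 1 else 0 := by
  simp only [exUndecided, Ex.eval_ifLt, Ex.eval_var, Ex.eval_sub, Ex.eval_mul, Ex.eval_zero,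
    Ex.eval_one, Ex.eval_ofNat, hσ.M, hσ.t]
  generalize d.eval M σ = e
  by_cases h : Undecided (z.τ + 1) e
  · rw [if_pos h]
    rcases h with h | ⟨h, h'⟩
    · rw [if_pos h]
    · rw [if_neg (by omega), if_neg (by omega), if_pos h']
  · rw [if_neg h]
    unfold Undecided at h
    rw [if_neg (by omega)]
    split_ifs <;> omega

theorem eval_exDig {M : Mem} {σ : ℕ → ℕ} (hσ : Base z n fl σ) {j : ℕ} (h21 : σ 21 = z.E ^ j) :
    exDig.eval M σ = σ 50 % z.W / z.E ^ j % z.E := by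
  simp only [Ex.eval_var, Ex.eval_div, Ex.eval_mod, hσ.W, hσ.E, h21]

theorem eval_exFirst {M : Mem} {σ : ℕ → ℕ} (hσ : Base z n fl σ) (d : Ex) :
    (exFirst d).eval M σ = first (z.τ + 1) (d.eval M σ) := by
  simp only [exFirst, first, Ex.eval_ifLt, Ex.eval_ifEq, Ex.eval_add, Ex.eval_sub, Ex.eval_mul,
    Ex.eval_one, Ex.eval_ofNat, Ex.eval_var, hσ.M]

theorem eval_exSecond {M : Mem} {σ : ℕ → ℕ} (hσ : Base z n fl σ) (d : Ex) :
    (exSecond d).eval M σ = second (z.τ + 1) (d.eval M σ) := by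
  simp only [exSecond, second, Ex.eval_ifLt, Ex.eval_ifEq, Ex.eval_add, Ex.eval_sub, Ex.eval_mul,
    Ex.eval_one, Ex.eval_ofNat, Ex.eval_var, hσ.M]

theorem NI_mul_W_le : z.NI * z.W ≤ 4 * (z.S * z.W) := by
  have := Setting.S_pos (z := z)
  have hNI : z.NI = 3 * z.S + 1 := rfl
  exact Setting.le_S_mul_W (a := z.NI) le_rfl (by omega) le_rfl

theorem E_pos : 0 < z.E := by change 0 < 11 * _ + 9; omega

include hs in
theorem pow_lt_X {j : ℕ} (hj : j ≤ k) : (3 * z.E) ^ j < X := by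
  have hW := Setting.W_pos (z := z)
  have h1 : (3 * z.E) ^ k ≤ z.W * z.W := by
    rw [mul_pow]
    exact Nat.mul_le_mul_right _ Setting.three_pow_le
  have h2 : (3 * z.E) ^ j ≤ (3 * z.E) ^ k := Nat.pow_le_pow_right (by have := E_pos (z := z); omega) hj
  refine hs.lt_X (a := 1) (b := z.W) (c := z.W) (d := 1) (Nat.le_add_left 1 _) le_rfl le_rfl hW ?_
  have : 0 < z.W * z.W := Nat.mul_pos hW hW
  rw [one_mul, mul_one]
  omega

section reads

variable {s : ℕ}

theorem memAt_decA (h : 20 < s) {id d : ℕ} (hi : id < z.NI) (hd : d < z.E) :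
    memAt H P l z s 20 (id * z.E + d) = (node H P l z id).decA z.τ d := by
  rw [memAt_of_lt h]
  refine (cut_of_lt (b := z.NI * z.E)
    (f := fun i => (node H P l z (i / z.E)).decA z.τ (i % z.E)) ?_).trans ?_
  · have := Nat.mul_le_mul_right z.E hi
    rw [Nat.succ_mul] at this
    omega
  · rw [mul_comm, Nat.mul_add_div E_pos, Nat.div_eq_of_lt hd, Nat.mul_add_mod,
      Nat.mod_eq_of_lt hd, add_zero]

theorem memAt_decB (h : 21 < s) {id d : ℕ} (hi : id < z.NI) (hd : d < z.E) :
    memAt H P l z s 21 (id * z.E + d) = (node H P l z id).decB z.τ d := by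
  rw [memAt_of_lt h]
  refine (cut_of_lt (b := z.NI * z.E)
    (f := fun i => (node H P l z (i / z.E)).decB z.τ (i % z.E)) ?_).trans ?_
  · have := Nat.mul_le_mul_right z.E hi
    rw [Nat.succ_mul] at this
    omega
  · rw [mul_comm, Nat.mul_add_div E_pos, Nat.div_eq_of_lt hd, Nat.mul_add_mod,
      Nat.mod_eq_of_lt hd, add_zero]

end reads

include hX hB hs

/-- An array with one sum over the digits of each gate. -/
theorem computes_digitSum (s : ℕ) (ev eq : Ex) (g : ℕ → ℕ → ℕ) (q : ℕ → ℕ) (h9 : 9 ≤ s)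
    (hdeg : (Ex.ld s vi + ev * eq).deg ≤ degBound)
    (hsize : (vNI * vW).size + (Ex.ld s vi + ev * eq).size + 5 ≤ kcost)
    (hf : table H P l z s =
      cut (z.NI * z.W) fun i => digitSum (g (i / z.W)) (q (i / z.W)) z.E k (i % z.W))
    (hg : ∀ id < z.NI, ∀ d < z.E, g id d < 3 * z.E) (hq : ∀ id, q id ≤ 3 * z.E)
    (hev : ∀ j, ∀ M : Mem, (∀ a < s, M a = memAt H P l z s a) → ∀ σ, Base z n fl σ →
      σ 21 = z.E ^ j → σ 22 = (z.τ + 3) ^ j → σ 50 / z.W < z.NI →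
      ev.eval M σ = g (σ 50 / z.W) (σ 50 % z.W / z.E ^ j % z.E) ∧
        eq.eval M σ = q (σ 50 / z.W) ^ j) :
    Computes B X n H P l z fl s (digits (par (vNI * vW) s vi (.ld s vi + ev * eq))) := by
  have hW := Setting.W_pos (z := z)
  have hE := E_pos (z := z)
  refine digits_kernel hX hB hs s _ _ (z.NI * z.W)
    (fun j i => digitSum (g (i / z.W)) (q (i / z.W)) z.E j (i % z.W % z.E ^ j)) h9
    ⟨by decide, hdeg⟩ hsize ?_ (NI_mul_W_le.trans (Nat.mul_le_mul_right _ (by norm_num))) ?_ ?_ ?_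
  · rw [hf]
    congr 1
    funext i
    rw [Nat.mod_mod]
  · intro i _
    rfl
  · intro j hj i hi
    have hi' : i / z.W < z.NI := by rwa [Nat.div_lt_iff_lt_mul hW]
    exact (digitSum_lt_of_digits (hg _ hi') (hq _) _ (Nat.mod_lt _ (Nat.pow_pos hE))).trans
      (pow_lt_X hs hj)
  · intro j hj M hM hM' σ hσ h21 h22 h23
    refine ⟨by simp [hσ.NI, hσ.W], fun hi => ?_⟩
    have hi' : σ 50 / z.W < z.NI := by rwa [Nat.div_lt_iff_lt_mul hW]
    obtain ⟨h1, h2⟩ := hev j M hM σ hσ h21 h22 hi'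
    rw [Ex.eval_add, Ex.eval_mul, Ex.eval_ld, Ex.eval_var, hM' _ hi, h1, h2, digitSum_succ_mod]

/-- An array with one replacement in each gate. -/
theorem computes_replaceLast (s : ℕ) (eU : Ex) (U : ℕ → ℕ) (h9 : 9 ≤ s)
    (hdeg : (Ex.ifEq (exUndecided exDig) 1 (vi % vW % .var 21 + eU * .var 21)
      (.ld s vi + exDig * .var 21)).deg ≤ degBound)
    (hsize : (vNI * vW).size + (Ex.ifEq (exUndecided exDig) 1 (vi % vW % .var 21 + eU * .var 21)
      (.ld s vi + exDig * .var 21)).size + 5 ≤ kcost)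
    (hf : table H P l z s =
      cut (z.NI * z.W) fun i => replaceLast (Undecided (z.τ + 1)) U z.E k (i % z.W))
    (hU : ∀ d < z.E, Undecided (z.τ + 1) d → U d < z.E)
    (hev : ∀ j, ∀ M : Mem, ∀ σ, Base z n fl σ → σ 21 = z.E ^ j →
      eU.eval M σ = U (σ 50 % z.W / z.E ^ j % z.E)) :
    Computes B X n H P l z fl s (digits (par (vNI * vW) s vi
      (.ifEq (exUndecided exDig) 1 (vi % vW % .var 21 + eU * .var 21)
        (.ld s vi + exDig * .var 21)))) := by
  have hW := Setting.W_pos (z := z)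
  have hE := E_pos (z := z)
  refine digits_kernel hX hB hs s _ _ (z.NI * z.W)
    (fun j i => replaceLast (Undecided (z.τ + 1)) U z.E j (i % z.W % z.E ^ j)) h9
    ⟨by decide, hdeg⟩ hsize ?_ (NI_mul_W_le.trans (Nat.mul_le_mul_right _ (by norm_num))) ?_ ?_ ?_
  · rw [hf]
    congr 1
    funext i
    rw [Nat.mod_mod]
  · intro i _
    rfl
  · intro j hj i hi
    refine (replaceLast_lt_pow _ hU _ (Nat.mod_lt _ (Nat.pow_pos hE))).trans_le ?_
    refine le_trans ?_ (pow_lt_X hs hj).le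
    exact Nat.pow_le_pow_left (by omega) _
  · intro j hj M hM hM' σ hσ h21 h22 h23
    refine ⟨by simp [hσ.NI, hσ.W], fun hi => ?_⟩
    have h1 := eval_exDig (M := M) hσ h21
    rw [Ex.eval_ifEq, eval_exUndecided hσ, Ex.eval_add, Ex.eval_add, Ex.eval_mul, Ex.eval_mul,
      Ex.eval_ld, Ex.eval_var (i := 50), hM' _ hi, h1, hev j M σ hσ h21, replaceLast_succ_mod]
    simp only [Ex.eval_mod, Ex.eval_var, hσ.W, h21, Ex.eval_one]
    split_ifs <;> simp_all

theorem computes_sumA : Computes B X n H P l z fl 22 (digits (par (vNI * vW) 22 vi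
    (.ld 22 vi + .ld 20 (vi / vW * vE + exDig) *
      .ifEq (exLeaf (vi / vW)) 1 (.var 22) (.var 21)))) := by
  refine computes_digitSum hX hB hs 22 _ _ (fun id => (node H P l z id).decA z.τ)
    (fun id => (node H P l z id).opBase z.τ) (by norm_num) (by decide +kernel) (by decide +kernel) rfl
    (fun id _ d hd => decA_lt hs hd) ?_ ?_
  · intro id
    unfold Node.opBase
    change _ ≤ 3 * (11 * (z.τ + 1) + 9)
    split_ifs
    · omega
    · change 11 * (z.τ + 1) + 9 ≤ _; omega
  · intro j M hM σ hσ h21 h22 hi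
    rw [Ex.eval_ifEq, eval_exLeaf hσ, Ex.eval_ld, hM 20 (by norm_num), Ex.eval_add,
      eval_exDig hσ h21]
    simp only [Ex.eval_mul, Ex.eval_div, Ex.eval_var, Ex.eval_one, hσ.W, hσ.E, h21, h22]
    rw [memAt_decA (by norm_num) hi (Nat.mod_lt _ E_pos), Node.opBase,
      show (node H P l z (σ 50 / z.W)).leaf = z.isLeaf (σ 50 / z.W) from rfl]
    refine ⟨rfl, ?_⟩
    split_ifs <;> simp_all

theorem computes_sumB : Computes B X n H P l z fl 23 (digits (par (vNI * vW) 23 vi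
    (.ld 23 vi + (.ld 21 (vi / vW * vE + exDig) - 1) *
      .ifEq (exLeaf (vi / vW)) 1 (.var 22) (.var 21)))) := by
  refine computes_digitSum hX hB hs 23 _ _ (fun id d => (node H P l z id).decB z.τ d - 1)
    (fun id => (node H P l z id).opBase z.τ) (by norm_num) (by decide +kernel) (by decide +kernel) rfl
    (fun id _ d hd => (Nat.sub_le _ _).trans_lt (decB_lt hs hd)) ?_ ?_
  · intro id
    unfold Node.opBase
    change _ ≤ 3 * (11 * (z.τ + 1) + 9)
    split_ifs
    · omega
    · change 11 * (z.τ + 1) + 9 ≤ _; omega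
  · intro j M hM σ hσ h21 h22 hi
    rw [Ex.eval_ifEq, eval_exLeaf hσ, Ex.eval_sub, Ex.eval_ld, hM 21 (by norm_num), Ex.eval_add,
      eval_exDig hσ h21]
    simp only [Ex.eval_mul, Ex.eval_div, Ex.eval_var, Ex.eval_one, hσ.W, hσ.E, h21, h22]
    rw [memAt_decB (by norm_num) hi (Nat.mod_lt _ E_pos), Node.opBase,
      show (node H P l z (σ 50 / z.W)).leaf = z.isLeaf (σ 50 / z.W) from rfl]
    refine ⟨rfl, ?_⟩
    split_ifs <;> simp_all

theorem computes_impossible : Computes B X n H P l z fl 24 (digits (par (vNI * vW) 24 vi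
    (.ld 24 vi + .ifEq (.ld 21 (vi / vW * vE + exDig)) 0 1 0 * 1))) := by
  have hE := E_pos (z := z)
  refine computes_digitSum hX hB hs 24 _ _
    (fun id d => if (node H P l z id).decB z.τ d = 0 then 1 else 0)
    (fun id => 1) (by norm_num) (by decide +kernel) (by decide +kernel) rfl
    (fun id _ d hd => by split_ifs <;> omega) (fun id => by omega) ?_
  · intro j M hM σ hσ h21 h22 hi
    rw [Ex.eval_ifEq, Ex.eval_ld, hM 21 (by norm_num), Ex.eval_add, eval_exDig hσ h21]
    simp only [Ex.eval_mul, Ex.eval_div, Ex.eval_var, Ex.eval_one, Ex.eval_zero, hσ.W, hσ.E]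
    rw [memAt_decB (by norm_num) hi (Nat.mod_lt _ E_pos)]
    exact ⟨rfl, (one_pow _).symm⟩

theorem computes_undecided : Computes B X n H P l z fl 25 (digits (par (vNI * vW) 25 vi
    (.ld 25 vi + exUndecided exDig * 1))) := by
  have hE := E_pos (z := z)
  refine computes_digitSum hX hB hs 25 _ _ (fun _ d => if Undecided (z.τ + 1) d then 1 else 0)
    (fun id => 1) (by norm_num) (by decide +kernel) (by decide +kernel) rfl
    (fun id _ d hd => by split_ifs <;> omega) (fun id => by omega) ?_
  · intro j M hM σ hσ h21 h22 hi
    rw [eval_exUndecided hσ, eval_exDig hσ h21]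
    exact ⟨rfl, (one_pow _).symm⟩

theorem computes_first : Computes B X n H P l z fl 26 (digits (par (vNI * vW) 26 vi
    (.ifEq (exUndecided exDig) 1 (vi % vW % .var 21 + exFirst exDig * .var 21)
      (.ld 26 vi + exDig * .var 21)))) := by
  refine computes_replaceLast hX hB hs 26 _ (first (z.τ + 1)) (by norm_num) (by decide +kernel)
    (by decide +kernel) rfl ?_ ?_
  · exact fun d hd h => first_lt (Nat.succ_pos _) hd h
  · intro j M σ hσ h21
    rw [eval_exFirst hσ, eval_exDig hσ h21]

theorem computes_second : Computes B X n H P l z fl 27 (digits (par (vNI * vW) 27 vi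
    (.ifEq (exUndecided exDig) 1 (vi % vW % .var 21 + exSecond exDig * .var 21)
      (.ld 27 vi + exDig * .var 21)))) := by
  refine computes_replaceLast hX hB hs 27 _ (second (z.τ + 1)) (by norm_num) (by decide +kernel)
    (by decide +kernel) rfl ?_ ?_
  · exact fun d hd h => second_lt (Nat.succ_pos _) hd h
  · intro j M σ hσ h21
    rw [eval_exSecond hσ, eval_exDig hσ h21]

end wiring

end SubpathDP

/-! ### Partial matches and initial values -/

namespace SubpathDP

open CREW Status Digit

/-- See `badPair`. The number of the bag is in `j`, the digits of `u` and `v` are in `du` and `dv`. -/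
def exBadPair (j u v du dv : Ex) : Ex :=
  .ifLt du vt
    (.ifEq u v (.ifLt du (.ld 10 j) 0 1)
      (.ifLt dv vt
        (.ifEq du dv 1 (.ifEq (.ld 1 (u * vk + v)) 0 0
          (1 - .ld 2 (.ld 11 (j * vt + du) * vn + .ld 11 (j * vt + dv)))))
        0))
    0

/-- See `convDigit`. -/
def exConv (d : Ex) : Ex := .ifLt d vt (3 + d) (.ifEq d vt 1 0)

section start

variable {B X : ℕ} (hX : 2 ≤ X) (hB : X ^ degBound ≤ B)
  {k n : ℕ} {ι : Type*} {H : SimpleGraph (Fin k)} {G : SimpleGraph (Fin n)}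
  {T : TreeDecomposition G ι} {P : Subpath T} {l : ι → List (Fin n)} {z : Sizes k} {fl : ℕ}
  (hs : Setting P l z X)

theorem N_pos : 0 < z.N := Nat.pow_pos (by omega)

theorem eval_exConv {M : Mem} {σ : ℕ → ℕ} (hσ : Base z n fl σ) (d : Ex) :
    (exConv d).eval M σ = convDigit z.τ (d.eval M σ) := by
  simp only [exConv, convDigit, Ex.eval_ifLt, Ex.eval_ifEq, Ex.eval_add, Ex.eval_zero,
    Ex.eval_one, Ex.eval_ofNat, Ex.eval_var, hσ.t]

theorem badPair_le_one {X : List (Fin n)} {τ c u v : ℕ} : badPair H G τ X c u v ≤ 1 := by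
  unfold badPair
  split_ifs <;> omega

section reads

variable {s : ℕ}

theorem memAt_sumA (h : 22 < s) {i : ℕ} (hi : i < z.NI * z.W) :
    memAt H P l z s 22 i = digitSum ((node H P l z (i / z.W)).decA z.τ)
      ((node H P l z (i / z.W)).opBase z.τ) z.E k (i % z.W) := by
  rw [memAt_of_lt h]
  exact if_pos hi

theorem memAt_sumB (h : 23 < s) {i : ℕ} (hi : i < z.NI * z.W) :
    memAt H P l z s 23 i = digitSum (fun d => (node H P l z (i / z.W)).decB z.τ d - 1)
      ((node H P l z (i / z.W)).opBase z.τ) z.E k (i % z.W) := by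
  rw [memAt_of_lt h]
  exact if_pos hi

theorem memAt_impossible (h : 24 < s) {i : ℕ} (hi : i < z.NI * z.W) :
    memAt H P l z s 24 i = (node H P l z (i / z.W)).impossible z.τ (i % z.W) := by
  rw [memAt_of_lt h]
  exact if_pos hi

theorem memAt_undecided (h : 25 < s) {i : ℕ} (hi : i < z.NI * z.W) :
    memAt H P l z s 25 i = Node.undecided k z.τ (i % z.W) := by
  rw [memAt_of_lt h]
  exact if_pos hi

theorem memAt_first (h : 26 < s) {i : ℕ} (hi : i < z.NI * z.W) :
    memAt H P l z s 26 i =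
      replaceLast (Undecided (z.τ + 1)) (first (z.τ + 1)) z.E k (i % z.W) := by
  rw [memAt_of_lt h]
  exact if_pos hi

theorem memAt_second (h : 27 < s) {i : ℕ} (hi : i < z.NI * z.W) :
    memAt H P l z s 27 i =
      replaceLast (Undecided (z.τ + 1)) (second (z.τ + 1)) z.E k (i % z.W) := by
  rw [memAt_of_lt h]
  exact if_pos hi

theorem memAt_badPairs (h : 28 < s) {i u : ℕ} (hi : i < (z.p + 2) * z.N) (hu : u < k) :
    memAt H P l z s 28 (i * k + u) = ∑ v ∈ Finset.range k,
      badPair H G z.τ (bagList P l z (i / z.N)) (i % z.N) u v := by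
  have hk : 0 < k := by omega
  have h1 : (i * k + u) / k = i := by
    rw [mul_comm, Nat.mul_add_div hk, Nat.div_eq_of_lt hu, add_zero]
  have h2 : (i * k + u) % k = u := by rw [mul_comm, Nat.mul_add_mod, Nat.mod_eq_of_lt hu]
  rw [memAt_of_lt h]
  refine (cut_of_lt (b := (z.p + 2) * z.N * k) (f := fun i => ∑ v ∈ Finset.range k,
    badPair H G z.τ (bagList P l z (i / k / z.N)) (i / k % z.N) (i % k) v) ?_).trans ?_
  · have := Nat.mul_le_mul_right k hi
    rw [Nat.succ_mul] at this
    omega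
  · simp only [h1, h2]

theorem memAt_badSum (h : 29 < s) {i : ℕ} (hi : i < (z.p + 2) * z.N) :
    memAt H P l z s 29 i = badSum H G z.τ (bagList P l z (i / z.N)) (i % z.N) := by
  rw [memAt_of_lt h]
  exact if_pos hi

end reads

theorem node_opA (id : ℕ) : (node H P l z id).opA = z.opA id := rfl

theorem node_opB (id : ℕ) : (node H P l z id).opB = z.opB id := rfl

theorem S_mul_W_le : z.S * z.W ≤ z.S * (z.W * z.W) :=
  Nat.mul_le_mul_left _ (Nat.le_mul_of_pos_right _ Setting.W_pos)

theorem pow_le_S : (3 * z.E) ^ k ≤ z.S * (z.W * z.W) := by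
  rw [mul_pow]
  exact (Nat.mul_le_mul_right _ Setting.three_pow_le).trans
    (Nat.le_mul_of_pos_left _ Setting.S_pos)

theorem opBase_le (id : ℕ) : (node H P l z id).opBase z.τ ≤ 3 * z.E := by
  unfold Node.opBase
  change _ ≤ 3 * (11 * (z.τ + 1) + 9)
  split_ifs
  · omega
  · change 11 * (z.τ + 1) + 9 ≤ _; omega

include hs

theorem pm_le {c : ℕ} (hc : c ≤ z.W) : (z.p + 2) * c ≤ 2 * (z.S * z.W) := by
  have := hs.le
  have := Setting.S_pos (z := z)
  exact Setting.le_S_mul_W hc (a := z.p + 2) (by omega) le_rfl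

theorem NI_mul_W_W_le {x : ℕ} (hx : x ≤ 7 * (z.S * (z.W * z.W))) : x < X := by
  have hW := Setting.W_pos (z := z)
  have hS := Setting.S_pos (z := z)
  refine hs.lt_X (a := z.S) (b := z.W) (c := z.W) (d := 1) ?_ le_rfl le_rfl hW ?_
  · have : z.NI = 3 * z.S + 1 := rfl
    omega
  · have := Nat.mul_pos hS (Nat.mul_pos hW hW)
    rw [mul_one, mul_assoc]
    omega

theorem src₁_lt {i : ℕ} (hi : i < z.NI * z.W) :
    (node H P l z (i / z.W)).src₁ z.τ (i / z.W * z.W) (i % z.W) < X := by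
  have hW := Setting.W_pos (z := z)
  have hE := E_pos (z := z)
  have hi' : i / z.W < z.NI := by rwa [Nat.div_lt_iff_lt_mul hW]
  have h0 := S_mul_W_le (z := z)
  have h1 := z.opA_le hs.le hi'
  have h2 := Nat.mul_le_mul_left z.S (Setting.N_le_W hs)
  have h3 := Nat.mul_le_mul_right z.W (Setting.S_pos (z := z))
  rw [mul_assoc] at h1
  have h4 : i / z.W * z.W + z.W ≤ z.NI * z.W := by
    rw [← Nat.succ_mul]
    exact Nat.mul_le_mul_right _ hi'
  have h5 := NI_mul_W_le (z := z)
  have h6 := Nat.mod_lt i hW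
  refine NI_mul_W_W_le hs ?_
  unfold Node.src₁
  rw [node_opA]
  split_ifs
  · have := digitSum_lt_of_digits (g := (node H P l z (i / z.W)).decA z.τ) (Q := 3 * z.E)
      (fun d hd => decA_lt hs hd) (opBase_le (H := H) (P := P) (l := l) (i / z.W)) k h6
    have h7 := pow_le_S (z := z)
    change z.opA (i / z.W) + digitSum _ _ z.E k _ ≤ _
    omega
  · omega
  · have := replaceLast_lt_pow (Undecided (z.τ + 1)) (U := first (z.τ + 1)) (E := z.E)
      (fun d hd h => first_lt (Nat.succ_pos _) hd h) k h6
    change _ < z.W at this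
    change _ + replaceLast _ _ z.E k _ ≤ _
    omega

theorem src₂_lt {i : ℕ} (hi : i < z.NI * z.W) :
    (node H P l z (i / z.W)).src₂ z.τ (i / z.W * z.W) (i % z.W) < X := by
  have hW := Setting.W_pos (z := z)
  have hE := E_pos (z := z)
  have hi' : i / z.W < z.NI := by rwa [Nat.div_lt_iff_lt_mul hW]
  have h0 := S_mul_W_le (z := z)
  have h1 := z.opB_le hs.le hi'
  have h2 := Nat.mul_le_mul_left z.S (Setting.N_le_W hs)
  have h3 := Nat.mul_le_mul_right z.W (Setting.S_pos (z := z))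
  rw [mul_assoc] at h1
  have h4 : i / z.W * z.W + z.W ≤ z.NI * z.W := by
    rw [← Nat.succ_mul]
    exact Nat.mul_le_mul_right _ hi'
  have h5 := NI_mul_W_le (z := z)
  have h6 := Nat.mod_lt i hW
  refine NI_mul_W_W_le hs ?_
  unfold Node.src₂
  rw [node_opB]
  split_ifs
  · have := digitSum_lt_of_digits (g := fun d => (node H P l z (i / z.W)).decB z.τ d - 1)
      (Q := 3 * z.E) (fun d hd => (Nat.sub_le _ _).trans_lt (decB_lt hs hd))
      (opBase_le (H := H) (P := P) (l := l) (i / z.W)) k h6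
    have h7 := pow_le_S (z := z)
    change z.opB (i / z.W) + digitSum _ _ z.E k _ ≤ _
    omega
  · omega
  · have := replaceLast_lt_pow (Undecided (z.τ + 1)) (U := second (z.τ + 1)) (E := z.E)
      (fun d hd h => second_lt (Nat.succ_pos _) hd h) k h6
    change _ < z.W at this
    change _ + replaceLast _ _ z.E k _ ≤ _
    omega

include hX hB

theorem computes_badPairs : Computes B X n H P l z fl 28 (digits (par ((vp + 2) * vN * vk) 28 vi
    (.ld 28 vi + exBadPair (vi / vk / vN) (vi % vk) (.var 23)
      (vi / vk % vN / .ld 9 (vi % vk) % vb) (vi / vk % vN / .var 22 % vb)))) := by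
  have hN := N_pos (z := z)
  have hk := hs.k_pos
  refine digits_kernel hX hB hs 28 _ _ ((z.p + 2) * z.N * k)
    (fun j i => ∑ v ∈ Finset.range j,
      badPair H G z.τ (bagList P l z (i / k / z.N)) (i / k % z.N) (i % k) v) (by norm_num)
    ⟨by decide +kernel, by decide +kernel⟩ (by decide +kernel) rfl ?_ (fun _ _ => rfl) ?_ ?_
  · rw [mul_assoc]
    exact (pm_le hs Setting.N_mul_le).trans (Nat.mul_le_mul_right _ (by norm_num))
  · intro j hj i hi
    refine hs.lt_X' (Setting.le_W (le_trans ?_ Setting.k_le_W))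
    refine (Finset.sum_le_card_nsmul _ _ 1 fun v _ => badPair_le_one).trans ?_
    simpa using hj
  · intro j hj M hM hM' σ hσ h21 h22 h23
    refine ⟨by simp [hσ.p, hσ.N, hσ.k], fun hi => ?_⟩
    have hu : σ 50 % k < k := Nat.mod_lt _ hk
    have hj' : σ 50 / k / z.N < z.p + 2 := by
      rwa [Nat.div_lt_iff_lt_mul hN, Nat.div_lt_iff_lt_mul hk]
    have hj'' : σ 50 / k / z.N < 2 * z.S + 2 := by have := hs.le; omega
    rw [Finset.sum_range_succ, ← hM' _ hi]
    have r9 := memAt_powers (H := H) (P := P) (l := l) (z := z) (show 9 < 28 by norm_num) hu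
    have a1 : inputMem H T z.τ l P 1 = adjArray H := rfl
    have a2 : inputMem H T z.τ l P 2 = adjArray G := rfl
    have r10 := memAt_bagSizes (H := H) (P := P) (l := l) (show 10 < 28 by norm_num) hj''
    have r11 := fun {x} => memAt_bags (H := H) (P := P) (l := l) (x := x)
      (show 11 < 28 by norm_num) hj''
    simp only [Ex.eval_add, Ex.eval_ld, Ex.eval_var, exBadPair, Ex.eval_ifLt, Ex.eval_ifEq,
      Ex.eval_sub, Ex.eval_mul, Ex.eval_div, Ex.eval_mod, Ex.eval_zero, Ex.eval_one, hσ.k, hσ.N,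
      hσ.b, hσ.t, hσ.n, h22, h23, hM 9 (by norm_num), hM 10 (by norm_num), hM 11 (by norm_num),
      hM 1 (by norm_num), hM 2 (by norm_num), memAt_input (show 1 < 9 by norm_num),
      memAt_input (show 2 < 9 by norm_num), r9, r10, a1, a2]
    congr 1
    unfold badPair
    split_ifs with h1 h2 h3 h4 h5 h6
    · rfl
    · rfl
    · rfl
    · rfl
    · rw [r11 h1, r11 h4]
    · rfl
    · rfl

theorem computes_badSum : Computes B X n H P l z fl 29 (digits (par ((vp + 2) * vN) 29 vi
    (.ld 29 vi + .ld 28 (vi * vk + .var 23)))) := by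
  have hk := hs.k_pos
  refine digits_kernel hX hB hs 29 _ _ ((z.p + 2) * z.N)
    (fun j i => ∑ u ∈ Finset.range j, ∑ v ∈ Finset.range k,
      badPair H G z.τ (bagList P l z (i / z.N)) (i % z.N) u v) (by norm_num)
    ⟨by decide +kernel, by decide +kernel⟩ (by decide +kernel) rfl ?_ (fun _ _ => rfl) ?_ ?_
  · exact (pm_le hs hs.N_le_W).trans (Nat.mul_le_mul_right _ (by norm_num))
  · intro j hj i hi
    have hW := Setting.W_pos (z := z)
    have h1 : ∀ u ∈ Finset.range (j + 1), ∑ v ∈ Finset.range k,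
        badPair H G z.τ (bagList P l z (i / z.N)) (i % z.N) u v ≤ k := fun u _ => by
      refine (Finset.sum_le_card_nsmul _ _ 1 fun v _ => badPair_le_one).trans ?_
      simp
    refine NI_mul_W_W_le hs ((Finset.sum_le_card_nsmul _ _ k h1).trans ?_)
    rw [Finset.card_range, smul_eq_mul]
    have h2 := Nat.mul_le_mul ((Nat.succ_le_of_lt hj).trans (Setting.k_le_W (z := z))) (Setting.k_le_W (z := z))
    have h3 := Nat.le_mul_of_pos_left (z.W * z.W) (Setting.S_pos (z := z))
    have h4 : (j + 1) * k ≤ z.W * z.W := h2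
    omega
  · intro j hj M hM hM' σ hσ h21 h22 h23
    refine ⟨by simp [hσ.p, hσ.N], fun hi => ?_⟩
    rw [Finset.sum_range_succ, ← hM' _ hi]
    simp only [Ex.eval_add, Ex.eval_ld, Ex.eval_mul, Ex.eval_var, hσ.k, h23, hM 28 (by norm_num),
      memAt_badPairs (H := H) (P := P) (l := l) (show 28 < 29 by norm_num) hi hj]

theorem computes_src₁ : Computes B X n H P l z fl 30 (par (vNI * vW) 30 vi
    (.ifEq (.ld 25 vi) 0 (.ifEq (.ld 24 vi) 0 (.ld 17 (vi / vW) + .ld 22 vi) vi)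
      (vi / vW * vW + .ld 26 vi))) := by
  have hW := Setting.W_pos (z := z)
  refine kernel hX hB hs 30 _ _ (z.NI * z.W) _ (by norm_num)
    ⟨by decide, by decide⟩ (by decide) rfl
    (NI_mul_W_le.trans (Nat.mul_le_mul_right _ (by norm_num))) (fun i hi => src₁_lt hs hi) ?_
  intro σ hσ
  refine ⟨by simp [hσ.NI, hσ.W], fun hi => ?_⟩
  have hi' : σ 50 / z.W < z.NI := by rwa [Nat.div_lt_iff_lt_mul hW]
  simp only [Ex.eval_ifEq, Ex.eval_ld, Ex.eval_var, Ex.eval_add, Ex.eval_mul, Ex.eval_div,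
    Ex.eval_zero, hσ.W, memAt_undecided (show 25 < 30 by norm_num) hi,
    memAt_impossible (show 24 < 30 by norm_num) hi, memAt_opA (show 17 < 30 by norm_num) hi',
    memAt_sumA (show 22 < 30 by norm_num) hi, memAt_first (show 26 < 30 by norm_num) hi]
  unfold Node.src₁
  rw [Nat.div_add_mod', node_opA]

theorem computes_src₂ : Computes B X n H P l z fl 31 (par (vNI * vW) 31 vi
    (.ifEq (.ld 25 vi) 0 (.ifEq (.ld 24 vi) 0 (.ld 18 (vi / vW) + .ld 23 vi) vi)
      (vi / vW * vW + .ld 27 vi))) := by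
  have hW := Setting.W_pos (z := z)
  refine kernel hX hB hs 31 _ _ (z.NI * z.W) _ (by norm_num)
    ⟨by decide, by decide⟩ (by decide) rfl
    (NI_mul_W_le.trans (Nat.mul_le_mul_right _ (by norm_num))) (fun i hi => src₂_lt hs hi) ?_
  intro σ hσ
  refine ⟨by simp [hσ.NI, hσ.W], fun hi => ?_⟩
  have hi' : σ 50 / z.W < z.NI := by rwa [Nat.div_lt_iff_lt_mul hW]
  simp only [Ex.eval_ifEq, Ex.eval_ld, Ex.eval_var, Ex.eval_add, Ex.eval_mul, Ex.eval_div,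
    Ex.eval_zero, hσ.W, memAt_undecided (show 25 < 31 by norm_num) hi,
    memAt_impossible (show 24 < 31 by norm_num) hi, memAt_opB (show 18 < 31 by norm_num) hi',
    memAt_sumB (show 23 < 31 by norm_num) hi, memAt_second (show 27 < 31 by norm_num) hi]
  unfold Node.src₂
  rw [Nat.div_add_mod', node_opB]

theorem computes_thr : Computes B X n H P l z fl 32
    (par (vNI * vW) 32 vi (.ifEq (.ld 25 vi) 0 1 0)) := by
  refine kernel hX hB hs 32 _ _ (z.NI * z.W) _ (by norm_num)
    ⟨by decide, by decide⟩ (by decide) rfl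
    (NI_mul_W_le.trans (Nat.mul_le_mul_right _ (by norm_num))) (fun i hi => ?_) ?_
  · unfold Node.thr
    split_ifs <;> omega
  intro σ hσ
  refine ⟨by simp [hσ.NI, hσ.W], fun hi => ?_⟩
  simp only [Ex.eval_ifEq, Ex.eval_ld, Ex.eval_var, Ex.eval_zero, Ex.eval_one,
    memAt_undecided (show 25 < 32 by norm_num) hi, Node.thr]

theorem computes_conv : Computes B X n H P l z fl 33 (digits (par vN 33 vi
    (.ld 33 vi + exConv (vi / .var 22 % vb) * .var 21))) := by
  have hW := Setting.W_pos (z := z)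
  have hE : z.E = 11 * (z.τ + 1) + 9 := rfl
  refine digits_kernel hX hB hs 33 _ _ z.N
    (fun j c => digitSum (convDigit z.τ) z.E (z.τ + 3) j (c % (z.τ + 3) ^ j)) (by norm_num)
    ⟨by decide, by decide⟩ (by decide) ?_ (Setting.le_W hs.N_le_W) (fun _ _ => rfl) ?_ ?_
  · funext c
    change cut z.N _ c = _
    unfold cut
    split_ifs with hc
    · exact congrArg _ (Nat.mod_eq_of_lt hc).symm
    · rfl
  · intro j hj i hi
    have h1 := digitSum_lt_of_digits (g := convDigit z.τ) (q := z.E) (Q := 3 * z.E)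
      (E := z.τ + 3) (fun d hd => by unfold convDigit; split_ifs <;> omega) (by omega) (j + 1)
      (Nat.mod_lt i (Nat.pow_pos (by omega)))
    exact h1.trans (pow_lt_X hs hj)
  · intro j hj M hM hM' σ hσ h21 h22 h23
    refine ⟨by simp [hσ.N], fun hi => ?_⟩
    rw [Ex.eval_add, Ex.eval_mul, eval_exConv hσ, digitSum_succ_mod]
    simp only [Ex.eval_ld, Ex.eval_var, Ex.eval_mod, Ex.eval_div, hM' _ hi, h21, h22, hσ.b]

end start

end SubpathDP

/-! ### The evaluation of the network -/

namespace SubpathDP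

open CREW Status Digit

/-- See `startGates`. -/
def exStart : Ex :=
  .ifLt vi vTab (.ifEq vi (2 * vS * vW) 1 0)
    (.ifLt vi vPm
      (.ifEq vfl 0
        (.ifEq ((vi - vTab) / vN) 0 (.ifEq ((vi - vTab) % vN) (vN - 1) 1 0)
          (.ifEq ((vi - vTab) / vN) vp (.ifEq ((vi - vTab) % vN) (vN - 1) 1 0)
            (.ld 7 (vi - vTab))))
        (.ld 7 (vi - vTab)))
      (.ifEq (.ld 29 (vi - vPm)) 0 1 0))

/-- The next value of the gate at the address `a`. -/
def exNext (a : Ex) : Ex :=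
  .ifLt (.ld 32 a) (.ld 34 (.ld 30 a) + .ld 34 (.ld 31 a)) 1 0

/-- The evaluation of the gates at the addresses `a` of `T` processors, repeated `e` times. -/
def sweepLoop (e T a : Ex) : Prog := rep 24 e (par T 34 a (exNext a))

section network

variable {B X : ℕ} (hX : 2 ≤ X) (hB : X ^ degBound ≤ B)
  {k n : ℕ} {ι : Type*} {H : SimpleGraph (Fin k)} {G : SimpleGraph (Fin n)}
  {T : TreeDecomposition G ι} {P : Subpath T} {l : ι → List (Fin n)} {z : Sizes k} {fl : ℕ}
  (hs : Setting P l z X)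

section reads

variable {s : ℕ}

theorem memAt_src₁ (h : 30 < s) {i : ℕ} (hi : i < z.NI * z.W) :
    memAt H P l z s 30 i = (node H P l z (i / z.W)).src₁ z.τ (i / z.W * z.W) (i % z.W) := by
  rw [memAt_of_lt h]
  exact if_pos hi

theorem memAt_src₂ (h : 31 < s) {i : ℕ} (hi : i < z.NI * z.W) :
    memAt H P l z s 31 i = (node H P l z (i / z.W)).src₂ z.τ (i / z.W * z.W) (i % z.W) := by
  rw [memAt_of_lt h]
  exact if_pos hi

theorem memAt_thr (h : 32 < s) {i : ℕ} (hi : i < z.NI * z.W) :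
    memAt H P l z s 32 i = Node.thr k z.τ (i % z.W) := by
  rw [memAt_of_lt h]
  exact if_pos hi

theorem memAt_conv (h : 33 < s) {c : ℕ} (hc : c < z.N) :
    memAt H P l z s 33 c = digitSum (convDigit z.τ) z.E (z.τ + 3) k c := by
  rw [memAt_of_lt h]
  exact if_pos hc

end reads

theorem startGates_le_one (a : ℕ) : startGates H P l z a ≤ 1 := by
  have h7 : ∀ x, inputMem H T z.τ l P 7 x ≤ 1 := fun x => by
    simp only [inputMem]
    split_ifs
    · exact validTable_le_one H _ _
    · omega
  unfold startGates
  split_ifs <;> first | omega | exact h7 _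

theorem gates_le_one (t a : ℕ) : gates H P l z (startGates H P l z) t a ≤ 1 := by
  induction t generalizing a with
  | zero => exact startGates_le_one a
  | succ t ih =>
    unfold gates sweep Node.next
    split_ifs <;> first | omega | exact ih a

variable (H P l z) in
/-- The memory after `t` steps of the network. -/
noncomputable def gateMem (t : ℕ) : Mem :=
  Function.update (memAt H P l z 34) 34 (gates H P l z (startGates H P l z) t)

theorem gateMem_zero : gateMem H P l z 0 = memAt H P l z 35 := update_memAt

theorem gateMem_of_ne {t a : ℕ} (h : a ≠ 34) : gateMem H P l z t a = memAt H P l z 34 a :=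
  Function.update_of_ne h _ _

theorem gateMem_self {t : ℕ} :
    gateMem H P l z t 34 = gates H P l z (startGates H P l z) t := Function.update_self ..

include hX hB hs

open Classical in
theorem computes_startGates (hfl : fl = if T.IsLeaf (P.node 0) then 0 else 1) :
    Computes B X n H P l z fl 34 (par (vPm + (vp + 2) * vN) 34 vi exStart) := by
  have hle := hs.le
  have hS := Setting.S_pos (z := z)
  have hW := Setting.W_pos (z := z)
  have hpm : z.pmBase = z.NI * z.W + (z.p + 1) * z.N := rfl
  refine kernel hX hB hs 34 _ _ (z.pmBase + (z.p + 2) * z.N) (startGates H P l z) (by norm_num)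
    ⟨by decide +kernel, by decide +kernel⟩ (by decide +kernel) ?_ ?_ ?_ ?_
  · funext a
    change startGates H P l z a = cut _ _ a
    unfold cut
    split_ifs with h
    · rfl
    · unfold startGates
      rw [if_neg, if_neg, if_neg h]
      · omega
      · have : z.tabBase = z.NI * z.W := rfl
        omega
  · have h1 := NI_mul_W_le (z := z)
    have h2 : (z.p + 1) * z.N + (z.p + 2) * z.N ≤ 3 * (z.S * z.W) := by
      rw [← add_mul]
      exact Setting.le_S_mul_W hs.N_le_W (by omega) le_rfl
    omega
  · intro i _
    exact (startGates_le_one i).trans_lt (by omega)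
  · intro σ hσ
    refine ⟨by simp [hσ.pmBase, hσ.p, hσ.N], fun hi => ?_⟩
    unfold startGates exStart
    simp only [Ex.eval_ifLt, Ex.eval_ifEq, Ex.eval_var, Ex.eval_ld, Ex.eval_zero, Ex.eval_one,
      Ex.eval_sub, Ex.eval_mul, Ex.eval_div, Ex.eval_mod, Ex.eval_ofNat, hσ.tabBase,
      hσ.pmBase, hσ.fl, hσ.S, hσ.W, hσ.N, hσ.p, memAt_input (show 7 < 9 by norm_num)]
    by_cases h1 : σ 50 < z.tabBase
    · rw [if_pos h1, if_pos h1]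
    rw [if_neg h1, if_neg h1]
    by_cases h2 : σ 50 < z.pmBase
    · rw [if_pos h2, if_pos h2, hfl]
      by_cases h3 : T.IsLeaf (P.node 0)
      · rw [if_pos h3, if_pos rfl]
        by_cases h4 : (σ 50 - z.tabBase) / z.N = 0
        · rw [if_pos h4]
          exact (if_pos ⟨h3, .inl h4⟩).symm
        rw [if_neg h4]
        by_cases h5 : (σ 50 - z.tabBase) / z.N = z.p
        · rw [if_pos h5]
          exact (if_pos ⟨h3, .inr h5⟩).symm
        · rw [if_neg h5, if_neg (by tauto)]
      · rw [if_neg h3, if_neg one_ne_zero, if_neg (by tauto)]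
    · rw [if_neg h2, if_neg h2, if_pos hi, memAt_badSum (show 29 < 34 by norm_num) (by omega)]

/-- One step of the network. -/
theorem spec_sweep {Rf : List (ℕ × ℕ)} (hRf : ∀ q ∈ Rf, q.1 ≠ 50) (Tx a : Ex) (Tn t : ℕ)
    (addr : ℕ → ℕ) (hdeg : Tx.deg ≤ degBound ∧ a.deg ≤ degBound ∧ (exNext a).deg ≤ degBound)
    (hsize : Tx.size + a.size + (exNext a).size + 3 ≤ kcost)
    (h : ∀ M σ, (∀ q ∈ Rf, σ q.1 = q.2) →
      Tx.eval M σ = Tn ∧ (σ 50 < Tn → a.eval M σ = addr (σ 50)))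
    (hT : Tn ≤ 7 * (z.S * z.W)) (hinj : ∀ i < Tn, ∀ j < Tn, addr i = addr j → i = j)
    (hact : ∀ x, x < z.NI * z.W ∧ z.Active t (x / z.W) ↔ ∃ i < Tn, addr i = x) :
    Spec B (par Tx 34 a (exNext a)) (St X Rf (gateMem H P l z t)) (kcost * (Tn + 1)) kcost
      (St X Rf (gateMem H P l z (t + 1))) := by
  have key := spec_par hX hB (M := gateMem H P l z t) (Rf := Rf) Tx 34 a (exNext a) Tn kcost addr
    (fun i => gates H P l z (startGates H P l z) (t + 1) (addr i))
    (gates H P l z (startGates H P l z) (t + 1)) hdeg hsize hRf (fun σ hσ => ?_) (hs.lt_X' hT) hinj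
    (fun i _ => (gates_le_one _ _).trans_lt (by omega)) (fun _ _ => rfl) (fun y hy => ?_)
  · rwa [gateMem, Function.update_idem] at key
  · obtain ⟨h1, h2⟩ := h (gateMem H P l z t) σ hσ
    refine ⟨h1, fun hi => ⟨h2 hi, ?_⟩⟩
    obtain ⟨h3, h4⟩ := (hact (addr (σ 50))).2 ⟨_, hi, rfl⟩
    simp only [exNext, Ex.eval_ifLt, Ex.eval_ld, Ex.eval_add, Ex.eval_zero, Ex.eval_one, h2 hi,
      gateMem_self, gateMem_of_ne (show 30 ≠ 34 by norm_num),
      gateMem_of_ne (show 31 ≠ 34 by norm_num), gateMem_of_ne (show 32 ≠ 34 by norm_num),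
      memAt_src₁ (show 30 < 34 by norm_num) h3, memAt_src₂ (show 31 < 34 by norm_num) h3,
      memAt_thr (show 32 < 34 by norm_num) h3]
    exact (if_pos (α := ℕ) ⟨h3, h4⟩).symm
  · rw [gates, sweep, if_neg, gateMem_self]
    rw [hact]
    rintro ⟨i, hi, e⟩
    exact hy i hi e

theorem spec_sweepLoop {Rf : List (ℕ × ℕ)} (hRf : ∀ q ∈ Rf, q.1 < 24) (e Tx a : Ex)
    (Tn t r : ℕ) (addr : ℕ → ℕ) (he : e.size = 2) (he' : e.deg ≤ degBound)
    (hr : ∀ M σ, (∀ q ∈ Rf, σ q.1 = q.2) → e.eval M σ = r) (hrX : r < X)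
    (hdeg : Tx.deg ≤ degBound ∧ a.deg ≤ degBound ∧ (exNext a).deg ≤ degBound)
    (hsize : Tx.size + a.size + (exNext a).size + 3 ≤ kcost)
    (h : ∀ M σ, (∀ q ∈ Rf, σ q.1 = q.2) →
      Tx.eval M σ = Tn ∧ (σ 50 < Tn → a.eval M σ = addr (σ 50)))
    (hT : Tn ≤ 7 * (z.S * z.W)) (hinj : ∀ i < Tn, ∀ j < Tn, addr i = addr j → i = j)
    (hact : ∀ j < r, ∀ x, x < z.NI * z.W ∧ z.Active (t + j) (x / z.W) ↔ ∃ i < Tn, addr i = x) :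
    Spec B (sweepLoop e Tx a) (St X Rf (gateMem H P l z t)) (r * (4000 * Tn + 4007) + 5)
      (r * 4007 + 5) (St X Rf (gateMem H P l z (t + r))) := by
  refine (spec_rep hX hB 24 e _ r kcost (fun _ => kcost * (Tn + 1)) (fun _ => Rf)
    (fun j => gateMem H P l z (t + j)) he' (hr _) hrX
    (fun q hq => ⟨hq, (hRf q hq).ne⟩) (fun _ q hq => (hRf q hq).ne) fun j hj => ?_).cost ?_ ?_
  · refine spec_sweep hX hB hs (fun q hq => ?_) Tx a Tn (t + j) addr hdeg hsize
      (fun M σ hσ => h M σ fun q hq => hσ q (List.mem_cons_of_mem _ hq)) hT hinj (hact j hj)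
    rcases List.mem_cons.1 hq with rfl | hq
    · simp
    · exact ((hRf q hq).trans (by norm_num)).ne
  · rw [Finset.sum_const, Finset.card_range, smul_eq_mul, he]
    have : kcost * (Tn + 1) + 7 = 4000 * Tn + 4007 := by change 4000 * _ + 7 = _; ring
    rw [this]
    omega
  · rw [he]
    change 2 + r * 4007 + 3 ≤ _
    omega

omit hX hB in
theorem EX_lt : z.EX < X := by
  have := Nat.mul_le_mul hs.L_le (Setting.k_le_W (z := z))
  refine NI_mul_W_W_le hs (this.trans ?_)
  exact (Nat.le_mul_of_pos_left _ Setting.S_pos).trans (Nat.le_mul_of_pos_left _ (by norm_num))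

omit hX hB in
theorem K_lt : z.K < X := by
  have h1 := Setting.k_le_W (z := z)
  have h2 := hs.k_pos
  have h3 : z.W ≤ z.S * z.W := Nat.le_mul_of_pos_left _ Setting.S_pos
  refine hs.lt_X' ?_
  change 2 * k + 1 ≤ _
  omega

theorem spec_sweepLevels (Tx a : Ex) (t : ℕ) (Tn : ℕ → ℕ) (addr : ℕ → ℕ → ℕ)
    (hdeg : Tx.deg ≤ degBound ∧ a.deg ≤ degBound ∧ (exNext a).deg ≤ degBound)
    (hsize : Tx.size + a.size + (exNext a).size + 3 ≤ kcost)
    (h : ∀ j ≤ z.d, ∀ M σ, Base z n fl σ → σ 21 = 2 ^ j → σ 22 = z.S / 2 ^ j →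
      Tx.eval M σ = Tn j ∧ (σ 50 < Tn j → a.eval M σ = addr j (σ 50)))
    (hT : ∀ j ≤ z.d, Tn j ≤ 7 * (z.S * z.W))
    (hsum : ∑ j ∈ Finset.range (z.d + 1), Tn j ≤ 4 * (z.S * z.W))
    (hinj : ∀ j ≤ z.d, ∀ i < Tn j, ∀ i' < Tn j, addr j i = addr j i' → i = i')
    (hact : ∀ j ≤ z.d, ∀ r < z.K, ∀ x, x < z.NI * z.W ∧ z.Active (t + z.K * j + r) (x / z.W) ↔
      ∃ i < Tn j, addr j i = x) :
    Spec B (levels (sweepLoop vK Tx a)) (St X (baseRegs z n fl) (gateMem H P l z t))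
      (84000 * z.work) (13000 * z.depth)
      (St X (baseRegs z n fl) (gateMem H P l z (t + z.K * (z.d + 1)))) := by
  have hdS := d_lt_S (z := z)
  have hk := hs.k_pos
  have hK : z.K ≤ 3 * k := by change 2 * k + 1 ≤ _; omega
  refine (spec_levels hX hB (p := sweepLoop vK Tx a) (z := z) (n := n) (fl := fl)
    (fun j => gateMem H P l z (t + z.K * j)) (fun j => z.K * (4000 * Tn j + 4007) + 5)
    (z.K * 4007 + 5) (hs.lt_X' (Setting.le_S (by omega)))
    (hs.lt_X' (Setting.le_S (by omega))) (fun j hj => ?_)).cost ?_ ?_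
  · rw [Nat.mul_succ z.K j, ← Nat.add_assoc]
    refine spec_sweepLoop hX hB hs (fun q hq => ?_) vK Tx a (Tn j) (t + z.K * j) z.K (addr j) rfl
      (by decide +kernel) (fun M σ hσ => ?_) (K_lt hs) hdeg hsize (fun M σ hσ => ?_)
      (hT j (Nat.le_of_lt_succ hj)) (hinj j (Nat.le_of_lt_succ hj)) (hact j (Nat.le_of_lt_succ hj))
    · have := mem_baseRegs_lt (z := z) (n := n) (fl := fl) q
      simp only [List.mem_cons] at hq
      rcases hq with rfl | rfl | rfl | hq <;> [simp; simp; simp; skip]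
      have := this hq
      omega
    · simp only [List.forall_mem_cons] at hσ
      exact (Base.of_mem hσ.2.2.2).K
    · simp only [List.forall_mem_cons] at hσ
      exact h j (Nat.le_of_lt_succ hj) M σ (Base.of_mem hσ.2.2.2) hσ.2.2.1 hσ.2.1
  · have h1 : ∑ j ∈ Finset.range (z.d + 1), (z.K * (4000 * Tn j + 4007) + 5 + 30) =
        z.K * (4000 * ∑ j ∈ Finset.range (z.d + 1), Tn j) + (z.d + 1) * (z.K * 4007 + 35) := by
      have h0 : ∀ j, z.K * (4000 * Tn j + 4007) + 5 + 30 =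
          z.K * (4000 * Tn j) + (z.K * 4007 + 35) := fun j => by ring
      rw [Finset.mul_sum, Finset.mul_sum, Finset.sum_congr rfl fun j _ => h0 j,
        Finset.sum_add_distrib, Finset.sum_const, Finset.card_range, smul_eq_mul]
    rw [h1]
    have hW := Setting.W_pos (z := z)
    have h2 := Nat.mul_le_mul hK (Nat.mul_le_mul_left 4000 hsum)
    have h3 : (z.d + 1) * (z.K * 4007 + 35) ≤ (z.S * z.W) * (12056 * k) := by
      refine Nat.mul_le_mul ?_ (by omega)
      exact hdS.trans (Nat.le_mul_of_pos_right _ hW)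
    have h4 : 0 < k * (z.S * z.W) := by
      have := Setting.S_pos (z := z)
      positivity
    have h5 : 3 * k * (4000 * (4 * (z.S * z.W))) = 48000 * (k * (z.S * z.W)) := by ring
    have h6 : z.S * z.W * (12056 * k) = 12056 * (k * (z.S * z.W)) := by ring
    rw [h5] at h2
    rw [h6] at h3
    refine hs.mul_le_work ?_
    omega
  · have h1 : (z.d + 1) * (z.K * 4007 + 5 + 30) ≤ (z.L + z.d + 1) * (12056 * k) :=
      Nat.mul_le_mul (Nat.add_le_add_right (Nat.le_add_left _ _) 1) (by omega)
    have h2 : (z.L + z.d + 1) * (12056 * k) = 12056 * z.depth := by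
      unfold Sizes.depth; ring
    have h3 := Setting.k_le_depth (z := z)
    rw [h2] at h1
    exact (Nat.add_le_add_right h1 30).trans (by omega)

end network

section schedule

variable {k : ℕ} {z : Sizes k}

theorem active_segments {t id : ℕ} (h : t < z.EX) : z.Active t id ↔ id < 2 * z.S := by
  rw [Sizes.Active, if_pos h]

theorem mul_add_lt {K d j r : ℕ} (hj : j ≤ d) (hr : r < K) : K * j + r < K * (d + 1) := by
  have h1 := Nat.mul_le_mul_left K (Nat.succ_le_succ hj)
  rw [Nat.mul_succ] at h1
  change _ ≤ K * (d + 1) at h1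
  omega

theorem mul_add_div_self {K j r : ℕ} (hr : r < K) : (K * j + r) / K = j := by
  rw [Nat.mul_add_div (by omega), Nat.div_eq_of_lt hr, add_zero]

theorem active_segmentLevel {j r id : ℕ} (hj : j ≤ z.d) (hr : r < z.K) :
    z.Active (z.EX + z.K * j + r) id ↔ id < 2 * (z.S / 2 ^ j) := by
  have h1 := mul_add_lt hj hr
  have h2 : z.EX + z.K * j + r - z.EX = z.K * j + r := by omega
  rw [Sizes.Active, if_neg (by omega), if_pos (by omega), h2, mul_add_div_self hr,
    Nat.mul_div_assoc _ (pow_dvd_pow 2 hj)]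

theorem active_prefixLevel {j r id : ℕ} (hj : j ≤ z.d) (hr : r < z.K) :
    z.Active (z.EX + z.K * (z.d + 1) + z.K * j + r) id ↔
      ∃ c, 1 ≤ c ∧ c ≤ 2 ^ j ∧ id = 2 * z.S + c * (z.S / 2 ^ j) := by
  have h1 := mul_add_lt hj hr
  have h2 : z.EX + z.K * (z.d + 1) + z.K * j + r - z.EX - z.K * (z.d + 1) = z.K * j + r := by omega
  rw [Sizes.Active, if_neg (by omega), if_neg (by omega), if_pos (by omega), h2,
    mul_add_div_self hr]

theorem active_prefixes {r id : ℕ} :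
    z.Active (z.EX + z.K * (z.d + 1) + z.K * (z.d + 1) + r) id ↔ 2 * z.S < id ∧ id < z.NI := by
  rw [Sizes.Active, if_neg (by omega), if_neg (by omega), if_neg (by omega)]

end schedule

/-- The evaluation of the network: the steps of `Sizes.Active`. -/
def network : Prog :=
  .seq (sweepLoop vEX (2 * vS * vW) vi)
    (.seq (levels (sweepLoop vK (2 * .var 22 * vW) vi))
      (.seq (levels (sweepLoop vK (.var 21 * vW)
          ((2 * vS + (vi / vW + 1) * .var 22) * vW + vi % vW)))
        (sweepLoop vEX (vS * vW) ((2 * vS + 1) * vW + vi))))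

section network

variable {B X : ℕ} (hX : 2 ≤ X) (hB : X ^ degBound ≤ B)
  {k n : ℕ} {ι : Type*} {H : SimpleGraph (Fin k)} {G : SimpleGraph (Fin n)}
  {T : TreeDecomposition G ι} {P : Subpath T} {l : ι → List (Fin n)} {z : Sizes k} {fl : ℕ}
  (hs : Setting P l z X)

theorem lt_mul_W_iff {x m : ℕ} (hm : m ≤ z.NI) :
    x < z.NI * z.W ∧ x / z.W < m ↔ ∃ i < m * z.W, i = x := by
  have hW := Setting.W_pos (z := z)
  rw [Nat.div_lt_iff_lt_mul hW]
  constructor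
  · exact fun h => ⟨x, h.2, rfl⟩
  · rintro ⟨i, hi, rfl⟩
    exact ⟨hi.trans_le (Nat.mul_le_mul_right _ hm), hi⟩

include hX hB hs

theorem spec_sweepLoop_EX (Tx a : Ex) (Tn t : ℕ) (addr : ℕ → ℕ)
    (hdeg : Tx.deg ≤ degBound ∧ a.deg ≤ degBound ∧ (exNext a).deg ≤ degBound)
    (hsize : Tx.size + a.size + (exNext a).size + 3 ≤ kcost)
    (h : ∀ M σ, Base z n fl σ → Tx.eval M σ = Tn ∧ (σ 50 < Tn → a.eval M σ = addr (σ 50)))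
    (hT : Tn ≤ 2 * (z.S * z.W)) (hinj : ∀ i < Tn, ∀ j < Tn, addr i = addr j → i = j)
    (hact : ∀ j < z.EX, ∀ x, x < z.NI * z.W ∧ z.Active (t + j) (x / z.W) ↔
      ∃ i < Tn, addr i = x) :
    Spec B (sweepLoop vEX Tx a) (St X (baseRegs z n fl) (gateMem H P l z t)) (13000 * z.work)
      (13000 * z.depth) (St X (baseRegs z n fl) (gateMem H P l z (t + z.EX))) := by
  have hk := hs.k_pos
  have hL := hs.L_pos
  have hSW := Nat.mul_pos (Setting.S_pos (z := z)) (Setting.W_pos (z := z))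
  have hkL := Nat.mul_pos hL hk
  refine (spec_sweepLoop hX hB hs (fun q hq => (mem_baseRegs_lt q hq).trans (by norm_num)) vEX Tx a
    Tn t z.EX addr rfl (by decide +kernel) (fun M σ hσ => (Base.of_mem hσ).EX) (EX_lt hs) hdeg hsize
    (fun M σ hσ => h M σ (Base.of_mem hσ)) (by omega) hinj hact).cost ?_ ?_
  · have h1 : z.L * k * (4000 * Tn + 4007) ≤ z.L * k * (12500 * (z.S * z.W)) :=
      Nat.mul_le_mul_left _ (by omega)
    have h2 : z.L * k * (12500 * (z.S * z.W)) = 12500 * (k * z.L * z.S * z.W) := by ring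
    have h3 : 0 < k * z.L * z.S * z.W := by
      have := Nat.mul_pos hkL hSW
      have e : z.L * k * (z.S * z.W) = k * z.L * z.S * z.W := by ring
      rwa [e] at this
    have h4 : 12500 * (k * z.L * z.S * z.W) + 5 ≤ 13000 * (k * z.L * z.S * z.W) := by omega
    refine (Nat.add_le_add_right (h1.trans h2.le) 5).trans (h4.trans ?_)
    exact Nat.mul_le_mul_left _ (Nat.le_add_right _ _)
  · have h1 : z.L * k ≤ z.depth := by
      rw [mul_comm]
      exact Nat.mul_le_mul_left _ (by omega)
    change z.L * k * 4007 + 5 ≤ _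
    have h2 : z.L * k * 4007 + 5 ≤ 13000 * (z.L * k) := by omega
    exact h2.trans (Nat.mul_le_mul_left _ h1)

theorem spec_network : Spec B network (St X (baseRegs z n fl) (memAt H P l z 35))
    (200000 * z.work) (60000 * z.depth)
    (St X (baseRegs z n fl) (gateMem H P l z z.steps)) := by
  have hW := Setting.W_pos (z := z)
  have hS := Setting.S_pos (z := z)
  have hNI : z.NI = 3 * z.S + 1 := rfl
  have hdiv : ∀ j ≤ z.d, 2 ^ j * (z.S / 2 ^ j) = z.S := fun j hj =>
    Nat.mul_div_cancel' (pow_dvd_pow 2 hj)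
  have p1 := spec_sweepLoop_EX hX hB hs (H := H) (fl := fl) (n := n) (2 * vS * vW) vi
    (2 * z.S * z.W) 0 id ⟨by decide +kernel, by decide +kernel, by decide +kernel⟩
    (by decide +kernel) (fun M σ hσ => ⟨by simp [hσ.S, hσ.W], fun _ => rfl⟩)
    (by rw [mul_assoc]) (fun i _ j _ h => h) (fun j hj x => by
      rw [zero_add, active_segments hj]
      exact lt_mul_W_iff (by omega))
  have p2 := spec_sweepLevels hX hB hs (H := H) (fl := fl) (n := n) (2 * .var 22 * vW) vi
    z.EX (fun j => 2 * (z.S / 2 ^ j) * z.W) (fun _ => id)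
    ⟨by decide +kernel, by decide +kernel, by decide +kernel⟩ (by decide +kernel)
    (fun j hj M σ hσ h21 h22 => ⟨by simp [h22, hσ.W], fun _ => rfl⟩)
    (fun j hj => by
      have h1 := Nat.mul_le_mul_right z.W (Nat.mul_le_mul_left 2 (Nat.div_le_self z.S (2 ^ j)))
      rw [mul_assoc 2 z.S] at h1
      exact h1.trans (Nat.mul_le_mul_right _ (by norm_num)))
    (by
      rw [← Finset.sum_mul, ← Finset.mul_sum, ← mul_assoc]
      refine Nat.mul_le_mul_right _ ?_
      exact (Nat.mul_le_mul_left 2 (sum_div_two_pow z.d)).trans (by rw [← mul_assoc]; exact le_refl (4 * 2 ^ z.d)))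
    (fun j _ i _ i' _ h => h) (fun j hj r hr x => by
      rw [active_segmentLevel hj hr]
      refine lt_mul_W_iff ?_
      have := Nat.div_le_self z.S (2 ^ j)
      omega)
  have p3 := spec_sweepLevels hX hB hs (H := H) (fl := fl) (n := n) (.var 21 * vW)
    ((2 * vS + (vi / vW + 1) * .var 22) * vW + vi % vW)
    (z.EX + z.K * (z.d + 1)) (fun j => 2 ^ j * z.W)
    (fun j i => (2 * z.S + (i / z.W + 1) * (z.S / 2 ^ j)) * z.W + i % z.W)
    ⟨by decide +kernel, by decide +kernel, by decide +kernel⟩ (by decide +kernel)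
    (fun j hj M σ hσ h21 h22 => ⟨by simp [h21, hσ.W], fun _ => by simp [h22, hσ.W, hσ.S]⟩)
    (fun j hj => by
      rw [← mul_assoc]
      refine Nat.mul_le_mul_right z.W ?_
      have := Nat.pow_le_pow_right (show 0 < 2 by norm_num) hj
      change 2 ^ j ≤ 7 * 2 ^ z.d
      omega)
    (by
      rw [← Finset.sum_mul, ← mul_assoc]
      refine Nat.mul_le_mul_right _ ((sum_two_pow z.d).trans ?_)
      exact Nat.mul_le_mul_right _ (by norm_num))
    (fun j hj i hi i' hi' h => by
      have hq : 0 < z.S / 2 ^ j := Nat.pos_of_mul_pos_left (by rw [hdiv j hj]; exact hS)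
      have h1 : ∀ i, ((2 * z.S + (i / z.W + 1) * (z.S / 2 ^ j)) * z.W + i % z.W) / z.W =
          2 * z.S + (i / z.W + 1) * (z.S / 2 ^ j) := fun i => by
        rw [mul_comm, Nat.mul_add_div hW, Nat.div_eq_of_lt (Nat.mod_lt _ hW), add_zero]
      have h2 : ∀ i, ((2 * z.S + (i / z.W + 1) * (z.S / 2 ^ j)) * z.W + i % z.W) % z.W =
          i % z.W := fun i => by
        rw [mul_comm, Nat.mul_add_mod, Nat.mod_mod]
      have h3 := h1 i
      rw [h, h1] at h3
      have h4 := h2 i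
      rw [h, h2] at h4
      have h5 := Nat.eq_of_mul_eq_mul_right hq (Nat.add_left_cancel h3)
      rw [← Nat.div_add_mod i z.W, ← Nat.div_add_mod i' z.W, h4, Nat.succ_injective h5])
    (fun j hj r hr x => by
      rw [active_prefixLevel hj hr]
      constructor
      · rintro ⟨-, c, hc1, hc2, hx⟩
        obtain ⟨c, rfl⟩ := Nat.exists_eq_add_of_le' hc1
        refine ⟨c * z.W + x % z.W, ?_, ?_⟩
        · have := Nat.mul_le_mul_right z.W hc2
          have := Nat.mod_lt x hW
          rw [Nat.succ_mul] at *
          omega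
        · rw [mul_comm c, Nat.mul_add_div hW, Nat.div_eq_of_lt (Nat.mod_lt _ hW), add_zero,
            Nat.mul_add_mod, Nat.mod_mod, ← hx, Nat.div_add_mod']
      · rintro ⟨i, hi, rfl⟩
        have h1 : i / z.W < 2 ^ j := (Nat.div_lt_iff_lt_mul hW).2 hi
        have h2 : (i / z.W + 1) * (z.S / 2 ^ j) ≤ z.S :=
          (Nat.mul_le_mul_right _ h1).trans (hdiv j hj).le
        have h3 : ((2 * z.S + (i / z.W + 1) * (z.S / 2 ^ j)) * z.W + i % z.W) / z.W =
            2 * z.S + (i / z.W + 1) * (z.S / 2 ^ j) := by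
          rw [mul_comm, Nat.mul_add_div hW, Nat.div_eq_of_lt (Nat.mod_lt _ hW), add_zero]
        refine ⟨?_, i / z.W + 1, Nat.le_add_left _ _, h1, h3⟩
        rw [← Nat.div_lt_iff_lt_mul hW, h3]
        omega)
  have p4 := spec_sweepLoop_EX hX hB hs (H := H) (fl := fl) (n := n) (vS * vW)
    ((2 * vS + 1) * vW + vi) (z.S * z.W) (z.EX + z.K * (z.d + 1) + z.K * (z.d + 1))
    (fun i => (2 * z.S + 1) * z.W + i)
    ⟨by decide +kernel, by decide +kernel, by decide +kernel⟩
    (by decide +kernel) (fun M σ hσ => ⟨by simp [hσ.S, hσ.W], fun _ => by simp [hσ.S, hσ.W]⟩)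
    (by omega) (fun i _ j _ h => by simpa using h) (fun j hj x => by
      rw [active_prefixes]
      have e : z.NI * z.W = (2 * z.S + 1) * z.W + z.S * z.W := by ring
      have h1 : 2 * z.S < x / z.W ↔ (2 * z.S + 1) * z.W ≤ x := by
        rw [← Nat.le_div_iff_mul_le hW]; rfl
      have h2 : x / z.W < z.NI ↔ x < z.NI * z.W := Nat.div_lt_iff_lt_mul hW
      rw [h1, h2]
      constructor
      · rintro ⟨h3, h4, -⟩
        exact ⟨x - (2 * z.S + 1) * z.W, by omega, by omega⟩
      · rintro ⟨i, hi, rfl⟩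
        omega)
  rw [zero_add, gateMem_zero] at p1
  have e : z.EX + z.K * (z.d + 1) + z.K * (z.d + 1) + z.EX = z.steps := by
    change _ = 2 * z.EX + 2 * (z.K * (z.d + 1))
    omega
  rw [e] at p4
  refine (p1.seq (p2.seq (p3.seq p4))).cost ?_ ?_ <;> omega

end network

end SubpathDP

/-! ### The program after the computation of the sizes -/

namespace SubpathDP

open CREW Status Digit

section output

variable {B X : ℕ} (hX : 2 ≤ X) (hB : X ^ degBound ≤ B)
  {k n : ℕ} {ι : Type*} {H : SimpleGraph (Fin k)} {G : SimpleGraph (Fin n)}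
  {T : TreeDecomposition G ι} {P : Subpath T} {l : ι → List (Fin n)} {z : Sizes k} {fl : ℕ}
  (hs : Setting P l z X)

variable (H P l z) in
/-- The tables of the nodes of the subpath, one after the other. -/
noncomputable def tables (i : ℕ) : ℕ :=
  cut (z.p * z.N) (fun i => validTable H T z.τ l (P.node (i / z.N)) (i % z.N)) i

include hX hB hs

/-- The tables are read off the gates of the prefixes. -/
theorem spec_output [Finite ι] (hl : ∀ i, (l i).toFinset = T.bag i)
    (hL : 2 * (z.τ + 1) ≤ 2 ^ z.L) :
    Spec B (par (vp * vN) 8 vi (.ifEq (.ld 29 ((vi / vN + 2) * vN + vi % vN)) 0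
        (.ld 34 ((2 * vS + vi / vN + 2) * vW + .ld 33 (vi % vN))) 0))
      (St X (baseRegs z n fl) (gateMem H P l z z.steps)) (84000 * z.work) (4080 * z.depth)
      (St X (baseRegs z n fl)
        (Function.update (gateMem H P l z z.steps) 8 (tables H P l z))) := by
  have hle := hs.le
  have hN := N_pos (z := z)
  have hT : z.p * z.N ≤ 1 * (z.S * z.W) := Setting.le_S_mul_W hs.N_le_W (by omega) le_rfl
  refine (spec_par_id hX hB (vp * vN) 8 _ (z.p * z.N) kcost (tables H P l z)
    ⟨by decide +kernel, by decide +kernel⟩ (by decide +kernel)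
    (fun q hq => by have := mem_baseRegs_lt q hq; change q.1 ≠ 50; omega) (fun σ hσ => ?_)
    (hs.lt_X' (by omega)) (fun i hi => ?_) fun i hi => ?_).cost ?_ ?_
  · have hσ := Base.of_mem hσ
    refine ⟨by simp [hσ.p, hσ.N], fun hi => ?_⟩
    change σ 50 < _ at hi
    have hj : σ 50 / z.N < z.p := (Nat.div_lt_iff_lt_mul hN).2 hi
    have hc : σ 50 % z.N < z.N := Nat.mod_lt _ hN
    have h29 : (σ 50 / z.N + 2) * z.N + σ 50 % z.N < (z.p + 2) * z.N := by
      have := Nat.mul_le_mul_right z.N (show σ 50 / z.N + 3 ≤ z.p + 2 by omega)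
      have e : (σ 50 / z.N + 3) * z.N = (σ 50 / z.N + 2) * z.N + z.N := by ring
      omega
    have e1 : ((σ 50 / z.N + 2) * z.N + σ 50 % z.N) / z.N = σ 50 / z.N + 2 := by
      rw [mul_comm, Nat.mul_add_div hN, Nat.div_eq_of_lt hc, add_zero]
    have e2 : ((σ 50 / z.N + 2) * z.N + σ 50 % z.N) % z.N = σ 50 % z.N := by
      rw [mul_comm, Nat.mul_add_mod, Nat.mod_mod]
    rw [tables, cut_of_lt hi, validTable_eq H P z hs.len hle hs.bag hl hL hj hc]
    simp only [Ex.eval_ifEq, Ex.eval_ld, Ex.eval_var, Ex.eval_add, Ex.eval_mul, Ex.eval_div,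
      Ex.eval_mod, Ex.eval_zero, Ex.eval_ofNat, hσ.S, hσ.W, hσ.N, gateMem_self,
      gateMem_of_ne (show 29 ≠ 34 by norm_num), gateMem_of_ne (show 33 ≠ 34 by norm_num),
      memAt_badSum (show 29 < 34 by norm_num) h29, memAt_conv (show 33 < 34 by norm_num) hc, e1, e2]
  · rw [tables, cut_of_lt hi]
    exact (validTable_le_one H _ _).trans_lt (by omega)
  · rw [gateMem_of_ne (show 8 ≠ 34 by norm_num), memAt_input (show 8 < 9 by norm_num)]
    exact if_neg (by omega)
  · have := hs.S_mul_W_le (x := z.p * z.N + 1) (c := 2) (by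
      have := Nat.mul_pos (Setting.S_pos (z := z)) (Setting.W_pos (z := z))
      omega)
    rw [show kcost = 4000 from rfl]
    omega
  · have := Setting.k_le_depth (z := z)
    have := hs.k_pos
    rw [show kcost = 4000 from rfl]
    omega

end output

open Classical in
/-- There is a program that computes the tables, when the sizes have been computed. -/
theorem exists_tables_program : ∃ prog : Prog, ∀ (B X : ℕ), 2 ≤ X → X ^ degBound ≤ B →
    ∀ (k n : ℕ) (ι : Type) [Finite ι] (H : SimpleGraph (Fin k)) (G : SimpleGraph (Fin n))
      (T : TreeDecomposition G ι) (P : Subpath T) (l : ι → List (Fin n)) (z : Sizes k) (fl : ℕ),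
    Setting P l z X → (∀ i, (l i).toFinset = T.bag i) → 2 * (z.τ + 1) ≤ 2 ^ z.L →
    fl = (if T.IsLeaf (P.node 0) then 0 else 1) →
    Spec B prog (St X (baseRegs z n fl) (inputMem H T z.τ l P)) (2500000 * z.work)
      (250000 * z.depth) (St X (baseRegs z n fl)
        (Function.update (gateMem H P l z z.steps) 8 (tables H P l z))) := by
  apply Exists.intro
  intro B X hX hB k n ι _ H G T P l z fl hs hl hL hfl
  rw [← memAt_nine]
  refine ((computes_powers hX hB hs).seq <| (computes_bagSizes hX hB hs).seq <|
    (computes_bags hX hB hs).seq <| (computes_segStep hX hB hs).seq <|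
    (computes_preStep hX hB hs).seq <| (computes_botBag hX hB hs).seq <|
    (computes_topBag hX hB hs).seq <| (computes_midBag hX hB hs).seq <|
    (computes_opA hX hB hs).seq <| (computes_opB hX hB hs).seq <|
    (computes_transl hX hB hs).seq <| (computes_decA hX hB hs).seq <|
    (computes_decB hX hB hs).seq <| (computes_sumA hX hB hs).seq <|
    (computes_sumB hX hB hs).seq <| (computes_impossible hX hB hs).seq <|
    (computes_undecided hX hB hs).seq <| (computes_first hX hB hs).seq <|
    (computes_second hX hB hs).seq <| (computes_badPairs hX hB hs).seq <|
    (computes_badSum hX hB hs).seq <| (computes_src₁ hX hB hs).seq <|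
    (computes_src₂ hX hB hs).seq <| (computes_thr hX hB hs).seq <|
    (computes_conv hX hB hs).seq <| (computes_startGates hX hB hs hfl).seq <|
    (spec_network hX hB hs).seq (spec_output hX hB hs hl hL)).cost ?_ ?_
  · generalize z.work = w
    clear hfl hl hL hs hX hB
    omega
  · generalize z.depth = w
    clear hfl hl hL hs hX hB
    omega

end SubpathDP

/-! ### The computation of the sizes -/

namespace SubpathDP

open CREW Status Digit

/-- Store in `r` the binary logarithm of `e`, rounded up, and its power of two in the variable 21. -/
def clogLoop (r : ℕ) (e : Ex) : Prog :=
  .seq (asg 21 1) (.seq (asg r 0) (.seq (asg 22 (.ifLt (.var 21) e 1 0)) (.while (2 * 22)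
    (.seq (asg 21 (.var 21 * 2)) (.seq (asg r (.var r + 1)) (asg 22 (.ifLt (.var 21) e 1 0)))))))

section init

variable {B X : ℕ} (hX : 2 ≤ X) (hB : X ^ degBound ≤ B)

include hX hB

theorem spec_asg_cons {Rf : List (ℕ × ℕ)} {M : Mem} (r : ℕ) (e : Ex) (val : ℕ)
    (he : e.deg ≤ degBound) (h : ∀ σ, (∀ q ∈ Rf, σ q.1 = q.2) → e.eval M σ = val) (hv : val < X)
    (hr : ∀ q ∈ Rf, q.1 ≠ r) (hsize : e.size ≤ 40) :
    Spec B (asg r e) (St X Rf M) 42 42 (St X ((r, val) :: Rf) M) := by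
  refine (spec_asg hX hB r e val he h hv fun q hq => ?_).cost (by omega) (by omega)
  rcases List.mem_cons.1 hq with rfl | hq
  · exact .inl rfl
  · exact .inr ⟨hq, hr q hq⟩

theorem spec_clogLoop {Rf : List (ℕ × ℕ)} {M : Mem} (r : ℕ) (e : Ex) (v : ℕ) (hr : r ≠ 21)
    (hr' : r ≠ 22) (hRf : ∀ q ∈ Rf, q.1 ≠ 21 ∧ q.1 ≠ 22 ∧ q.1 ≠ r)
    (hdeg : (Ex.ifLt (.var 21) e 1 0).deg ≤ degBound)
    (hsize : (Ex.ifLt (.var 21) e 1 0).size ≤ 40)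
    (h : ∀ σ, (∀ q ∈ Rf, σ q.1 = q.2) → e.eval M σ = v) (hv : 2 ^ Nat.clog 2 v < X) :
    Spec B (clogLoop r e) (St X Rf M) (200 * (Nat.clog 2 v + 1)) (200 * (Nat.clog 2 v + 1))
      (St X ((r, Nat.clog 2 v) :: (21, 2 ^ Nat.clog 2 v) :: Rf) M) := by
  have hpow : ∀ j ≤ Nat.clog 2 v, 2 ^ j < X := fun j hj =>
    (Nat.pow_le_pow_right (by norm_num) hj).trans_lt hv
  have hlog : Nat.clog 2 v < 2 ^ Nat.clog 2 v := Nat.lt_pow_self (by norm_num)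
  let R : ℕ → List (ℕ × ℕ) := fun j =>
    (22, if 2 ^ j < v then 1 else 0) :: (r, j) :: (21, 2 ^ j) :: Rf
  have flag : ∀ j ≤ Nat.clog 2 v, ∀ σ : ℕ → ℕ, (∀ q ∈ (r, j) :: (21, 2 ^ j) :: Rf, σ q.1 = q.2) →
      (Ex.ifLt (.var 21) e 1 0).eval M σ = if 2 ^ j < v then 1 else 0 := by
    intro j _ σ hσ
    simp only [List.forall_mem_cons] at hσ
    rw [Ex.eval_ifLt, h σ hσ.2.2]
    simp [hσ.2.1]
  have hflag : ∀ j, (if 2 ^ j < v then 1 else 0) < X := fun j => by split_ifs <;> omega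
  have h1 := spec_asg_cons hX hB (Rf := Rf) (M := M) 21 1 1 (by decide) (fun _ _ => rfl) (by omega)
    (fun q hq => (hRf q hq).1) (by decide)
  have h2 := spec_asg_cons hX hB (Rf := (21, 1) :: Rf) (M := M) r 0 0 (by decide) (fun _ _ => rfl)
    (by omega) (by
      simp only [List.forall_mem_cons]
      exact ⟨hr.symm, fun q hq => (hRf q hq).2.2⟩) (by decide)
  have h3 := spec_asg_cons hX hB (Rf := (r, 0) :: (21, 1) :: Rf) (M := M) 22 _ _ hdeg
    (flag 0 (Nat.zero_le _)) (hflag 0) (by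
      simp only [List.forall_mem_cons]
      exact ⟨hr', by norm_num, fun q hq => (hRf q hq).2.1⟩) hsize
  have h4 := Spec.while (B := B) (p := .seq (asg 21 (.var 21 * 2)) (.seq (asg r (.var r + 1))
      (asg 22 (.ifLt (.var 21) e 1 0)))) (d := 126) 22 (Nat.clog 2 v) (fun j => St X (R j) M)
    (fun _ => 126)
    (fun j hj m σ hm => by
      have h5 := hm.2.2.1 _ (List.mem_cons_self ..)
      simp only [if_pos ((Nat.lt_clog_iff_pow_lt (by norm_num)).1 hj)] at h5
      omega)
    (fun m σ hm => by
      have h5 := hm.2.2.1 _ (List.mem_cons_self ..)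
      have h6 := Nat.le_pow_clog (show 1 < 2 by norm_num) v
      simp only [if_neg (Nat.not_lt.2 h6)] at h5
      exact h5)
    (fun j hj => by
      have a1 := spec_asg hX hB (Rf := R j) (Rf' := (r, j) :: (21, 2 ^ (j + 1)) :: Rf) (M := M)
        21 (.var 21 * 2) (2 ^ (j + 1)) (by decide) (fun σ h => by
          simp only [R, List.forall_mem_cons] at h
          simp [h.2.2.1, pow_succ]) (hpow _ hj) (by
          intro q hq
          simp only [R, List.mem_cons] at hq ⊢
          rcases hq with rfl | rfl | hq
          · exact .inr ⟨.inr (.inl rfl), hr⟩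
          · exact .inl rfl
          · exact .inr ⟨.inr (.inr (.inr hq)), (hRf q hq).1⟩)
      have a2 := spec_asg hX hB (Rf := (r, j) :: (21, 2 ^ (j + 1)) :: Rf)
        (Rf' := (r, j + 1) :: (21, 2 ^ (j + 1)) :: Rf) (M := M)
        r (.var r + 1) (j + 1) (by change 3 ≤ 3000; norm_num) (fun σ h => by
          simp only [List.forall_mem_cons] at h
          simp [h.1]) (by omega) (by
          intro q hq
          simp only [List.mem_cons] at hq ⊢
          rcases hq with rfl | rfl | hq
          · exact .inl rfl
          · exact .inr ⟨.inr (.inl rfl), hr.symm⟩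
          · exact .inr ⟨.inr (.inr hq), (hRf q hq).2.2⟩)
      have a3 := spec_asg_cons hX hB (Rf := (r, j + 1) :: (21, 2 ^ (j + 1)) :: Rf) (M := M) 22 _ _
        hdeg (flag (j + 1) hj) (hflag _) (by
          simp only [List.forall_mem_cons]
          exact ⟨hr', by norm_num, fun q hq => (hRf q hq).2.1⟩) hsize
      exact (a1.seq (a2.seq a3)).cost (by
        change 4 + 2 + (4 + 2 + 42) ≤ _; norm_num) (by change 4 + 2 + (4 + 2 + 42) ≤ _; norm_num))
  refine (h1.seq (h2.seq (h3.seq h4))).mono (fun _ _ h => h) ?_ ?_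
    fun m σ h => h.weaken fun q hq => List.mem_cons_of_mem _ hq
  · simp only [Finset.sum_const, Finset.card_range, smul_eq_mul]
    omega
  · omega

end init

section sizes

variable {B X : ℕ} (hX : 2 ≤ X) (hB : X ^ degBound ≤ B)
  {k n : ℕ} {ι : Type*} {H : SimpleGraph (Fin k)} {G : SimpleGraph (Fin n)}
  {T : TreeDecomposition G ι} {P : Subpath T} {l : ι → List (Fin n)} {z : Sizes k} {fl : ℕ}
  (hs : Setting P l z X)

include hX hB hs

/-- The variables that are read from the input, and simple functions of them. -/
theorem spec_input (hfl : inputMem H T z.τ l P 0 4 = fl) (hfl' : fl < X) :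
    Spec B (.seq (asg 0 (.ld 0 0)) <| .seq (asg 1 (.ld 0 1)) <| .seq (asg 2 (.ld 0 2)) <|
        .seq (asg 3 (.ld 0 3)) <| .seq (asg 4 (.ld 0 4)) <| .seq (asg 5 (vτ + 1)) <|
        .seq (asg 6 (vτ + 3)) <| .seq (asg 7 (3 * vt + 3)) <| asg 8 (11 * vt + 9))
      (St X [] (inputMem H T z.τ l P)) 378 378
      (St X [(8, z.E), (7, numPairs (z.τ + 1)), (6, z.τ + 3), (5, z.τ + 1), (4, fl), (3, z.p),
        (2, z.τ), (1, n), (0, k)] (inputMem H T z.τ l P)) := by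
  have hW := Setting.W_pos (z := z)
  have hS := Setting.S_pos (z := z)
  have hE : z.E = 11 * (z.τ + 1) + 9 := rfl
  have hM : numPairs (z.τ + 1) = 3 * (z.τ + 1) + 3 := rfl
  have hEX := hs.lt_X' (Setting.le_W hs.E_le_W)
  have hk := hs.lt_X' (Setting.le_W Setting.k_le_W)
  have hp := hs.lt_X' (Setting.le_S (x := z.p) (c := 7) (by have := hs.le; omega))
  have hp' := hs.len
  have s0 := spec_asg_cons hX hB (Rf := []) (M := inputMem H T z.τ l P) 0 (.ld 0 0) k (by decide)
    (fun _ _ => rfl) hk (by simp) (by decide)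
  have s1 := spec_asg_cons hX hB (Rf := [(0, k)]) (M := inputMem H T z.τ l P) 1 (.ld 0 1) n
    (by decide) (fun _ _ => rfl) hs.n_lt (by simp) (by decide)
  have s2 := spec_asg_cons hX hB (Rf := [(1, n), (0, k)]) (M := inputMem H T z.τ l P) 2 (.ld 0 2)
    z.τ (by decide) (fun _ _ => rfl) (by omega) (by simp) (by decide)
  have s3 := spec_asg_cons hX hB (Rf := [(2, z.τ), (1, n), (0, k)]) (M := inputMem H T z.τ l P) 3
    (.ld 0 3) z.p (by decide) (fun _ _ => hp') hp (by simp) (by decide)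
  have s4 := spec_asg_cons hX hB (Rf := [(3, z.p), (2, z.τ), (1, n), (0, k)])
    (M := inputMem H T z.τ l P) 4 (.ld 0 4) fl (by decide) (fun _ _ => hfl) hfl' (by simp)
    (by decide)
  have s5 := spec_asg_cons hX hB (Rf := [(4, fl), (3, z.p), (2, z.τ), (1, n), (0, k)])
    (M := inputMem H T z.τ l P) 5 (vτ + 1) (z.τ + 1) (by decide) (fun σ h => by
      simp only [List.forall_mem_cons] at h
      simp [h]) (by omega) (by simp) (by decide)
  have s6 := spec_asg_cons hX hB
    (Rf := [(5, z.τ + 1), (4, fl), (3, z.p), (2, z.τ), (1, n), (0, k)])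
    (M := inputMem H T z.τ l P) 6 (vτ + 3) (z.τ + 3) (by decide) (fun σ h => by
      simp only [List.forall_mem_cons] at h
      simp [h]) (by omega) (by simp) (by decide)
  have s7 := spec_asg_cons hX hB
    (Rf := [(6, z.τ + 3), (5, z.τ + 1), (4, fl), (3, z.p), (2, z.τ), (1, n), (0, k)])
    (M := inputMem H T z.τ l P) 7 (3 * vt + 3) (numPairs (z.τ + 1)) (by decide) (fun σ h => by
      simp only [List.forall_mem_cons] at h
      simp [h, hM]) (by omega) (by simp) (by decide)
  have s8 := spec_asg_cons hX hB
    (Rf := [(7, numPairs (z.τ + 1)), (6, z.τ + 3), (5, z.τ + 1), (4, fl), (3, z.p), (2, z.τ),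
      (1, n), (0, k)])
    (M := inputMem H T z.τ l P) 8 (11 * vt + 9) z.E (by decide) (fun σ h => by
      simp only [List.forall_mem_cons] at h
      simp [h, hE]) (by omega) (by simp) (by decide)
  exact (s0.seq <| s1.seq <| s2.seq <| s3.seq <| s4.seq <| s5.seq <| s6.seq <| s7.seq s8).cost
    (by norm_num) (by norm_num)

/-- The powers `N` and `W`. -/
theorem spec_powers {M : Mem} :
    Spec B (.seq (asg 9 1) <| .seq (asg 10 1) <|
        rep 20 vk (.seq (asg 9 (vN * vb)) (asg 10 (vW * vE))))
      (St X [(8, z.E), (7, numPairs (z.τ + 1)), (6, z.τ + 3), (5, z.τ + 1), (4, fl), (3, z.p),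
        (2, z.τ), (1, n), (0, k)] M) (91 * k + 89) (91 * k + 89)
      (St X [(10, z.W), (9, z.N), (8, z.E), (7, numPairs (z.τ + 1)), (6, z.τ + 3), (5, z.τ + 1),
        (4, fl), (3, z.p), (2, z.τ), (1, n), (0, k)] M) := by
  have hW := hs.lt_X' (Setting.le_W le_rfl)
  have hN := hs.lt_X' (Setting.le_W hs.N_le_W)
  have hk := hs.lt_X' (Setting.le_W Setting.k_le_W)
  have s9 := spec_asg_cons hX hB (Rf := [(8, z.E), (7, numPairs (z.τ + 1)), (6, z.τ + 3),
    (5, z.τ + 1), (4, fl), (3, z.p), (2, z.τ), (1, n), (0, k)]) (M := M) 9 1 1 (by decide)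
    (fun _ _ => rfl) (by omega) (by simp) (by decide)
  have s10 := spec_asg_cons hX hB (Rf := [(9, 1), (8, z.E), (7, numPairs (z.τ + 1)), (6, z.τ + 3),
    (5, z.τ + 1), (4, fl), (3, z.p), (2, z.τ), (1, n), (0, k)]) (M := M) 10 1 1 (by decide)
    (fun _ _ => rfl) (by omega) (by simp) (by decide)
  have s11 := spec_rep hX hB (Rf := [(10, 1), (9, 1), (8, z.E), (7, numPairs (z.τ + 1)),
    (6, z.τ + 3), (5, z.τ + 1), (4, fl), (3, z.p), (2, z.τ), (1, n), (0, k)]) 20 vk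
    (.seq (asg 9 (vN * vb)) (asg 10 (vW * vE))) k 84 (fun _ => 84)
    (fun j => [(10, z.E ^ j), (9, (z.τ + 3) ^ j), (8, z.E), (7, numPairs (z.τ + 1)), (6, z.τ + 3),
      (5, z.τ + 1), (4, fl), (3, z.p), (2, z.τ), (1, n), (0, k)]) (fun _ => M) (by decide)
    (fun σ h => by
      simp only [List.forall_mem_cons] at h
      simp [h]) hk (by simp) (by simp) (fun j hj => by
      have hj1 : z.E ^ (j + 1) ≤ z.W := Nat.pow_le_pow_right (by change 0 < 11 * _ + 9; omega) hj
      have hj2 : (z.τ + 3) ^ (j + 1) ≤ z.N := Nat.pow_le_pow_right (by omega) hj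
      have a1 := spec_asg hX hB (Rf := [(20, k - j), (10, z.E ^ j), (9, (z.τ + 3) ^ j), (8, z.E),
          (7, numPairs (z.τ + 1)), (6, z.τ + 3), (5, z.τ + 1), (4, fl), (3, z.p), (2, z.τ), (1, n),
          (0, k)])
        (Rf' := [(20, k - j), (10, z.E ^ j), (9, (z.τ + 3) ^ (j + 1)), (8, z.E),
          (7, numPairs (z.τ + 1)), (6, z.τ + 3), (5, z.τ + 1), (4, fl), (3, z.p), (2, z.τ), (1, n),
          (0, k)]) (M := M) 9 (vN * vb) ((z.τ + 3) ^ (j + 1)) (by decide) (fun σ h => by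
          simp only [List.forall_mem_cons] at h
          simp [h, pow_succ]) (by omega) (by simp)
      have a2 := spec_asg hX hB (Rf := [(20, k - j), (10, z.E ^ j), (9, (z.τ + 3) ^ (j + 1)),
          (8, z.E), (7, numPairs (z.τ + 1)), (6, z.τ + 3), (5, z.τ + 1), (4, fl), (3, z.p),
          (2, z.τ), (1, n), (0, k)])
        (Rf' := [(20, k - j), (10, z.E ^ (j + 1)), (9, (z.τ + 3) ^ (j + 1)), (8, z.E),
          (7, numPairs (z.τ + 1)), (6, z.τ + 3), (5, z.τ + 1), (4, fl), (3, z.p), (2, z.τ), (1, n),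
          (0, k)]) (M := M) 10 (vW * vE) (z.E ^ (j + 1)) (by decide) (fun σ h => by
          simp only [List.forall_mem_cons] at h
          simp [h, pow_succ]) (by omega) (by simp)
      exact (a1.seq a2).cost (by change 5 + 2 + (5 + 2) ≤ 84; norm_num)
        (by change 5 + 2 + (5 + 2) ≤ 84; norm_num))
  refine (s9.seq (s10.seq s11)).cost ?_ ?_
  · simp only [Finset.sum_const, Finset.card_range, smul_eq_mul]
    change 42 + (42 + (2 + k * (84 + 7) + 3)) ≤ _
    omega
  · change 42 + (42 + (2 + k * (84 + 7) + 3)) ≤ _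
    omega

/-- The layout of the network. -/
theorem spec_layout {M : Mem} (hd : z.d = Nat.clog 2 (z.p + 1))
    (hL : z.L = Nat.clog 2 (2 * (z.τ + 1))) :
    Spec B (.seq (clogLoop 12 (vp + 1)) <| .seq (asg 11 (.var 21)) <| .seq (clogLoop 13 (2 * vt)) <|
        .seq (asg 14 (3 * vS + 1)) <| .seq (asg 15 (vNI * vW)) <|
        .seq (asg 16 (vTab + (vp + 1) * vN)) <| .seq (asg 17 (2 * vk + 1)) (asg 18 (vL * vk)))
      (St X [(10, z.W), (9, z.N), (8, z.E), (7, numPairs (z.τ + 1)), (6, z.τ + 3), (5, z.τ + 1),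
        (4, fl), (3, z.p), (2, z.τ), (1, n), (0, k)] M)
      (200 * (z.d + z.L) + 652) (200 * (z.d + z.L) + 652) (St X (baseRegs z n fl) M) := by
  have hW := Setting.W_pos (z := z)
  have hS := Setting.S_pos (z := z)
  have hSX := hs.lt_X' (Setting.le_S (x := z.S) (c := 7) (by omega))
  have hE : z.E = 11 * (z.τ + 1) + 9 := rfl
  have hEW := hs.E_le_W
  have hSd : 2 ^ Nat.clog 2 (z.p + 1) = z.S := by rw [← hd]
  have hSL : 2 ^ Nat.clog 2 (2 * (z.τ + 1)) < X := by
    have h1 := Nat.pow_pred_clog_lt_self (b := 2) (by norm_num) (show 1 < 2 * (z.τ + 1) by omega)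
    have h2 : 0 < Nat.clog 2 (2 * (z.τ + 1)) := hL ▸ hs.L_pos
    obtain ⟨c, hc⟩ := Nat.exists_eq_add_of_le' h2
    rw [hc] at h1 ⊢
    rw [Nat.pred_eq_sub_one, Nat.add_sub_cancel] at h1
    refine hs.lt_X' (Setting.le_W ?_)
    rw [pow_succ]
    omega
  have hNI := NI_mul_W_le (z := z)
  have hpm : z.pmBase = z.NI * z.W + (z.p + 1) * z.N := rfl
  have hpN : (z.p + 1) * z.N ≤ 1 * (z.S * z.W) :=
    Setting.le_S_mul_W hs.N_le_W (by have := hs.le; omega) le_rfl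
  have hSW : z.S ≤ z.S * z.W := Nat.le_mul_of_pos_right _ hW
  have c1 := spec_clogLoop hX hB (Rf := [(10, z.W), (9, z.N), (8, z.E), (7, numPairs (z.τ + 1)),
    (6, z.τ + 3), (5, z.τ + 1), (4, fl), (3, z.p), (2, z.τ), (1, n), (0, k)]) (M := M) 12 (vp + 1)
    (z.p + 1) (by norm_num) (by norm_num) (by simp) (by decide) (by decide) (fun σ h => by
      simp only [List.forall_mem_cons] at h
      simp [h]) (by omega)
  rw [hSd, ← hd] at c1
  have c2 := spec_asg hX hB (Rf := [(12, z.d), (21, z.S), (10, z.W), (9, z.N), (8, z.E),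
      (7, numPairs (z.τ + 1)), (6, z.τ + 3), (5, z.τ + 1), (4, fl), (3, z.p), (2, z.τ), (1, n),
      (0, k)])
    (Rf' := [(12, z.d), (11, z.S), (10, z.W), (9, z.N), (8, z.E), (7, numPairs (z.τ + 1)),
      (6, z.τ + 3), (5, z.τ + 1), (4, fl), (3, z.p), (2, z.τ), (1, n), (0, k)]) (M := M) 11
    (.var 21) z.S (by decide) (fun σ h => by
      simp only [List.forall_mem_cons] at h
      exact h.2.1) hSX (by simp)
  have c3 := spec_clogLoop hX hB (Rf := [(12, z.d), (11, z.S), (10, z.W), (9, z.N), (8, z.E),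
    (7, numPairs (z.τ + 1)), (6, z.τ + 3), (5, z.τ + 1), (4, fl), (3, z.p), (2, z.τ), (1, n),
    (0, k)]) (M := M) 13 (2 * vt) (2 * (z.τ + 1)) (by norm_num) (by norm_num) (by simp) (by decide)
    (by decide) (fun σ h => by
      simp only [List.forall_mem_cons] at h
      simp [h]) hSL
  rw [← hL] at c3
  have c4 := spec_asg_cons hX hB (Rf := [(13, z.L), (21, 2 ^ z.L), (12, z.d), (11, z.S), (10, z.W),
    (9, z.N), (8, z.E), (7, numPairs (z.τ + 1)), (6, z.τ + 3), (5, z.τ + 1), (4, fl), (3, z.p),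
    (2, z.τ), (1, n), (0, k)]) (M := M) 14 (3 * vS + 1) z.NI (by decide) (fun σ h => by
      simp only [List.forall_mem_cons] at h
      simp [h]) (hs.lt_X' (by change 3 * z.S + 1 ≤ _; omega)) (by simp) (by decide)
  have c5 := spec_asg_cons hX hB (Rf := [(14, z.NI), (13, z.L), (21, 2 ^ z.L), (12, z.d), (11, z.S),
    (10, z.W), (9, z.N), (8, z.E), (7, numPairs (z.τ + 1)), (6, z.τ + 3), (5, z.τ + 1), (4, fl),
    (3, z.p), (2, z.τ), (1, n), (0, k)]) (M := M) 15 (vNI * vW) z.tabBase (by decide) (fun σ h => by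
      simp only [List.forall_mem_cons] at h
      simp [h, Sizes.tabBase]) (hs.lt_X' (by change z.NI * z.W ≤ _; omega)) (by simp) (by decide)
  have c6 := spec_asg_cons hX hB (Rf := [(15, z.tabBase), (14, z.NI), (13, z.L), (21, 2 ^ z.L),
    (12, z.d), (11, z.S), (10, z.W), (9, z.N), (8, z.E), (7, numPairs (z.τ + 1)), (6, z.τ + 3),
    (5, z.τ + 1), (4, fl), (3, z.p), (2, z.τ), (1, n), (0, k)]) (M := M) 16
    (vTab + (vp + 1) * vN) z.pmBase (by decide) (fun σ h => by
      simp only [List.forall_mem_cons] at h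
      simp [h, Sizes.pmBase]) (hs.lt_X' (by omega)) (by simp) (by decide)
  have c7 := spec_asg_cons hX hB (Rf := [(16, z.pmBase), (15, z.tabBase), (14, z.NI), (13, z.L),
    (21, 2 ^ z.L), (12, z.d), (11, z.S), (10, z.W), (9, z.N), (8, z.E), (7, numPairs (z.τ + 1)),
    (6, z.τ + 3), (5, z.τ + 1), (4, fl), (3, z.p), (2, z.τ), (1, n), (0, k)]) (M := M) 17
    (2 * vk + 1) z.K (by decide) (fun σ h => by
      simp only [List.forall_mem_cons] at h
      simp [h]) (K_lt hs) (by simp) (by decide)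
  have c8 := spec_asg_cons hX hB (Rf := [(17, z.K), (16, z.pmBase), (15, z.tabBase), (14, z.NI),
    (13, z.L), (21, 2 ^ z.L), (12, z.d), (11, z.S), (10, z.W), (9, z.N), (8, z.E),
    (7, numPairs (z.τ + 1)), (6, z.τ + 3), (5, z.τ + 1), (4, fl), (3, z.p), (2, z.τ), (1, n),
    (0, k)]) (M := M) 18 (vL * vk) z.EX (by decide) (fun σ h => by
      simp only [List.forall_mem_cons] at h
      simp [h]) (EX_lt hs) (by simp) (by decide)
  refine (c1.seq <| c2.seq <| c3.seq <| c4.seq <| c5.seq <| c6.seq <| c7.seq c8).mono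
    (fun _ _ h => h) ?_ ?_ fun m σ h => h.weaken (by simp [baseRegs])
  · change 200 * (z.d + 1) + (2 + 2 + _) ≤ _
    omega
  · change 200 * (z.d + 1) + (2 + 2 + _) ≤ _
    omega

end sizes

end SubpathDP

/-! ### The whole program and its cost -/

namespace SubpathDP

open CREW Status Digit

/-- The cost of a program that computes all tables, in terms of `Sizes.work` and `Sizes.depth`. -/
theorem exists_program : ∃ prog : Prog, ∀ (B X : ℕ), 2 ≤ X → X ^ degBound ≤ B →
    ∀ (k n : ℕ) (ι : Type) [Finite ι] (H : SimpleGraph (Fin k)) (G : SimpleGraph (Fin n))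
      (T : TreeDecomposition G ι) (P : Subpath T) (l : ι → List (Fin n)) (z : Sizes k),
    Setting P l z X → (∀ i, (l i).toFinset = T.bag i) → z.d = Nat.clog 2 (z.p + 1) →
    z.L = Nat.clog 2 (2 * (z.τ + 1)) →
    Spec B prog (St X [] (inputMem H T z.τ l P)) (2600000 * z.work) (252000 * z.depth)
      (St X [] (Function.update (gateMem H P l z z.steps) 8 (tables H P l z))) := by
  classical
  obtain ⟨p, hp⟩ := exists_tables_program
  apply Exists.intro
  intro B X hX hB k n ι _ H G T P l z hs hl hd hL
  have hfl : (if T.IsLeaf (P.node 0) then 0 else 1) < X := by split_ifs <;> omega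
  refine ((spec_input hX hB hs (fl := if T.IsLeaf (P.node 0) then 0 else 1) rfl hfl).seq <|
    (spec_powers hX hB hs).seq <| (spec_layout hX hB hs hd hL).seq
    (hp B X hX hB k n ι H G T P l z _ hs hl (hL ▸ Nat.le_pow_clog (by norm_num) _) rfl)).mono
    (fun _ _ h => h) ?_ ?_ fun m σ h => h.weaken (by simp)
  · have h1 := hs.mul_le_work (c := 1) (x := k * (z.S * z.W)) (by omega)
    have h2 : k ≤ k * (z.S * z.W) := Nat.le_mul_of_pos_right _
      (Nat.mul_pos Setting.S_pos Setting.W_pos)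
    have h3 : z.d ≤ z.work := by
      have h4 := hs.S_mul_W_le (c := 1) (x := z.S) (Setting.le_S (by omega))
      have h5 := d_lt_S (z := z)
      omega
    have h6 : z.L ≤ z.work := by
      have h7 : 0 < k * (z.S * z.W) := Nat.mul_pos hs.k_pos
        (Nat.mul_pos Setting.S_pos Setting.W_pos)
      calc z.L ≤ z.L * (k * (z.S * z.W)) := Nat.le_mul_of_pos_right _ h7
        _ = k * z.L * z.S * z.W := by ring
        _ ≤ _ := Nat.le_add_right _ _
    have h8 := hs.k_pos
    clear hB
    omega
  · have h1 := Setting.k_le_depth (z := z)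
    have h2 : z.L + z.d + 1 ≤ z.depth := Nat.le_mul_of_pos_left _ hs.k_pos
    have h8 := hs.k_pos
    clear hB
    omega

theorem mul_pow_le_pow (k : ℕ) : k * 20 ^ k ≤ 3 * 27 ^ k := by
  have h : (20 + 7 * k) * 20 ^ k ≤ 20 * 27 ^ k := by
    induction k with
    | zero => norm_num
    | succ k ih =>
      calc (20 + 7 * (k + 1)) * 20 ^ (k + 1) = (540 + 140 * k) * 20 ^ k := by ring
        _ ≤ 27 * (20 + 7 * k) * 20 ^ k := Nat.mul_le_mul_right _ (by omega)
        _ = 27 * ((20 + 7 * k) * 20 ^ k) := by ring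
        _ ≤ 27 * (20 * 27 ^ k) := Nat.mul_le_mul_left _ ih
        _ = 20 * 27 ^ (k + 1) := by ring
  rw [add_mul, mul_assoc] at h
  omega

/-- The gates of a node are as many as the triples of codes, up to a factor that decreases
exponentially with `k`; this makes up for the factor `k` of the running time of the sweeps. -/
theorem mul_W_le {k : ℕ} (z : Sizes k) : k * z.W ≤ 3 * (z.τ + 3) ^ (3 * k) := by
  have h1 : 27 * z.E ≤ 20 * (z.τ + 3) ^ 3 := by
    change 27 * (11 * (z.τ + 1) + 9) ≤ _
    have : 20 * (z.τ + 3) ^ 3 = 540 + 540 * z.τ + 180 * z.τ ^ 2 + 20 * z.τ ^ 3 := by ring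
    nlinarith [Nat.zero_le (z.τ ^ 2), Nat.zero_le (z.τ ^ 3)]
  have h2 := Nat.pow_le_pow_left h1 k
  rw [mul_pow, mul_pow, ← pow_mul] at h2
  refine le_of_mul_le_mul_left ?_ (show 0 < 27 ^ k from Nat.pow_pos (by norm_num))
  calc 27 ^ k * (k * z.W) = k * (27 ^ k * z.W) := by ring
    _ ≤ k * (20 ^ k * (z.τ + 3) ^ (3 * k)) := Nat.mul_le_mul_left _ h2
    _ = k * 20 ^ k * (z.τ + 3) ^ (3 * k) := by ring
    _ ≤ 3 * 27 ^ k * (z.τ + 3) ^ (3 * k) := Nat.mul_le_mul_right _ (mul_pow_le_pow k)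
    _ = _ := by ring

theorem S_le {k : ℕ} {z : Sizes k} (hp : 0 < z.p) (hd : z.d = Nat.clog 2 (z.p + 1)) :
    z.S ≤ 3 * z.p := by
  have h1 := Nat.pow_pred_clog_lt_self (b := 2) (by norm_num) (show 1 < z.p + 1 by omega)
  have h2 : 0 < Nat.clog 2 (z.p + 1) := Nat.clog_pos (by norm_num) (by omega)
  obtain ⟨c, hc⟩ := Nat.exists_eq_add_of_le' h2
  rw [hc, Nat.pred_eq_sub_one, Nat.add_sub_cancel] at h1
  change 2 ^ z.d ≤ _
  rw [hd, hc, pow_succ]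
  omega

theorem L_le {k : ℕ} {z : Sizes k} (hL : z.L = Nat.clog 2 (2 * (z.τ + 1))) : z.L ≤ z.τ + 1 := by
  rw [hL]
  refine Nat.clog_le_of_le_pow ?_
  rw [pow_succ, mul_comm]
  exact Nat.mul_le_mul_right _ (Nat.lt_pow_self (by norm_num))

theorem work_le {k : ℕ} {z : Sizes k} (hk : 0 < k) (hp : 0 < z.p)
    (hd : z.d = Nat.clog 2 (z.p + 1)) (hL : z.L = Nat.clog 2 (2 * (z.τ + 1))) :
    z.work ≤ 12 * (z.p * (z.τ + 3) ^ (3 * k + 1)) := by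
  have h1 : k * z.L * z.S * z.W ≤ 9 * (z.p * (z.τ + 3) ^ (3 * k + 1)) :=
    calc k * z.L * z.S * z.W = (k * z.W) * (z.S * z.L) := by ring
      _ ≤ 3 * (z.τ + 3) ^ (3 * k) * (3 * z.p * (z.τ + 3)) :=
        Nat.mul_le_mul (mul_W_le z) (Nat.mul_le_mul (S_le hp hd) ((L_le hL).trans (by omega)))
      _ = _ := by ring
  have h2 : z.S * (z.τ + 3) ^ 2 ≤ 3 * (z.p * (z.τ + 3) ^ (3 * k + 1)) :=
    (Nat.mul_le_mul (S_le hp hd) (Nat.pow_le_pow_right (by omega) (by omega))).trans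
      (mul_assoc _ _ _).le
  unfold Sizes.work
  omega

theorem depth_le {k : ℕ} {z : Sizes k} {n a : ℕ} (hn : 2 ≤ n) (hp : z.p ≤ n ^ a)
    (hτ : z.τ + 1 ≤ n) (hd : z.d = Nat.clog 2 (z.p + 1))
    (hL : z.L = Nat.clog 2 (2 * (z.τ + 1))) :
    z.depth ≤ (5 + 2 * a) * (k * Nat.log 2 n) := by
  have h1 : 1 ≤ Nat.log 2 n := Nat.log_pos (by norm_num) hn
  have h2 : n ≤ 2 ^ (Nat.log 2 n + 1) := (Nat.lt_pow_succ_log_self (by norm_num) n).le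
  have h3 : z.L ≤ Nat.log 2 n + 2 := by
    rw [hL]
    refine Nat.clog_le_of_le_pow ?_
    rw [pow_succ]
    omega
  have h4 : z.d ≤ a * (Nat.log 2 n + 1) + 1 := by
    rw [hd]
    refine Nat.clog_le_of_le_pow ?_
    have h5 : n ^ a ≤ 2 ^ (a * (Nat.log 2 n + 1)) := by
      rw [mul_comm a, pow_mul]
      exact Nat.pow_le_pow_left h2 a
    have h6 : 0 < 2 ^ (a * (Nat.log 2 n + 1)) := by positivity
    rw [pow_succ]
    omega
  have h7 : a * (Nat.log 2 n + 1) ≤ a * (2 * Nat.log 2 n) := Nat.mul_le_mul_left _ (by omega)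
  calc z.depth ≤ k * (5 * Nat.log 2 n + a * (2 * Nat.log 2 n)) :=
        Nat.mul_le_mul_left _ (by omega)
    _ = _ := by ring

section input

variable {k n : ℕ} {ι : Type} [Fintype ι] {H : SimpleGraph (Fin k)} {G : SimpleGraph (Fin n)}
  {T : TreeDecomposition G ι} {P : Subpath T} {l : ι → List (Fin n)}
  (hl : ∀ i, (l i).Nodup ∧ (l i).toFinset = T.bag i)

theorem width_lt (hn : 0 < n) : T.width + 1 ≤ n := by
  have : (Finset.univ.sup fun i => (T.bag i).card) ≤ n :=
    Finset.sup_le fun i _ => (Finset.card_le_univ _).trans (Fintype.card_fin n).le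
  unfold TreeDecomposition.width
  omega

include hl

theorem length_le (i : ι) : (l i).length ≤ T.width + 1 := by
  have h1 := Finset.le_sup (f := fun i => (T.bag i).card) (Finset.mem_univ i)
  rw [← List.toFinset_card_of_nodup (hl i).1, (hl i).2]
  unfold TreeDecomposition.width
  omega

theorem bagList_spec (z : Sizes k) (j : ℕ) :
    (bagList P l z j).Nodup ∧ (bagList P l z j).length ≤ T.width + 1 := by
  have h1 : ∀ i, (l i).Nodup ∧ (l i).length ≤ T.width + 1 := fun i =>
    ⟨(hl i).1, length_le hl i⟩
  have h2 : ([] : List (Fin n)).Nodup ∧ ([] : List (Fin n)).length ≤ T.width + 1 := by simp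
  unfold bagList layer offList
  repeat' split
  all_goals first | exact h1 _ | exact h2

open Classical in
theorem inputMem_lt {X : ℕ} (hX : 2 ≤ X) (hk : k < X) (hn : n < X) (hp : P.length < X)
    (hτ : T.width + 1 < X) (a x : ℕ) : inputMem H T T.width l P a x < X := by
  have h1 : ∀ i, (l i).length < X := fun i => (length_le hl i).trans_lt hτ
  have h2 : ∀ (L : List (Fin n)) x, (L.map Fin.val).getD x 0 < X := by
    intro L x
    rw [List.getD_eq_getElem?_getD, List.getElem?_map]
    rcases L[x]? with _ | y
    · simp; omega
    · simp; omega
  have h3 : ∀ i c, validTable H T T.width l i c < X := fun i c =>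
    (validTable_le_one H i c).trans_lt (by omega)
  have h4 : ∀ {m : ℕ} (G : SimpleGraph (Fin m)) x, adjArray G x < X := fun G x => by
    unfold adjArray
    split_ifs <;> omega
  rcases a with _ | _ | _ | _ | _ | _ | _ | _ | a
  · rcases x with _ | _ | _ | _ | _ | x
    · exact hk
    · exact hn
    · exact (Nat.lt_succ_self _).trans hτ
    · exact hp
    · change (if T.IsLeaf (P.node 0) then 0 else 1) < X
      split_ifs <;> omega
    · change 0 < X
      omega
  · exact h4 H x
  · exact h4 G x
  all_goals simp only [inputMem]
  all_goals try split_ifs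
  all_goals first | exact h1 _ | exact h2 _ _ | exact h3 _ _ | omega

end input

/-- All memory cells are below a power of `n + |P|` with exponent `O(k)`. -/
theorem room_le {k n : ℕ} (z : Sizes k) (hk : 0 < k) (hn : 2 ≤ n) (hp : 0 < z.p)
    (hτ : z.τ + 1 ≤ n) (hd : z.d = Nat.clog 2 (z.p + 1)) :
    8 * (z.NI * z.W * z.W * z.W) ≤ (n + z.p) ^ (18 * k) := by
  set Q := n + z.p with hQ
  have hQ3 : 3 ≤ Q := by omega
  have h27 : 27 ≤ Q ^ 3 := (show 27 = 3 ^ 3 by norm_num).le.trans (Nat.pow_le_pow_left hQ3 3)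
  have h9 : 9 ≤ Q ^ 2 := (show 9 = 3 ^ 2 by norm_num).le.trans (Nat.pow_le_pow_left hQ3 2)
  have hE : z.E ≤ Q ^ 4 := by
    change 11 * (z.τ + 1) + 9 ≤ Q ^ 4
    calc 11 * (z.τ + 1) + 9 ≤ 27 * Q := by omega
      _ ≤ Q ^ 3 * Q := Nat.mul_le_mul_right _ h27
      _ = Q ^ 4 := by ring
  have hW : z.W ≤ Q ^ (4 * k) := by
    rw [pow_mul]
    exact Nat.pow_le_pow_left hE k
  have hNI : z.NI ≤ Q ^ 4 := by
    have h1 := S_le hp hd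
    have h2 : z.NI = 3 * z.S + 1 := rfl
    calc z.NI ≤ 27 * Q := by omega
      _ ≤ Q ^ 3 * Q := Nat.mul_le_mul_right _ h27
      _ = Q ^ 4 := by ring
  calc 8 * (z.NI * z.W * z.W * z.W)
      ≤ Q ^ 2 * (Q ^ 4 * Q ^ (4 * k) * Q ^ (4 * k) * Q ^ (4 * k)) :=
        Nat.mul_le_mul (by omega)
          (Nat.mul_le_mul (Nat.mul_le_mul (Nat.mul_le_mul hNI hW) hW) hW)
    _ = Q ^ (12 * k + 6) := by ring
    _ ≤ Q ^ (18 * k) := Nat.pow_le_pow_right (by omega) (by omega)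

end SubpathDP

/-- One program `prog` computes, for every subpath `P`, the tables of the valid partial matches of all
its nodes in array `8`, given the tables of the children off the path. Words have
`O(k log (n + |P|))` bits. The constant of the depth bound depends only on the exponent `a` of a
polynomial bound for the number of nodes of `P` in terms of `n`. -/
theorem mainTheorem9 :
    ∃ (prog : CREW.Prog) (cword cwork : ℕ), ∀ a : ℕ, ∃ cdepth : ℕ,
      ∀ (k n τ : ℕ), 1 ≤ k → 2 ≤ n →
      ∀ (H : SimpleGraph (Fin k)) (G : SimpleGraph (Fin n)) (ι : Type) [Fintype ι]
        (T : TreeDecomposition G ι), T.width = τ →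
      ∀ P : Subpath T, P.length ≤ n ^ a →
      ∀ l : ι → List (Fin n), (∀ i, (l i).Nodup ∧ (l i).toFinset = T.bag i) →
      ∃ (m : CREW.Mem) (act : List CREW.Regs) (work depth : ℕ),
        CREW.Exec ((n + P.length) ^ (cword * k)) prog (inputMem H T τ l P) [fun _ => 0]
          m act work depth ∧
        (∀ i < P.length, ∀ c < (τ + 3) ^ k,
          m 8 (i * (τ + 3) ^ k + c) = validTable H T τ l (P.node i) c) ∧
        work ≤ cwork * (P.length * (τ + 3) ^ (3 * k + 1)) ∧
        depth ≤ cdepth * (k * Nat.log 2 n) := by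
  classical
  obtain ⟨prog, hprog⟩ := SubpathDP.exists_program
  refine ⟨prog, 54000, 31200000, fun a => ⟨252000 * (5 + 2 * a), ?_⟩⟩
  intro k n τ hk hn H G ι _ T hT P hP l hl
  subst hT
  have hp := P.length_pos
  have hτ := SubpathDP.width_lt (T := T) (show 0 < n by omega)
  let z : SubpathDP.Sizes k :=
    ⟨T.width, P.length, Nat.clog 2 (P.length + 1), Nat.clog 2 (2 * (T.width + 1))⟩
  set X := (n + P.length) ^ (18 * k) with hXdef
  have hnX : n + P.length ≤ X := Nat.le_self_pow (by omega) _
  have hs : SubpathDP.Setting P l z X :=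
    { k_pos := hk
      L_pos := show 0 < Nat.clog 2 (2 * (T.width + 1)) from
        Nat.clog_pos (by norm_num) (by omega)
      L_le := (SubpathDP.L_le (z := z) rfl).trans
        ((show z.τ + 1 ≤ 11 * (z.τ + 1) + 9 by omega).trans (Nat.le_self_pow (by omega) _))
      len := rfl
      le := Nat.le_pow_clog (by norm_num) _
      bag := SubpathDP.bagList_spec hl z
      room := SubpathDP.room_le z hk hn hp hτ rfl
      n_lt := by omega }
  have hB : X ^ SubpathDP.degBound ≤ (n + P.length) ^ (54000 * k) := by
    rw [hXdef, ← pow_mul]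
    exact Nat.pow_le_pow_right (by omega)
      (by change 18 * k * 3000 ≤ _; exact le_of_eq (by ring))
  obtain ⟨m, ρ, work, depth, h1, h2, h3, -, -, -, h4⟩ :=
    hprog ((n + P.length) ^ (54000 * k)) X (by omega) hB k n ι H G T P l z hs (fun i => (hl i).2)
      rfl rfl (inputMem H T T.width l P) (fun _ => 0)
      ⟨SubpathDP.inputMem_lt hl (by omega)
        (hs.lt_X' (SubpathDP.Setting.le_W SubpathDP.Setting.k_le_W)) (by omega) (by omega)
        (by omega), fun _ => show 0 < X by omega, by simp, rfl⟩
  refine ⟨m, [ρ], work, depth, h1, fun i hi c hc => ?_, ?_, ?_⟩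
  · have hi' : i * z.N + c < z.p * z.N := by
      have := Nat.mul_le_mul_right z.N (Nat.succ_le_of_lt hi)
      rw [Nat.succ_mul] at this
      exact (Nat.add_lt_add_left hc _).trans_le this
    rw [h4, Function.update_self]
    change SubpathDP.tables H P l z (i * z.N + c) = _
    rw [SubpathDP.tables, SubpathDP.cut_of_lt hi', mul_comm i,
      Nat.mul_add_div SubpathDP.N_pos, Nat.mul_add_mod, Nat.div_eq_of_lt hc, Nat.mod_eq_of_lt hc,
      add_zero]
  · refine h2.trans ((Nat.mul_le_mul_left _ (SubpathDP.work_le (z := z) hk hp rfl rfl)).trans ?_)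
    change 2600000 * (12 * (P.length * (T.width + 3) ^ (3 * k + 1))) ≤ _
    omega
  · refine h3.trans ((Nat.mul_le_mul_left _
      (SubpathDP.depth_le (z := z) hn hP hτ rfl rfl)).trans ?_)
    exact le_of_eq (mul_assoc _ _ _).symm
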